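/- **Setting.** Let $(\mathcal A,\phi,\epsilon,\kappa,*)$ be a Hopf $*$-algebra over $\mathbb C$ and $\Psi$ a bicovariant $*$-bimodule over $\mathcal A$, with left and right coactions $\ell\colon\Psi\to\mathcal A\otimes\Psi$ and $\wp\colon\Psi\to\Psi\otimes\mathcal A$ which are hermitian. Let $\mathbb V=\{\theta\in\Psi:\ell(\theta)=1\otimes\theta\}$, let $\varkappa=\wp|_{\mathbb V}\colon\mathbb V\to\mathbb V\otimes\mathcal A$ and $\theta\circ a=\kappa(a^{(1)})\theta a^{(2)}$; extend these to $\mathbb V^\otimes$ by $\varkappa(\theta\eta)=\varkappa(\theta)\varkappa(\eta)$, $(\theta\eta)\circ a=(\theta\circ a^{(1)})(\eta\circ a^{(2)})$, $1\circ a=\epsilon(a)1$. Let $\sigma\colon\mathbb V^{\otimes2}\to\mathbb V^{\otimes2}$, $\sigma(\eta\otimes\theta)=\sum_k\theta_k\otimes(\eta\circ c_k)$ where $\varkappa(\theta)=\sum_k\theta_k\otimes c_k$, be the braiding. For $\pi\in S_n$ let $\sigma_\pi$ be the operator on $\mathbb V^{\otimes n}$ obtained from a minimal decomposition of $\pi$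 into transpositions of neighbours by replacing these by the corresponding twists $\sigma$. Let $Y$ be the operator on $\mathbb V^\otimes$ that acts on $\mathbb V^{\otimes n}$ as $\sum_{\pi\in S_n}\sigma_\pi$; let $M_{kl}=\sum_{\pi\in S_{kl}}\sigma_{\pi^{-1}}$, where $S_{kl}\subset S_{k+l}$ consists of the permutations preserving the order of the first $k$ and of the last $l$ letters; let $\mathrm I$ act on $\mathbb V^{\otimes n}$ as $\sigma_{w}$, where $w\in S_n$ is the total order reversal. Put $S(\mathbb V)=\mathbb V^\otimes/\ker Y$. Let $P=(\mathcal B,i,F)$ be a quantum principal bundle over a $*$-algebra $\mathcal V$: $\mathcal B$ is a $*$-algebra, $F\colon\mathcal B\to\mathcal B\otimes\mathcal A$ is a counital coassociative $*$-homomorphism, $i$ is a $*$-isomorphism of $\mathcal V$ onto the subalgebra $\{b:F(b)=b\otimes1\}$, and $X\colon\mathcal B\otimes_{\mathcal V}\mathcal B\to\mathcal B\otimes\mathcal A$, $X(q\otimes b)=qF(b)$, is surjective. Assume that $P$ is Hopf–Galois, i.e. that $X$ is bijective, and let $\tau(a)=X^{-1}(1\otimes a)=[a]_1\otimes[a]_2$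 be its translation map. **Claim.** 1. $\ker Y$ is a two-sided ideal of $\mathbb V^\otimes$. Let $T(\Psi)$ be the tensor algebra of the $\mathcal A$-bimodule $\Psi$. Its quotient by the linear span of the products $a\,x$ with $a\in\mathcal A$, $x\in\ker Y\subset\mathbb V^\otimes$, is an algebra $\widetilde{\mathcal A}$ which is identified with $\mathcal A\otimes S(\mathbb V)$ by $a\otimes[x]\leftrightarrow[a\,x]$ (with product $(a\otimes\theta)(b\otimes\eta)=ab^{(1)}\otimes(\theta\circ b^{(2)})\eta$). It is a Hopf $*$-algebra with bijective antipode, also denoted $\kappa$; its structure extends that of $\mathcal A$, and $\phi(\psi)=\ell(\psi)+\wp(\psi)$, $\epsilon(\psi)=0$ on $\Psi$, with the given $*$ on $\Psi$. 2. $\widetilde{\mathcal B}=\mathcal B\otimes S(\mathbb V)$, with the product $(q\otimes\theta)(b\otimes\eta)=\sum_k qb_k\otimes(\theta\circ c_k)\eta$ for $F(b)=\sum_k b_k\otimes c_k$, is a $*$-algebra whose involution extends those of $\mathcal B$ and $\mathbb V$. There is a homomorphism $H\colon\widetilde{\mathcal B}\to\widetilde{\mathcal B}\otimes\widetilde{\mathcal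 A}$ which extends $F$ and satisfies $H(\theta)=1\otimes\theta+\varkappa(\theta)$ for $\theta\in\mathbb V$, and $\widetilde P=(\widetilde{\mathcal B},i,H)$ is a quantum principal bundle over $\mathcal V$ with respect to $\widetilde{\mathcal A}$ (in the sense above, so that $H$ is a counital coassociative $*$-homomorphism with fixed-point algebra $i(\mathcal V)$, and $\widetilde X\colon\widetilde{\mathcal B}\otimes_{\mathcal V}\widetilde{\mathcal B}\to\widetilde{\mathcal B}\otimes\widetilde{\mathcal A}$, $\widetilde X(q\otimes b)=qH(b)$, is surjective). 3. There is a well-defined linear map $\tau\colon\widetilde{\mathcal A}\to\widetilde{\mathcal B}\otimes_{\mathcal V}\widetilde{\mathcal B}$ extending the translation map of $P$ such that, for $a\in\mathcal A$ and $\vartheta\in\mathbb V^{\otimes n}$ with class $[\vartheta]\in S(\mathbb V)$, $$\tau(a\otimes[\vartheta])=\sum_{k+l=n}(-1)^k\sum_{\alpha,\beta}\,\mathrm I\{t_{\beta}\}\,[c_{\beta\alpha}]_1\,\tau(a)\,[c_{\beta\alpha}]_2\,\vartheta_\alpha ,$$ where, for each $k$, $\sum_\alpha t_\alpha\otimes\vartheta_\alpha=M_{kl}(\vartheta)$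 with $t_\alpha\in\mathbb V^{\otimes k}$, $\vartheta_\alpha\in\mathbb V^{\otimes l}$, and $\varkappa(t_\alpha)=\sum_\beta t_\beta\otimes c_{\beta\alpha}$. Writing $\tau(\psi)=[\psi]_1\otimes[\psi]_2$, it satisfies for all $\psi\in\widetilde{\mathcal A}$ $$[\psi]_1\otimes H[\psi]_2=[\psi^{(1)}]_1\otimes[\psi^{(1)}]_2\otimes\psi^{(2)},\qquad [\psi]_1[\psi]_2=\epsilon(\psi)1,$$ $${}^{\mathrm{op}}H[\psi]_1\otimes[\psi]_2=\psi^{(1)}\otimes[\psi^{(2)}]_1\otimes[\psi^{(2)}]_2,$$ where ${}^{\mathrm{op}}H(q)=\sum_k\kappa^{-1}(d_k)\otimes q_k$ for $H(q)=\sum_kq_k\otimes d_k$. 4. Consequently $\widetilde X$ is bijective, with $\widetilde X^{-1}(1\otimes\psi)=\tau(\psi)$ for all $\psi\in\widetilde{\mathcal A}$; so $\widetilde P$ is a quantum principal bundle that is again Hopf–Galois (the quantum affine extension of $P$). -/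

import Mathlib

open scoped TensorProduct DirectSum

set_option linter.unusedSectionVars false
set_option linter.unusedSimpArgs false

namespace AffineBundle

noncomputable section

section Bimodule

variable (A Ψ : Type*) [Ring A] [HopfAlgebra ℂ A] [StarRing A] [StarModule ℂ A]
  [AddCommGroup Ψ] [Module ℂ Ψ] [Module A Ψ] [Module Aᵐᵒᵖ Ψ] [SMulCommClass A Aᵐᵒᵖ Ψ]
  [IsScalarTower ℂ A Ψ] [IsScalarTower ℂ Aᵐᵒᵖ Ψ]

/-- Left multiplication `a ↦ (ψ ↦ a ψ)` of a bimodule. -/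
def lmul : A →ₗ[ℂ] Ψ →ₗ[ℂ] Ψ := (Algebra.lsmul ℂ ℂ Ψ : A →ₐ[ℂ] Module.End ℂ Ψ).toLinearMap

/-- Right multiplication `a ↦ (ψ ↦ ψ a)` of a bimodule. -/
def rmul : A →ₗ[ℂ] Ψ →ₗ[ℂ] Ψ :=
  (Algebra.lsmul ℂ ℂ Ψ : Aᵐᵒᵖ →ₐ[ℂ] Module.End ℂ Ψ).toLinearMap ∘ₗ
    (MulOpposite.opLinearEquiv ℂ : A ≃ₗ[ℂ] Aᵐᵒᵖ).toLinearMap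

variable {A Ψ}

@[simp] theorem lmul_apply (a : A) (ψ : Ψ) : lmul A Ψ a ψ = a • ψ := rfl

@[simp] theorem rmul_apply (a : A) (ψ : Ψ) : rmul A Ψ a ψ = MulOpposite.op a • ψ := rfl

variable (A Ψ) in
/-- A bicovariant *-bimodule over the Hopf *-algebra `A`: the `A`-bimodule `Ψ` carries a left
coaction and a right coaction of `A` which commute with each other and are compatible with both
multiplications, together with an involution for which everything is hermitian. -/
structure BicovariantStarBimodule [StarAddMonoid Ψ] [StarModule ℂ Ψ] where
  /-- the left action map `ℓ : Ψ → A ⊗ Ψ` -/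
  left : Ψ →ₗ[ℂ] A ⊗[ℂ] Ψ
  /-- the right action map `℘ : Ψ → Ψ ⊗ A` -/
  right : Ψ →ₗ[ℂ] Ψ ⊗[ℂ] A
  left_coassoc : ∀ ψ, TensorProduct.assoc ℂ A A Ψ (Coalgebra.comul.rTensor Ψ (left ψ)) =
    left.lTensor A (left ψ)
  left_counit : ∀ ψ, TensorProduct.lid ℂ Ψ (Coalgebra.counit.rTensor Ψ (left ψ)) = ψ
  right_coassoc : ∀ ψ, TensorProduct.assoc ℂ Ψ A A (right.rTensor A (right ψ)) =
    Coalgebra.comul.lTensor Ψ (right ψ)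
  right_counit : ∀ ψ, TensorProduct.rid ℂ Ψ (Coalgebra.counit.lTensor Ψ (right ψ)) = ψ
  left_right : ∀ ψ, TensorProduct.assoc ℂ A Ψ A (left.rTensor A (right ψ)) =
    right.lTensor A (left ψ)
  left_lmul : ∀ (a : A) (ψ : Ψ), left (a • ψ) =
    TensorProduct.map₂ (LinearMap.mul ℂ A) (lmul A Ψ) (Coalgebra.comul a) (left ψ)
  left_rmul : ∀ (a : A) (ψ : Ψ), left (MulOpposite.op a • ψ) =
    TensorProduct.map₂ (LinearMap.mul ℂ A).flip (rmul A Ψ) (Coalgebra.comul a) (left ψ)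
  right_lmul : ∀ (a : A) (ψ : Ψ), right (a • ψ) =
    TensorProduct.map₂ (lmul A Ψ) (LinearMap.mul ℂ A) (Coalgebra.comul a) (right ψ)
  right_rmul : ∀ (a : A) (ψ : Ψ), right (MulOpposite.op a • ψ) =
    TensorProduct.map₂ (rmul A Ψ) (LinearMap.mul ℂ A).flip (Coalgebra.comul a) (right ψ)
  star_lmul : ∀ (a : A) (ψ : Ψ), star (a • ψ) = MulOpposite.op (star a) • star ψ
  star_rmul : ∀ (a : A) (ψ : Ψ), star (MulOpposite.op a • ψ) = star a • star ψ
  left_star : ∀ ψ, left (star ψ) = star (left ψ)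
  right_star : ∀ ψ, right (star ψ) = star (right ψ)

section conv

open WithConv

variable {E : Type*} [Semiring E] [Algebra ℂ E]

theorem conv_antipode (f : A →ₐ[ℂ] E) :
    toConv (f.toLinearMap ∘ₗ HopfAlgebra.antipode ℂ) * toConv f.toLinearMap = 1 := by
  have h := LinearMap.algHom_comp_convMul_distrib f
    (toConv (HopfAlgebra.antipode ℂ (A := A))) (toConv LinearMap.id)
  rw [LinearMap.antipode_mul_id] at h
  apply WithConv.ofConv_injective
  rw [← LinearMap.comp_id f.toLinearMap]
  refine Eq.trans ?_ (h.symm.trans ?_)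
  · rfl
  · ext a; simp [LinearMap.convOne_def]

theorem conv_antipode' (f : A →ₐ[ℂ] E) :
    toConv f.toLinearMap * toConv (f.toLinearMap ∘ₗ HopfAlgebra.antipode ℂ) = 1 := by
  have h := LinearMap.algHom_comp_convMul_distrib f
    (toConv LinearMap.id) (toConv (HopfAlgebra.antipode ℂ (A := A)))
  rw [LinearMap.id_mul_antipode] at h
  apply WithConv.ofConv_injective
  rw [← LinearMap.comp_id f.toLinearMap]
  refine Eq.trans ?_ (h.symm.trans ?_)
  · rfl
  · ext a; simp [LinearMap.convOne_def]

end conv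


open WithConv

variable (A Ψ) in
/-- The right action `ψ ∘ a = κ(a⁽¹⁾) ψ a⁽²⁾`, as a map `a ↦ (ψ ↦ ψ ∘ a)`. -/
def circ : A →ₗ[ℂ] Module.End ℂ Ψ :=
  LinearMap.mul' ℂ (Module.End ℂ Ψ) ∘ₗ
    TensorProduct.map (lmul A Ψ ∘ₗ HopfAlgebra.antipode ℂ) (rmul A Ψ) ∘ₗ Coalgebra.comul

theorem circ_eq : toConv (circ A Ψ) =
    toConv (lmul A Ψ ∘ₗ HopfAlgebra.antipode ℂ) * toConv (rmul A Ψ) := rfl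

theorem circ_apply {ι : Type*} {a : A} (r : Coalgebra.Repr ℂ a ι) (ψ : Ψ) :
    circ A Ψ a ψ = ∑ i ∈ r.index,
      HopfAlgebra.antipode ℂ (r.left i) • MulOpposite.op (r.right i) • ψ := by
  simp [circ, ← r.eq, LinearMap.sum_apply]

theorem circ_one : circ A Ψ 1 = 1 := by
  ext ψ; simp [circ, Algebra.TensorProduct.one_def]

theorem circ_mul (a b : A) : circ A Ψ (a * b) = circ A Ψ b * circ A Ψ a := by
  ext ψ
  simp only [circ, LinearMap.comp_apply, Bialgebra.comul_mul, Module.End.mul_apply]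
  induction Coalgebra.comul (R := ℂ) a using TensorProduct.induction_on with
  | zero => simp
  | add x y hx hy => simp_all [add_mul]
  | tmul x y =>
    induction Coalgebra.comul (R := ℂ) b using TensorProduct.induction_on with
    | zero => simp
    | add x y hx hy => simp_all [mul_add]
    | tmul u v =>
      simp [HopfAlgebra.antipode_mul_antidistrib, mul_smul]
      rw [smul_comm (HopfAlgebra.antipode ℂ x) (MulOpposite.op v)]

namespace BicovariantStarBimodule

variable [StarAddMonoid Ψ] [StarModule ℂ Ψ] (X : BicovariantStarBimodule A Ψ)

variable (A Ψ) in
/-- The action of `A` on `A ⊗ Ψ` by left multiplication through the coproduct. -/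
def lamL : A →ₐ[ℂ] Module.End ℂ (A ⊗[ℂ] Ψ) :=
  ((Module.endTensorEndAlgHom (R := ℂ) (S := ℂ) (A := ℂ) (M := A) (N := Ψ)).comp
    (Algebra.TensorProduct.map (Algebra.lmul ℂ A) (Algebra.lsmul ℂ ℂ Ψ))).comp
    (Bialgebra.comulAlgHom ℂ A)

variable (A Ψ) in
/-- The action of `A` on `Ψ ⊗ A` by left multiplication through the coproduct. -/
def lamR : A →ₐ[ℂ] Module.End ℂ (Ψ ⊗[ℂ] A) :=
  ((Module.endTensorEndAlgHom (R := ℂ) (S := ℂ) (A := ℂ) (M := Ψ) (N := A)).comp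
    (Algebra.TensorProduct.map (Algebra.lsmul ℂ ℂ Ψ) (Algebra.lmul ℂ A))).comp
    (Bialgebra.comulAlgHom ℂ A)

theorem lamL_conv : toConv (lamL A Ψ).toLinearMap =
    toConv ((Module.End.rTensorAlgHom ℂ A Ψ).comp (Algebra.lmul ℂ A)).toLinearMap *
    toConv ((Module.End.lTensorAlgHom ℂ Ψ A).comp (Algebra.lsmul ℂ ℂ Ψ)).toLinearMap := by
  apply WithConv.ofConv_injective
  ext a
  simp only [lamL, LinearMap.convMul_def]
  simp
  induction Coalgebra.comul (R := ℂ) a using TensorProduct.induction_on with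
  | zero => simp
  | tmul x y => rfl
  | add x y hx hy => simp_all

theorem lamR_conv : toConv (lamR A Ψ).toLinearMap =
    toConv ((Module.End.rTensorAlgHom ℂ Ψ A).comp (Algebra.lsmul ℂ ℂ Ψ)).toLinearMap *
    toConv ((Module.End.lTensorAlgHom ℂ A Ψ).comp (Algebra.lmul ℂ A)).toLinearMap := by
  apply WithConv.ofConv_injective
  ext a
  simp only [lamR, LinearMap.convMul_def]
  simp
  induction Coalgebra.comul (R := ℂ) a using TensorProduct.induction_on with
  | zero => simp
  | tmul x y => rfl
  | add x y hx hy => simp_all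

theorem lamL_apply (a : A) (t : A ⊗[ℂ] Ψ) : lamL A Ψ a t =
    TensorProduct.map₂ (LinearMap.mul ℂ A) (lmul A Ψ) (Coalgebra.comul a) t := by
  simp only [lamL, AlgHom.comp_apply, Bialgebra.comulAlgHom_apply]
  induction Coalgebra.comul (R := ℂ) a using TensorProduct.induction_on with
  | zero => simp
  | tmul x y => rfl
  | add x y hx hy => simp_all

theorem lamR_apply (a : A) (t : Ψ ⊗[ℂ] A) : lamR A Ψ a t =
    TensorProduct.map₂ (lmul A Ψ) (LinearMap.mul ℂ A) (Coalgebra.comul a) t := by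
  simp only [lamR, AlgHom.comp_apply, Bialgebra.comulAlgHom_apply]
  induction Coalgebra.comul (R := ℂ) a using TensorProduct.induction_on with
  | zero => simp
  | tmul x y => rfl
  | add x y hx hy => simp_all

theorem map_circ {N : Type*} [AddCommGroup N] [Module ℂ N] (f : Ψ →ₗ[ℂ] N)
    (Λ R : A →ₗ[ℂ] Module.End ℂ N) (ψ : Ψ)
    (hΛ : ∀ a ψ, f (a • ψ) = Λ a (f ψ)) (hR : ∀ a : A, f (MulOpposite.op a • ψ) = R a (f ψ))
    (a : A) : f (circ A Ψ a ψ) =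
      (toConv (Λ ∘ₗ HopfAlgebra.antipode ℂ) * toConv R).ofConv a (f ψ) := by
  simp only [circ, LinearMap.convMul_def, LinearMap.comp_apply]
  induction Coalgebra.comul (R := ℂ) a using TensorProduct.induction_on with
  | zero => simp
  | tmul x y => simp [hΛ, hR]
  | add x y hx hy => simp_all

variable (A Ψ) in
theorem circ_lTensor (N : Type*) [AddCommGroup N] [Module ℂ N] :
    toConv ((Module.End.lTensorAlgHom ℂ Ψ N).toLinearMap ∘ₗ circ A Ψ) =
    toConv (((Module.End.lTensorAlgHom ℂ Ψ N).comp (Algebra.lsmul ℂ ℂ Ψ)).toLinearMap ∘ₗ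
        HopfAlgebra.antipode ℂ) *
      toConv ((Module.End.lTensorAlgHom ℂ Ψ N).toLinearMap ∘ₗ rmul A Ψ) :=
  WithConv.ofConv_injective (LinearMap.algHom_comp_convMul_distrib
    (Module.End.lTensorAlgHom ℂ Ψ N) (toConv (lmul A Ψ ∘ₗ HopfAlgebra.antipode ℂ))
    (toConv (rmul A Ψ)))

variable (A Ψ) in
theorem circ_rTensor (N : Type*) [AddCommGroup N] [Module ℂ N] :
    toConv ((Module.End.rTensorAlgHom ℂ Ψ N).toLinearMap ∘ₗ circ A Ψ) =
    toConv (((Module.End.rTensorAlgHom ℂ Ψ N).comp (Algebra.lsmul ℂ ℂ Ψ)).toLinearMap ∘ₗ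
        HopfAlgebra.antipode ℂ) *
      toConv ((Module.End.rTensorAlgHom ℂ Ψ N).toLinearMap ∘ₗ rmul A Ψ) :=
  WithConv.ofConv_injective (LinearMap.algHom_comp_convMul_distrib
    (Module.End.rTensorAlgHom ℂ Ψ N) (toConv (lmul A Ψ ∘ₗ HopfAlgebra.antipode ℂ))
    (toConv (rmul A Ψ)))

theorem left_circ (θ : Ψ) (hθ : X.left θ = 1 ⊗ₜ θ) (a : A) :
    X.left (circ A Ψ a θ) = 1 ⊗ₜ circ A Ψ a θ := by
  let lam := ((Module.End.rTensorAlgHom ℂ A Ψ).comp (Algebra.lmul ℂ A))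
  let L := ((Module.End.lTensorAlgHom ℂ Ψ A).comp (Algebra.lsmul ℂ ℂ Ψ : A →ₐ[ℂ] _))
  let R := ((Module.End.lTensorAlgHom ℂ Ψ A).toLinearMap ∘ₗ rmul A Ψ)
  have h := map_circ X.left (lamL A Ψ).toLinearMap
    (toConv lam.toLinearMap * toConv R).ofConv θ
    (fun a ψ => by rw [X.left_lmul, AlgHom.toLinearMap_apply, lamL_apply])
    (fun a => by
      rw [X.left_rmul, hθ, LinearMap.convMul_def]
      simp only [LinearMap.comp_apply]
      induction Coalgebra.comul (R := ℂ) a using TensorProduct.induction_on with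
      | zero => simp
      | tmul x y =>
        rw [TensorProduct.map_tmul, LinearMap.mul'_apply, Module.End.mul_apply]
        change _ = LinearMap.rTensor Ψ (LinearMap.mulLeft ℂ x)
          (LinearMap.lTensor A (rmul A Ψ y) (1 ⊗ₜ θ))
        simp
      | add x y hx hy => simp_all) a
  have e : toConv ((lamL A Ψ).toLinearMap ∘ₗ HopfAlgebra.antipode ℂ) *
      (toConv lam.toLinearMap * toConv R) =
      toConv ((Module.End.lTensorAlgHom ℂ Ψ A).toLinearMap ∘ₗ circ A Ψ) := by
    have h1 : toConv R = toConv L.toLinearMap *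
        (toConv (L.toLinearMap ∘ₗ HopfAlgebra.antipode ℂ) * toConv R) := by
      rw [← mul_assoc, conv_antipode', one_mul]
    rw [circ_lTensor]
    conv_lhs => rw [h1, ← mul_assoc (toConv lam.toLinearMap), ← lamL_conv, ← mul_assoc,
      conv_antipode, one_mul]
  rw [h, toConv_ofConv, e, hθ]
  rfl

/-- The coaction of `ψ ∘ a` is `(ψ₀ ∘ a⁽²⁾) ⊗ κ(a⁽¹⁾) ψ₁ a⁽³⁾`. -/
theorem right_circ (ψ : Ψ) (a : A) :
    X.right (circ A Ψ a ψ) =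
      (toConv ((Module.End.lTensorAlgHom ℂ A Ψ).toLinearMap ∘ₗ LinearMap.mul ℂ A ∘ₗ
          HopfAlgebra.antipode ℂ) *
        (toConv ((Module.End.rTensorAlgHom ℂ Ψ A).toLinearMap ∘ₗ circ A Ψ) *
        toConv ((Module.End.lTensorAlgHom ℂ A Ψ).toLinearMap ∘ₗ
          (LinearMap.mul ℂ A).flip))).ofConv a (X.right ψ) := by
  let lam := ((Module.End.lTensorAlgHom ℂ A Ψ).comp (Algebra.lmul ℂ A))
  let L := ((Module.End.rTensorAlgHom ℂ Ψ A).comp (Algebra.lsmul ℂ ℂ Ψ : A →ₐ[ℂ] _))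
  let R := ((Module.End.rTensorAlgHom ℂ Ψ A).toLinearMap ∘ₗ rmul A Ψ)
  let ρ := ((Module.End.lTensorAlgHom ℂ A Ψ).toLinearMap ∘ₗ (LinearMap.mul ℂ A).flip)
  have h := map_circ X.right (lamR A Ψ).toLinearMap
    (toConv R * toConv ρ).ofConv ψ
    (fun a ψ => by rw [X.right_lmul, AlgHom.toLinearMap_apply, lamR_apply])
    (fun a => by
      rw [X.right_rmul, LinearMap.convMul_def]
      simp only [LinearMap.comp_apply]
      induction Coalgebra.comul (R := ℂ) a using TensorProduct.induction_on with
      | zero => simp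
      | tmul x y =>
        induction X.right ψ using TensorProduct.induction_on with
        | zero => simp
        | tmul u v => simp [ρ, R]; rfl
        | add u v hu hv => simp_all
      | add x y hx hy => simp_all) a
  have e : toConv ((lamR A Ψ).toLinearMap ∘ₗ HopfAlgebra.antipode ℂ) =
      toConv (lam.toLinearMap ∘ₗ HopfAlgebra.antipode ℂ) *
      toConv (L.toLinearMap ∘ₗ HopfAlgebra.antipode ℂ) := by
    refine (left_inv_eq_right_inv (a := toConv (lamR A Ψ).toLinearMap) ?_
      (conv_antipode' _)).symm
    rw [lamR_conv, mul_assoc, ← mul_assoc (toConv (L.toLinearMap ∘ₗ _)), conv_antipode,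
      one_mul, conv_antipode]
  rw [h, toConv_ofConv, e, circ_rTensor]
  simp only [mul_assoc]
  rfl

/-- The space `𝕍` of left-invariant elements of `Ψ`. -/
def inv : Submodule ℂ Ψ := LinearMap.ker (X.left - TensorProduct.mk ℂ A Ψ 1)

theorem mem_inv {θ : Ψ} : θ ∈ X.inv ↔ X.left θ = 1 ⊗ₜ θ := by
  simp [inv, sub_eq_zero]

/-- The right action `θ ∘ a` of `A` on the left-invariant part, as a map `a ↦ (θ ↦ θ ∘ a)`. -/
def invCirc : A →ₗ[ℂ] Module.End ℂ X.inv where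
  toFun a := (circ A Ψ a).restrict fun θ hθ =>
    X.mem_inv.2 (X.left_circ θ (X.mem_inv.1 hθ) a)
  map_add' a b := by ext; simp
  map_smul' r a := by ext; simp

@[simp] theorem coe_invCirc (a : A) (θ : X.inv) :
    (X.invCirc a θ : Ψ) = circ A Ψ a (θ : Ψ) := rfl

theorem invCirc_one : X.invCirc 1 = 1 := by ext; simp [circ_one]

theorem invCirc_mul (a b : A) : X.invCirc (a * b) = X.invCirc b * X.invCirc a := by
  ext; simp [circ_mul]

theorem right_mem (θ : X.inv) :
    X.right θ ∈ LinearMap.range (LinearMap.rTensor A X.inv.subtype) := by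
  have h := Module.Flat.rTensor_exact A
    (LinearMap.exact_subtype_ker_map (X.left - TensorProduct.mk ℂ A Ψ 1))
  refine (h _).1 ?_
  apply (TensorProduct.assoc ℂ A Ψ A).injective
  rw [LinearMap.rTensor_sub, map_zero]
  refine (map_sub (TensorProduct.assoc ℂ A Ψ A) (LinearMap.rTensor A X.left (X.right θ))
    (LinearMap.rTensor A (TensorProduct.mk ℂ A Ψ 1) (X.right θ))).trans ?_
  rw [X.left_right, X.mem_inv.1 θ.2, LinearMap.lTensor_tmul, sub_eq_zero]
  induction X.right (θ : Ψ) using TensorProduct.induction_on with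
  | zero => simp
  | tmul u v => simp
  | add u v hu hv => simp_all [TensorProduct.tmul_add]

/-- The right coaction `ϰ : 𝕍 → 𝕍 ⊗ A`, the restriction of the right action map of `Ψ`. -/
def coact : X.inv →ₗ[ℂ] X.inv ⊗[ℂ] A :=
  LinearMap.codRestrictOfInjective (X.right ∘ₗ X.inv.subtype)
    (LinearMap.rTensor A X.inv.subtype)
    (Module.Flat.rTensor_preserves_injective_linearMap _ X.inv.injective_subtype)
    (fun θ => X.right_mem θ)

theorem rTensor_coact (θ : X.inv) :
    LinearMap.rTensor A X.inv.subtype (X.coact θ) = X.right θ :=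
  LinearMap.codRestrictOfInjective_comp_apply _ _ _ _ θ

theorem star_mem_inv (θ : X.inv) : star (θ : Ψ) ∈ X.inv := by
  rw [X.mem_inv, X.left_star, X.mem_inv.1 θ.2]; simp

/-- The involution of `𝕍`. -/
def invStar (θ : X.inv) : X.inv := ⟨star (θ : Ψ), X.star_mem_inv θ⟩

end BicovariantStarBimodule
end Bimodule
section TensorAlgebraCases

variable {V : Type*} [AddCommGroup V] [Module ℂ V]

/-- The product `V ⊗ T(V) → T(V)`. -/
def consMap (V : Type*) [AddCommGroup V] [Module ℂ V] :
    V ⊗[ℂ] TensorAlgebra ℂ V →ₗ[ℂ] TensorAlgebra ℂ V :=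
  TensorProduct.lift (LinearMap.mul ℂ (TensorAlgebra ℂ V) ∘ₗ TensorAlgebra.ι ℂ)

@[simp] theorem consMap_tmul (v : V) (x : TensorAlgebra ℂ V) :
    consMap V (v ⊗ₜ x) = TensorAlgebra.ι ℂ v * x := rfl

/-- The inverse of `(r, v ⊗ x) ↦ r + v x`. -/
def unconsMap (V : Type*) [AddCommGroup V] [Module ℂ V] :
    TensorAlgebra ℂ V →ₗ[ℂ] ℂ × (V ⊗[ℂ] TensorAlgebra ℂ V) :=
  LinearMap.applyₗ ((1 : ℂ), (0 : V ⊗[ℂ] TensorAlgebra ℂ V)) ∘ₗ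
    (TensorAlgebra.lift ℂ (A := Module.End ℂ (ℂ × (V ⊗[ℂ] TensorAlgebra ℂ V)))
      (LinearMap.llcomp ℂ _ _ _ (LinearMap.inr ℂ ℂ (V ⊗[ℂ] TensorAlgebra ℂ V)) ∘ₗ
        LinearMap.lcomp ℂ (V ⊗[ℂ] TensorAlgebra ℂ V)
          (LinearMap.coprod (Algebra.linearMap ℂ (TensorAlgebra ℂ V)) (consMap V)) ∘ₗ
        TensorProduct.mk ℂ V (TensorAlgebra ℂ V))).toLinearMap

@[simp] theorem unconsMap_one : unconsMap V 1 = (1, 0) := by simp [unconsMap]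

theorem unconsMap_algebraMap (r : ℂ) : unconsMap V (algebraMap ℂ _ r) = (r, 0) := by
  rw [Algebra.algebraMap_eq_smul_one, map_smul, unconsMap_one]; simp

theorem unconsMap_left (x : TensorAlgebra ℂ V) :
    algebraMap ℂ _ (unconsMap V x).1 + consMap V (unconsMap V x).2 = x := by
  suffices h : ∀ (x y : TensorAlgebra ℂ V), algebraMap ℂ _ (unconsMap V y).1 +
      consMap V (unconsMap V y).2 = y → algebraMap ℂ _ (unconsMap V (x * y)).1 +
      consMap V (unconsMap V (x * y)).2 = x * y by
    have := h x 1 (by simp)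
    rwa [mul_one] at this
  intro x
  induction x using TensorAlgebra.induction with
  | algebraMap r =>
    intro y hy
    rw [← Algebra.smul_def, map_smul]
    simp only [Prod.smul_fst, Prod.smul_snd, map_smul]
    nth_rewrite 3 [← hy]
    rw [smul_add, smul_eq_mul, map_mul, Algebra.smul_def, Algebra.smul_def]
  | ι v =>
    intro y hy
    simp only [unconsMap, LinearMap.comp_apply, AlgHom.toLinearMap_apply, map_mul,
      TensorAlgebra.lift_ι_apply] at hy ⊢
    simp
    simpa using congrArg (TensorAlgebra.ι ℂ v * ·) hy
  | add a b ha hb =>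
    intro y hy
    have h1 := ha y hy
    have h2 := hb y hy
    rw [add_mul, map_add]
    simp only [Prod.fst_add, Prod.snd_add, map_add]
    rw [add_add_add_comm, h1, h2]
  | mul a b ha hb =>
    intro y hy
    rw [mul_assoc]; exact ha _ (hb _ hy)

@[simp] theorem unconsMap_ι_mul (v : V) (x : TensorAlgebra ℂ V) :
    unconsMap V (TensorAlgebra.ι ℂ v * x) = (0, v ⊗ₜ x) := by
  have h := unconsMap_left x
  simp only [unconsMap, LinearMap.comp_apply, AlgHom.toLinearMap_apply, map_mul,
      TensorAlgebra.lift_ι_apply] at h ⊢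
  simp at h ⊢
  simp [h]

/-- The linear map on `T(V)` with `1 ↦ n` and `v x ↦ g (v ⊗ x)`. -/
def consCases {N : Type*} [AddCommGroup N] [Module ℂ N] (n : N)
    (g : V ⊗[ℂ] TensorAlgebra ℂ V →ₗ[ℂ] N) : TensorAlgebra ℂ V →ₗ[ℂ] N :=
  LinearMap.coprod (LinearMap.toSpanSingleton ℂ N n) g ∘ₗ unconsMap V

section
variable {N : Type*} [AddCommGroup N] [Module ℂ N] (n : N)
    (g : V ⊗[ℂ] TensorAlgebra ℂ V →ₗ[ℂ] N)

@[simp] theorem consCases_one : consCases n g 1 = n := by simp [consCases]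

@[simp] theorem consCases_ι_mul (v : V) (x : TensorAlgebra ℂ V) :
    consCases n g (TensorAlgebra.ι ℂ v * x) = g (v ⊗ₜ x) := by simp [consCases]

@[simp] theorem consCases_consMap (t : V ⊗[ℂ] TensorAlgebra ℂ V) :
    consCases n g (consMap V t) = g t := by
  induction t using TensorProduct.induction_on with
  | zero => simp
  | tmul v x => simp
  | add a b ha hb => simp [ha, hb]

@[simp] theorem consCases_ι (v : V) :
    consCases n g (TensorAlgebra.ι ℂ v) = g (v ⊗ₜ 1) := by
  simpa using consCases_ι_mul n g v 1

end

/-- Induction on `T(V) = ℂ ⊕ V ⊗ T(V)`. -/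
theorem cons_induction {p : TensorAlgebra ℂ V → Prop} (h1 : p 1)
    (hc : ∀ v x, p x → p (TensorAlgebra.ι ℂ v * x)) (ha : ∀ x y, p x → p y → p (x + y))
    (hs : ∀ (r : ℂ) x, p x → p (r • x)) (x : TensorAlgebra ℂ V) : p x := by
  suffices h : ∀ x y, p y → p (x * y) by simpa using h x 1 h1
  intro x
  induction x using TensorAlgebra.induction with
  | algebraMap r => intro y hy; rw [← Algebra.smul_def]; exact hs _ _ hy
  | ι v => intro y hy; exact hc _ _ hy
  | add a b h h' => intro y hy; rw [add_mul]; exact ha _ _ (h _ hy) (h' _ hy)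
  | mul a b h h' => intro y hy; rw [mul_assoc]; exact h _ (h' _ hy)

variable (V) in
/-- The component `V^{⊗n}` of `T(V)`. -/
abbrev deg (n : ℕ) : Submodule ℂ (TensorAlgebra ℂ V) :=
  LinearMap.range (TensorAlgebra.ι ℂ : V →ₗ[ℂ] TensorAlgebra ℂ V) ^ n

variable (β : V ⊗[ℂ] V →ₗ[ℂ] V ⊗[ℂ] V)

/-- The operator on `T(V)` which applies `β` to the tensor factors number `i` and `i + 1`
(counted from zero); it is the identity in degrees `≤ i + 1`. -/
def braidAt : ℕ → (TensorAlgebra ℂ V →ₗ[ℂ] TensorAlgebra ℂ V)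
  | 0 => consCases 1 (LinearMap.coprod (TensorAlgebra.ι ℂ ∘ₗ (TensorProduct.rid ℂ V).toLinearMap)
      (consMap V ∘ₗ (consMap V).lTensor V ∘ₗ
        (TensorProduct.assoc ℂ V V (TensorAlgebra ℂ V)).toLinearMap ∘ₗ
        β.rTensor (TensorAlgebra ℂ V) ∘ₗ
        (TensorProduct.assoc ℂ V V (TensorAlgebra ℂ V)).symm.toLinearMap) ∘ₗ
      (TensorProduct.prodRight ℂ ℂ V ℂ (V ⊗[ℂ] TensorAlgebra ℂ V)).toLinearMap ∘ₗ
      (unconsMap V).lTensor V)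
  | i + 1 => consCases 1 (consMap V ∘ₗ (braidAt i).lTensor V)

theorem braidAt_one (i : ℕ) : braidAt β i 1 = 1 := by cases i <;> simp [braidAt]

theorem braidAt_zero_ι (v : V) :
    braidAt β 0 (TensorAlgebra.ι ℂ v) = TensorAlgebra.ι ℂ v := by
  simp [braidAt]

/-- The product `V ⊗ V → T(V)`. -/
def pairMap (V : Type*) [AddCommGroup V] [Module ℂ V] :
    V ⊗[ℂ] V →ₗ[ℂ] TensorAlgebra ℂ V :=
  TensorProduct.lift ((LinearMap.mul ℂ (TensorAlgebra ℂ V)).compl₁₂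
    (TensorAlgebra.ι ℂ) (TensorAlgebra.ι ℂ))

theorem braidAt_zero (v w : V) (x : TensorAlgebra ℂ V) :
    braidAt β 0 (TensorAlgebra.ι ℂ v * (TensorAlgebra.ι ℂ w * x)) =
      pairMap V (β (v ⊗ₜ w)) * x := by
  simp only [braidAt, consCases_ι_mul]
  simp
  induction β (v ⊗ₜ w) using TensorProduct.induction_on with
  | zero => simp
  | tmul v x => simp [pairMap, mul_assoc]
  | add a b ha hb => simp_all [TensorProduct.add_tmul, add_mul]

theorem braidAt_succ (i : ℕ) (v : V) (x : TensorAlgebra ℂ V) :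
    braidAt β (i + 1) (TensorAlgebra.ι ℂ v * x) = TensorAlgebra.ι ℂ v * braidAt β i x := by
  simp [braidAt]

/-- A minimal decomposition of a permutation `π` of `{0, …, n - 1}` as a product
`s_{i₁} s_{i₂} ⋯ s_{iᵣ}` of the transpositions `s_i = (i, i + 1)`, given as the list
`[i₁, …, iᵣ]`: with `p = π 0` one has `π = (s_{p-1} ⋯ s_1 s_0) ρ`, where `ρ` fixes `0`. -/
def reducedWord : (n : ℕ) → Equiv.Perm (Fin n) → List ℕ
  | 0, _ => []
  | n + 1, π => (List.range (π 0 : ℕ)).reverse ++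
      (reducedWord n (Equiv.Perm.decomposeFin (Fin.cycleRange (π 0) * π)).2).map (· + 1)

/-- The operator `β_π` on `V^{⊗n}`: the transpositions in a minimal decomposition of `π` are
replaced by the corresponding `β`-twists. -/
def braidPerm {n : ℕ} (π : Equiv.Perm (Fin n)) : Module.End ℂ (TensorAlgebra ℂ V) :=
  ((reducedWord n π).map fun i => (braidAt β i : Module.End ℂ (TensorAlgebra ℂ V))).prod

/-- The symmetrizer `Y_n = ∑ β_π`, the sum over all permutations `π ∈ S_n`. -/
def symmDeg (n : ℕ) : Module.End ℂ (TensorAlgebra ℂ V) :=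
  ∑ π : Equiv.Perm (Fin n), braidPerm β π

/-- The total symmetrizer `Y : T(V) → T(V)`, acting as `Y_n` on `V^{⊗n}`. -/
def symm : TensorAlgebra ℂ V →ₗ[ℂ] TensorAlgebra ℂ V :=
  DirectSum.toModule ℂ ℕ (TensorAlgebra ℂ V) (fun n => symmDeg β n ∘ₗ (deg V n).subtype) ∘ₗ
    (DirectSum.decomposeLinearEquiv (deg V)).toLinearMap

theorem symm_apply {n : ℕ} {x : TensorAlgebra ℂ V} (hx : x ∈ deg V n) :
    symm β x = symmDeg β n x := by
  rw [symm, LinearMap.comp_apply]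
  have h : (DirectSum.decomposeLinearEquiv (deg V)).toLinearMap x =
      DirectSum.lof ℂ ℕ (fun n => deg V n) n ⟨x, hx⟩ :=
    DirectSum.decompose_of_mem (deg V) hx
  rw [h, DirectSum.toModule_lof]
  rfl

/-- The permutations of `k + l` letters which preserve the order of the first `k` letters and
the order of the last `l` letters. -/
def shuffles (k l : ℕ) : Finset (Equiv.Perm (Fin (k + l))) :=
  open Classical in
  Finset.univ.filter fun π => StrictMonoOn π {j | (j : ℕ) < k} ∧ StrictMonoOn π {j | k ≤ (j : ℕ)}

/-- The operator `M_{kl} = ∑ β_{π⁻¹}` on `V^{⊗(k+l)}`, the sum over all `π ∈ S_{kl}`. -/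
def shuffleOp (k l : ℕ) : Module.End ℂ (TensorAlgebra ℂ V) :=
  ∑ π ∈ shuffles k l, braidPerm β π⁻¹

/-- The total order reversal on `V^{⊗n}` by means of the braiding. -/
def reversal (n : ℕ) : Module.End ℂ (TensorAlgebra ℂ V) :=
  braidPerm β (Fin.revPerm : Equiv.Perm (Fin n))

/-- The identification `V^{⊗(k+l)} = V^{⊗k} ⊗ V^{⊗l}` for every `l` (zero in degrees `< k`). -/
def splitAt (V : Type*) [AddCommGroup V] [Module ℂ V] :
    ℕ → (TensorAlgebra ℂ V →ₗ[ℂ] TensorAlgebra ℂ V ⊗[ℂ] TensorAlgebra ℂ V)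
  | 0 => TensorProduct.mk ℂ _ _ 1
  | k + 1 => consCases 0 ((consMap V).rTensor (TensorAlgebra ℂ V) ∘ₗ
      (TensorProduct.assoc ℂ V (TensorAlgebra ℂ V) (TensorAlgebra ℂ V)).symm.toLinearMap ∘ₗ
      (splitAt V k).lTensor V)

end TensorAlgebraCases

section SymmetricAlgebra

open WithConv

variable {A Ψ : Type*} [Ring A] [HopfAlgebra ℂ A] [StarRing A] [StarModule ℂ A]
  [AddCommGroup Ψ] [Module ℂ Ψ] [Module A Ψ] [Module Aᵐᵒᵖ Ψ] [SMulCommClass A Aᵐᵒᵖ Ψ]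
  [IsScalarTower ℂ A Ψ] [IsScalarTower ℂ Aᵐᵒᵖ Ψ]

theorem conv_intertwine {M N : Type*} [AddCommGroup M] [Module ℂ M] [AddCommGroup N] [Module ℂ N]
    (s : M →ₗ[ℂ] N) (f g : WithConv (A →ₗ[ℂ] Module.End ℂ M))
    (f' g' : WithConv (A →ₗ[ℂ] Module.End ℂ N))
    (hf : ∀ a m, s (f.ofConv a m) = f'.ofConv a (s m))
    (hg : ∀ a m, s (g.ofConv a m) = g'.ofConv a (s m)) (a : A) (m : M) :
    s ((f * g).ofConv a m) = (f' * g').ofConv a (s m) := by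
  simp only [LinearMap.convMul_def, LinearMap.comp_apply]
  induction Coalgebra.comul (R := ℂ) a using TensorProduct.induction_on with
  | zero => simp
  | tmul x y => simp [hf, hg]
  | add x y hx hy => simp_all

namespace BicovariantStarBimodule

variable [StarAddMonoid Ψ] [StarModule ℂ Ψ] (X : BicovariantStarBimodule A Ψ)

/-- The braiding `τ : 𝕍 ⊗ 𝕍 → 𝕍 ⊗ 𝕍`, `τ(η ⊗ θ) = ∑ θ_k ⊗ (η ∘ c_k)` for
`ϰ(θ) = ∑ θ_k ⊗ c_k`. -/
def braid : X.inv ⊗[ℂ] X.inv →ₗ[ℂ] X.inv ⊗[ℂ] X.inv :=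
  TensorProduct.lift (LinearMap.lcomp ℂ _ X.coact ∘ₗ LinearMap.lTensorHom X.inv ∘ₗ
    X.invCirc.flip)

theorem braid_tmul (η θ : X.inv) :
    X.braid (η ⊗ₜ θ) = (X.invCirc.flip η).lTensor X.inv (X.coact θ) := rfl

theorem coact_circ (θ : X.inv) (a : A) :
    X.coact (X.invCirc a θ) =
      (toConv ((Module.End.lTensorAlgHom ℂ A X.inv).toLinearMap ∘ₗ LinearMap.mul ℂ A ∘ₗ
          HopfAlgebra.antipode ℂ) *
        (toConv ((Module.End.rTensorAlgHom ℂ X.inv A).toLinearMap ∘ₗ X.invCirc) *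
        toConv ((Module.End.lTensorAlgHom ℂ A X.inv).toLinearMap ∘ₗ
          (LinearMap.mul ℂ A).flip))).ofConv a (X.coact θ) := by
  apply Module.Flat.rTensor_preserves_injective_linearMap (M := A) _ X.inv.injective_subtype
  rw [X.rTensor_coact, X.coe_invCirc, X.right_circ, ← X.rTensor_coact]
  refine (conv_intertwine _ _ _ _ _ (fun a m => ?_) (conv_intertwine _ _ _ _ _
    (fun a m => ?_) (fun a m => ?_)) a _).symm <;>
  induction m using TensorProduct.induction_on with
  | zero => simp
  | tmul x y => rfl
  | add x y hx hy => rw [map_add, map_add, map_add, map_add, hx, hy]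

/-- The diagonal action of `A` on `𝕍 ⊗ 𝕍`. -/
def pairCirc : A →ₗ[ℂ] Module.End ℂ (X.inv ⊗[ℂ] X.inv) :=
  (toConv ((Module.End.rTensorAlgHom ℂ X.inv X.inv).toLinearMap ∘ₗ X.invCirc) *
    toConv ((Module.End.lTensorAlgHom ℂ X.inv X.inv).toLinearMap ∘ₗ X.invCirc)).ofConv

theorem pairCirc_tmul (a : A) (v w : X.inv) :
    X.pairCirc a (v ⊗ₜ w) =
      TensorProduct.map (X.invCirc.flip v) (X.invCirc.flip w) (Coalgebra.comul a) := by
  simp only [pairCirc, LinearMap.convMul_def, LinearMap.comp_apply]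
  induction Coalgebra.comul (R := ℂ) a using TensorProduct.induction_on with
  | zero => simp
  | tmul x y =>
    rw [TensorProduct.map_tmul, LinearMap.mul'_apply, Module.End.mul_apply]
    rfl
  | add x y hx hy => simp_all

theorem braid_pairCirc (a : A) (z : X.inv ⊗[ℂ] X.inv) :
    X.braid (X.pairCirc a z) = X.pairCirc a (X.braid z) := by
  induction z using TensorProduct.induction_on with
  | zero => simp
  | add x y hx hy => simp_all
  | tmul v w =>
    let m := toConv ((Module.End.lTensorAlgHom ℂ A X.inv).comp (Algebra.lmul ℂ A)).toLinearMap
    let Z := (toConv ((Module.End.lTensorAlgHom ℂ A X.inv).toLinearMap ∘ₗ LinearMap.mul ℂ A ∘ₗ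
          HopfAlgebra.antipode ℂ) *
        (toConv ((Module.End.rTensorAlgHom ℂ X.inv A).toLinearMap ∘ₗ X.invCirc) *
        toConv ((Module.End.lTensorAlgHom ℂ A X.inv).toLinearMap ∘ₗ
          (LinearMap.mul ℂ A).flip)))
    have h1 : X.braid (X.pairCirc a (v ⊗ₜ w)) =
        (X.invCirc.flip v).lTensor X.inv ((m * Z).ofConv a (X.coact w)) := by
      rw [pairCirc_tmul]
      simp only [LinearMap.convMul_def, LinearMap.comp_apply]
      induction Coalgebra.comul (R := ℂ) a using TensorProduct.induction_on with
      | zero => simp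
      | add x y hx hy => simp_all
      | tmul x y =>
        rw [TensorProduct.map_tmul, LinearMap.flip_apply, LinearMap.flip_apply, braid_tmul,
          coact_circ, TensorProduct.map_tmul, LinearMap.mul'_apply, Module.End.mul_apply]
        change _ = (LinearMap.lTensor X.inv (X.invCirc.flip v)) (LinearMap.lTensor X.inv
          (LinearMap.mulLeft ℂ x) (Z.ofConv y (X.coact w)))
        rw [← LinearMap.comp_apply (f := LinearMap.lTensor X.inv (X.invCirc.flip v)),
          ← LinearMap.lTensor_comp]
        congr 2
        ext b
        simp [invCirc_mul]
    have h2 : m * Z = toConv ((Module.End.rTensorAlgHom ℂ X.inv A).toLinearMap ∘ₗ X.invCirc) *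
        toConv ((Module.End.lTensorAlgHom ℂ A X.inv).toLinearMap ∘ₗ
          (LinearMap.mul ℂ A).flip) := by
      have := conv_antipode' ((Module.End.lTensorAlgHom ℂ A X.inv).comp (Algebra.lmul ℂ A))
      calc m * Z = (m * toConv (((Module.End.lTensorAlgHom ℂ A X.inv).comp
              (Algebra.lmul ℂ A)).toLinearMap ∘ₗ HopfAlgebra.antipode ℂ)) * _ := by
            rw [mul_assoc]; rfl
        _ = _ := by rw [this, one_mul]
    rw [h1, h2, braid_tmul]
    refine conv_intertwine _ _ _ _ _ (fun a m => ?_) (fun a m => ?_) a _ <;>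
    induction m using TensorProduct.induction_on with
    | zero => simp
    | add x y hx hy => rw [map_add, map_add, map_add, map_add, hx, hy]
    | tmul x y =>
      first
      | rfl
      | change x ⊗ₜ[ℂ] X.invCirc (y * a) v = x ⊗ₜ[ℂ] X.invCirc a (X.invCirc y v)
        rw [invCirc_mul]; rfl

/-- The right action `x ∘ a` of `A` on `T(𝕍) = 𝕍^⊗`, as a map `x ↦ (a ↦ x ∘ a)`: the extension of
the action on `𝕍` with `(x y) ∘ a = (x ∘ a⁽¹⁾) (y ∘ a⁽²⁾)` and `1 ∘ a = ε(a) 1`, that is, the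
extension which is multiplicative for the convolution product. -/
def tensorCirc : TensorAlgebra ℂ X.inv →ₐ[ℂ] WithConv (A →ₗ[ℂ] TensorAlgebra ℂ X.inv) :=
  TensorAlgebra.lift ℂ ((WithConv.linearEquiv ℂ _).symm.toLinearMap ∘ₗ
    LinearMap.compRight ℂ (TensorAlgebra.ι ℂ) ∘ₗ X.invCirc.flip)

theorem tensorCirc_ι (v : X.inv) (a : A) :
    (X.tensorCirc (TensorAlgebra.ι ℂ v)).ofConv a = TensorAlgebra.ι ℂ (X.invCirc a v) := by
  simp [tensorCirc]

theorem tensorCirc_one (a : A) :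
    (X.tensorCirc 1).ofConv a = Coalgebra.counit (R := ℂ) a • 1 := by
  rw [map_one, ← Algebra.algebraMap_eq_smul_one]; rfl

theorem tensorCirc_mul (x y : TensorAlgebra ℂ X.inv) (a : A) :
    (X.tensorCirc (x * y)).ofConv a = LinearMap.mul' ℂ _ (TensorProduct.map
      (X.tensorCirc x).ofConv (X.tensorCirc y).ofConv (Coalgebra.comul a)) := by
  rw [map_mul]; rfl

theorem tensorCirc_apply_one (x : TensorAlgebra ℂ X.inv) :
    (X.tensorCirc x).ofConv 1 = x := by
  induction x using cons_induction with
  | h1 => simp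
  | hc v x hx =>
    simp [Algebra.TensorProduct.one_def, hx, tensorCirc_ι, invCirc_one]
  | ha x y hx hy => simp [hx, hy]
  | hs r x hx => simp [hx]

theorem tensorCirc_apply_mul (x : TensorAlgebra ℂ X.inv) (a b : A) :
    (X.tensorCirc x).ofConv (a * b) =
      (X.tensorCirc ((X.tensorCirc x).ofConv a)).ofConv b := by
  induction x using cons_induction generalizing a b with
  | h1 => rw [tensorCirc_one, tensorCirc_one, map_smul, WithConv.ofConv_smul,
      LinearMap.smul_apply, tensorCirc_one, smul_smul, Bialgebra.counit_mul]
  | hc v x hx =>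
    rw [tensorCirc_mul, tensorCirc_mul, Bialgebra.comul_mul]
    induction Coalgebra.comul (R := ℂ) a using TensorProduct.induction_on with
    | zero => simp
    | add x y hx hy => simp_all [add_mul]
    | tmul p q =>
      rw [TensorProduct.map_tmul, LinearMap.mul'_apply, tensorCirc_mul]
      induction Coalgebra.comul (R := ℂ) b using TensorProduct.induction_on with
      | zero => simp
      | add x y hx hy => simp_all [mul_add]
      | tmul r s => simp [hx, tensorCirc_ι, invCirc_mul]
  | ha x y hx hy => simp [hx, hy]
  | hs r x hx => simp [hx]

theorem tensorCirc_pairMap (z : X.inv ⊗[ℂ] X.inv) (a : A) :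
    (X.tensorCirc (pairMap X.inv z)).ofConv a = pairMap X.inv (X.pairCirc a z) := by
  induction z using TensorProduct.induction_on with
  | zero => simp
  | add x y hx hy => simp_all
  | tmul v w =>
    rw [pairCirc_tmul]
    change (X.tensorCirc (TensorAlgebra.ι ℂ v * TensorAlgebra.ι ℂ w)).ofConv a = _
    rw [tensorCirc_mul]
    induction Coalgebra.comul (R := ℂ) a using TensorProduct.induction_on with
    | zero => simp
    | add x y hx hy => simp_all
    | tmul p q => simp [pairMap, tensorCirc_ι]

theorem braidAt_zero_pairMap {V : Type*} [AddCommGroup V] [Module ℂ V]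
    (β : V ⊗[ℂ] V →ₗ[ℂ] V ⊗[ℂ] V) (z : V ⊗[ℂ] V) (x : TensorAlgebra ℂ V) :
    braidAt β 0 (pairMap V z * x) = pairMap V (β z) * x := by
  induction z using TensorProduct.induction_on with
  | zero => simp
  | add x y hx hy => simp_all [add_mul]
  | tmul v w => rw [← braidAt_zero, ← mul_assoc]; rfl

theorem braidAt_circ (i : ℕ) (x : TensorAlgebra ℂ X.inv) (a : A) :
    (X.tensorCirc (braidAt X.braid i x)).ofConv a =
      braidAt X.braid i ((X.tensorCirc x).ofConv a) := by
  induction i generalizing x a with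
  | zero =>
    induction x using cons_induction with
    | h1 => rw [braidAt_one, tensorCirc_one, map_smul, braidAt_one]
    | ha x y hx hy => simp [hx, hy]
    | hs r x hx => simp [hx]
    | hc v x hx =>
      clear hx
      induction x using cons_induction with
      | h1 => rw [mul_one, braidAt_zero_ι, tensorCirc_ι, braidAt_zero_ι]
      | ha x y hx hy => simp_all [mul_add]
      | hs r x hx => simp_all
      | hc w x hx =>
        have h : TensorAlgebra.ι ℂ v * (TensorAlgebra.ι ℂ w * x) =
          pairMap X.inv (v ⊗ₜ w) * x := by rw [← mul_assoc]; rfl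
        rw [h, braidAt_zero_pairMap, tensorCirc_mul, tensorCirc_mul]
        induction Coalgebra.comul (R := ℂ) a using TensorProduct.induction_on with
        | zero => simp
        | add x y hx hy => simp_all
        | tmul p q => simp [tensorCirc_pairMap, braidAt_zero_pairMap, braid_pairCirc]
  | succ i ih =>
    induction x using cons_induction with
    | h1 => rw [braidAt_one, tensorCirc_one, map_smul, braidAt_one]
    | ha x y hx hy => simp [hx, hy]
    | hs r x hx => simp [hx]
    | hc v x hx =>
      rw [braidAt_succ, tensorCirc_mul, tensorCirc_mul]
      induction Coalgebra.comul (R := ℂ) a using TensorProduct.induction_on with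
      | zero => simp
      | add x y hx hy => simp_all
      | tmul p q => simp [tensorCirc_ι, ih, braidAt_succ]

theorem symmDeg_circ (n : ℕ) (x : TensorAlgebra ℂ X.inv) (a : A) :
    (X.tensorCirc (symmDeg X.braid n x)).ofConv a =
      symmDeg X.braid n ((X.tensorCirc x).ofConv a) := by
  simp only [symmDeg, LinearMap.sum_apply, map_sum, WithConv.ofConv_sum]
  refine Finset.sum_congr rfl fun π _ => ?_
  rw [braidPerm]
  induction reducedWord n π with
  | nil => simp
  | cons i l ih => simp [braidAt_circ, ih]

theorem circ_mem_deg (n : ℕ) (x : TensorAlgebra ℂ X.inv) (hx : x ∈ deg X.inv n) (a : A) :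
    (X.tensorCirc x).ofConv a ∈ deg X.inv n := by
  induction hx using Submodule.pow_induction_on_left' generalizing a with
  | algebraMap r =>
    rw [Algebra.algebraMap_eq_smul_one, map_smul, WithConv.ofConv_smul, LinearMap.smul_apply,
      tensorCirc_one, deg, pow_zero]
    exact Submodule.smul_mem _ _ (Submodule.smul_mem _ _ (Submodule.one_le.1 le_rfl))
  | add x y i hx hy ihx ihy => simpa using add_mem (ihx a) (ihy a)
  | mem_mul m hm i x hx ih =>
    obtain ⟨v, rfl⟩ := hm
    rw [tensorCirc_mul]
    induction Coalgebra.comul (R := ℂ) a using TensorProduct.induction_on with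
    | zero => simp
    | add x y hx hy => simpa using add_mem hx hy
    | tmul p q =>
      rw [TensorProduct.map_tmul, LinearMap.mul'_apply, tensorCirc_ι, deg, pow_succ']
      exact Submodule.mul_mem_mul ⟨_, rfl⟩ (ih q)

theorem symm_circ (x : TensorAlgebra ℂ X.inv) (a : A) :
    (X.tensorCirc (symm X.braid x)).ofConv a = symm X.braid ((X.tensorCirc x).ofConv a) := by
  induction x using DirectSum.Decomposition.inductionOn (deg X.inv) with
  | zero => simp
  | homogeneous m =>
    rw [symm_apply _ m.2, symmDeg_circ, symm_apply _ (X.circ_mem_deg _ _ m.2 a)]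
  | add m m' h h' => simp [h, h']

/-- The braided symmetric algebra `S(𝕍) = 𝕍^⊗ / ker Y`. -/
def SymAlg : Type _ :=
  RingQuot fun x y : TensorAlgebra ℂ X.inv => x ∈ LinearMap.ker (symm X.braid) ∧ y = 0

instance : Ring X.SymAlg := inferInstanceAs (Ring (RingQuot _))

instance : Algebra ℂ X.SymAlg := inferInstanceAs (Algebra ℂ (RingQuot _))

/-- The projection `𝕍^⊗ → S(𝕍)`. -/
def symMk : TensorAlgebra ℂ X.inv →ₐ[ℂ] X.SymAlg := RingQuot.mkAlgHom ℂ _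

theorem symMk_surjective : Function.Surjective X.symMk := RingQuot.mkAlgHom_surjective ℂ _

theorem symMk_eq_zero {x : TensorAlgebra ℂ X.inv} (hx : symm X.braid x = 0) : X.symMk x = 0 := by
  have := RingQuot.mkAlgHom_rel ℂ (s := fun x y : TensorAlgebra ℂ X.inv =>
    x ∈ LinearMap.ker (symm X.braid) ∧ y = 0) (x := x) (y := 0) ⟨hx, rfl⟩
  rw [map_zero] at this
  exact this

/-- The map `x ↦ (a ↦ [x ∘ a])` with values in `S(𝕍)`. -/
def symCircAux : TensorAlgebra ℂ X.inv →ₐ[ℂ] WithConv (A →ₗ[ℂ] X.SymAlg) :=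
  TensorAlgebra.lift ℂ ((WithConv.linearEquiv ℂ _).symm.toLinearMap ∘ₗ
    LinearMap.compRight ℂ (X.symMk.toLinearMap ∘ₗ TensorAlgebra.ι ℂ) ∘ₗ X.invCirc.flip)

theorem symCircAux_apply (x : TensorAlgebra ℂ X.inv) (a : A) :
    (X.symCircAux x).ofConv a = X.symMk ((X.tensorCirc x).ofConv a) := by
  induction x using cons_induction generalizing a with
  | h1 =>
    rw [tensorCirc_one, map_one, map_smul, map_one, ← Algebra.algebraMap_eq_smul_one]; rfl
  | ha x y hx hy => simp [hx, hy]
  | hs r x hx => simp [hx]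
  | hc v x hx =>
    rw [tensorCirc_mul, map_mul, LinearMap.convMul_def, ofConv_toConv, LinearMap.comp_apply,
      LinearMap.comp_apply]
    induction Coalgebra.comul (R := ℂ) a using TensorProduct.induction_on with
    | zero => simp
    | add x y hx hy => simp_all
    | tmul p q =>
      have h : (X.symCircAux (TensorAlgebra.ι ℂ v)).ofConv p =
        X.symMk (TensorAlgebra.ι ℂ (X.invCirc p v)) := by simp [symCircAux]
      simp [hx, tensorCirc_ι, h]

/-- The right action `s ∘ a` of `A` on `S(𝕍)`, as a map `s ↦ (a ↦ s ∘ a)`. -/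
def symCirc : X.SymAlg →ₐ[ℂ] WithConv (A →ₗ[ℂ] X.SymAlg) :=
  RingQuot.liftAlgHom ℂ ⟨X.symCircAux, by
    rintro x y ⟨hx, rfl⟩
    rw [map_zero]
    apply WithConv.ofConv_injective
    ext a
    rw [symCircAux_apply, symMk_eq_zero]
    · rfl
    · rw [← symm_circ, LinearMap.mem_ker.1 hx]; simp⟩

theorem symCirc_mk (x : TensorAlgebra ℂ X.inv) (a : A) :
    (X.symCirc (X.symMk x)).ofConv a = X.symMk ((X.tensorCirc x).ofConv a) := by
  rw [← symCircAux_apply]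
  congr 2
  exact RingQuot.liftAlgHom_mkAlgHom_apply ..

theorem symCirc_one (a : A) :
    (X.symCirc 1).ofConv a = Coalgebra.counit (R := ℂ) a • 1 := by
  rw [map_one, ← Algebra.algebraMap_eq_smul_one]; rfl

theorem symCirc_mul (x y : X.SymAlg) (a : A) :
    (X.symCirc (x * y)).ofConv a = LinearMap.mul' ℂ _ (TensorProduct.map
      (X.symCirc x).ofConv (X.symCirc y).ofConv (Coalgebra.comul a)) := by
  rw [map_mul]; rfl

theorem symCirc_apply_one (s : X.SymAlg) : (X.symCirc s).ofConv 1 = s := by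
  obtain ⟨x, rfl⟩ := X.symMk_surjective s
  rw [symCirc_mk, tensorCirc_apply_one]

theorem symCirc_apply_mul (s : X.SymAlg) (a b : A) :
    (X.symCirc s).ofConv (a * b) = (X.symCirc ((X.symCirc s).ofConv a)).ofConv b := by
  obtain ⟨x, rfl⟩ := X.symMk_surjective s
  rw [symCirc_mk, symCirc_mk, symCirc_mk, tensorCirc_apply_mul]

/-- The right coaction `ϰ : 𝕍^⊗ → 𝕍^⊗ ⊗ A`, the multiplicative extension of the coaction
on `𝕍`. -/
def tensorCoact : TensorAlgebra ℂ X.inv →ₐ[ℂ] TensorAlgebra ℂ X.inv ⊗[ℂ] A :=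
  TensorAlgebra.lift ℂ ((TensorAlgebra.ι ℂ).rTensor A ∘ₗ X.coact)

end BicovariantStarBimodule
end SymmetricAlgebra

/-- A right comodule algebra over `A`: a coassociative counital unital homomorphism
`F : B → B ⊗ A`. -/
structure ComoduleAlgebra (A B : Type*) [Ring A] [Algebra ℂ A] [Coalgebra ℂ A] [Ring B]
    [Algebra ℂ B] where
  /-- the coaction -/
  F : B →ₐ[ℂ] B ⊗[ℂ] A
  coassoc : ∀ b, TensorProduct.assoc ℂ B A A (F.toLinearMap.rTensor A (F b)) =
    Coalgebra.comul.lTensor B (F b)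
  counit : ∀ b, TensorProduct.rid ℂ B (Coalgebra.counit.lTensor B (F b)) = b

/-- `A` as a comodule algebra over itself, by the coproduct. -/
def ComoduleAlgebra.regular (A : Type*) [Ring A] [HopfAlgebra ℂ A] : ComoduleAlgebra A A where
  F := Bialgebra.comulAlgHom ℂ A
  coassoc a := Coalgebra.coassoc_apply a
  counit a := by simp

section CrossProduct

variable {A Ψ B : Type*} [Ring A] [HopfAlgebra ℂ A] [StarRing A] [StarModule ℂ A]
  [AddCommGroup Ψ] [Module ℂ Ψ] [Module A Ψ] [Module Aᵐᵒᵖ Ψ] [SMulCommClass A Aᵐᵒᵖ Ψ]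
  [IsScalarTower ℂ A Ψ] [IsScalarTower ℂ Aᵐᵒᵖ Ψ] [StarAddMonoid Ψ] [StarModule ℂ Ψ]
  [Ring B] [Algebra ℂ B]

/-- The vector space `B ⊗ S(𝕍)`, to be equipped with the cross product
`(q ⊗ θ)(b ⊗ η) = ∑ q b_k ⊗ (θ ∘ c_k) η`, where `F(b) = ∑ b_k ⊗ c_k`. -/
def CrossProduct (X : BicovariantStarBimodule A Ψ) (_C : ComoduleAlgebra A B) : Type _ :=
  B ⊗[ℂ] X.SymAlg

namespace CrossProduct

variable (X : BicovariantStarBimodule A Ψ) (C : ComoduleAlgebra A B)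

instance : AddCommGroup (CrossProduct X C) := inferInstanceAs (AddCommGroup (B ⊗[ℂ] X.SymAlg))

instance : Module ℂ (CrossProduct X C) := inferInstanceAs (Module ℂ (B ⊗[ℂ] X.SymAlg))

/-- The bilinear map `B × S(𝕍) → B ⊗ S(𝕍)`, `(b, s) ↦ b ⊗ s`. -/
def mk : B →ₗ[ℂ] X.SymAlg →ₗ[ℂ] CrossProduct X C := TensorProduct.mk ℂ B X.SymAlg

/-- Left multiplication by `q ⊗ θ`: the map `b ⊗ η ↦ ∑ q b_k ⊗ (θ ∘ c_k) η`. -/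
def mulTmul (q : B) (θ : X.SymAlg) : B ⊗[ℂ] X.SymAlg →ₗ[ℂ] B ⊗[ℂ] X.SymAlg :=
  TensorProduct.map (LinearMap.mulLeft ℂ q) (LinearMap.mul' ℂ X.SymAlg) ∘ₗ
    (TensorProduct.assoc ℂ B X.SymAlg X.SymAlg).toLinearMap ∘ₗ
    LinearMap.rTensor X.SymAlg ((X.symCirc θ).ofConv.lTensor B ∘ₗ C.F.toLinearMap)

theorem mulTmul_tmul (q b : B) (θ η : X.SymAlg) : mulTmul X C q θ (b ⊗ₜ η) =
    TensorProduct.map (LinearMap.mulLeft ℂ q)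
      (LinearMap.mulRight ℂ η ∘ₗ (X.symCirc θ).ofConv) (C.F b) := by
  simp only [mulTmul, LinearMap.comp_apply, LinearMap.rTensor_tmul, AlgHom.toLinearMap_apply]
  induction C.F b using TensorProduct.induction_on with
  | zero => simp
  | tmul x y => simp
  | add x y hx hy => simp_all [TensorProduct.add_tmul]

/-- The cross product multiplication. -/
def mulMap : B ⊗[ℂ] X.SymAlg →ₗ[ℂ] B ⊗[ℂ] X.SymAlg →ₗ[ℂ] B ⊗[ℂ] X.SymAlg :=
  TensorProduct.lift (LinearMap.mk₂ ℂ (mulTmul X C)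
    (fun q q' θ => by
      ext b η
      simp only [TensorProduct.AlgebraTensorModule.curry_apply, TensorProduct.curry_apply,
        LinearMap.coe_restrictScalars, LinearMap.add_apply, mulTmul_tmul]
      induction C.F b using TensorProduct.induction_on with
      | zero => simp
      | tmul x y => simp [add_mul, TensorProduct.add_tmul]
      | add x y hx hy => rw [map_add, map_add, map_add, hx, hy]; abel)
    (fun r q θ => by
      ext b η
      simp only [TensorProduct.AlgebraTensorModule.curry_apply, TensorProduct.curry_apply,
        LinearMap.coe_restrictScalars, LinearMap.smul_apply, mulTmul_tmul]
      induction C.F b using TensorProduct.induction_on with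
      | zero => simp
      | tmul x y => simp [TensorProduct.smul_tmul']
      | add x y hx hy => rw [map_add, map_add, hx, hy, smul_add])
    (fun q θ θ' => by
      ext b η
      simp only [TensorProduct.AlgebraTensorModule.curry_apply, TensorProduct.curry_apply,
        LinearMap.coe_restrictScalars, LinearMap.add_apply, mulTmul_tmul]
      induction C.F b using TensorProduct.induction_on with
      | zero => simp
      | tmul x y => simp [add_mul, TensorProduct.tmul_add]
      | add x y hx hy =>
        rw [LinearMap.map_add, LinearMap.map_add, LinearMap.map_add, hx, hy]; abel)
    (fun r q θ => by
      ext b η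
      simp only [TensorProduct.AlgebraTensorModule.curry_apply, TensorProduct.curry_apply,
        LinearMap.coe_restrictScalars, LinearMap.smul_apply, mulTmul_tmul]
      induction C.F b using TensorProduct.induction_on with
      | zero => simp
      | tmul x y => simp
      | add x y hx hy => rw [map_add, map_add, hx, hy, smul_add]))

theorem mulMap_tmul (q b : B) (θ η : X.SymAlg) : mulMap X C (q ⊗ₜ θ) (b ⊗ₜ η) =
    TensorProduct.map (LinearMap.mulLeft ℂ q)
      (LinearMap.mulRight ℂ η ∘ₗ (X.symCirc θ).ofConv) (C.F b) :=
  mulTmul_tmul X C q b θ η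

theorem mulMap_one_left (x : B ⊗[ℂ] X.SymAlg) : mulMap X C (1 ⊗ₜ 1) x = x := by
  induction x using TensorProduct.induction_on with
  | zero => simp
  | add x y hx hy => simp_all
  | tmul b η =>
    rw [mulMap_tmul]
    conv_rhs => rw [← C.counit b]
    induction C.F b using TensorProduct.induction_on with
    | zero => simp
    | tmul x y =>
      simp [Algebra.smul_def]
      rw [← Algebra.smul_def, ← Algebra.smul_def, TensorProduct.smul_tmul]
    | add x y hx hy => rw [map_add, hx, hy, map_add, map_add, TensorProduct.add_tmul]

theorem mulMap_one_right (x : B ⊗[ℂ] X.SymAlg) : mulMap X C x (1 ⊗ₜ 1) = x := by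
  induction x using TensorProduct.induction_on with
  | zero => simp
  | add x y hx hy => simp_all
  | tmul b η =>
    rw [mulMap_tmul, map_one, Algebra.TensorProduct.one_def]
    simp [X.symCirc_apply_one]

/-- Auxiliary map for associativity. -/
def assocAux (q : B) (θ η ζ : X.SymAlg) (t : B ⊗[ℂ] A) :
    (B ⊗[ℂ] A) ⊗[ℂ] A →ₗ[ℂ] B ⊗[ℂ] X.SymAlg :=
  TensorProduct.map LinearMap.id (LinearMap.mul' ℂ X.SymAlg) ∘ₗ
    (TensorProduct.assoc ℂ B X.SymAlg X.SymAlg).toLinearMap ∘ₗ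
    TensorProduct.map
      (TensorProduct.map (LinearMap.mulLeft ℂ q) (X.symCirc θ).ofConv ∘ₗ LinearMap.mulLeft ℂ t)
      (LinearMap.mulRight ℂ ζ ∘ₗ (X.symCirc η).ofConv)

theorem mulMap_assoc_tmul (q b c : B) (θ η ζ : X.SymAlg) :
    mulMap X C (mulMap X C (q ⊗ₜ θ) (b ⊗ₜ η)) (c ⊗ₜ ζ) =
      mulMap X C (q ⊗ₜ θ) (mulMap X C (b ⊗ₜ η) (c ⊗ₜ ζ)) := by
  have hL : ∀ t : B ⊗[ℂ] A, mulMap X C (TensorProduct.map (LinearMap.mulLeft ℂ q)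
      (LinearMap.mulRight ℂ η ∘ₗ (X.symCirc θ).ofConv) t) (c ⊗ₜ ζ) =
      assocAux X q θ η ζ t ((TensorProduct.assoc ℂ B A A).symm
        (Coalgebra.comul.lTensor B (C.F c))) := by
    intro t
    induction t using TensorProduct.induction_on with
    | zero => simp [assocAux]
    | add x y hx hy =>
      rw [map_add, map_add, LinearMap.add_apply, hx, hy]
      generalize (TensorProduct.assoc ℂ B A A).symm _ = s
      induction s using TensorProduct.induction_on with
      | zero => simp
      | add s s' h h' => rw [map_add, map_add, map_add, ← h, ← h']; abel
      | tmul u a => simp [assocAux, add_mul, TensorProduct.add_tmul]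
    | tmul x y =>
      rw [TensorProduct.map_tmul, mulMap_tmul]
      induction C.F c using TensorProduct.induction_on with
      | zero => simp
      | add s s' h h' => simp_all
      | tmul u a =>
        simp only [TensorProduct.map_tmul, LinearMap.lTensor_tmul, LinearMap.comp_apply,
          LinearMap.mulRight_apply, X.symCirc_mul]
        induction Coalgebra.comul (R := ℂ) a using TensorProduct.induction_on with
        | zero => simp
        | add s s' h h' => simp_all [TensorProduct.tmul_add, add_mul]
        | tmul p r => simp [assocAux, X.symCirc_apply_mul, mul_assoc]
  have hR : ∀ s : B ⊗[ℂ] A, mulMap X C (q ⊗ₜ θ) (TensorProduct.map (LinearMap.mulLeft ℂ b)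
      (LinearMap.mulRight ℂ ζ ∘ₗ (X.symCirc η).ofConv) s) =
      assocAux X q θ η ζ (C.F b) (C.F.toLinearMap.rTensor A s) := by
    intro s
    induction s using TensorProduct.induction_on with
    | zero => simp
    | add s s' h h' => simp_all
    | tmul u a =>
      rw [TensorProduct.map_tmul, mulMap_tmul, LinearMap.mulLeft_apply, map_mul,
        LinearMap.rTensor_tmul, AlgHom.toLinearMap_apply]
      simp only [assocAux, LinearMap.comp_apply, TensorProduct.map_tmul, LinearMap.mulLeft_apply]
      induction C.F b * C.F u using TensorProduct.induction_on with
      | zero => simp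
      | add s s' h h' => simp_all [TensorProduct.add_tmul]
      | tmul p r => simp [mul_assoc]
  rw [mulMap_tmul, hL, mulMap_tmul, hR, ← C.coassoc, LinearEquiv.symm_apply_apply]

theorem mulMap_assoc (x y z : B ⊗[ℂ] X.SymAlg) :
    mulMap X C (mulMap X C x y) z = mulMap X C x (mulMap X C y z) := by
  induction x using TensorProduct.induction_on with
  | zero => simp
  | add x x' h h' => simp only [map_add, LinearMap.add_apply, h, h']
  | tmul q θ =>
    induction y using TensorProduct.induction_on with
    | zero => simp
    | add x x' h h' => simp only [map_add, LinearMap.add_apply, h, h']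
    | tmul b η =>
      induction z using TensorProduct.induction_on with
      | zero => simp
      | add x x' h h' => simp only [map_add, h, h']
      | tmul c ζ => exact mulMap_assoc_tmul X C q b c θ η ζ

instance : Ring (CrossProduct X C) where
  mul x y := mulMap X C x y
  one := (1 : B) ⊗ₜ[ℂ] (1 : X.SymAlg)
  mul_assoc := mulMap_assoc X C
  one_mul := mulMap_one_left X C
  mul_one := mulMap_one_right X C
  left_distrib x y z := map_add (mulMap X C x) y z
  right_distrib x y z := LinearMap.map_add₂ (mulMap X C) x y z
  zero_mul x := LinearMap.map_zero₂ (mulMap X C) x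
  mul_zero x := map_zero (mulMap X C x)
  neg_add_cancel := neg_add_cancel
  zsmul := (· • ·)
  zsmul_zero' := zero_zsmul
  zsmul_succ' n a := SubNegMonoid.zsmul_succ' n a
  zsmul_neg' n a := SubNegMonoid.zsmul_neg' n a

instance : Algebra ℂ (CrossProduct X C) :=
  Algebra.ofModule (fun r x y => LinearMap.map_smul₂ (mulMap X C) r x y)
    (fun r x y => map_smul (mulMap X C x) r y)

theorem mk_mul_mk (q b : B) (θ η : X.SymAlg) : mk X C q θ * mk X C b η =
    TensorProduct.map (LinearMap.mulLeft ℂ q)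
      (LinearMap.mulRight ℂ η ∘ₗ (X.symCirc θ).ofConv) (C.F b) :=
  mulMap_tmul X C q b θ η

theorem one_eq : (1 : CrossProduct X C) = mk X C 1 1 := rfl

theorem mulMap_tmul_one (b b' : B) :
    mulMap X C (b ⊗ₜ 1) (b' ⊗ₜ 1) = (b * b') ⊗ₜ[ℂ] (1 : X.SymAlg) := by
  rw [mulMap_tmul]
  conv_rhs => rw [← C.counit b']
  induction C.F b' using TensorProduct.induction_on with
  | zero => simp
  | add s s' h h' => rw [map_add, h, h', map_add, map_add, mul_add, TensorProduct.add_tmul]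
  | tmul p r =>
    simp [X.symCirc_one, Algebra.algebraMap_eq_smul_one, TensorProduct.smul_tmul]

theorem mulMap_one_tmul (s s' : X.SymAlg) :
    mulMap X C (1 ⊗ₜ s) (1 ⊗ₜ s') = (1 : B) ⊗ₜ[ℂ] (s * s') := by
  rw [mulMap_tmul, map_one C.F, Algebra.TensorProduct.one_def]
  simp [X.symCirc_apply_one]

theorem mulMap_tmul_one_one_tmul (b : B) (s : X.SymAlg) :
    mulMap X C (b ⊗ₜ 1) (1 ⊗ₜ s) = b ⊗ₜ[ℂ] s := by
  rw [mulMap_tmul, map_one C.F, Algebra.TensorProduct.one_def]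
  simp [X.symCirc_apply_one]

/-- The inclusion `b ↦ b ⊗ 1`. -/
def inl : B →ₐ[ℂ] CrossProduct X C :=
  AlgHom.ofLinearMap ((mk X C).flip 1) rfl fun b b' => (mulMap_tmul_one X C b b').symm

/-- The inclusion `s ↦ 1 ⊗ s`. -/
def inr : X.SymAlg →ₐ[ℂ] CrossProduct X C :=
  AlgHom.ofLinearMap (mk X C 1) rfl fun s s' => (mulMap_one_tmul X C s s').symm

theorem inl_mul_inr (b : B) (s : X.SymAlg) : inl X C b * inr X C s = mk X C b s :=
  mulMap_tmul_one_one_tmul X C b s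

end CrossProduct
end CrossProduct

section Bundles

/-- The laws of a Hopf *-algebra with antipode `κ`, for an algebra which is also a coalgebra and
a *-algebra. -/
structure IsHopfStarAlgebra (A : Type*) [Ring A] [Algebra ℂ A] [Coalgebra ℂ A] [StarRing A]
    [StarModule ℂ A] (κ : A →ₗ[ℂ] A) : Prop where
  comul_one : Coalgebra.comul (R := ℂ) (1 : A) = 1
  comul_mul : ∀ a b : A, Coalgebra.comul (R := ℂ) (a * b) =
    Coalgebra.comul (R := ℂ) a * Coalgebra.comul (R := ℂ) b
  counit_one : Coalgebra.counit (R := ℂ) (1 : A) = 1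
  counit_mul : ∀ a b : A, Coalgebra.counit (R := ℂ) (a * b) =
    Coalgebra.counit (R := ℂ) a * Coalgebra.counit (R := ℂ) b
  antipode_left : ∀ a : A, LinearMap.mul' ℂ A (κ.rTensor A (Coalgebra.comul a)) =
    algebraMap ℂ A (Coalgebra.counit a)
  antipode_right : ∀ a : A, LinearMap.mul' ℂ A (κ.lTensor A (Coalgebra.comul a)) =
    algebraMap ℂ A (Coalgebra.counit a)
  comul_star : ∀ a : A, Coalgebra.comul (R := ℂ) (star a) = star (Coalgebra.comul (R := ℂ) a)

section Balanced

variable {V B : Type*} [Ring V] [Algebra ℂ V] [Ring B] [Algebra ℂ B] (i : V →ₐ[ℂ] B)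

/-- The span of the elements `q v ⊗ b - q ⊗ v b` of `B ⊗ B`, where `v ∈ V` acts through `i`. -/
def balancedRel : Submodule ℂ (B ⊗[ℂ] B) :=
  Submodule.span ℂ {t | ∃ q v b, t = (q * i v) ⊗ₜ[ℂ] b - q ⊗ₜ[ℂ] (i v * b)}

/-- The tensor product `B ⊗_V B` over the subalgebra `V` (embedded by `i`). -/
abbrev Balanced : Type _ := (B ⊗[ℂ] B) ⧸ balancedRel i

namespace Balanced

/-- The class of `q ⊗ b`. -/
def tmul (q b : B) : Balanced i := (balancedRel i).mkQ (q ⊗ₜ b)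

variable {i} in
/-- The map induced on `B ⊗_V B` by a balanced map on `B ⊗ B`. -/
def lift {N : Type*} [AddCommGroup N] [Module ℂ N] (f : B ⊗[ℂ] B →ₗ[ℂ] N)
    (hf : ∀ q v b, f ((q * i v) ⊗ₜ b) = f (q ⊗ₜ (i v * b))) : Balanced i →ₗ[ℂ] N :=
  (balancedRel i).liftQ f (Submodule.span_le.2 (by
    rintro _ ⟨q, v, b, rfl⟩
    simp [hf]))

@[simp] theorem lift_tmul {N : Type*} [AddCommGroup N] [Module ℂ N] (f : B ⊗[ℂ] B →ₗ[ℂ] N)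
    (hf : ∀ q v b, f ((q * i v) ⊗ₜ b) = f (q ⊗ₜ (i v * b))) (q b : B) :
    lift f hf (tmul i q b) = f (q ⊗ₜ b) := rfl

theorem tmul_balanced (q : B) (v : V) (b : B) : tmul i (q * i v) b = tmul i q (i v * b) := by
  rw [← sub_eq_zero, tmul, tmul, ← map_sub]
  exact (Submodule.Quotient.mk_eq_zero _).2 (Submodule.subset_span ⟨q, v, b, rfl⟩)

theorem hom_ext {N : Type*} [AddCommGroup N] [Module ℂ N] {f g : Balanced i →ₗ[ℂ] N}
    (h : ∀ q b, f (tmul i q b) = g (tmul i q b)) : f = g := by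
  apply Submodule.linearMap_qext
  ext q b
  exact h q b

/-- The product map `B ⊗_V B → B`. -/
def mul : Balanced i →ₗ[ℂ] B :=
  lift (LinearMap.mul' ℂ B) fun q v b => by simp [mul_assoc]

/-- Left multiplication of `B ⊗_V B` by elements of `B`. -/
def lact (z : B) : Balanced i →ₗ[ℂ] Balanced i :=
  lift ((balancedRel i).mkQ ∘ₗ (LinearMap.mulLeft ℂ z).rTensor B) fun q v b => by
    have := tmul_balanced i (z * q) v b
    simpa [tmul, mul_assoc] using this

/-- Right multiplication of `B ⊗_V B` by elements of `B`. -/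
def ract (w : B) : Balanced i →ₗ[ℂ] Balanced i :=
  lift ((balancedRel i).mkQ ∘ₗ (LinearMap.mulRight ℂ w).lTensor B) fun q v b => by
    have := tmul_balanced i q v (b * w)
    simpa [tmul, mul_assoc] using this

@[simp] theorem lact_tmul (z q b : B) : lact i z (tmul i q b) = tmul i (z * q) b := rfl

@[simp] theorem ract_tmul (w q b : B) : ract i w (tmul i q b) = tmul i q (b * w) := rfl

theorem tmul_add_left (q q' b : B) : tmul i (q + q') b = tmul i q b + tmul i q' b := by
  simp [tmul, TensorProduct.add_tmul]

theorem tmul_add_right (q b b' : B) : tmul i q (b + b') = tmul i q b + tmul i q b' := by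
  simp [tmul, TensorProduct.tmul_add]

theorem tmul_smul_left (r : ℂ) (q b : B) : tmul i (r • q) b = r • tmul i q b := by
  rw [tmul, ← TensorProduct.smul_tmul', map_smul, tmul]

theorem tmul_smul_right (r : ℂ) (q b : B) : tmul i q (r • b) = r • tmul i q b := by
  simp [tmul]

/-- The map `z ↦ (x ↦ z x)`. -/
def lactHom : B →ₗ[ℂ] Module.End ℂ (Balanced i) where
  toFun := lact i
  map_add' z z' := hom_ext i fun q b => by simp [add_mul, tmul_add_left]
  map_smul' r z := hom_ext i fun q b => by simp [tmul_smul_left]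

/-- The map `w ↦ (x ↦ x w)`. -/
def ractHom : B →ₗ[ℂ] Module.End ℂ (Balanced i) where
  toFun := ract i
  map_add' z z' := hom_ext i fun q b => by simp [mul_add, tmul_add_right]
  map_smul' r z := hom_ext i fun q b => by simp [tmul_smul_right]

/-- The map `B ⊗_V B → B' ⊗_V B'` induced by an algebra homomorphism `j : B → B'`. -/
def map {B' : Type*} [Ring B'] [Algebra ℂ B'] (j : B →ₐ[ℂ] B') :
    Balanced i →ₗ[ℂ] Balanced (j.comp i) :=
  lift ((balancedRel (j.comp i)).mkQ ∘ₗ TensorProduct.map j.toLinearMap j.toLinearMap)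
    fun q v b => by
      have := tmul_balanced (j.comp i) (j q) v (j b)
      simpa [tmul] using this

end Balanced

end Balanced

/-- A quantum bundle `(B, i, F)` over `V` without the freeness condition: `F` is a counital
coassociative *-homomorphism and `i` is a *-isomorphism of `V` onto the fixed-point subalgebra
of `F`. -/
structure PreBundle (A : Type*) [Ring A] [Algebra ℂ A] [Coalgebra ℂ A] [StarRing A]
    [StarModule ℂ A] {V B : Type*} [Ring V] [Algebra ℂ V] [StarRing V]
    [Ring B] [Algebra ℂ B] [StarRing B] [StarModule ℂ B] (i : V →ₐ[ℂ] B) extends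
    ComoduleAlgebra A B where
  F_star : ∀ b, F (star b) = star (F b)
  i_star : ∀ v, i (star v) = star (i v)
  i_injective : Function.Injective i
  range_i : ∀ b, b ∈ Set.range i ↔ F b = b ⊗ₜ 1

section PreBundle

variable {A : Type*} [Ring A] [Algebra ℂ A] [Coalgebra ℂ A] [StarRing A]
  [StarModule ℂ A] {V B : Type*} [Ring V] [Algebra ℂ V] [StarRing V]
  [Ring B] [Algebra ℂ B] [StarRing B] [StarModule ℂ B] {i : V →ₐ[ℂ] B}

namespace PreBundle

variable (P : PreBundle A i)

theorem F_i (v : V) : P.F (i v) = i v ⊗ₜ 1 := (P.range_i _).1 ⟨v, rfl⟩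

/-- The canonical map `X : B ⊗_V B → B ⊗ A`, `X(q ⊗ b) = q F(b)`. -/
def X : Balanced i →ₗ[ℂ] B ⊗[ℂ] A :=
  Balanced.lift (TensorProduct.lift ((LinearMap.mul ℂ (B ⊗[ℂ] A)).compl₁₂
      (Algebra.TensorProduct.includeLeft : B →ₐ[ℂ] B ⊗[ℂ] A).toLinearMap P.F.toLinearMap))
    fun q v b => by
      simp [P.F_i, ← mul_assoc]

@[simp] theorem X_tmul (q b : B) : P.X (Balanced.tmul i q b) = (q ⊗ₜ 1) * P.F b := rfl

/-- The map `id ⊗ F : B ⊗_V B → (B ⊗_V B) ⊗ A`. -/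
def rightCoact : Balanced i →ₗ[ℂ] Balanced i ⊗[ℂ] A :=
  Balanced.lift ((balancedRel i).mkQ.rTensor A ∘ₗ
    (TensorProduct.assoc ℂ B B A).symm.toLinearMap ∘ₗ P.F.toLinearMap.lTensor B)
    fun q v b => by
      simp only [LinearMap.comp_apply, LinearMap.lTensor_tmul, AlgHom.toLinearMap_apply,
        map_mul, P.F_i]
      induction P.F b using TensorProduct.induction_on with
      | zero => simp
      | add x y hx hy => simp_all [TensorProduct.tmul_add, mul_add]
      | tmul x y =>
        have := Balanced.tmul_balanced i q v x
        simp only [Balanced.tmul, Submodule.mkQ_apply] at this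
        simp [this]

/-- The map `B → A ⊗ B`, `q ↦ ∑ κ⁻¹(d_k) ⊗ q_k`, where `F(q) = ∑ q_k ⊗ d_k` (the opposite
action), with the inverse of the antipode as an argument. -/
def opF (κinv : A →ₗ[ℂ] A) : B →ₗ[ℂ] A ⊗[ℂ] B :=
  κinv.rTensor B ∘ₗ (TensorProduct.comm ℂ B A).toLinearMap ∘ₗ P.F.toLinearMap

/-- The map `B ⊗_V B → A ⊗ (B ⊗_V B)` given by the opposite action on the left factor. -/
def leftCoact (κinv : A →ₗ[ℂ] A) : Balanced i →ₗ[ℂ] A ⊗[ℂ] Balanced i :=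
  Balanced.lift ((balancedRel i).mkQ.lTensor A ∘ₗ
    (TensorProduct.assoc ℂ A B B).toLinearMap ∘ₗ (P.opF κinv).rTensor B)
    fun q v b => by
      simp only [LinearMap.comp_apply, LinearMap.rTensor_tmul, AlgHom.toLinearMap_apply, opF,
        map_mul, P.F_i]
      induction P.F q using TensorProduct.induction_on with
      | zero => simp
      | add x y hx hy => simp_all [TensorProduct.add_tmul, add_mul]
      | tmul x y =>
        have := Balanced.tmul_balanced i x v b
        simp only [Balanced.tmul, Submodule.mkQ_apply] at this
        simp [this]

/-- The translation map `τ(a) = X⁻¹(1 ⊗ a)` of a Hopf-Galois extension. -/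
def translation (hX : Function.Bijective P.X) : A →ₗ[ℂ] Balanced i :=
  (LinearEquiv.ofBijective P.X hX).symm.toLinearMap ∘ₗ TensorProduct.mk ℂ B A 1

theorem X_translation (hX : Function.Bijective P.X) (a : A) :
    P.X (P.translation hX a) = 1 ⊗ₜ a :=
  (LinearEquiv.ofBijective P.X hX).apply_symm_apply _

theorem X_lact (z : B) (x : Balanced i) : P.X (Balanced.lact i z x) = (z ⊗ₜ 1) * P.X x := by
  have : P.X ∘ₗ Balanced.lact i z = LinearMap.mulLeft ℂ (z ⊗ₜ 1) ∘ₗ P.X :=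
    Balanced.hom_ext i fun q b => by simp [← mul_assoc]
  exact LinearMap.congr_fun this x

theorem X_ract (v : V) (x : Balanced i) :
    P.X (Balanced.ract i (i v) x) = P.X x * (i v ⊗ₜ 1) := by
  have : P.X ∘ₗ Balanced.ract i (i v) = LinearMap.mulRight ℂ (i v ⊗ₜ 1) ∘ₗ P.X :=
    Balanced.hom_ext i fun q b => by simp [← mul_assoc, P.F_i]
  exact LinearMap.congr_fun this x

theorem translation_comm (hX : Function.Bijective P.X) (a : A) (v : V) :
    Balanced.lact i (i v) (P.translation hX a) = Balanced.ract i (i v) (P.translation hX a) := by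
  apply hX.1
  rw [X_lact, X_ract, X_translation]
  simp

/-- The map `z ⊗ w ↦ z τ(a) w` of `B ⊗_V B` to itself (it is balanced as `τ(a)` commutes with
the elements of `V`). -/
def insert (hX : Function.Bijective P.X) (a : A) : Balanced i →ₗ[ℂ] Balanced i :=
  Balanced.lift (TensorProduct.lift
    (((LinearMap.mul ℂ (Module.End ℂ (Balanced i))).compl₁₂ (Balanced.lactHom i)
      (Balanced.ractHom i)).compr₂ (LinearMap.applyₗ (P.translation hX a)))) fun q v b => by
    change Balanced.lact i (q * i v) (Balanced.ract i b (P.translation hX a)) =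
      Balanced.lact i q (Balanced.ract i (i v * b) (P.translation hX a))
    have h1 : Balanced.lact i (q * i v) ∘ₗ Balanced.ract i b =
        Balanced.lact i q ∘ₗ Balanced.ract i b ∘ₗ Balanced.lact i (i v) :=
      Balanced.hom_ext i fun q b => by simp [mul_assoc]
    have h2 : Balanced.ract i (i v * b) = Balanced.ract i b ∘ₗ Balanced.ract i (i v) :=
      Balanced.hom_ext i fun q b => by simp [mul_assoc]
    have h1' := LinearMap.congr_fun h1 (P.translation hX a)
    simp only [LinearMap.comp_apply] at h1'
    rw [h1', h2, LinearMap.comp_apply, translation_comm]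

theorem insert_tmul (hX : Function.Bijective P.X) (a : A) (z w : B) :
    P.insert hX a (Balanced.tmul i z w) =
      Balanced.lact i z (Balanced.ract i w (P.translation hX a)) := rfl

end PreBundle

variable (A i) in
/-- A quantum principal bundle `(B, i, F)` over `V`: the action `F` is moreover free, in the
sense that `X : B ⊗_V B → B ⊗ A` is surjective. -/
structure QuantumPrincipalBundle extends PreBundle A i where
  free : Function.Surjective toPreBundle.X

end PreBundle

end Bundles

section TensorBundle

variable (A Ψ : Type*) [Ring A] [Algebra ℂ A] [AddCommGroup Ψ] [Module ℂ Ψ] [Module A Ψ]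
  [Module Aᵐᵒᵖ Ψ]

/-- The relations of the tensor bundle algebra. -/
inductive TensorBundleRel : TensorAlgebra ℂ (A × Ψ) → TensorAlgebra ℂ (A × Ψ) → Prop
  | one : TensorBundleRel (TensorAlgebra.ι ℂ (1, 0)) 1
  | mul (a b : A) : TensorBundleRel (TensorAlgebra.ι ℂ (a * b, 0))
      (TensorAlgebra.ι ℂ (a, 0) * TensorAlgebra.ι ℂ (b, 0))
  | left (a : A) (ψ : Ψ) : TensorBundleRel (TensorAlgebra.ι ℂ (0, a • ψ))
      (TensorAlgebra.ι ℂ (a, 0) * TensorAlgebra.ι ℂ (0, ψ))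
  | right (a : A) (ψ : Ψ) : TensorBundleRel (TensorAlgebra.ι ℂ (0, MulOpposite.op a • ψ))
      (TensorAlgebra.ι ℂ (0, ψ) * TensorAlgebra.ι ℂ (a, 0))

/-- The tensor bundle algebra `T(Ψ)`, the tensor algebra of the bimodule `Ψ` over `A`. -/
def TensorBundle : Type _ := RingQuot (TensorBundleRel A Ψ)

namespace TensorBundle

instance : Ring (TensorBundle A Ψ) := inferInstanceAs (Ring (RingQuot _))

instance : Algebra ℂ (TensorBundle A Ψ) := inferInstanceAs (Algebra ℂ (RingQuot _))

/-- The projection to `T(Ψ)`. -/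
def proj : TensorAlgebra ℂ (A × Ψ) →ₐ[ℂ] TensorBundle A Ψ := RingQuot.mkAlgHom ℂ _

/-- The inclusion `A → T(Ψ)`. -/
def inA : A →ₐ[ℂ] TensorBundle A Ψ :=
  AlgHom.ofLinearMap ((proj A Ψ).toLinearMap ∘ₗ TensorAlgebra.ι ℂ ∘ₗ LinearMap.inl ℂ A Ψ)
    ((RingQuot.mkAlgHom_rel ℂ TensorBundleRel.one).trans (map_one (proj A Ψ)))
    fun a b => (RingQuot.mkAlgHom_rel ℂ (TensorBundleRel.mul a b)).trans
      (map_mul (proj A Ψ) _ _)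

/-- The inclusion `Ψ → T(Ψ)`. -/
def inΨ : Ψ →ₗ[ℂ] TensorBundle A Ψ :=
  (proj A Ψ).toLinearMap ∘ₗ TensorAlgebra.ι ℂ ∘ₗ LinearMap.inr ℂ A Ψ

end TensorBundle

end TensorBundle

section AffineExtension

variable {A Ψ : Type*} [Ring A] [HopfAlgebra ℂ A] [StarRing A] [StarModule ℂ A]
  [AddCommGroup Ψ] [Module ℂ Ψ] [Module A Ψ] [Module Aᵐᵒᵖ Ψ] [SMulCommClass A Aᵐᵒᵖ Ψ]
  [IsScalarTower ℂ A Ψ] [IsScalarTower ℂ Aᵐᵒᵖ Ψ] [StarAddMonoid Ψ] [StarModule ℂ Ψ]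

namespace BicovariantStarBimodule

variable (X : BicovariantStarBimodule A Ψ)

/-- The inclusion `𝕍^⊗ → T(Ψ)`. -/
def inT : TensorAlgebra ℂ X.inv →ₐ[ℂ] TensorBundle A Ψ :=
  TensorAlgebra.lift ℂ (TensorBundle.inΨ A Ψ ∘ₗ X.inv.subtype)

/-- The algebra `Ã = A ⊗ S(𝕍)` of the affine extension. -/
abbrev AffineAlg : Type _ := CrossProduct X (ComoduleAlgebra.regular A)

end BicovariantStarBimodule

variable {V B : Type*} [Ring V] [Algebra ℂ V] [StarRing V]
  [Ring B] [Algebra ℂ B] [StarRing B] [StarModule ℂ B] {i : V →ₐ[ℂ] B}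

namespace PreBundle

variable (P : PreBundle A i) (X : BicovariantStarBimodule A Ψ)

/-- The algebra `B̃ = B ⊗ S(𝕍)`. -/
abbrev AffineTotal : Type _ := CrossProduct X P.toComoduleAlgebra

/-- The inclusion of `V` into `B̃`. -/
abbrev affineBase : V →ₐ[ℂ] P.AffineTotal X := (CrossProduct.inl X P.toComoduleAlgebra).comp i

/-- The map `𝕍^⊗ → B̃`. -/
def inTotal : TensorAlgebra ℂ X.inv →ₗ[ℂ] P.AffineTotal X :=
  (CrossProduct.inr X P.toComoduleAlgebra).toLinearMap ∘ₗ X.symMk.toLinearMap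

/-- The map `t ↦ ∑ I{t_β} [c_β]₁ τ(a) [c_β]₂` on `𝕍^{⊗k}`, where `ϰ(t) = ∑ t_β ⊗ c_β` and
`τ(c) = [c]₁ ⊗ [c]₂`. -/
def affineSummandLeft (hX : Function.Bijective P.X) (a : A) (k : ℕ) :
    TensorAlgebra ℂ X.inv →ₗ[ℂ] Balanced (P.affineBase X) :=
  TensorProduct.lift ((Balanced.lactHom (P.affineBase X) ∘ₗ P.inTotal X ∘ₗ
      reversal X.braid k).compl₂ (Balanced.map i (CrossProduct.inl X P.toComoduleAlgebra) ∘ₗ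
        P.insert hX a ∘ₗ P.translation hX)) ∘ₗ
    X.tensorCoact.toLinearMap

/-- The map `t ⊗ ϑ ↦ ∑ I{t_β} [c_β]₁ τ(a) [c_β]₂ ϑ` on `𝕍^{⊗k} ⊗ 𝕍^⊗`. -/
def affineSummand (hX : Function.Bijective P.X) (a : A) (k : ℕ) :
    TensorAlgebra ℂ X.inv ⊗[ℂ] TensorAlgebra ℂ X.inv →ₗ[ℂ] Balanced (P.affineBase X) :=
  TensorProduct.lift ((Balanced.ractHom (P.affineBase X) ∘ₗ P.inTotal X).flip.compl₁₂
    (P.affineSummandLeft X hX a k) LinearMap.id)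

/-- The right-hand side of the formula for the extended translation map on `a ⊗ [x]`, for `x` of
degree `n`:
`∑_{k+l=n} (-1)^k ∑ I{t_β} [c_{βα}]₁ τ(a) [c_{βα}]₂ ϑ_α`, where `∑ t_α ⊗ ϑ_α = M_{kl}(x)`
and `ϰ(t_α) = ∑ t_β ⊗ c_{βα}`. -/
def affineTranslation (hX : Function.Bijective P.X) (a : A) (n : ℕ)
    (x : TensorAlgebra ℂ X.inv) : Balanced (P.affineBase X) :=
  ∑ kl ∈ Finset.HasAntidiagonal.antidiagonal n, (-1 : ℂ) ^ kl.1 •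
    P.affineSummand X hX a kl.1 (splitAt X.inv kl.1 (shuffleOp X.braid kl.1 kl.2 x))

end PreBundle

end AffineExtension

end

end AffineBundle

/-!
# The quantum affine extension of a Hopf-Galois quantum principal bundle

*The kernel of the symmetrizer.* Let `D : 𝕍^⊗ → 𝕍 ⊗ 𝕍^⊗` be the braided derivative (`deriv`),
which sums over all ways to move one letter to the front by means of the braiding. Decomposing a
permutation into the choice of the letter which comes first and a permutation of the others gives
the recursion `Y = ε + (id ⊗ Y) D` (`symm_eq_deriv`). Consequently `ker Y` is the largest subspace of
the kernel of the augmentation `ε` which is stable under `D` (`symm_eq_zero_of_stable`). Every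
property of `ker Y` is a consequence of this description and of a formula for `D`:

* `D` obeys a Leibniz rule for multiplication from the left and from the right (`deriv_ι_mul`,
  `deriv_mul_ι`), so `ker Y` is a two-sided ideal (`symm_mul_eq_zero`);
* `D(x*)` is determined by `D(x)` (`deriv_tensorStar`), so `ker Y` is invariant under the involution
  (`symm_tensorStar_eq_zero`);
* if `h` is the algebra homomorphism with `h(v) = 1 ⊗ v + ϰ(v)`, then `(D ⊗ id) h(x)` is determined by
  `(id ⊗ h) D(x)` (`derivFst_h`), so `h` is well defined on `S(𝕍)` (`rTensor_h_eq_zero`).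

*The structure of `Ã` and `B̃`.* Both are cross products `B ⊗ S(𝕍)`, for `B` a comodule algebra over
`A`; in the first case it is `A` itself. Homomorphisms of a cross product are given by compatible
homomorphisms of its two factors (`CrossProduct.lift`), and identities between them may be verified on
`B` and `𝕍` (`CrossProduct.algHom_ext`). In this way one gets the coaction `H`, with `A` in place of
`B` the coproduct of `Ã`, and, as a homomorphism to the complex conjugate opposite algebra, the
involution. The fixed points of `H` are found by applying the projection `B̃ → B`.

*Bijectivity.* The map `q ⊗ a s ↦ (q ⊗ a) H(s)` differs from the identity by a map which lowers the
degree in `S(𝕍)`, so it is bijective (`CrossProduct.spreadOp_bijective`). For `Ã` this yields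
bijectivity of `q ⊗ b ↦ q b⁽¹⁾ ⊗ b⁽²⁾`, and a bialgebra with this property is a Hopf algebra
(`canonicalAntipode`). The antipode of a Hopf *-algebra is bijective, with inverse `a ↦ κ(a*)*`. For
`P̃`, the composition of `X̃` with the surjective map `q ⊗ a s ↦ q τ(a) s` is the bijection above,
and `X̃` is therefore bijective (`PreBundle.affine_X_bijective`).

*The translation map* is `τ(ψ) = X̃⁻¹(1 ⊗ ψ)`. Its three identities hold in every Hopf-Galois bundle:
they are verified by applying the injective map `X̃`. For the explicit formula, `X̃` turns the
summand with index `k` into `(1 ⊗ a) ∑ (I{t_β} ⊗ c_{βα}) h(ϑ_α)`. An unshuffle either leaves the first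
letter in front or moves it to the position `k`, and the move splits (`reversedMul_move`): one part
cancels against the terms of the neighbouring index in the alternating sum, the other one is covered
by induction (`sum_reversedMul_unshuffleOp`), so that the sum is `1 ⊗ a [ϑ]`.

*The identification with a quotient of `T(Ψ)`.* As `Ψ` is generated by `𝕍` as a left module
(`smul_inv_induction`), the products `a x` with `x ∈ 𝕍^⊗` span `T(Ψ)`. The projection `a x ↦ a ⊗ [x]`
to `Ã` then has the kernel `A ker Y`, by right exactness of the tensor product (`ker_bundleProj`).
-/

namespace AffineBundle

section Shortcuts

/-! Shortcut instances, which keep the instance search for tensor products and for linear maps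
between them short. -/

variable {M N : Type*}

theorem linearMap_addHomClass [AddCommMonoid M] [AddCommMonoid N] [Module ℂ M] [Module ℂ N] :
    AddHomClass (M →ₗ[ℂ] N) M N := inferInstance

theorem linearMap_zeroHomClass [AddCommMonoid M] [AddCommMonoid N] [Module ℂ M] [Module ℂ N] :
    ZeroHomClass (M →ₗ[ℂ] N) M N := inferInstance

theorem linearEquiv_addHomClass [AddCommMonoid M] [AddCommMonoid N] [Module ℂ M] [Module ℂ N] :
    AddHomClass (M ≃ₗ[ℂ] N) M N := inferInstance

theorem linearEquiv_zeroHomClass [AddCommMonoid M] [AddCommMonoid N] [Module ℂ M] [Module ℂ N] :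
    ZeroHomClass (M ≃ₗ[ℂ] N) M N := inferInstance

theorem algHom_addHomClass [Semiring M] [Semiring N] [Algebra ℂ M] [Algebra ℂ N] :
    AddHomClass (M →ₐ[ℂ] N) M N := inferInstance

theorem algHom_zeroHomClass [Semiring M] [Semiring N] [Algebra ℂ M] [Algebra ℂ N] :
    ZeroHomClass (M →ₐ[ℂ] N) M N := inferInstance

noncomputable abbrev tensorNonUnitalNonAssocSemiring [Semiring M] [Semiring N] [Algebra ℂ M]
    [Algebra ℂ N] : NonUnitalNonAssocSemiring (M ⊗[ℂ] N) := inferInstance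

noncomputable abbrev tensorNonAssocSemiring [Semiring M] [Semiring N] [Algebra ℂ M]
    [Algebra ℂ N] : NonAssocSemiring (M ⊗[ℂ] N) := inferInstance

end Shortcuts

attribute [local instance] linearMap_addHomClass linearMap_zeroHomClass linearEquiv_addHomClass
  linearEquiv_zeroHomClass algHom_addHomClass algHom_zeroHomClass tensorNonUnitalNonAssocSemiring
  tensorNonAssocSemiring

/-! ### The symmetrizer and the braided derivative -/

noncomputable section

section Perm

/-- A permutation of `{0, …, n}` is determined by the image `p` of `0` and the permutation of
`{1, …, n}` which remains after `p` has been moved to the front. -/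
def permCons (n : ℕ) : Fin (n + 1) × Equiv.Perm (Fin n) ≃ Equiv.Perm (Fin (n + 1)) where
  toFun q := (Fin.cycleRange q.1).symm * Equiv.Perm.decomposeFin.symm (0, q.2)
  invFun π := (π 0, (Equiv.Perm.decomposeFin (Fin.cycleRange (π 0) * π)).2)
  left_inv q := by
    have h : ((Fin.cycleRange q.1).symm * Equiv.Perm.decomposeFin.symm (0, q.2)) 0 = q.1 := by
      simp [Equiv.Perm.mul_apply]
    refine Prod.ext h ?_
    dsimp only
    rw [h, ← mul_assoc]
    have : (Fin.cycleRange q.1) * (Fin.cycleRange q.1).symm = 1 := by ext; simp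
    rw [this, one_mul, Equiv.apply_symm_apply]
  right_inv π := by
    have h : (Equiv.Perm.decomposeFin (Fin.cycleRange (π 0) * π)).1 = 0 := by
      have := Equiv.Perm.decomposeFin_symm_apply_zero
        (Equiv.Perm.decomposeFin (Fin.cycleRange (π 0) * π)).1
        (Equiv.Perm.decomposeFin (Fin.cycleRange (π 0) * π)).2
      rw [Prod.mk.eta, Equiv.symm_apply_apply] at this
      rw [← this]
      simp
    have h2 : ((0 : Fin (n + 1)), (Equiv.Perm.decomposeFin (Fin.cycleRange (π 0) * π)).2) =
        Equiv.Perm.decomposeFin (Fin.cycleRange (π 0) * π) := Prod.ext h.symm rfl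
    dsimp only
    rw [h2, Equiv.symm_apply_apply, ← mul_assoc]
    have : (Fin.cycleRange (π 0)).symm * (Fin.cycleRange (π 0)) = 1 := by ext; simp
    rw [this, one_mul]

theorem permCons_zero (n : ℕ) (p : Fin (n + 1)) (ρ : Equiv.Perm (Fin n)) :
    permCons n (p, ρ) 0 = p := by
  simp [permCons]

theorem permCons_succ (n : ℕ) (p : Fin (n + 1)) (ρ : Equiv.Perm (Fin n)) (j : Fin n) :
    permCons n (p, ρ) j.succ = p.succAbove (ρ j) := by
  simp [permCons, Fin.cycleRange_symm_succ]

theorem reducedWord_permCons (n : ℕ) (p : Fin (n + 1)) (ρ : Equiv.Perm (Fin n)) :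
    reducedWord (n + 1) (permCons n (p, ρ)) =
      (List.range (p : ℕ)).reverse ++ (reducedWord n ρ).map (· + 1) := by
  have h : ∀ π : Equiv.Perm (Fin (n + 1)), reducedWord (n + 1) π =
      (List.range (((permCons n).symm π).1 : ℕ)).reverse ++
        (reducedWord n ((permCons n).symm π).2).map (· + 1) := fun _ => rfl
  rw [h, Equiv.symm_apply_apply]

end Perm

section Braid

variable {V : Type*} [AddCommGroup V] [Module ℂ V] (β : V ⊗[ℂ] V →ₗ[ℂ] V ⊗[ℂ] V)

/-- The product of the twists number `p - 1, …, 1, 0`: it moves the first letter across the next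
`p` letters. -/
def moveOp (p : ℕ) : Module.End ℂ (TensorAlgebra ℂ V) :=
  ((List.range p).reverse.map fun i => (braidAt β i : Module.End ℂ (TensorAlgebra ℂ V))).prod

theorem moveOp_zero : moveOp β 0 = 1 := rfl

theorem prod_map_succ_ι_mul (l : List ℕ) (v : V) (x : TensorAlgebra ℂ V) :
    ((l.map (· + 1)).map fun i => (braidAt β i : Module.End ℂ (TensorAlgebra ℂ V))).prod
      (TensorAlgebra.ι ℂ v * x) = TensorAlgebra.ι ℂ v *
      (l.map fun i => (braidAt β i : Module.End ℂ (TensorAlgebra ℂ V))).prod x := by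
  induction l with
  | nil => simp
  | cons i l ih =>
    simp only [List.map_cons, List.prod_cons, Module.End.mul_apply, ih]
    exact braidAt_succ β i v _

/-- The twists of a reduced word first permute the other letters, and then move the first letter to
its place. -/
theorem braidPerm_permCons {n : ℕ} (p : Fin (n + 1)) (ρ : Equiv.Perm (Fin n)) (v : V)
    (x : TensorAlgebra ℂ V) :
    braidPerm β (permCons n (p, ρ)) (TensorAlgebra.ι ℂ v * x) =
      moveOp β p (TensorAlgebra.ι ℂ v * braidPerm β ρ x) := by
  rw [braidPerm, reducedWord_permCons, List.map_append, List.prod_append, Module.End.mul_apply,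
    prod_map_succ_ι_mul]
  rfl

theorem moveOp_succ (p : ℕ) : moveOp β (p + 1) =
    (((List.range p).reverse.map (· + 1)).map
      fun i => (braidAt β i : Module.End ℂ (TensorAlgebra ℂ V))).prod * braidAt β 0 := by
  rw [moveOp, List.range_succ_eq_map, List.reverse_cons, List.map_append, List.prod_append,
    ← List.map_reverse]
  simp

theorem moveOp_succ_ι_mul_ι_mul (p : ℕ) (v w : V) (x : TensorAlgebra ℂ V) :
    moveOp β (p + 1) (TensorAlgebra.ι ℂ v * (TensorAlgebra.ι ℂ w * x)) =
      TensorProduct.lift ((LinearMap.mul ℂ (TensorAlgebra ℂ V)).compl₁₂ (TensorAlgebra.ι ℂ)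
        (moveOp β p ∘ₗ LinearMap.mulRight ℂ x ∘ₗ TensorAlgebra.ι ℂ)) (β (v ⊗ₜ w)) := by
  rw [moveOp_succ, Module.End.mul_apply]
  rw [braidAt_zero]
  induction β (v ⊗ₜ w) using TensorProduct.induction_on with
  | zero => simp
  | add a b ha hb => simp_all [add_mul]
  | tmul a b =>
    simp only [pairMap, TensorProduct.lift.tmul, LinearMap.compl₁₂_apply, LinearMap.mul_apply',
      mul_assoc, prod_map_succ_ι_mul]
    rfl

/-- Right multiplication of the second tensor factor: `w ⊗ y ↦ w ⊗ y x`. -/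
def rightMul (x : TensorAlgebra ℂ V) :
    V ⊗[ℂ] TensorAlgebra ℂ V →ₗ[ℂ] V ⊗[ℂ] TensorAlgebra ℂ V :=
  (LinearMap.mulRight ℂ x).lTensor V

@[simp] theorem rightMul_tmul (x y : TensorAlgebra ℂ V) (w : V) :
    rightMul x (w ⊗ₜ y) = w ⊗ₜ (y * x) := rfl

/-- The map `w ⊗ y ↦ w' ⊗ v' y`, where `β(v ⊗ w) = w' ⊗ v'`. -/
def twist : V →ₗ[ℂ] V ⊗[ℂ] TensorAlgebra ℂ V →ₗ[ℂ] V ⊗[ℂ] TensorAlgebra ℂ V :=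
  TensorProduct.curry ((consMap V).lTensor V ∘ₗ
    (TensorProduct.assoc ℂ V V (TensorAlgebra ℂ V)).toLinearMap ∘ₗ
    β.rTensor (TensorAlgebra ℂ V) ∘ₗ
    (TensorProduct.assoc ℂ V V (TensorAlgebra ℂ V)).symm.toLinearMap)

theorem twist_tmul (v w : V) (y : TensorAlgebra ℂ V) :
    twist β v (w ⊗ₜ y) = rightMul y ((TensorAlgebra.ι ℂ).lTensor V (β (v ⊗ₜ w))) := by
  simp only [twist, TensorProduct.curry_apply, LinearMap.comp_apply, LinearEquiv.coe_coe,
    TensorProduct.assoc_symm_tmul, LinearMap.rTensor_tmul]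
  induction β (v ⊗ₜ w) using TensorProduct.induction_on with
  | zero => simp
  | add a b ha hb => simp_all [TensorProduct.add_tmul]
  | tmul a b => simp

/-- The action of `𝕍^⊗` on pairs `(x, D(x))` which is induced by left multiplication on `x`: a
letter `v` acts by `(x, t) ↦ (v x, v ⊗ x + twist v t)`. -/
def derivAux : TensorAlgebra ℂ V →ₐ[ℂ]
    Module.End ℂ (TensorAlgebra ℂ V × (V ⊗[ℂ] TensorAlgebra ℂ V)) :=
  TensorAlgebra.lift ℂ
    { toFun := fun v => LinearMap.prod (LinearMap.mulLeft ℂ (TensorAlgebra.ι ℂ v) ∘ₗ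
          LinearMap.fst ℂ _ _)
        (LinearMap.coprod (TensorProduct.mk ℂ V (TensorAlgebra ℂ V) v) (twist β v))
      map_add' := fun v w => by
        refine LinearMap.ext fun z => Prod.ext ?_ ?_
        · simp [add_mul]
        · simp; abel
      map_smul' := fun r v => by
        refine LinearMap.ext fun z => Prod.ext ?_ ?_
        · simp
        · simp [TensorProduct.smul_tmul'] }

/-- The braided derivative `T(V) → V ⊗ T(V)`: it is the sum over all ways to move one letter to
the front, that is the component of `V ⊗ T(V)` in the braided coproduct for which the letters are
primitive. It is read off from the action `derivAux` on the pair `(1, 0) = (1, D(1))`. -/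
def deriv : TensorAlgebra ℂ V →ₗ[ℂ] V ⊗[ℂ] TensorAlgebra ℂ V :=
  LinearMap.snd ℂ _ _ ∘ₗ LinearMap.applyₗ (1, 0) ∘ₗ (derivAux β).toLinearMap

@[simp] theorem deriv_one : deriv β 1 = 0 := by simp [deriv]

/-- The letter moved to the front of `v x` is `v`, or a letter of `x` which then crosses `v`. -/
theorem deriv_ι_mul (v : V) (x : TensorAlgebra ℂ V) :
    deriv β (TensorAlgebra.ι ℂ v * x) = v ⊗ₜ x + twist β v (deriv β x) := by
  -- the first component of the pair belonging to `x` is `x`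
  have h : ∀ x : TensorAlgebra ℂ V, (derivAux β x (1, 0)).1 = x := fun x => by
    induction x using cons_induction with
    | h1 => simp
    | hc v x hx => simpa [derivAux] using congrArg (TensorAlgebra.ι ℂ v * ·) hx
    | ha x y hx hy => simp [hx, hy]
    | hs r x hx => simp [hx]
  have := h x
  simp only [deriv, LinearMap.comp_apply, AlgHom.toLinearMap_apply, map_mul,
    LinearMap.applyₗ_apply_apply, Module.End.mul_apply]
  conv_lhs => rw [derivAux, TensorAlgebra.lift_ι_apply, ← derivAux]
  simp [this]

theorem symmDeg_succ (n : ℕ) (v : V) (x : TensorAlgebra ℂ V) :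
    symmDeg β (n + 1) (TensorAlgebra.ι ℂ v * x) =
      ∑ p : Fin (n + 1), moveOp β p (TensorAlgebra.ι ℂ v * symmDeg β n x) := by
  rw [symmDeg, LinearMap.sum_apply, ← (permCons n).sum_comp, Fintype.sum_prod_type]
  refine Finset.sum_congr rfl fun p _ => ?_
  simp only [braidPerm_permCons]
  rw [symmDeg, LinearMap.sum_apply, Finset.mul_sum, map_sum]

/-- The map `v ⊗ x ↦ ∑ β_{p-1} ⋯ β_0 (v x)`, the sum over `p ≤ n`: the first letter is moved to
each of the first `n + 1` positions. -/
def spread (n : ℕ) (v : V) : TensorAlgebra ℂ V →ₗ[ℂ] TensorAlgebra ℂ V :=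
  (∑ p : Fin (n + 1), moveOp β p) ∘ₗ LinearMap.mulLeft ℂ (TensorAlgebra.ι ℂ v)

theorem spread_apply (n : ℕ) (v : V) (x : TensorAlgebra ℂ V) :
    spread β n v x = ∑ p : Fin (n + 1), moveOp β p (TensorAlgebra.ι ℂ v * x) := by
  simp [spread]

theorem spread_consMap (n : ℕ) (v : V) (t : V ⊗[ℂ] TensorAlgebra ℂ V) :
    spread β (n + 1) v (consMap V ((symmDeg β n).lTensor V t)) =
      TensorAlgebra.ι ℂ v * consMap V ((symmDeg β n).lTensor V t) +
        consMap V ((symmDeg β (n + 1)).lTensor V (twist β v t)) := by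
  induction t using TensorProduct.induction_on with
  | zero => simp
  | add a b ha hb => simp only [map_add, ha, hb, mul_add]; abel
  | tmul w y =>
    rw [LinearMap.lTensor_tmul, consMap_tmul, spread_apply, Fin.sum_univ_succ]
    congr 1
    rw [twist_tmul]
    simp only [Fin.val_succ, moveOp_succ_ι_mul_ι_mul]
    induction β (v ⊗ₜ w) using TensorProduct.induction_on with
    | zero => simp
    | add a b ha hb => simp only [map_add, ← ha, ← hb, Finset.sum_add_distrib]
    | tmul a b => simp [symmDeg_succ, Finset.mul_sum]

/-- Moving every letter but one reproduces the symmetrizer: both sides are sums over the same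
words in the twists, up to the commutation of distant twists. -/
theorem symmDeg_eq_deriv (n : ℕ) {x : TensorAlgebra ℂ V} (hx : x ∈ deg V (n + 1)) :
    symmDeg β (n + 1) x = consMap V ((symmDeg β n).lTensor V (deriv β x)) := by
  induction n generalizing x with
  | zero =>
    rw [deg, zero_add, pow_one] at hx
    obtain ⟨v, rfl⟩ := hx
    rw [← mul_one (TensorAlgebra.ι ℂ v), symmDeg_succ, deriv_ι_mul]
    simp [moveOp_zero]
  | succ n ih =>
    rw [deg, pow_succ'] at hx
    induction hx using Submodule.mul_induction_on' with
    | add x _ y _ hx hy => simp only [map_add, hx, hy]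
    | mem_mul_mem m hm y hy =>
      obtain ⟨v, rfl⟩ := hm
      rw [symmDeg_succ, ← spread_apply, ih hy, spread_consMap, ← ih hy, deriv_ι_mul, map_add,
        map_add]
      rfl

/-- The derivative lowers the degree by one. -/
theorem deriv_mem_deg (n : ℕ) {x : TensorAlgebra ℂ V} (hx : x ∈ deg V (n + 1)) :
    deriv β x ∈ LinearMap.range ((deg V n).subtype.lTensor V) := by
  have key : ∀ (n : ℕ) (v : V) (y : TensorAlgebra ℂ V), y ∈ deg V n →
      v ⊗ₜ[ℂ] y ∈ LinearMap.range ((deg V n).subtype.lTensor V) :=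
    fun n v y hy => ⟨v ⊗ₜ ⟨y, hy⟩, rfl⟩
  induction n generalizing x with
  | zero =>
    rw [deg, zero_add, pow_one] at hx
    obtain ⟨v, rfl⟩ := hx
    rw [← mul_one (TensorAlgebra.ι ℂ v), deriv_ι_mul]
    simpa using key 0 v 1 (by rw [deg, pow_zero]; exact Submodule.one_le.1 le_rfl)
  | succ n ih =>
    rw [deg, pow_succ'] at hx
    induction hx using Submodule.mul_induction_on' with
    | add x _ y _ hx hy => rw [map_add]; exact add_mem hx hy
    | mem_mul_mem m hm y hy =>
      obtain ⟨v, rfl⟩ := hm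
      rw [deriv_ι_mul]
      refine add_mem (key _ _ _ hy) ?_
      obtain ⟨t, ht⟩ := ih hy
      rw [← ht]
      clear ht
      induction t using TensorProduct.induction_on with
      | zero => simp
      | add a b ha hb => rw [map_add, map_add]; exact add_mem ha hb
      | tmul w z =>
        rw [LinearMap.lTensor_tmul, twist_tmul]
        induction β (v ⊗ₜ w) using TensorProduct.induction_on with
        | zero => simp
        | add a b ha hb => rw [map_add, map_add]; exact add_mem ha hb
        | tmul a b =>
          refine key _ _ _ ?_
          rw [deg, pow_succ']
          exact Submodule.mul_mem_mul ⟨_, rfl⟩ z.2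

theorem symm_one : symm β 1 = 1 := by
  have h : (1 : TensorAlgebra ℂ V) ∈ deg V 0 := by
    rw [deg, pow_zero]; exact Submodule.one_le.1 le_rfl
  rw [symm_apply β h, symmDeg]
  simp [braidPerm, reducedWord]

theorem mem_deg_zero {x : TensorAlgebra ℂ V} : x ∈ deg V 0 ↔ ∃ r : ℂ, algebraMap ℂ _ r = x := by
  rw [deg, pow_zero, Submodule.mem_one]

theorem algebraMapInv_of_mem_deg (n : ℕ) {x : TensorAlgebra ℂ V} (hx : x ∈ deg V (n + 1)) :
    TensorAlgebra.algebraMapInv x = 0 := by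
  rw [deg, pow_succ'] at hx
  induction hx using Submodule.mul_induction_on' with
  | add x _ y _ hx hy => simp [hx, hy]
  | mem_mul_mem m hm y hy =>
    obtain ⟨v, rfl⟩ := hm
    simp [TensorAlgebra.algebraMapInv]

/-- The recursion for the symmetrizer, `Y(x) = ε(x) + (id ⊗ Y)(D x)`. -/
theorem symm_eq_deriv (x : TensorAlgebra ℂ V) :
    symm β x = algebraMap ℂ _ (TensorAlgebra.algebraMapInv x) +
      consMap V ((symm β).lTensor V (deriv β x)) := by
  induction x using DirectSum.Decomposition.inductionOn (deg V) with
  | zero => simp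
  | add m m' h h' => simp only [map_add, h, h']; abel
  | @homogeneous n m =>
    rcases n with _ | n
    · obtain ⟨r, hr⟩ := mem_deg_zero.1 m.2
      rw [← hr, Algebra.algebraMap_eq_smul_one]
      simp [symm_one, Algebra.algebraMap_eq_smul_one]
    · rw [symm_apply β m.2, symmDeg_eq_deriv β n m.2, algebraMapInv_of_mem_deg n m.2, map_zero,
        zero_add]
      obtain ⟨t, ht⟩ := deriv_mem_deg β n m.2
      rw [← ht, ← LinearMap.comp_apply (f := (symmDeg β n).lTensor V),
        ← LinearMap.comp_apply (f := (symm β).lTensor V), ← LinearMap.lTensor_comp,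
        ← LinearMap.lTensor_comp]
      congr 3
      ext y
      exact (symm_apply β y.2).symm

/-- The tensors of length less than `n`. -/
def degLT (V : Type*) [AddCommGroup V] [Module ℂ V] (n : ℕ) : Submodule ℂ (TensorAlgebra ℂ V) :=
  ⨆ m : Fin n, deg V m

theorem mem_degLT {m n : ℕ} (h : m < n) {x : TensorAlgebra ℂ V} (hx : x ∈ deg V m) :
    x ∈ degLT V n :=
  Submodule.mem_iSup_of_mem (⟨m, h⟩ : Fin n) hx

theorem degLT_mono {m n : ℕ} (h : m ≤ n) : degLT V m ≤ degLT V n :=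
  iSup_le fun j _ hx => mem_degLT (j.2.trans_le h) hx

theorem exists_mem_degLT (x : TensorAlgebra ℂ V) : ∃ n, x ∈ degLT V n := by
  induction x using DirectSum.Decomposition.inductionOn (deg V) with
  | zero => exact ⟨0, zero_mem _⟩
  | @homogeneous n m => exact ⟨n + 1, mem_degLT n.lt_succ_self m.2⟩
  | add m m' h h' =>
    obtain ⟨n, hn⟩ := h
    obtain ⟨n', hn'⟩ := h'
    exact ⟨max n n', add_mem (degLT_mono (le_max_left _ _) hn) (degLT_mono (le_max_right _ _) hn')⟩

/-- The contraction `w ⊗ y ↦ λ(w) y`. -/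
def contract (V : Type*) [AddCommGroup V] [Module ℂ V] {M : Type*} [AddCommGroup M] [Module ℂ M]
    (l : Module.Dual ℂ V) : V ⊗[ℂ] M →ₗ[ℂ] M :=
  (TensorProduct.lid ℂ M).toLinearMap ∘ₗ l.rTensor M

@[simp] theorem contract_tmul {M : Type*} [AddCommGroup M] [Module ℂ M] (l : Module.Dual ℂ V)
    (w : V) (y : M) : contract V l (w ⊗ₜ y) = l w • y := rfl

theorem contract_lTensor {M N : Type*} [AddCommGroup M] [Module ℂ M] [AddCommGroup N] [Module ℂ N]
    (l : Module.Dual ℂ V) (f : M →ₗ[ℂ] N) (t : V ⊗[ℂ] M) :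
    contract V l (f.lTensor V t) = f (contract V l t) := by
  induction t using TensorProduct.induction_on with
  | zero => simp
  | add a b ha hb => simp only [map_add, ha, hb]
  | tmul w y => simp

/-- A tensor is zero if all its contractions with linear functionals are zero: over a field, `V` has
a basis. -/
theorem eq_zero_of_contract {M : Type*} [AddCommGroup M] [Module ℂ M] (t : V ⊗[ℂ] M)
    (h : ∀ l, contract V l t = 0) : t = 0 := by
  let b := Module.Free.chooseBasis ℂ V
  apply (TensorProduct.equivFinsuppOfBasisLeft b).injective
  ext i
  rw [map_zero, Finsupp.zero_apply, ← h (b.coord i)]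
  clear h
  induction t using TensorProduct.induction_on with
  | zero => simp
  | add a b ha hb => rw [map_add, map_add, Finsupp.add_apply, ha, hb]
  | tmul w y => simp

theorem contract_mem {M : Type*} [AddCommGroup M] [Module ℂ M] {N : Submodule ℂ M}
    {t : V ⊗[ℂ] M} (ht : t ∈ LinearMap.range (N.subtype.lTensor V)) (l : Module.Dual ℂ V) :
    contract V l t ∈ N := by
  obtain ⟨s, rfl⟩ := ht
  rw [contract_lTensor]
  exact (contract V l s).2

/-- The kernel of the symmetrizer is the largest subspace stable under the derivative on which
the augmentation vanishes. -/
theorem symm_eq_zero_of_stable (N : Submodule ℂ (TensorAlgebra ℂ V))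
    (h0 : N ≤ LinearMap.ker (TensorAlgebra.algebraMapInv (R := ℂ) (M := V)).toLinearMap)
    (hN : ∀ l, N ≤ N.comap (contract V l ∘ₗ deriv β)) {x : TensorAlgebra ℂ V} (hx : x ∈ N) :
    symm β x = 0 := by
  have hd : ∀ (n : ℕ) (l : Module.Dual ℂ V) (x : TensorAlgebra ℂ V), x ∈ degLT V (n + 1) →
      contract V l (deriv β x) ∈ degLT V n := by
    intro n l x hx
    refine Submodule.iSup_induction _ (motive := fun x => contract V l (deriv β x) ∈ degLT V n)
      hx ?_ (by simp) (fun x y hx hy => by rw [map_add, map_add]; exact add_mem hx hy)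
    rintro ⟨m, hm⟩ x hx
    rcases m with _ | m
    · obtain ⟨r, rfl⟩ := mem_deg_zero.1 hx
      simp [Algebra.algebraMap_eq_smul_one]
    · exact mem_degLT (by omega) (contract_mem (deriv_mem_deg β m hx) l)
  have key : ∀ n, ∀ x ∈ N, x ∈ degLT V n → symm β x = 0 := by
    intro n
    induction n with
    | zero =>
      intro x _ hx
      have : x = 0 := by simpa only [degLT, iSup_of_empty, Submodule.mem_bot] using hx
      rw [this, map_zero]
    | succ n ih =>
      intro x hx hxn
      have : (symm β).lTensor V (deriv β x) = 0 := eq_zero_of_contract _ fun l => by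
        rw [contract_lTensor]
        exact ih _ (hN l hx) (hd n l x hxn)
      have h0x : TensorAlgebra.algebraMapInv x = 0 := h0 hx
      rw [symm_eq_deriv, h0x, this]
      simp
  obtain ⟨n, hn⟩ := exists_mem_degLT x
  exact key n x hx hn

/-- The case `N = ker Y` of `symm_eq_zero_of_stable`, and its converse. -/
theorem symm_eq_zero_iff (x : TensorAlgebra ℂ V) : symm β x = 0 ↔
    TensorAlgebra.algebraMapInv x = 0 ∧ ∀ l, symm β (contract V l (deriv β x)) = 0 := by
  have hinj : Function.Injective (consMap V) := fun s t h => by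
    simpa using congrArg (consCases 0 LinearMap.id) h
  have h0 : ∀ t, TensorAlgebra.algebraMapInv (consMap V t) = 0 := fun t => by
    induction t using TensorProduct.induction_on with
    | zero => simp
    | add a b ha hb => simp_all
    | tmul w y => simp [TensorAlgebra.algebraMapInv]
  constructor
  · intro h
    rw [symm_eq_deriv] at h
    have h1 : TensorAlgebra.algebraMapInv x = 0 := by
      have := congrArg TensorAlgebra.algebraMapInv h
      rw [map_add, h0] at this
      simpa using this
    rw [h1, map_zero, zero_add, ← map_zero (consMap V)] at h
    refine ⟨h1, fun l => ?_⟩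
    rw [← contract_lTensor, hinj h, map_zero]
  · rintro ⟨h, h'⟩
    rw [symm_eq_deriv, h, eq_zero_of_contract ((symm β).lTensor V (deriv β x)) fun l => by
      rw [contract_lTensor, h' l]]
    simp

/-- The derivative maps the kernel `K` of the symmetrizer to `V ⊗ K`. -/
theorem deriv_mem_ker {x : TensorAlgebra ℂ V} (hx : symm β x = 0) :
    deriv β x ∈ LinearMap.range ((LinearMap.ker (symm β)).subtype.lTensor V) := by
  have := Module.Flat.lTensor_exact V (LinearMap.exact_subtype_ker_map (symm β))
  refine (this _).1 (eq_zero_of_contract _ fun l => ?_)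
  rw [contract_lTensor, ((symm_eq_zero_iff β x).1 hx).2 l]

/-- The kernel `K` of the symmetrizer is a left ideal: `K + V K` is stable under the derivative. -/
theorem symm_ι_mul_eq_zero (v : V) {x : TensorAlgebra ℂ V} (hx : symm β x = 0) :
    symm β (TensorAlgebra.ι ℂ v * x) = 0 := by
  let N : Submodule ℂ (TensorAlgebra ℂ V) :=
    LinearMap.ker (symm β) ⊔ LinearMap.range (TensorAlgebra.ι ℂ) * LinearMap.ker (symm β)
  have hle : LinearMap.ker (symm β) ≤ N := le_sup_left
  refine symm_eq_zero_of_stable β N (sup_le ?_ ?_) (fun l => sup_le ?_ ?_)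
    (Submodule.mem_sup_right (Submodule.mul_mem_mul ⟨v, rfl⟩ hx))
  · exact fun y hy => ((symm_eq_zero_iff β y).1 hy).1
  · refine Submodule.mul_le.2 ?_
    rintro _ ⟨w, rfl⟩ y _
    simp [TensorAlgebra.algebraMapInv]
  · exact fun y hy => hle (((symm_eq_zero_iff β y).1 hy).2 l)
  · refine Submodule.mul_le.2 ?_
    rintro _ ⟨w, rfl⟩ y hy
    rw [Submodule.mem_comap, LinearMap.comp_apply, deriv_ι_mul, map_add]
    refine add_mem (hle (by simpa using Submodule.smul_mem _ _ hy)) ?_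
    obtain ⟨t, ht⟩ := deriv_mem_ker β hy
    rw [← ht]
    clear ht
    induction t using TensorProduct.induction_on with
    | zero => simp
    | add a b ha hb => simp only [map_add]; exact add_mem ha hb
    | tmul u z =>
      rw [LinearMap.lTensor_tmul, twist_tmul]
      induction β (w ⊗ₜ u) using TensorProduct.induction_on with
      | zero => simp
      | add a b ha hb => simp only [map_add]; exact add_mem ha hb
      | tmul a b =>
        exact Submodule.mem_sup_right (Submodule.smul_mem _ _ (Submodule.mul_mem_mul ⟨_, rfl⟩ z.2))

/-- The total reversal of `v x` moves `v` behind the reversal of `x`. -/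
theorem reversal_succ (n : ℕ) (v : V) (x : TensorAlgebra ℂ V) :
    reversal β (n + 1) (TensorAlgebra.ι ℂ v * x) =
      moveOp β n (TensorAlgebra.ι ℂ v * reversal β n x) := by
  have h : (Fin.revPerm : Equiv.Perm (Fin (n + 1))) = permCons n (Fin.last n, Fin.revPerm) := by
    ext j
    refine Fin.cases ?_ (fun j => ?_) j
    · rw [permCons_zero]; simp
    · rw [permCons_succ]; simp [Fin.rev_succ]
  rw [reversal, h, braidPerm_permCons]
  rfl

/-- The inverses of the permutations of `{0, …, n - 1}` which preserve the order of the first `k`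
letters and of the others. -/
def unshuffles (n k : ℕ) : Finset (Equiv.Perm (Fin n)) :=
  open Classical in
  Finset.univ.filter fun σ => ∀ i j, ((σ i : ℕ) < k ↔ (σ j : ℕ) < k) → σ i < σ j → i < j

theorem mem_unshuffles {n k : ℕ} {σ : Equiv.Perm (Fin n)} : σ ∈ unshuffles n k ↔
    ∀ i j, ((σ i : ℕ) < k ↔ (σ j : ℕ) < k) → σ i < σ j → i < j := by
  simp [unshuffles]

theorem inv_mem_unshuffles {k l : ℕ} {π : Equiv.Perm (Fin (k + l))} :
    π⁻¹ ∈ unshuffles (k + l) k ↔ π ∈ shuffles k l := by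
  rw [mem_unshuffles, shuffles, Finset.mem_filter]
  constructor
  · intro h
    refine ⟨Finset.mem_univ _, fun a ha b hb hab => ?_, fun a ha b hb hab => ?_⟩ <;>
    · have := h (π a) (π b)
      simp only [Equiv.Perm.inv_def, Equiv.symm_apply_apply] at this
      simp only [Set.mem_ofPred_eq] at ha hb
      exact this (by omega) hab
  · rintro ⟨-, h1, h2⟩ i j hij hlt
    have e : ∀ i, π (π⁻¹ i) = i := π.apply_symm_apply
    rw [← e i, ← e j]
    by_cases hk : ((π⁻¹ i : Fin (k + l)) : ℕ) < k
    · exact h1 hk (hij.1 hk) hlt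
    · exact h2 (not_lt.1 hk) (not_lt.1 fun h => hk (hij.2 h)) hlt

theorem permCons_mem_unshuffles {n k : ℕ} {p : Fin (n + 1)} {ρ : Equiv.Perm (Fin n)} :
    permCons n (p, ρ) ∈ unshuffles (n + 1) k ↔
      ((p : ℕ) = 0 ∧ 0 < k ∧ ρ ∈ unshuffles n (k - 1)) ∨ ((p : ℕ) = k ∧ ρ ∈ unshuffles n k) := by
  have hs : ∀ x : Fin n, (p.succAbove x : ℕ) = if (x : ℕ) < p then (x : ℕ) else x + 1 := fun x => by
    simp only [Fin.succAbove, Fin.lt_def, Fin.val_castSucc]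
    split_ifs <;> simp
  simp only [mem_unshuffles, Fin.forall_fin_succ, permCons_zero, permCons_succ, Fin.lt_def, hs,
    Fin.val_succ, Fin.val_zero]
  constructor
  · rintro ⟨-, h⟩
    have h0 : ∀ y : Fin n, (y : ℕ) < p → ¬((y : ℕ) < k ↔ (p : ℕ) < k) := fun y hy hyk => by
      have := (h (ρ.symm y)).1
      rw [Equiv.apply_symm_apply, if_pos hy] at this
      exact absurd (this hyk hy) (by omega)
    by_cases hp : (p : ℕ) = 0
    · rcases Nat.eq_zero_or_pos k with hk | hk
      · refine Or.inr ⟨by omega, fun i j hij hlt => ?_⟩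
        have := (h i).2 j
        rw [if_neg (by omega), if_neg (by omega)] at this
        have := this (by omega) (by omega)
        omega
      · refine Or.inl ⟨hp, hk, fun i j hij hlt => ?_⟩
        have := (h i).2 j
        rw [if_neg (by omega), if_neg (by omega)] at this
        have := this (by omega) (by omega)
        omega
    · have hpn := p.2
      have h1 := h0 ⟨0, by omega⟩ (by dsimp only; omega)
      have h2 := h0 ⟨p - 1, by omega⟩ (by dsimp only; omega)
      dsimp only at h1 h2
      refine Or.inr ⟨by omega, fun i j hij hlt => ?_⟩
      have := (h i).2 j
      have := this (by split_ifs <;> omega) (by split_ifs <;> omega)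
      omega
  · rintro (⟨hp, hk, h⟩ | ⟨hp, h⟩)
    · refine ⟨⟨fun _ h => absurd h (lt_irrefl _), fun j _ _ => by omega⟩, fun i => ⟨fun _ hlt => ?_, fun j hij hlt => ?_⟩⟩
      · omega
      · rw [if_neg (by omega), if_neg (by omega)] at hij hlt
        have := h i j (by omega) (by omega)
        omega
    · refine ⟨⟨fun _ h => absurd h (lt_irrefl _), fun j _ _ => by omega⟩, fun i => ⟨fun h1 hlt => ?_, fun j hij hlt => ?_⟩⟩
      · split_ifs at h1 hlt <;> omega
      · have := h i j (by split_ifs at hij <;> omega) (by split_ifs at hlt <;> omega)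
        omega

/-- `unshuffles` consists of the inverses of the permutations which define `M_{kl}`. -/
theorem shuffleOp_eq (k l : ℕ) :
    shuffleOp β k l = ∑ σ ∈ unshuffles (k + l) k, braidPerm β σ := by
  rw [shuffleOp]
  refine Finset.sum_bij (fun π _ => π⁻¹) (fun π hπ => inv_mem_unshuffles.2 hπ)
    (fun _ _ _ _ h => inv_injective h) (fun σ hσ => ⟨σ⁻¹, ?_, inv_inv σ⟩) (fun _ _ => rfl)
  rw [← inv_mem_unshuffles, inv_inv]
  exact hσ

/-- The sum of the operators of the inverse shuffles of `n` letters, the first `k` letters being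
separated from the others. -/
def unshuffleOp (n k : ℕ) : Module.End ℂ (TensorAlgebra ℂ V) :=
  ∑ σ ∈ unshuffles n k, braidPerm β σ

theorem unshuffleOp_zero (k : ℕ) (x : TensorAlgebra ℂ V) : unshuffleOp β 0 k x = x := by
  have : unshuffles 0 k = Finset.univ := by
    refine Finset.eq_univ_iff_forall.2 fun σ => mem_unshuffles.2 fun i => i.elim0
  simp [unshuffleOp, this, braidPerm, reducedWord]

/-- In an unshuffle of `v x` the letter `v` stays in front, or it is moved to the position `k`
behind the first block. For `k = 0` only the second alternative exists, for `k = n + 1` only the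
first one. -/
theorem unshuffleOp_succ_eq_sum (n k : ℕ) (v : V) (x : TensorAlgebra ℂ V) :
    unshuffleOp β (n + 1) k (TensorAlgebra.ι ℂ v * x) =
      (if 0 < k then TensorAlgebra.ι ℂ v * unshuffleOp β n (k - 1) x else 0) +
      (if k ≤ n then moveOp β k (TensorAlgebra.ι ℂ v * unshuffleOp β n k x) else 0) := by
  classical
  have h1 : unshuffleOp β (n + 1) k (TensorAlgebra.ι ℂ v * x) =
      ∑ p : Fin (n + 1), ∑ ρ : Equiv.Perm (Fin n),
        if permCons n (p, ρ) ∈ unshuffles (n + 1) k then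
          moveOp β p (TensorAlgebra.ι ℂ v * braidPerm β ρ x) else 0 := by
    rw [unshuffleOp, LinearMap.sum_apply]
    conv_lhs => rw [← Finset.univ_inter (unshuffles (n + 1) k)]
    rw [← Finset.sum_ite_mem, ← (permCons n).sum_comp, Fintype.sum_prod_type]
    simp only [braidPerm_permCons]
  have h2 : ∀ k', ∑ ρ : Equiv.Perm (Fin n), (if ρ ∈ unshuffles n k' then
      TensorAlgebra.ι ℂ v * braidPerm β ρ x else 0) =
      TensorAlgebra.ι ℂ v * unshuffleOp β n k' x := fun k' => by
    rw [Finset.sum_ite_mem, Finset.univ_inter, unshuffleOp, LinearMap.sum_apply, Finset.mul_sum]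
  have h3 : ∀ (p : Fin (n + 1)) (ρ : Equiv.Perm (Fin n)),
      (if permCons n (p, ρ) ∈ unshuffles (n + 1) k then
          moveOp β p (TensorAlgebra.ι ℂ v * braidPerm β ρ x) else 0) =
      (if (p : ℕ) = 0 then (if 0 < k then moveOp β p (if ρ ∈ unshuffles n (k - 1) then
          TensorAlgebra.ι ℂ v * braidPerm β ρ x else 0) else 0) else 0) +
      (if (p : ℕ) = k then moveOp β p (if ρ ∈ unshuffles n k then
          TensorAlgebra.ι ℂ v * braidPerm β ρ x else 0) else 0) := fun p ρ => by
    rw [if_congr permCons_mem_unshuffles rfl rfl]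
    split_ifs <;> simp_all
  simp only [h1, h3, Finset.sum_add_distrib]
  congr 1
  · rw [Fin.sum_univ_succ]
    simp only [Fin.val_zero, if_true, Fin.val_succ, Nat.succ_ne_zero, if_false,
      Finset.sum_const_zero, add_zero]
    split_ifs with hk
    · rw [← map_sum, h2]; rfl
    · simp
  · split_ifs with hk
    · rw [Finset.sum_eq_single (⟨k, by omega⟩ : Fin (n + 1))]
      · simp only [if_true]
        rw [← map_sum, h2]
      · intro p _ hp
        simp only [if_neg (fun h : (p : ℕ) = k => hp (Fin.ext h)), Finset.sum_const_zero]
      · simp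
    · refine Finset.sum_eq_zero fun p _ => ?_
      simp only [if_neg (show ¬(p : ℕ) = k by omega), Finset.sum_const_zero]

end Braid
end

/-! ### The kernel of the symmetrizer is an ideal -/

noncomputable section

section Sweedler

variable {A : Type*} [Ring A] [HopfAlgebra ℂ A]

/-- The convolution product `a ↦ ∑ f(a⁽¹⁾) g(a⁽²⁾)`. -/
def conv {E : Type*} [Ring E] [Algebra ℂ E] (f g : A →ₗ[ℂ] E) : A →ₗ[ℂ] E :=
  LinearMap.mul' ℂ E ∘ₗ TensorProduct.map f g ∘ₗ Coalgebra.comul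

theorem algHom_conv {E E' : Type*} [Ring E] [Algebra ℂ E] [Ring E'] [Algebra ℂ E'] (J : E →ₐ[ℂ] E')
    (f g : A →ₗ[ℂ] E) (a : A) :
    J (conv f g a) = conv (J.toLinearMap ∘ₗ f) (J.toLinearMap ∘ₗ g) a := by
  simp only [conv, LinearMap.comp_apply]
  induction Coalgebra.comul (R := ℂ) a using TensorProduct.induction_on with
  | zero => simp
  | add x y hx hy => simp only [map_add, hx, hy]
  | tmul x y => simp

/-- Coassociativity of a coaction `ρ`, in the form in which it is applied to two maps which
describe one and the same expression in Sweedler notation. -/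
theorem coassoc_lift {M N : Type*} [AddCommGroup M] [Module ℂ M] [AddCommGroup N] [Module ℂ N]
    {ρ : M →ₗ[ℂ] M ⊗[ℂ] A}
    (hρ : ∀ m, TensorProduct.assoc ℂ M A A (ρ.rTensor A (ρ m)) = Coalgebra.comul.lTensor M (ρ m))
    (F G : M ⊗[ℂ] A →ₗ[ℂ] N) (Φ : M ⊗[ℂ] (A ⊗[ℂ] A) →ₗ[ℂ] N)
    (hF : ∀ m c, F (m ⊗ₜ c) = Φ (TensorProduct.assoc ℂ M A A (ρ m ⊗ₜ c)))
    (hG : ∀ m c, G (m ⊗ₜ c) = Φ (m ⊗ₜ Coalgebra.comul c)) (m : M) : F (ρ m) = G (ρ m) := by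
  have h1 : F = Φ ∘ₗ (TensorProduct.assoc ℂ M A A).toLinearMap ∘ₗ ρ.rTensor A :=
    TensorProduct.ext' fun m c => by simp [hF]
  have h2 : G = Φ ∘ₗ Coalgebra.comul.lTensor M :=
    TensorProduct.ext' fun m c => by simp [hG]
  rw [h1, h2]
  exact congrArg Φ (hρ m)

end Sweedler

variable {A Ψ : Type*} [Ring A] [HopfAlgebra ℂ A] [StarRing A] [StarModule ℂ A]
  [AddCommGroup Ψ] [Module ℂ Ψ] [Module A Ψ] [Module Aᵐᵒᵖ Ψ] [SMulCommClass A Aᵐᵒᵖ Ψ]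
  [IsScalarTower ℂ A Ψ] [IsScalarTower ℂ Aᵐᵒᵖ Ψ] [StarAddMonoid Ψ] [StarModule ℂ Ψ]

namespace BicovariantStarBimodule

variable (X : BicovariantStarBimodule A Ψ)

theorem coact_coassoc (v : X.inv) : TensorProduct.assoc ℂ X.inv A A (X.coact.rTensor A (X.coact v)) =
    Coalgebra.comul.lTensor X.inv (X.coact v) := by
  apply Module.Flat.rTensor_preserves_injective_linearMap (M := A ⊗[ℂ] A) _ X.inv.injective_subtype
  have h := X.right_coassoc (v : Ψ)
  rw [← X.rTensor_coact] at h
  have h1 : ∀ t : X.inv ⊗[ℂ] A, TensorProduct.assoc ℂ Ψ A A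
      (X.right.rTensor A (LinearMap.rTensor A X.inv.subtype t)) =
      LinearMap.rTensor (A ⊗[ℂ] A) X.inv.subtype
        (TensorProduct.assoc ℂ X.inv A A (X.coact.rTensor A t)) := fun t => by
    induction t using TensorProduct.induction_on with
    | zero => simp
    | add x y hx hy => simp only [map_add, hx, hy]
    | tmul w c =>
      simp only [LinearMap.rTensor_tmul, Submodule.subtype_apply]
      rw [← X.rTensor_coact]
      induction X.coact w using TensorProduct.induction_on with
      | zero => simp
      | add x y hx hy => simp only [map_add, TensorProduct.add_tmul, hx, hy]
      | tmul u d => simp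
  have h2 : ∀ t : X.inv ⊗[ℂ] A, Coalgebra.comul.lTensor Ψ (LinearMap.rTensor A X.inv.subtype t) =
      LinearMap.rTensor (A ⊗[ℂ] A) X.inv.subtype
        (Coalgebra.comul.lTensor X.inv t) := fun t => by
    induction t using TensorProduct.induction_on with
    | zero => simp
    | add x y hx hy => simp only [map_add, hx, hy]
    | tmul w c => simp
  rw [← h1, ← h2]
  exact h

theorem coact_counit (v : X.inv) :
    TensorProduct.rid ℂ X.inv (Coalgebra.counit.lTensor X.inv (X.coact v)) = v := by
  apply X.inv.injective_subtype
  have h := X.right_counit (v : Ψ)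
  rw [← X.rTensor_coact] at h
  rw [Submodule.subtype_apply, Submodule.subtype_apply]
  conv_rhs => rw [← h]
  induction X.coact v using TensorProduct.induction_on with
  | zero => simp
  | add x y hx hy => simp only [map_add, ← hx, ← hy, Submodule.coe_add]
  | tmul w c => simp

/-- The map `c ↦ ∑ (v_k ∘ c) ⊗ e_k`, where `ϰ(v) = ∑ v_k ⊗ e_k`. -/
def circCoact (v : X.inv) : A →ₗ[ℂ] TensorAlgebra ℂ X.inv ⊗[ℂ] A where
  toFun c := (TensorAlgebra.ι ℂ ∘ₗ X.invCirc c).rTensor A (X.coact v)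
  map_add' c d := by
    rw [map_add, LinearMap.comp_add, LinearMap.rTensor_add, LinearMap.add_apply]
  map_smul' r c := by
    rw [map_smul, LinearMap.comp_smul, LinearMap.rTensor_smul, LinearMap.smul_apply, RingHom.id_apply]

theorem circCoact_apply (v : X.inv) (c : A) :
    X.circCoact v c = (TensorAlgebra.ι ℂ ∘ₗ X.invCirc c).rTensor A (X.coact v) := rfl

theorem tensorCoact_ι (v : X.inv) : X.tensorCoact (TensorAlgebra.ι ℂ v) =
    (TensorAlgebra.ι ℂ).rTensor A (X.coact v) := by
  simp [tensorCoact]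

open WithConv in
/-- The compatibility of the action with the coaction of `𝕍`:
`∑ (1 ⊗ c⁽¹⁾) ϰ(v ∘ c⁽²⁾) = ∑ (v_k ∘ c⁽¹⁾) ⊗ e_k c⁽²⁾`, where `ϰ(v) = ∑ v_k ⊗ e_k`. -/
theorem conv_coact_circ (v : X.inv) (a : A) :
    conv (Algebra.TensorProduct.includeRight : A →ₐ[ℂ] TensorAlgebra ℂ X.inv ⊗[ℂ] A).toLinearMap
      (X.tensorCoact.toLinearMap ∘ₗ TensorAlgebra.ι ℂ ∘ₗ X.invCirc.flip v) a =
    conv (X.circCoact v)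
      (Algebra.TensorProduct.includeRight : A →ₐ[ℂ] TensorAlgebra ℂ X.inv ⊗[ℂ] A).toLinearMap a := by
  let m := toConv ((Module.End.lTensorAlgHom ℂ A X.inv).comp (Algebra.lmul ℂ A)).toLinearMap
  let Z := (toConv ((Module.End.lTensorAlgHom ℂ A X.inv).toLinearMap ∘ₗ LinearMap.mul ℂ A ∘ₗ
        HopfAlgebra.antipode ℂ) *
      (toConv ((Module.End.rTensorAlgHom ℂ X.inv A).toLinearMap ∘ₗ X.invCirc) *
      toConv ((Module.End.lTensorAlgHom ℂ A X.inv).toLinearMap ∘ₗ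
        (LinearMap.mul ℂ A).flip)))
  have h2 : m * Z = toConv ((Module.End.rTensorAlgHom ℂ X.inv A).toLinearMap ∘ₗ X.invCirc) *
      toConv ((Module.End.lTensorAlgHom ℂ A X.inv).toLinearMap ∘ₗ
        (LinearMap.mul ℂ A).flip) := by
    have := conv_antipode' ((Module.End.lTensorAlgHom ℂ A X.inv).comp (Algebra.lmul ℂ A))
    calc m * Z = (m * toConv (((Module.End.lTensorAlgHom ℂ A X.inv).comp
            (Algebra.lmul ℂ A)).toLinearMap ∘ₗ HopfAlgebra.antipode ℂ)) * _ := by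
          rw [mul_assoc]; rfl
      _ = _ := by rw [this, one_mul]
  have h1 := congrArg (fun f => (TensorAlgebra.ι ℂ).rTensor A (f.ofConv a (X.coact v))) h2
  simp only [LinearMap.convMul_def, LinearMap.comp_apply, ofConv_toConv] at h1
  simp only [conv, LinearMap.comp_apply]
  refine Eq.trans ?_ (h1.trans ?_)
  · induction Coalgebra.comul (R := ℂ) a using TensorProduct.induction_on with
    | zero => simp
    | add x y hx hy => simp only [map_add, LinearMap.add_apply, hx, hy]
    | tmul x y =>
      simp only [TensorProduct.map_tmul, LinearMap.mul'_apply, LinearMap.comp_apply,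
        AlgHom.toLinearMap_apply, LinearMap.flip_apply, tensorCoact_ι, X.coact_circ,
        Module.End.mul_apply]
      change _ = (TensorAlgebra.ι ℂ).rTensor A (LinearMap.lTensor X.inv (LinearMap.mulLeft ℂ x)
          (Z.ofConv y (X.coact v)))
      change Algebra.TensorProduct.includeRight x *
        (TensorAlgebra.ι ℂ).rTensor A (Z.ofConv y (X.coact v)) = _
      induction Z.ofConv y (X.coact v) using TensorProduct.induction_on with
      | zero => simp
      | add x y hx hy => simp only [map_add, mul_add, hx, hy]
      | tmul u d => simp
  · induction Coalgebra.comul (R := ℂ) a using TensorProduct.induction_on with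
    | zero => simp
    | add x y hx hy => simp only [map_add, LinearMap.add_apply, hx, hy]
    | tmul x y =>
      simp only [TensorProduct.map_tmul, LinearMap.mul'_apply, LinearMap.comp_apply,
        AlgHom.toLinearMap_apply, Module.End.mul_apply, circCoact_apply]
      induction X.coact v using TensorProduct.induction_on with
      | zero => simp
      | add x y hx hy => simp only [map_add, add_mul, hx, hy]
      | tmul u d =>
        change _ = (TensorAlgebra.ι ℂ (X.invCirc x u) ⊗ₜ d) * (1 ⊗ₜ y)
        rw [Algebra.TensorProduct.tmul_mul_tmul, mul_one]
        rfl

/-- The operation `twist` in terms of the action and the coaction of `𝕍`. -/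
theorem twist_braid_tmul (u w : X.inv) (y : TensorAlgebra ℂ X.inv) :
    twist X.braid u (w ⊗ₜ y) = (LinearMap.mulRight ℂ y ∘ₗ TensorAlgebra.ι ℂ ∘ₗ
      X.invCirc.flip u).lTensor X.inv (X.coact w) := by
  rw [twist_tmul, braid_tmul, rightMul, LinearMap.lTensor_comp, LinearMap.lTensor_comp]
  rfl

/-- Coassociativity of `ϰ`, as in `coassoc_lift`, for expressions `∑ v_j ⊗ f(c_j)`. -/
theorem coact_lift {N : Type*} [AddCommGroup N] [Module ℂ N]
    (F : X.inv ⊗[ℂ] A →ₗ[ℂ] X.inv ⊗[ℂ] N) (f : A ⊗[ℂ] A →ₗ[ℂ] N)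
    (hF : ∀ w c, F (w ⊗ₜ c) = (f ∘ₗ (TensorProduct.mk ℂ A A).flip c).lTensor X.inv (X.coact w))
    (v : X.inv) : F (X.coact v) = (f ∘ₗ Coalgebra.comul).lTensor X.inv (X.coact v) := by
  refine coassoc_lift X.coact_coassoc F _ (f.lTensor X.inv) (fun m c => ?_) (fun m c => ?_) v
  · rw [hF]
    induction X.coact m using TensorProduct.induction_on with
    | zero => simp
    | add x y hx hy => simp only [map_add, TensorProduct.add_tmul, hx, hy]
    | tmul w d => simp
  · rw [LinearMap.lTensor_tmul, LinearMap.lTensor_tmul, LinearMap.comp_apply]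

theorem twist_braid_coact (u v : X.inv) (f : A →ₗ[ℂ] TensorAlgebra ℂ X.inv) :
    twist X.braid u (f.lTensor X.inv (X.coact v)) =
      (conv (TensorAlgebra.ι ℂ ∘ₗ X.invCirc.flip u) f).lTensor X.inv (X.coact v) := by
  refine X.coact_lift (twist X.braid u ∘ₗ f.lTensor X.inv)
    (LinearMap.mul' ℂ _ ∘ₗ TensorProduct.map (TensorAlgebra.ι ℂ ∘ₗ X.invCirc.flip u) f)
    (fun m c => ?_) v
  rw [LinearMap.comp_apply, LinearMap.lTensor_tmul, twist_braid_tmul]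
  rfl

theorem tensorCirc_mul_eq_conv (x y : TensorAlgebra ℂ X.inv) :
    (X.tensorCirc (x * y)).ofConv = conv (X.tensorCirc x).ofConv (X.tensorCirc y).ofConv :=
  LinearMap.ext fun a => X.tensorCirc_mul x y a

theorem tensorCirc_ι_eq (v : X.inv) :
    (X.tensorCirc (TensorAlgebra.ι ℂ v)).ofConv = TensorAlgebra.ι ℂ ∘ₗ X.invCirc.flip v :=
  LinearMap.ext fun a => X.tensorCirc_ι v a

/-- The braided Leibniz rule for the derivative: the letter moved to the front of `x v` is a letter
of `x`, or it is `v`, which crosses all of `x`. -/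
theorem deriv_mul_ι (x : TensorAlgebra ℂ X.inv) (v : X.inv) :
    deriv X.braid (x * TensorAlgebra.ι ℂ v) = rightMul (TensorAlgebra.ι ℂ v) (deriv X.braid x) +
      (X.tensorCirc x).ofConv.lTensor X.inv (X.coact v) := by
  induction x using cons_induction with
  | h1 =>
    have h : (X.tensorCirc 1).ofConv.lTensor X.inv (X.coact v) =
        TensorProduct.rid ℂ X.inv (Coalgebra.counit.lTensor X.inv (X.coact v)) ⊗ₜ 1 := by
      induction X.coact v using TensorProduct.induction_on with
      | zero => simp
      | add x y hx hy => simp only [map_add, hx, hy, TensorProduct.add_tmul]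
      | tmul w c =>
        rw [LinearMap.lTensor_tmul, tensorCirc_one]
        simp [TensorProduct.smul_tmul]
    rw [h, X.coact_counit, one_mul, deriv_one, map_zero, zero_add,
      ← mul_one (TensorAlgebra.ι ℂ v), deriv_ι_mul]
    simp
  | hc u x hx =>
    have h : ∀ t, twist X.braid u (rightMul (TensorAlgebra.ι ℂ v) t) =
        rightMul (TensorAlgebra.ι ℂ v) (twist X.braid u t) := fun t => by
      induction t using TensorProduct.induction_on with
      | zero => simp
      | add x y hx hy => simp only [map_add, hx, hy]
      | tmul w y =>
        rw [rightMul_tmul, twist_tmul, twist_tmul]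
        generalize (TensorAlgebra.ι ℂ).lTensor X.inv (X.braid (u ⊗ₜ w)) = s
        induction s using TensorProduct.induction_on with
        | zero => simp
        | add x y hx hy => simp only [map_add, hx, hy]
        | tmul a b => simp [mul_assoc]
    rw [mul_assoc, deriv_ι_mul, hx, map_add, twist_braid_coact, deriv_ι_mul, map_add, rightMul_tmul,
      h, X.tensorCirc_mul_eq_conv, tensorCirc_ι_eq, add_assoc]
  | ha x y hx hy =>
    rw [add_mul, map_add, hx, hy, map_add, map_add, map_add, WithConv.ofConv_add,
      LinearMap.lTensor_add, LinearMap.add_apply]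
    abel
  | hs r x hx =>
    rw [smul_mul_assoc, map_smul, hx, map_smul, map_smul, map_smul, WithConv.ofConv_smul,
      LinearMap.lTensor_smul, LinearMap.smul_apply, smul_add]

/-- The kernel `K` of the symmetrizer is a right ideal: `K + K 𝕍` is stable under the derivative, as
`K` is invariant under the action of `A`. -/
theorem symm_mul_ι_eq_zero {x : TensorAlgebra ℂ X.inv} (hx : symm X.braid x = 0) (v : X.inv) :
    symm X.braid (x * TensorAlgebra.ι ℂ v) = 0 := by
  let N : Submodule ℂ (TensorAlgebra ℂ X.inv) := LinearMap.ker (symm X.braid) ⊔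
    LinearMap.ker (symm X.braid) * LinearMap.range (TensorAlgebra.ι ℂ)
  have hle : LinearMap.ker (symm X.braid) ≤ N := le_sup_left
  refine symm_eq_zero_of_stable X.braid N (sup_le ?_ ?_) (fun l => sup_le ?_ ?_)
    (Submodule.mem_sup_right (Submodule.mul_mem_mul hx ⟨v, rfl⟩))
  · exact fun y hy => ((symm_eq_zero_iff X.braid y).1 hy).1
  · refine Submodule.mul_le.2 ?_
    rintro y _ _ ⟨w, rfl⟩
    simp [TensorAlgebra.algebraMapInv]
  · exact fun y hy => hle (((symm_eq_zero_iff X.braid y).1 hy).2 l)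
  · refine Submodule.mul_le.2 ?_
    rintro y hy _ ⟨w, rfl⟩
    rw [Submodule.mem_comap, LinearMap.comp_apply, deriv_mul_ι, map_add]
    refine add_mem ?_ (hle ?_)
    · rw [rightMul, contract_lTensor]
      exact Submodule.mem_sup_right (Submodule.mul_mem_mul
        (((symm_eq_zero_iff X.braid y).1 hy).2 l) ⟨w, rfl⟩)
    · rw [contract_lTensor, LinearMap.mem_ker, ← symm_circ, LinearMap.mem_ker.1 hy]
      simp

/-- The kernel of the symmetrizer on `𝕍^⊗` is a two-sided ideal. -/
theorem symm_mul_eq_zero (x y : TensorAlgebra ℂ X.inv) :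
    (symm X.braid y = 0 → symm X.braid (x * y) = 0) ∧
      (symm X.braid x = 0 → symm X.braid (x * y) = 0) := by
  constructor
  · intro hy
    induction x using cons_induction with
    | h1 => rwa [one_mul]
    | hc v x hx => rw [mul_assoc]; exact symm_ι_mul_eq_zero _ _ hx
    | ha x z hx hz => rw [add_mul, map_add, hx, hz, add_zero]
    | hs r x hx => rw [smul_mul_assoc, map_smul, hx, smul_zero]
  · intro hx
    induction y using cons_induction generalizing x with
    | h1 => rwa [mul_one]
    | hc v y hy => rw [← mul_assoc]; exact hy _ (X.symm_mul_ι_eq_zero hx v)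
    | ha y z hy hz => rw [mul_add, map_add, hy _ hx, hz _ hx, add_zero]
    | hs r y hy => rw [mul_smul_comm, map_smul, hy _ hx, smul_zero]

/-- The ideal defining `S(𝕍)` is not larger than `ker Y`: equality modulo `ker Y` is a ring
congruence, as `ker Y` is an ideal. -/
theorem symMk_eq_zero_iff (x : TensorAlgebra ℂ X.inv) :
    X.symMk x = 0 ↔ symm X.braid x = 0 := by
  refine ⟨fun h => ?_, fun h => X.symMk_eq_zero h⟩
  let c : RingCon (TensorAlgebra ℂ X.inv) :=
    { r := fun x y => symm X.braid (x - y) = 0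
      iseqv := ⟨fun x => by simp, fun {x y} h => by rw [← neg_sub, map_neg, h, neg_zero],
        fun {x y z} h h' => by rw [← sub_add_sub_cancel x y z, map_add, h, h', add_zero]⟩
      add' := fun {w x y z} h h' => by
        rw [add_sub_add_comm, map_add, h, h', add_zero]
      mul' := fun {w x y z} h h' => by
        have : w * y - x * z = (w - x) * y + x * (y - z) := by noncomm_ring
        rw [this, map_add, (X.symm_mul_eq_zero _ _).2 h, (X.symm_mul_eq_zero _ _).1 h', add_zero] }
  have e : ∀ a b, RingQuot.mkRingHom (fun x y : TensorAlgebra ℂ X.inv =>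
      x ∈ LinearMap.ker (symm X.braid) ∧ y = 0) a = RingQuot.mkRingHom _ b → c a b := by
    intro a b hab
    have hr : ∀ ⦃x y : TensorAlgebra ℂ X.inv⦄, x ∈ LinearMap.ker (symm X.braid) ∧ y = 0 →
        c.mk' x = c.mk' y := by
      rintro x y ⟨hx, rfl⟩
      refine c.eq.2 ?_
      change symm X.braid (x - 0) = 0
      rwa [sub_zero]
    have := congrArg (RingQuot.lift ⟨c.mk', hr⟩) hab
    rw [RingQuot.lift_mkRingHom_apply, RingQuot.lift_mkRingHom_apply] at this
    exact c.eq.1 this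
  have h' : symm X.braid (x - 0) = 0 := e x 0 (by
    rw [map_zero, ← RingQuot.mkAlgHom_coe ℂ]
    exact h)
  rwa [sub_zero] at h'

end BicovariantStarBimodule
end

/-! ### The coproduct of the tensor algebra of `𝕍` -/

noncomputable section

variable {A Ψ : Type*} [Ring A] [HopfAlgebra ℂ A] [StarRing A] [StarModule ℂ A]
  [AddCommGroup Ψ] [Module ℂ Ψ] [Module A Ψ] [Module Aᵐᵒᵖ Ψ] [SMulCommClass A Aᵐᵒᵖ Ψ]
  [IsScalarTower ℂ A Ψ] [IsScalarTower ℂ Aᵐᵒᵖ Ψ] [StarAddMonoid Ψ] [StarModule ℂ Ψ]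

/-- An algebra `E` which receives `𝕍^⊗ ⊗ A` (by `J`) and another copy of `𝕍^⊗` (by `r`), the
latter commuting with the first factor and obeying `v c = ∑ c⁽¹⁾ (v ∘ c⁽²⁾)` with respect to the
second: the setting in which the coproduct `v ↦ 1 ⊗ v + ϰ(v)` can be formed. The main instances are
`B̃ ⊗ Ã`, in which the coproduct is to be constructed, and `𝕍^⊗ ⊗ R`, where the first factor can still
be differentiated. -/
structure CoproductFrame (X : BicovariantStarBimodule A Ψ) (E : Type*) [Ring E] [Algebra ℂ E] where
  /-- The map of `𝕍^⊗ ⊗ A`. -/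
  J : TensorAlgebra ℂ X.inv ⊗[ℂ] A →ₐ[ℂ] E
  /-- The second copy of `𝕍^⊗`. -/
  r : TensorAlgebra ℂ X.inv →ₐ[ℂ] E
  /-- The second copy of `𝕍^⊗` commutes with the first one. -/
  comm : ∀ v y, r (TensorAlgebra.ι ℂ v) * J (y ⊗ₜ 1) = J (y ⊗ₜ 1) * r (TensorAlgebra.ι ℂ v)
  /-- The relation `v c = ∑ c⁽¹⁾ (v ∘ c⁽²⁾)` for the second copy of `𝕍^⊗`. -/
  cross : ∀ v c, r (TensorAlgebra.ι ℂ v) * J (1 ⊗ₜ c) =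
    conv (J.comp Algebra.TensorProduct.includeRight).toLinearMap
      (r.toLinearMap ∘ₗ TensorAlgebra.ι ℂ ∘ₗ X.invCirc.flip v) c

namespace CoproductFrame

variable {X : BicovariantStarBimodule A Ψ} {E : Type*} [Ring E] [Algebra ℂ E]
  (Φ : CoproductFrame X E)

/-- The inclusion of `A`. -/
def α : A →ₐ[ℂ] E := Φ.J.comp Algebra.TensorProduct.includeRight

/-- The coproduct `𝕍^⊗ → E`, the algebra homomorphism with `v ↦ 1 ⊗ v + ϰ(v)`. -/
def h : TensorAlgebra ℂ X.inv →ₐ[ℂ] E :=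
  TensorAlgebra.lift ℂ (Φ.r.toLinearMap ∘ₗ TensorAlgebra.ι ℂ +
    Φ.J.toLinearMap ∘ₗ X.tensorCoact.toLinearMap ∘ₗ TensorAlgebra.ι ℂ)

theorem h_ι (v : X.inv) : Φ.h (TensorAlgebra.ι ℂ v) =
    Φ.r (TensorAlgebra.ι ℂ v) + Φ.J (X.tensorCoact (TensorAlgebra.ι ℂ v)) := by
  simp [h]

theorem conv_add_right (f g g' : A →ₗ[ℂ] E) (c : A) :
    conv f (g + g') c = conv f g c + conv f g' c := by
  simp [conv, TensorProduct.map_add_right]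

/-- The map `c ↦ ∑ J((v_k ∘ c) ⊗ e_k)`, where `ϰ(v) = ∑ v_k ⊗ e_k`. -/
def g (v : X.inv) : A →ₗ[ℂ] E := Φ.J.toLinearMap ∘ₗ X.circCoact v

/-- The coproduct respects the relation `v c = ∑ c⁽¹⁾ (v ∘ c⁽²⁾)`: in `∑ c⁽¹⁾ h(v ∘ c⁽²⁾)` both terms of
`h` can be moved to the left of `c`. -/
theorem conv_h (v : X.inv) (c : A) :
    conv Φ.α.toLinearMap (Φ.h.toLinearMap ∘ₗ TensorAlgebra.ι ℂ ∘ₗ X.invCirc.flip v) c =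
      Φ.r (TensorAlgebra.ι ℂ v) * Φ.α c + conv (Φ.g v) Φ.α.toLinearMap c := by
  have h1 : Φ.h.toLinearMap ∘ₗ TensorAlgebra.ι ℂ ∘ₗ X.invCirc.flip v =
      Φ.r.toLinearMap ∘ₗ TensorAlgebra.ι ℂ ∘ₗ X.invCirc.flip v +
      Φ.J.toLinearMap ∘ₗ X.tensorCoact.toLinearMap ∘ₗ TensorAlgebra.ι ℂ ∘ₗ X.invCirc.flip v :=
    LinearMap.ext fun a => Φ.h_ι _
  rw [h1, conv_add_right]
  congr 1
  · exact (Φ.cross v c).symm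
  · have := congrArg Φ.J (X.conv_coact_circ v c)
    rwa [algHom_conv, algHom_conv] at this

end CoproductFrame

section FreeFrame

variable (X : BicovariantStarBimodule A Ψ) {E R : Type*} [Ring E] [Algebra ℂ E] [Ring R] [Algebra ℂ R] (j : A →ₐ[ℂ] R)
  (s : TensorAlgebra ℂ X.inv →ₐ[ℂ] R)
  (hs : ∀ v c, s (TensorAlgebra.ι ℂ v) * j c = conv j.toLinearMap
    (s.toLinearMap ∘ₗ TensorAlgebra.ι ℂ ∘ₗ X.invCirc.flip v) c)

/-- The frame `𝕍^⊗ ⊗ R`, for an algebra `R` which receives `A` and `𝕍^⊗`. -/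
def freeFrame : CoproductFrame X (TensorAlgebra ℂ X.inv ⊗[ℂ] R) where
  J := Algebra.TensorProduct.map (AlgHom.id ℂ _) j
  r := Algebra.TensorProduct.includeRight.comp s
  comm v y := by simp
  cross v c := by
    have := congrArg (Algebra.TensorProduct.includeRight : R →ₐ[ℂ] TensorAlgebra ℂ X.inv ⊗[ℂ] R)
      (hs v c)
    rw [algHom_conv] at this
    refine Eq.trans ?_ (this.trans ?_)
    · simp
    · congr 2

/-- The derivative of the first factor. -/
def derivFst (X : BicovariantStarBimodule A Ψ) (R : Type*) [Ring R] [Algebra ℂ R] :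
    TensorAlgebra ℂ X.inv ⊗[ℂ] R →ₗ[ℂ] X.inv ⊗[ℂ] (TensorAlgebra ℂ X.inv ⊗[ℂ] R) :=
  (TensorProduct.assoc ℂ _ _ _).toLinearMap ∘ₗ (deriv X.braid).rTensor R

theorem derivFst_tmul_mul (a : R) (z : TensorAlgebra ℂ X.inv ⊗[ℂ] R) :
    derivFst X R ((1 ⊗ₜ a) * z) = (LinearMap.mulLeft ℂ (1 ⊗ₜ a)).lTensor X.inv (derivFst X R z) := by
  induction z using TensorProduct.induction_on with
  | zero => simp
  | add x y hx hy => simp only [mul_add, map_add, hx, hy]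
  | tmul x b =>
    simp only [derivFst, Algebra.TensorProduct.tmul_mul_tmul, one_mul, LinearMap.comp_apply,
      LinearMap.rTensor_tmul, LinearEquiv.coe_coe]
    induction deriv X.braid x using TensorProduct.induction_on with
    | zero => simp
    | add x y hx hy => simp only [map_add, TensorProduct.add_tmul, hx, hy]
    | tmul w y => simp

/-- The map `w ⊗ q ↦ ∑ w_k ⊗ f(c_k) q`, where `ϰ(w) = ∑ w_k ⊗ c_k`. -/
def coactMul (X : BicovariantStarBimodule A Ψ) {E : Type*} [Ring E] [Algebra ℂ E] (f : A →ₗ[ℂ] E) :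
    X.inv ⊗[ℂ] E →ₗ[ℂ] X.inv ⊗[ℂ] E :=
  (LinearMap.mul' ℂ E).lTensor X.inv ∘ₗ (TensorProduct.assoc ℂ X.inv E E).toLinearMap ∘ₗ
    (f.lTensor X.inv ∘ₗ X.coact).rTensor E

theorem coactMul_tmul {E : Type*} [Ring E] [Algebra ℂ E] (f : A →ₗ[ℂ] E) (w : X.inv) (q : E) :
    coactMul X f (w ⊗ₜ q) = (LinearMap.mulRight ℂ q ∘ₗ f).lTensor X.inv (X.coact w) := by
  simp only [coactMul, LinearMap.comp_apply, LinearMap.rTensor_tmul, LinearEquiv.coe_coe]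
  induction X.coact w using TensorProduct.induction_on with
  | zero => simp
  | add x y hx hy => simp only [map_add, TensorProduct.add_tmul, hx, hy]
  | tmul w y => simp

theorem coactMul_coactMul {E : Type*} [Ring E] [Algebra ℂ E] (f g : A →ₗ[ℂ] E)
    (t : X.inv ⊗[ℂ] E) : coactMul X f (coactMul X g t) = coactMul X (conv f g) t := by
  induction t using TensorProduct.induction_on with
  | zero => simp
  | add x y hx hy => simp only [map_add, hx, hy]
  | tmul w q =>
    rw [coactMul_tmul, coactMul_tmul]
    refine X.coact_lift (coactMul X f ∘ₗ (LinearMap.mulRight ℂ q ∘ₗ g).lTensor X.inv)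
      (LinearMap.mulRight ℂ q ∘ₗ LinearMap.mul' ℂ E ∘ₗ TensorProduct.map f g) (fun u c => ?_) w
    rw [LinearMap.comp_apply, LinearMap.lTensor_tmul, coactMul_tmul]
    congr 2
    ext d
    simp [mul_assoc]

theorem coactMul_add (X : BicovariantStarBimodule A Ψ) {E : Type*} [Ring E] [Algebra ℂ E]
    (f g : A →ₗ[ℂ] E) : coactMul X (f + g) = coactMul X f + coactMul X g := by
  simp only [coactMul, LinearMap.lTensor_add, LinearMap.add_comp, LinearMap.rTensor_add,
    LinearMap.comp_add]

theorem coactMul_zero (X : BicovariantStarBimodule A Ψ) {E : Type*} [Ring E] [Algebra ℂ E] :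
    coactMul X (0 : A →ₗ[ℂ] E) = 0 := by
  simp [coactMul]

/-- The map `c ↦ (u ∘ c) ⊗ d`, depending linearly on `u ⊗ d`. -/
def circTensor (X : BicovariantStarBimodule A Ψ) :
    X.inv ⊗[ℂ] A →ₗ[ℂ] A →ₗ[ℂ] TensorAlgebra ℂ X.inv ⊗[ℂ] A :=
  TensorProduct.lift (LinearMap.mk₂ ℂ (fun u d =>
      (TensorProduct.mk ℂ (TensorAlgebra ℂ X.inv) A).flip d ∘ₗ TensorAlgebra.ι ℂ ∘ₗ
        X.invCirc.flip u)
    (fun u u' d => by ext c; simp [TensorProduct.add_tmul])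
    (fun r u d => by ext c; simp [TensorProduct.smul_tmul'])
    (fun u d d' => by ext c; simp [TensorProduct.tmul_add])
    (fun r u d => by ext c; simp))

theorem circTensor_tmul (u : X.inv) (c d : A) :
    circTensor X (u ⊗ₜ d) c = TensorAlgebra.ι ℂ (X.invCirc c u) ⊗ₜ d := rfl

theorem circCoact_eq (v : X.inv) : X.circCoact v = circTensor X (X.coact v) := by
  ext c
  rw [X.circCoact_apply]
  induction X.coact v using TensorProduct.induction_on with
  | zero => simp
  | add x y hx hy => simp only [map_add, LinearMap.add_apply, hx, hy]
  | tmul w y => rw [circTensor_tmul]; rfl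

/-- The derivative of `ϰ(v) z`, with respect to the first factor, is `∑ v_k ⊗ c_k z` plus the terms in
which a letter of `z` crosses `ϰ(v)`. -/
theorem derivFst_coact_mul (v : X.inv) (z : TensorAlgebra ℂ X.inv ⊗[ℂ] R) :
    derivFst X R ((freeFrame X j s hs).J (X.tensorCoact (TensorAlgebra.ι ℂ v)) * z) =
      coactMul X (freeFrame X j s hs).α.toLinearMap (v ⊗ₜ z) +
      coactMul X ((freeFrame X j s hs).g v) (derivFst X R z) := by
  have key : ∀ c : X.inv ⊗[ℂ] A, derivFst X R ((freeFrame X j s hs).J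
      ((TensorAlgebra.ι ℂ).rTensor A c) * z) =
      (LinearMap.mulRight ℂ z ∘ₗ (freeFrame X j s hs).α.toLinearMap).lTensor X.inv c +
      coactMul X ((freeFrame X j s hs).J.toLinearMap ∘ₗ circTensor X c) (derivFst X R z) := by
    intro c
    induction c using TensorProduct.induction_on with
    | zero => simp [coactMul_zero]
    | add x y hx hy =>
      simp only [map_add, add_mul, hx, hy, LinearMap.comp_add, coactMul_add, LinearMap.add_apply]
      abel
    | tmul u d =>
      induction z using TensorProduct.induction_on with
      | zero => simp
      | add x y hx hy =>
        rw [LinearMap.lTensor_tmul, LinearMap.comp_apply, LinearMap.mulRight_apply] at hx hy ⊢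
        simp only [mul_add, map_add, hx, hy, TensorProduct.tmul_add]
        abel
      | tmul y b =>
        have h1 : (freeFrame X j s hs).J ((TensorAlgebra.ι ℂ).rTensor A (u ⊗ₜ d)) * (y ⊗ₜ b) =
          (TensorAlgebra.ι ℂ u * y) ⊗ₜ (j d * b) := by
            simp [freeFrame]
        rw [h1, derivFst, LinearMap.comp_apply, LinearMap.rTensor_tmul, deriv_ι_mul,
          TensorProduct.add_tmul, map_add]
        congr 1
        · simp [CoproductFrame.α, freeFrame]
        · rw [LinearMap.comp_apply, LinearMap.rTensor_tmul]
          induction deriv X.braid y using TensorProduct.induction_on with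
          | zero => simp
          | add x y hx hy => simp only [map_add, TensorProduct.add_tmul, hx, hy]
          | tmul w y' =>
            rw [X.twist_braid_tmul, LinearEquiv.coe_coe, TensorProduct.assoc_tmul, coactMul_tmul]
            induction X.coact w using TensorProduct.induction_on with
            | zero => simp
            | add x y hx hy => simp only [map_add, TensorProduct.add_tmul, hx, hy]
            | tmul w c =>
              simp [freeFrame, circTensor_tmul]
  rw [X.tensorCoact_ι, key, coactMul_tmul, CoproductFrame.g, circCoact_eq]

theorem coactMul_mulLeft (e : E) (f : A →ₗ[ℂ] E) (t : X.inv ⊗[ℂ] E) :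
    coactMul X (LinearMap.mulLeft ℂ e ∘ₗ f) t =
      (LinearMap.mulLeft ℂ e).lTensor X.inv (coactMul X f t) := by
  induction t using TensorProduct.induction_on with
  | zero => simp
  | add x y hx hy => simp only [map_add, hx, hy]
  | tmul w q =>
    rw [coactMul_tmul, coactMul_tmul,
      ← LinearMap.comp_apply (f := (LinearMap.mulLeft ℂ e).lTensor X.inv), ← LinearMap.lTensor_comp]
    congr 2
    ext d
    simp [mul_assoc]

/-- The first factor of the coproduct can be differentiated by means of the derivative:
`(D ⊗ id) h(x) = ∑ w_k ⊗ (1 ⊗ c_k) h(y)`, where `D(x) = w ⊗ y` and `ϰ(w) = ∑ w_k ⊗ c_k`. -/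
theorem derivFst_h (x : TensorAlgebra ℂ X.inv) :
    derivFst X R ((freeFrame X j s hs).h x) = coactMul X (freeFrame X j s hs).α.toLinearMap
      ((freeFrame X j s hs).h.toLinearMap.lTensor X.inv (deriv X.braid x)) := by
  induction x using cons_induction with
  | h1 => simp [derivFst, Algebra.TensorProduct.one_def]
  | ha x y hx hy => simp only [map_add, hx, hy]
  | hs r x hx => simp only [map_smul, hx]
  | hc v x hx =>
    set Φ := freeFrame X j s hs with hΦ
    have h1 : ∀ t : X.inv ⊗[ℂ] TensorAlgebra ℂ X.inv,
        coactMul X Φ.α.toLinearMap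
          (Φ.h.toLinearMap.lTensor X.inv (twist X.braid v t)) =
        (LinearMap.mulLeft ℂ (Φ.r (TensorAlgebra.ι ℂ v))).lTensor X.inv
          (coactMul X Φ.α.toLinearMap
            (Φ.h.toLinearMap.lTensor X.inv t)) +
        coactMul X (Φ.g v) (coactMul X Φ.α.toLinearMap
            (Φ.h.toLinearMap.lTensor X.inv t)) := by
      intro t
      rw [coactMul_coactMul]
      induction t using TensorProduct.induction_on with
      | zero => simp
      | add x y hx hy => simp only [map_add, hx, hy]; abel
      | tmul w y =>
        have h2 : ∀ c : X.inv ⊗[ℂ] A, Φ.h.toLinearMap.lTensor X.inv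
            ((LinearMap.mulRight ℂ y ∘ₗ TensorAlgebra.ι ℂ ∘ₗ X.invCirc.flip v).lTensor X.inv c) =
          (LinearMap.mulRight ℂ (Φ.h y) ∘ₗ (Φ.h.toLinearMap ∘ₗ
            TensorAlgebra.ι ℂ ∘ₗ X.invCirc.flip v)).lTensor X.inv c := fun c => by
          rw [← LinearMap.comp_apply, ← LinearMap.lTensor_comp]
          congr 2
          ext d
          simp
        have h3 : Φ.h.toLinearMap.lTensor X.inv (twist X.braid v (w ⊗ₜ y)) =
            coactMul X (Φ.h.toLinearMap ∘ₗ TensorAlgebra.ι ℂ ∘ₗ X.invCirc.flip v)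
              (w ⊗ₜ Φ.h y) := by
          rw [X.twist_braid_tmul, h2, coactMul_tmul]
        have h4 : conv Φ.α.toLinearMap (Φ.h.toLinearMap ∘ₗ TensorAlgebra.ι ℂ ∘ₗ X.invCirc.flip v) =
            LinearMap.mulLeft ℂ (Φ.r (TensorAlgebra.ι ℂ v)) ∘ₗ Φ.α.toLinearMap +
              conv (Φ.g v) Φ.α.toLinearMap := LinearMap.ext fun c => Φ.conv_h v c
        rw [h3, coactMul_coactMul, h4, coactMul_add, LinearMap.add_apply, coactMul_mulLeft]
        rfl
    rw [map_mul, Φ.h_ι, add_mul, map_add, derivFst_coact_mul, hx, deriv_ι_mul,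
      map_add, map_add, h1, LinearMap.lTensor_tmul]
    have h5 : Φ.r (TensorAlgebra.ι ℂ v) = 1 ⊗ₜ s (TensorAlgebra.ι ℂ v) := rfl
    rw [h5, derivFst_tmul_mul, hx, AlgHom.toLinearMap_apply]
    abel

theorem eq_zero_of_contract_right {M : Type*} [AddCommGroup M] [Module ℂ M] (z : M ⊗[ℂ] R)
    (hz : ∀ μ : Module.Dual ℂ R, contract R μ (TensorProduct.comm ℂ M R z) = 0) : z = 0 :=
  (TensorProduct.comm ℂ M R).injective (by
    rw [map_zero]; exact eq_zero_of_contract _ hz)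

include hs in
/-- The coproduct of an element of the kernel `K` of the symmetrizer vanishes modulo `K` in both
factors. Modulo `K` in the second factor, the coefficients in the first factor of the elements
`(1 ⊗ c) h(y)` with `y ∈ K` form a subspace which is stable under the derivative, by `derivFst_h`, and
on which the augmentation vanishes. -/
theorem rTensor_h_eq_zero {M : Type*} [AddCommGroup M] [Module ℂ M]
    (q : TensorAlgebra ℂ X.inv →ₗ[ℂ] M) (hq : ∀ x, symm X.braid x = 0 → q x = 0)
    (hs0 : ∀ x, symm X.braid x = 0 → s x = 0) {x : TensorAlgebra ℂ X.inv}
    (hx : symm X.braid x = 0) : q.rTensor R ((freeFrame X j s hs).h x) = 0 := by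
  set Φ := freeFrame X j s hs with hΦ
  let N₀ : Submodule ℂ (TensorAlgebra ℂ X.inv ⊗[ℂ] R) :=
    Submodule.span ℂ {z | ∃ c y, symm X.braid y = 0 ∧ z = (1 ⊗ₜ j c) * Φ.h y}
  have hN₀ : ∀ c, N₀ ≤ N₀.comap (LinearMap.mulLeft ℂ (1 ⊗ₜ j c)) := fun c =>
    Submodule.span_le.2 (by
      rintro _ ⟨c', y, hy, rfl⟩
      refine Submodule.subset_span ⟨c * c', y, hy, ?_⟩
      rw [LinearMap.mulLeft_apply, ← mul_assoc, Algebra.TensorProduct.tmul_mul_tmul, one_mul,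
        map_mul])
  let co (μ : Module.Dual ℂ R) : TensorAlgebra ℂ X.inv ⊗[ℂ] R →ₗ[ℂ] TensorAlgebra ℂ X.inv :=
    contract R μ ∘ₗ (TensorProduct.comm ℂ _ R).toLinearMap
  -- the augmentation of the first factor maps `h(y)` to `y`
  have hε : ∀ y, (TensorProduct.lid ℂ R) ((TensorAlgebra.algebraMapInv (R := ℂ)
      (M := X.inv)).toLinearMap.rTensor R (Φ.h y)) = s y := by
    let e := (Algebra.TensorProduct.lid ℂ R).toAlgHom.comp
      (Algebra.TensorProduct.map (TensorAlgebra.algebraMapInv (R := ℂ) (M := X.inv))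
        (AlgHom.id ℂ R))
    have he : e.comp Φ.h = s := by
      refine TensorAlgebra.hom_ext (LinearMap.ext fun v => ?_)
      simp only [LinearMap.comp_apply, AlgHom.toLinearMap_apply, AlgHom.comp_apply, Φ.h_ι, map_add,
        X.tensorCoact_ι]
      have h1 : e (Φ.r (TensorAlgebra.ι ℂ v)) = s (TensorAlgebra.ι ℂ v) := by
        simp [e, hΦ, freeFrame]
      have h2 : ∀ c : X.inv ⊗[ℂ] A, e (Φ.J ((TensorAlgebra.ι ℂ).rTensor A c)) = 0 := fun c => by
        induction c using TensorProduct.induction_on with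
        | zero => simp
        | add x y hx hy => simp only [map_add, hx, hy, add_zero]
        | tmul w y => simp [e, hΦ, freeFrame, TensorAlgebra.algebraMapInv]
      rw [h1, h2, add_zero]
    exact fun y => AlgHom.congr_fun he y
  -- `co μ` takes the coefficient with respect to a functional on the second factor
  have key : ∀ μ, ∀ z ∈ N₀, symm X.braid (co μ z) = 0 := by
    intro μ z hz
    refine symm_eq_zero_of_stable X.braid (N₀.map (co μ)) ?_ (fun l => ?_) ⟨z, hz, rfl⟩
    · rw [Submodule.map_le_iff_le_comap]
      refine Submodule.span_le.2 ?_
      rintro _ ⟨c, y, hy, rfl⟩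
      have h1 : ∀ z : TensorAlgebra ℂ X.inv ⊗[ℂ] R,
          TensorAlgebra.algebraMapInv (co μ ((1 ⊗ₜ j c) * z)) =
          μ (j c * TensorProduct.lid ℂ R ((TensorAlgebra.algebraMapInv (R := ℂ)
            (M := X.inv)).toLinearMap.rTensor R z)) := fun z => by
        induction z using TensorProduct.induction_on with
        | zero => simp
        | add x y hx hy => simp only [mul_add, map_add, hx, hy]
        | tmul w y => simp [co, mul_comm]
      change TensorAlgebra.algebraMapInv (co μ ((1 ⊗ₜ j c) * Φ.h y)) = 0
      rw [h1, hε, hs0 y hy, mul_zero, map_zero]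
    · rw [Submodule.map_le_iff_le_comap]
      refine Submodule.span_le.2 ?_
      rintro _ ⟨c, y, hy, rfl⟩
      have h1 : ∀ z : TensorAlgebra ℂ X.inv ⊗[ℂ] R, contract X.inv l (deriv X.braid (co μ z)) =
          co μ (contract X.inv l (derivFst X R z)) := fun z => by
        induction z using TensorProduct.induction_on with
        | zero => simp
        | add x y hx hy => simp only [map_add, hx, hy]
        | tmul x b =>
          simp only [co, derivFst, LinearMap.comp_apply, LinearEquiv.coe_coe,
            TensorProduct.comm_tmul, contract_tmul, map_smul, LinearMap.rTensor_tmul]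
          induction deriv X.braid x using TensorProduct.induction_on with
          | zero => simp
          | add x y hx hy => simp only [map_add, smul_add, TensorProduct.add_tmul, hx, hy]
          | tmul w y => simp; exact smul_comm _ _ _
      change contract X.inv l (deriv X.braid (co μ ((1 ⊗ₜ j c) * Φ.h y))) ∈ N₀.map (co μ)
      rw [h1]
      refine ⟨_, ?_, rfl⟩
      rw [derivFst_tmul_mul, contract_lTensor]
      refine hN₀ c ?_
      rw [hΦ, derivFst_h]
      obtain ⟨t, ht⟩ := deriv_mem_ker X.braid hy
      rw [← ht]
      clear ht
      induction t using TensorProduct.induction_on with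
      | zero => simp
      | add a b ha hb => simp only [map_add]; exact add_mem ha hb
      | tmul u z =>
        rw [LinearMap.lTensor_tmul, LinearMap.lTensor_tmul, coactMul_tmul]
        induction X.coact u using TensorProduct.induction_on with
        | zero => simp
        | add a b ha hb => simp only [map_add]; exact add_mem ha hb
        | tmul a b =>
          refine Submodule.smul_mem _ _ (Submodule.subset_span ⟨b, z, z.2, ?_⟩)
          simp [CoproductFrame.α, hΦ, freeFrame]
  refine eq_zero_of_contract_right _ fun μ => ?_
  have h2 : ∀ z : TensorAlgebra ℂ X.inv ⊗[ℂ] R, contract R μ (TensorProduct.comm ℂ M R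
      (q.rTensor R z)) = q (co μ z) := fun z => by
    induction z using TensorProduct.induction_on with
    | zero => simp
    | add x y hx hy => simp only [map_add, hx, hy]
    | tmul x b => simp [co]
  rw [h2]
  exact hq _ (key μ _ (Submodule.subset_span ⟨1, x, hx, by
    rw [map_one, ← Algebra.TensorProduct.one_def, one_mul]⟩))

end FreeFrame
end

/-! ### Cross products and their coactions -/

noncomputable section

section Coconv

variable {A : Type*} [Ring A] [HopfAlgebra ℂ A] {M E : Type*} [AddCommGroup M] [Module ℂ M]
  [Ring E] [Algebra ℂ E]

/-- The map `m ↦ ∑ j(m_k) f(c_k)`, where `ρ(m) = ∑ m_k ⊗ c_k`. -/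
def coconv (ρ : M →ₗ[ℂ] M ⊗[ℂ] A) (j : M →ₗ[ℂ] E) (f : A →ₗ[ℂ] E) : M →ₗ[ℂ] E :=
  LinearMap.mul' ℂ E ∘ₗ TensorProduct.map j f ∘ₗ ρ

/-- Coassociativity: a coaction followed by a coaction is a coaction by the convolution product. -/
theorem coconv_coconv {ρ : M →ₗ[ℂ] M ⊗[ℂ] A}
    (hρ : ∀ m, TensorProduct.assoc ℂ M A A (ρ.rTensor A (ρ m)) = Coalgebra.comul.lTensor M (ρ m))
    (j : M →ₗ[ℂ] E) (f g : A →ₗ[ℂ] E) :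
    coconv ρ (coconv ρ j f) g = coconv ρ j (conv f g) := by
  ext m
  refine coassoc_lift hρ (LinearMap.mul' ℂ E ∘ₗ TensorProduct.map (coconv ρ j f) g)
    (LinearMap.mul' ℂ E ∘ₗ TensorProduct.map j (conv f g))
    (LinearMap.mul' ℂ E ∘ₗ TensorProduct.map j (LinearMap.mul' ℂ E ∘ₗ TensorProduct.map f g))
    (fun m c => ?_) (fun m c => ?_) m
  · simp only [LinearMap.comp_apply, TensorProduct.map_tmul, coconv]
    induction ρ m using TensorProduct.induction_on with
    | zero => simp
    | add x y hx hy =>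
      simp only [map_add, TensorProduct.add_tmul, ← hx, ← hy]
    | tmul w d => simp [mul_assoc]
  · simp [conv]

theorem coconv_add_right (ρ : M →ₗ[ℂ] M ⊗[ℂ] A) (j : M →ₗ[ℂ] E) (f g : A →ₗ[ℂ] E) :
    coconv ρ j (f + g) = coconv ρ j f + coconv ρ j g := by
  simp only [coconv, TensorProduct.map_add_right, LinearMap.add_comp, LinearMap.comp_add]

theorem mulLeft_coconv (ρ : M →ₗ[ℂ] M ⊗[ℂ] A) (j : M →ₗ[ℂ] E) (f : A →ₗ[ℂ] E) (e : E) (m : M) :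
    e * coconv ρ j f m = coconv ρ (LinearMap.mulLeft ℂ e ∘ₗ j) f m := by
  simp only [coconv, LinearMap.comp_apply]
  induction ρ m using TensorProduct.induction_on with
  | zero => simp
  | add x y hx hy => simp only [map_add, mul_add, hx, hy]
  | tmul w d => simp [mul_assoc]

theorem coconv_mulLeft (ρ : M →ₗ[ℂ] M ⊗[ℂ] A) (j : M →ₗ[ℂ] E) (f : A →ₗ[ℂ] E) (e : E)
    (h : ∀ m, e * j m = j m * e) (m : M) :
    e * coconv ρ j f m = coconv ρ j (LinearMap.mulLeft ℂ e ∘ₗ f) m := by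
  simp only [coconv, LinearMap.comp_apply]
  induction ρ m using TensorProduct.induction_on with
  | zero => simp
  | add x y hx hy => simp only [map_add, mul_add, hx, hy]
  | tmul w d => simp [← mul_assoc, h]

theorem algHom_coconv {E' : Type*} [Ring E'] [Algebra ℂ E'] (J : E →ₐ[ℂ] E')
    (ρ : M →ₗ[ℂ] M ⊗[ℂ] A) (j : M →ₗ[ℂ] E) (f : A →ₗ[ℂ] E) (m : M) :
    J (coconv ρ j f m) = coconv ρ (J.toLinearMap ∘ₗ j) (J.toLinearMap ∘ₗ f) m := by
  simp only [coconv, LinearMap.comp_apply]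
  induction ρ m using TensorProduct.induction_on with
  | zero => simp
  | add x y hx hy => simp only [map_add, hx, hy]
  | tmul w d => simp

end Coconv

variable {A Ψ B : Type*} [Ring A] [HopfAlgebra ℂ A] [StarRing A] [StarModule ℂ A]
  [AddCommGroup Ψ] [Module ℂ Ψ] [Module A Ψ] [Module Aᵐᵒᵖ Ψ] [SMulCommClass A Aᵐᵒᵖ Ψ]
  [IsScalarTower ℂ A Ψ] [IsScalarTower ℂ Aᵐᵒᵖ Ψ] [StarAddMonoid Ψ] [StarModule ℂ Ψ]
  [Ring B] [Algebra ℂ B]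

namespace CrossProduct

variable (X : BicovariantStarBimodule A Ψ) (C : ComoduleAlgebra A B)

theorem inr_mul_inl (s : X.SymAlg) (b : B) : inr X C s * inl X C b =
    coconv C.F.toLinearMap (inl X C).toLinearMap
      ((inr X C).toLinearMap ∘ₗ (X.symCirc s).ofConv) b := by
  refine (mk_mul_mk X C 1 b s 1).trans ?_
  simp only [coconv, LinearMap.comp_apply, AlgHom.toLinearMap_apply]
  induction C.F b using TensorProduct.induction_on with
  | zero => simp; rfl
  | add x y hx hy => simp only [map_add, ← hx, ← hy]; rfl
  | tmul w d =>
    simp only [TensorProduct.map_tmul, LinearMap.mulLeft_apply, one_mul, LinearMap.comp_apply,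
      LinearMap.mulRight_apply, mul_one, LinearMap.mul'_apply, AlgHom.toLinearMap_apply, inl_mul_inr]
    rfl

/-- The inclusion of `𝕍^⊗`, which factors through `S(𝕍)`. -/
def inrT : TensorAlgebra ℂ X.inv →ₐ[ℂ] CrossProduct X C := (inr X C).comp X.symMk

theorem inrT_apply (x : TensorAlgebra ℂ X.inv) : inrT X C x = inr X C (X.symMk x) := rfl

theorem inrT_ι_mul_inl (v : X.inv) (b : B) : inrT X C (TensorAlgebra.ι ℂ v) * inl X C b =
    coconv C.F.toLinearMap (inl X C).toLinearMap
      ((inrT X C).toLinearMap ∘ₗ TensorAlgebra.ι ℂ ∘ₗ X.invCirc.flip v) b := by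
  rw [inrT_apply, inr_mul_inl]
  congr 1
  congr 1
  ext a
  simp [X.symCirc_mk, X.tensorCirc_ι, inrT_apply]

variable {X C} in
/-- The cross product is generated by `B` and `𝕍`. -/
theorem induction {p : CrossProduct X C → Prop} (hl : ∀ b, p (inl X C b))
    (hr : ∀ v, p (inrT X C (TensorAlgebra.ι ℂ v))) (hm : ∀ x y, p x → p y → p (x * y))
    (ha : ∀ x y, p x → p y → p (x + y)) (x : CrossProduct X C) : p x := by
  have h : ∀ y, p (inrT X C y) := fun y => by
    induction y using cons_induction with
    | h1 => rw [map_one, ← map_one (inl X C)]; exact hl 1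
    | hc v x hx => rw [map_mul]; exact hm _ _ (hr v) hx
    | ha x y hx hy => rw [map_add]; exact ha _ _ hx hy
    | hs r x hx =>
      rw [map_smul, ← one_mul (inrT X C x), ← smul_mul_assoc, ← map_one (inl X C), ← map_smul]
      exact hm _ _ (hl _) hx
  change B ⊗[ℂ] X.SymAlg at x
  induction x using TensorProduct.induction_on with
  | zero => exact (map_zero (inl X C)) ▸ hl 0
  | add x y hx hy => exact ha _ _ hx hy
  | tmul b s =>
    obtain ⟨y, rfl⟩ := X.symMk_surjective s
    have := hm _ _ (hl b) (h y)
    rw [inrT_apply, inl_mul_inr] at this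
    exact this

theorem algHom_ext {E : Type*} [Ring E] [Algebra ℂ E] {f g : CrossProduct X C →ₐ[ℂ] E}
    (hl : ∀ b, f (inl X C b) = g (inl X C b))
    (hr : ∀ v, f (inrT X C (TensorAlgebra.ι ℂ v)) = g (inrT X C (TensorAlgebra.ι ℂ v))) :
    f = g := by
  refine AlgHom.ext fun x => ?_
  induction x using induction with
  | hl b => exact hl b
  | hr v => exact hr v
  | hm x y hx hy => rw [map_mul, map_mul, hx, hy]
  | ha x y hx hy => rw [map_add, map_add, hx, hy]

section lift

variable {X C} {E : Type*} [Ring E] [Algebra ℂ E] (f : B →ₐ[ℂ] E)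
  (g : TensorAlgebra ℂ X.inv →ₐ[ℂ] E) (hg : ∀ x, symm X.braid x = 0 → g x = 0)
  (hfg : ∀ v b, g (TensorAlgebra.ι ℂ v) * f b = coconv C.F.toLinearMap f.toLinearMap
    (g.toLinearMap ∘ₗ TensorAlgebra.ι ℂ ∘ₗ X.invCirc.flip v) b)

/-- The map of `S(𝕍)` induced by `g`. -/
def liftSym : X.SymAlg →ₐ[ℂ] E :=
  RingQuot.liftAlgHom ℂ ⟨g, by
    rintro x y ⟨hx, rfl⟩
    rw [map_zero]
    exact hg x hx⟩

theorem liftSym_symMk (x : TensorAlgebra ℂ X.inv) : liftSym g hg (X.symMk x) = g x :=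
  RingQuot.liftAlgHom_mkAlgHom_apply ..

include hfg in
/-- The relation `v b = ∑ b_k (v ∘ c_k)` extends from letters to words. -/
theorem mul_eq_coconv (x : TensorAlgebra ℂ X.inv) (b : B) : g x * f b =
    coconv C.F.toLinearMap f.toLinearMap (g.toLinearMap ∘ₗ (X.tensorCirc x).ofConv) b := by
  induction x using cons_induction generalizing b with
  | h1 =>
    rw [map_one, one_mul]
    conv_lhs => rw [← C.counit b]
    simp only [coconv, LinearMap.comp_apply, AlgHom.toLinearMap_apply]
    induction C.F b using TensorProduct.induction_on with
    | zero => simp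
    | add x y hx hy => simp only [map_add, hx, hy]
    | tmul w d =>
      rw [LinearMap.lTensor_tmul, TensorProduct.map_tmul, LinearMap.comp_apply,
        X.tensorCirc_one]
      simp
  | ha x y hx hy =>
    rw [map_add, add_mul, hx, hy, map_add, WithConv.ofConv_add, LinearMap.comp_add,
      coconv_add_right, LinearMap.add_apply]
  | hs r x hx =>
    rw [map_smul, smul_mul_assoc, hx, map_smul, WithConv.ofConv_smul]
    simp only [coconv, LinearMap.comp_smul, TensorProduct.map_smul_right, LinearMap.smul_apply,
      LinearMap.smul_comp]
  | hc v x hx =>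
    rw [map_mul, mul_assoc, hx, mulLeft_coconv]
    have h1 : LinearMap.mulLeft ℂ (g (TensorAlgebra.ι ℂ v)) ∘ₗ f.toLinearMap =
        coconv C.F.toLinearMap f.toLinearMap
          (g.toLinearMap ∘ₗ TensorAlgebra.ι ℂ ∘ₗ X.invCirc.flip v) :=
      LinearMap.ext fun b => hfg v b
    have h2 : g.toLinearMap ∘ₗ (X.tensorCirc (TensorAlgebra.ι ℂ v * x)).ofConv =
        conv (g.toLinearMap ∘ₗ TensorAlgebra.ι ℂ ∘ₗ X.invCirc.flip v)
          (g.toLinearMap ∘ₗ (X.tensorCirc x).ofConv) := by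
      ext a
      rw [X.tensorCirc_mul_eq_conv, X.tensorCirc_ι_eq, LinearMap.comp_apply,
        AlgHom.toLinearMap_apply, algHom_conv]
    rw [h1, h2, coconv_coconv C.coassoc]

/-- The homomorphism `b ⊗ [x] ↦ f(b) g(x)` of the cross product. -/
def lift : CrossProduct X C →ₐ[ℂ] E :=
  AlgHom.ofLinearMap (LinearMap.mul' ℂ E ∘ₗ
      TensorProduct.map f.toLinearMap (liftSym g hg).toLinearMap :
        B ⊗[ℂ] X.SymAlg →ₗ[ℂ] E) (by
    change LinearMap.mul' ℂ E (TensorProduct.map f.toLinearMap (liftSym g hg).toLinearMap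
      ((1 : B) ⊗ₜ[ℂ] (1 : X.SymAlg))) = 1
    simp) (by
    intro x y
    change LinearMap.mul' ℂ E (TensorProduct.map f.toLinearMap (liftSym g hg).toLinearMap
      (mulMap X C x y)) = LinearMap.mul' ℂ E (TensorProduct.map f.toLinearMap
        (liftSym g hg).toLinearMap x) * LinearMap.mul' ℂ E (TensorProduct.map f.toLinearMap
        (liftSym g hg).toLinearMap y)
    change B ⊗[ℂ] X.SymAlg at x y
    induction x using TensorProduct.induction_on with
    | zero => simp
    | add x x' hx hx' => simp only [map_add, LinearMap.add_apply, add_mul, hx, hx']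
    | tmul q s =>
      induction y using TensorProduct.induction_on with
      | zero => simp
      | add x x' hx hx' => simp only [map_add, mul_add, hx, hx']
      | tmul b s' =>
        obtain ⟨x, rfl⟩ := X.symMk_surjective s
        obtain ⟨y, rfl⟩ := X.symMk_surjective s'
        have h := mul_eq_coconv f g hfg x b
        rw [mulMap_tmul]
        simp only [TensorProduct.map_tmul, LinearMap.mul'_apply, AlgHom.toLinearMap_apply,
          liftSym_symMk]
        rw [mul_assoc, ← mul_assoc (g x), h]
        simp only [coconv, LinearMap.comp_apply, AlgHom.toLinearMap_apply]
        induction C.F b using TensorProduct.induction_on with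
        | zero => simp
        | add x x' hx hx' => simp only [map_add, add_mul, mul_add, hx, hx']
        | tmul w d => simp [X.symCirc_mk, liftSym_symMk, mul_assoc])

theorem lift_mk (b : B) (x : TensorAlgebra ℂ X.inv) :
    lift f g hg hfg (mk X C b (X.symMk x)) = f b * g x := by
  rw [← liftSym_symMk g hg]
  rfl

@[simp] theorem lift_inl (b : B) : lift f g hg hfg (inl X C b) = f b := by
  have := lift_mk f g hg hfg b 1
  rwa [map_one X.symMk, map_one g, mul_one] at this

@[simp] theorem lift_inrT (x : TensorAlgebra ℂ X.inv) : lift f g hg hfg (inrT X C x) = g x := by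
  have := lift_mk f g hg hfg 1 x
  rwa [map_one f, one_mul] at this

end lift

/-- The algebra `Ã = A ⊗ S(𝕍)`. -/
local notation "Aff" => CrossProduct X (ComoduleAlgebra.regular A)

theorem inrT_eq_zero {x : TensorAlgebra ℂ X.inv} (hx : symm X.braid x = 0) : inrT X C x = 0 := by
  rw [inrT_apply, X.symMk_eq_zero hx, map_zero]

/-- The frame `B̃ ⊗ Ã`. -/
def frame : CoproductFrame X (CrossProduct X C ⊗[ℂ] Aff) where
  J := Algebra.TensorProduct.map (inrT X C) (inl X (ComoduleAlgebra.regular A))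
  r := Algebra.TensorProduct.includeRight.comp (inrT X (ComoduleAlgebra.regular A))
  comm v y := by simp
  cross v c := by
    have := congrArg (Algebra.TensorProduct.includeRight : Aff →ₐ[ℂ] CrossProduct X C ⊗[ℂ] Aff)
      (inrT_ι_mul_inl X (ComoduleAlgebra.regular A) v c)
    rw [algHom_coconv] at this
    refine Eq.trans ?_ (this.trans ?_)
    · simp
    · simp only [coconv, conv]
      congr 3
      ext c
      simp

theorem frame_α (c : A) : (frame X C).α c = 1 ⊗ₜ inl X (ComoduleAlgebra.regular A) c := by
  simp [CoproductFrame.α, frame]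

theorem frame_h_ι (v : X.inv) : (frame X C).h (TensorAlgebra.ι ℂ v) =
    1 ⊗ₜ inrT X (ComoduleAlgebra.regular A) (TensorAlgebra.ι ℂ v) +
      TensorProduct.map ((inrT X C).toLinearMap ∘ₗ TensorAlgebra.ι ℂ)
        (inl X (ComoduleAlgebra.regular A)).toLinearMap (X.coact v) := by
  rw [CoproductFrame.h_ι, X.tensorCoact_ι]
  congr 1
  induction X.coact v using TensorProduct.induction_on with
  | zero => simp
  | add x y hx hy => simp only [map_add, hx, hy]
  | tmul w d => simp [frame]

/-- The coproduct to `B̃ ⊗ Ã` is the image of the coproduct to `𝕍^⊗ ⊗ Ã`, to which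
`rTensor_h_eq_zero` applies. -/
theorem frame_h_eq_zero {x : TensorAlgebra ℂ X.inv} (hx : symm X.braid x = 0) :
    (frame X C).h x = 0 := by
  let Φ := freeFrame X (inl X (ComoduleAlgebra.regular A)) (inrT X (ComoduleAlgebra.regular A))
    (inrT_ι_mul_inl X (ComoduleAlgebra.regular A))
  have h : (frame X C).h = (Algebra.TensorProduct.map (inrT X C) (AlgHom.id ℂ _)).comp Φ.h := by
    refine TensorAlgebra.hom_ext (LinearMap.ext fun v => ?_)
    simp only [LinearMap.comp_apply, AlgHom.toLinearMap_apply, AlgHom.comp_apply,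
      CoproductFrame.h_ι, map_add, X.tensorCoact_ι]
    congr 1
    · simp [frame, Φ, freeFrame]
    · induction X.coact v using TensorProduct.induction_on with
      | zero => simp
      | add x y hx hy => simp only [map_add, hx, hy]
      | tmul w d => simp [frame, Φ, freeFrame]
  rw [h]
  exact rTensor_h_eq_zero X _ _ (inrT_ι_mul_inl X (ComoduleAlgebra.regular A))
    (inrT X C).toLinearMap (fun x hx => inrT_eq_zero X C hx) (fun x hx => inrT_eq_zero X _ hx) hx

/-- The inclusion of `B` in the first factor of `B̃ ⊗ Ã`. -/
def inlFst : B →ₐ[ℂ] CrossProduct X C ⊗[ℂ] Aff :=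
  Algebra.TensorProduct.includeLeft.comp (inl X C)

/-- The coaction `F`, with values in `B̃ ⊗ Ã`. -/
def coactInl : B →ₐ[ℂ] CrossProduct X C ⊗[ℂ] Aff :=
  (Algebra.TensorProduct.map (inl X C) (inl X (ComoduleAlgebra.regular A))).comp C.F

theorem coactInl_eq : (coactInl X C).toLinearMap = coconv C.F.toLinearMap
    (inlFst X C).toLinearMap (frame X C).α.toLinearMap := by
  ext b
  simp only [coconv, coactInl, LinearMap.comp_apply, AlgHom.toLinearMap_apply, AlgHom.comp_apply]
  induction C.F b using TensorProduct.induction_on with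
  | zero => simp
  | add x y hx hy => simp only [map_add, hx, hy]
  | tmul w d => simp [frame_α, inlFst]

/-- The maps `h` and `F` obey the relation `v b = ∑ b_k (v ∘ c_k)`, so that they define a homomorphism
of `B̃`. -/
theorem frame_h_mul_coactInl (v : X.inv) (b : B) :
    (frame X C).h (TensorAlgebra.ι ℂ v) * coactInl X C b =
      coconv C.F.toLinearMap (coactInl X C).toLinearMap
        ((frame X C).h.toLinearMap ∘ₗ TensorAlgebra.ι ℂ ∘ₗ X.invCirc.flip v) b := by
  have h4 : conv (frame X C).α.toLinearMap ((frame X C).h.toLinearMap ∘ₗ TensorAlgebra.ι ℂ ∘ₗ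
      X.invCirc.flip v) =
      LinearMap.mulLeft ℂ ((frame X C).r (TensorAlgebra.ι ℂ v)) ∘ₗ (frame X C).α.toLinearMap +
        conv ((frame X C).g v) (frame X C).α.toLinearMap :=
    LinearMap.ext fun c => (frame X C).conv_h v c
  have h5 : ∀ b, coactInl X C b = coconv C.F.toLinearMap
      (inlFst X C).toLinearMap (frame X C).α.toLinearMap b := fun b =>
    LinearMap.congr_fun (coactInl_eq X C) b
  have h6 : LinearMap.mulLeft ℂ ((frame X C).J (X.tensorCoact (TensorAlgebra.ι ℂ v))) ∘ₗ
      (inlFst X C).toLinearMap = coconv C.F.toLinearMap (inlFst X C).toLinearMap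
        ((frame X C).g v) := by
    ext b
    rw [LinearMap.comp_apply, LinearMap.mulLeft_apply, CoproductFrame.g, circCoact_eq,
      X.tensorCoact_ι, AlgHom.toLinearMap_apply]
    induction X.coact v using TensorProduct.induction_on with
    | zero => simp [coconv]
    | add x y hx hy =>
      simp only [map_add, add_mul, hx, hy, LinearMap.comp_add, coconv_add_right,
        LinearMap.add_apply]
    | tmul w d =>
      have h7 : (frame X C).J ((TensorAlgebra.ι ℂ).rTensor A (w ⊗ₜ d)) * inlFst X C b =
          (inrT X C (TensorAlgebra.ι ℂ w) * inl X C b) ⊗ₜ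
            inl X (ComoduleAlgebra.regular A) d := by
        simp [frame, inlFst]
      rw [h7, inrT_ι_mul_inl]
      simp only [coconv, LinearMap.comp_apply, AlgHom.toLinearMap_apply]
      induction C.F b using TensorProduct.induction_on with
      | zero => simp
      | add x y hx hy => simp only [map_add, TensorProduct.add_tmul, hx, hy]
      | tmul u e => simp [frame, inlFst, circTensor_tmul]
  rw [coactInl_eq, coconv_coconv C.coassoc, h4, coconv_add_right, LinearMap.add_apply,
    ← coconv_coconv C.coassoc, ← h6, ← mulLeft_coconv, ← coconv_mulLeft, ← add_mul,
    CoproductFrame.h_ι, h5]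
  intro b
  simp [frame, inlFst]

/-- The coaction `H : B̃ → B̃ ⊗ Ã`, the common extension of `F` and of `v ↦ 1 ⊗ v + ϰ(v)`. For `B = A`
it is the coproduct of `Ã`. -/
def coaction : CrossProduct X C →ₐ[ℂ] CrossProduct X C ⊗[ℂ] Aff :=
  lift (coactInl X C) (frame X C).h (fun _ hx => frame_h_eq_zero X C hx)
    (frame_h_mul_coactInl X C)

@[simp] theorem coaction_inl (b : B) : coaction X C (inl X C b) = coactInl X C b :=
  lift_inl _ _ _ _ b

@[simp] theorem coaction_inrT (x : TensorAlgebra ℂ X.inv) :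
    coaction X C (inrT X C x) = (frame X C).h x :=
  lift_inrT _ _ _ _ x

theorem algebraMapInv_eq_zero {x : TensorAlgebra ℂ X.inv} (hx : symm X.braid x = 0) :
    TensorAlgebra.algebraMapInv x = 0 := ((symm_eq_zero_iff X.braid x).1 hx).1

/-- The projection `B̃ → B` which annihilates `𝕍`. -/
def proj : CrossProduct X C →ₐ[ℂ] B :=
  lift (AlgHom.id ℂ B) ((Algebra.ofId ℂ B).comp TensorAlgebra.algebraMapInv)
    (fun x hx => by simp [algebraMapInv_eq_zero X hx])
    (fun v b => by
      have : ((Algebra.ofId ℂ B).comp (TensorAlgebra.algebraMapInv (M := X.inv))).toLinearMap ∘ₗ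
          TensorAlgebra.ι ℂ ∘ₗ X.invCirc.flip v = 0 := by
        ext c; simp [TensorAlgebra.algebraMapInv]
      rw [this]
      simp [coconv, TensorAlgebra.algebraMapInv])

@[simp] theorem proj_inl (b : B) : proj X C (inl X C b) = b := lift_inl _ _ _ _ b

@[simp] theorem proj_inrT_ι (v : X.inv) : proj X C (inrT X C (TensorAlgebra.ι ℂ v)) = 0 := by
  rw [proj, lift_inrT]
  simp [TensorAlgebra.algebraMapInv]

/-- The counit of `Ã`. -/
def affCounit : Aff →ₐ[ℂ] ℂ :=
  (Bialgebra.counitAlgHom ℂ A).comp (proj X (ComoduleAlgebra.regular A))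

theorem coaction_coassoc : (Algebra.TensorProduct.assoc ℂ ℂ ℂ (CrossProduct X C) Aff Aff).toAlgHom.comp
    ((Algebra.TensorProduct.map (coaction X C) (AlgHom.id ℂ Aff)).comp (coaction X C)) =
    (Algebra.TensorProduct.map (AlgHom.id ℂ _)
      (coaction X (ComoduleAlgebra.regular A))).comp (coaction X C) := by
  refine algHom_ext X C (fun b => ?_) (fun v => ?_)
  · have h := congrArg (TensorProduct.map (inl X C).toLinearMap (TensorProduct.map
      (inl X (ComoduleAlgebra.regular A)).toLinearMap
      (inl X (ComoduleAlgebra.regular A)).toLinearMap)) (C.coassoc b)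
    simp only [AlgHom.comp_apply, coaction_inl, coactInl]
    refine Eq.trans ?_ (h.trans ?_)
    · induction C.F b using TensorProduct.induction_on with
      | zero => simp
      | add x y hx hy => simp only [map_add, hx, hy]
      | tmul w d =>
        simp only [Algebra.TensorProduct.map_tmul, coaction_inl, coactInl, AlgHom.comp_apply,
          LinearMap.rTensor_tmul, AlgHom.toLinearMap_apply]
        induction C.F w using TensorProduct.induction_on with
        | zero => simp
        | add x y hx hy => simp only [map_add, TensorProduct.add_tmul, hx, hy]
        | tmul u e => simp
    · induction C.F b using TensorProduct.induction_on with
      | zero => simp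
      | add x y hx hy => simp only [map_add, hx, hy]
      | tmul w d =>
        simp only [Algebra.TensorProduct.map_tmul, coaction_inl, coactInl, AlgHom.comp_apply,
          LinearMap.lTensor_tmul, TensorProduct.map_tmul]
        rfl
  · have h := congrArg (TensorProduct.map ((inrT X C).toLinearMap ∘ₗ TensorAlgebra.ι ℂ)
      (TensorProduct.map (inl X (ComoduleAlgebra.regular A)).toLinearMap
      (inl X (ComoduleAlgebra.regular A)).toLinearMap)) (X.coact_coassoc v)
    simp only [AlgHom.comp_apply, coaction_inrT, frame_h_ι, map_add]
    have h1 : ∀ t : X.inv ⊗[ℂ] A, (Algebra.TensorProduct.assoc ℂ ℂ ℂ (CrossProduct X C) Aff Aff).toAlgHom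
        (Algebra.TensorProduct.map (coaction X C) (AlgHom.id ℂ Aff)
          (TensorProduct.map ((inrT X C).toLinearMap ∘ₗ TensorAlgebra.ι ℂ)
            (inl X (ComoduleAlgebra.regular A)).toLinearMap t)) =
        1 ⊗ₜ (TensorProduct.map ((inrT X (ComoduleAlgebra.regular A)).toLinearMap ∘ₗ TensorAlgebra.ι ℂ)
            (inl X (ComoduleAlgebra.regular A)).toLinearMap t) +
        (TensorProduct.map ((inrT X C).toLinearMap ∘ₗ TensorAlgebra.ι ℂ)
          (TensorProduct.map (inl X (ComoduleAlgebra.regular A)).toLinearMap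
          (inl X (ComoduleAlgebra.regular A)).toLinearMap))
          (TensorProduct.assoc ℂ X.inv A A (X.coact.rTensor A t)) := fun t => by
      induction t using TensorProduct.induction_on with
      | zero => simp
      | add x y hx hy => simp only [map_add, hx, hy, TensorProduct.tmul_add]; abel
      | tmul w d =>
        simp only [TensorProduct.map_tmul, LinearMap.comp_apply, AlgHom.toLinearMap_apply,
          Algebra.TensorProduct.map_tmul, coaction_inrT, frame_h_ι, TensorProduct.add_tmul, map_add,
          LinearMap.rTensor_tmul]
        congr 1
        induction X.coact w using TensorProduct.induction_on with
        | zero => simp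
        | add x y hx hy => simp only [map_add, TensorProduct.add_tmul, hx, hy]
        | tmul u e => simp
    have h2 : ∀ t : X.inv ⊗[ℂ] A, Algebra.TensorProduct.map (AlgHom.id ℂ (CrossProduct X C))
        (coaction X (ComoduleAlgebra.regular A))
          (TensorProduct.map ((inrT X C).toLinearMap ∘ₗ TensorAlgebra.ι ℂ)
            (inl X (ComoduleAlgebra.regular A)).toLinearMap t) =
        (TensorProduct.map ((inrT X C).toLinearMap ∘ₗ TensorAlgebra.ι ℂ)
          (TensorProduct.map (inl X (ComoduleAlgebra.regular A)).toLinearMap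
          (inl X (ComoduleAlgebra.regular A)).toLinearMap))
          (Coalgebra.comul.lTensor X.inv t) := fun t => by
      induction t using TensorProduct.induction_on with
      | zero => simp
      | add x y hx hy => simp only [map_add, hx, hy]
      | tmul w d =>
        simp only [TensorProduct.map_tmul, LinearMap.comp_apply, AlgHom.toLinearMap_apply,
          Algebra.TensorProduct.map_tmul, coaction_inl, LinearMap.lTensor_tmul]
        rfl
    rw [h1, h2, h, Algebra.TensorProduct.map_tmul, Algebra.TensorProduct.map_tmul, map_one,
      coaction_inrT, frame_h_ι, map_one, TensorProduct.tmul_add]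
    simp [Algebra.TensorProduct.one_def, add_assoc]

theorem coaction_counit : (Algebra.TensorProduct.rid ℂ ℂ (CrossProduct X C)).toAlgHom.comp
    ((Algebra.TensorProduct.map (AlgHom.id ℂ _) (affCounit X)).comp (coaction X C)) =
    AlgHom.id ℂ _ := by
  refine algHom_ext X C (fun b => ?_) (fun v => ?_)
  · have h := congrArg (inl X C) (C.counit b)
    simp only [AlgHom.comp_apply, coaction_inl, coactInl]
    refine Eq.trans ?_ h
    induction C.F b using TensorProduct.induction_on with
    | zero => simp
    | add x y hx hy => simp only [map_add, hx, hy]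
    | tmul w d => simp [affCounit]
  · have h := congrArg (fun v => inrT X C (TensorAlgebra.ι ℂ v)) (X.coact_counit v)
    simp only [AlgHom.comp_apply, coaction_inrT, frame_h_ι]
    refine Eq.trans ?_ h
    rw [map_add, map_add, Algebra.TensorProduct.map_tmul]
    have h1 : affCounit X (inrT X (ComoduleAlgebra.regular A) (TensorAlgebra.ι ℂ v)) = 0 := by
      simp [affCounit]
    rw [h1, TensorProduct.tmul_zero, map_zero, zero_add]
    induction X.coact v using TensorProduct.induction_on with
    | zero => simp
    | add x y hx hy => simp only [map_add, hx, hy]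
    | tmul w d => simp [affCounit]

theorem affCounit_coaction : (Algebra.TensorProduct.lid ℂ Aff).toAlgHom.comp
    ((Algebra.TensorProduct.map (affCounit X) (AlgHom.id ℂ _)).comp
      (coaction X (ComoduleAlgebra.regular A))) = AlgHom.id ℂ _ := by
  refine algHom_ext X _ (fun b => ?_) (fun v => ?_)
  · have h : inl X (ComoduleAlgebra.regular A) (TensorProduct.lid ℂ A
        (Coalgebra.counit.rTensor A (Coalgebra.comul (R := ℂ) b))) = inl X _ b := by simp
    simp only [AlgHom.comp_apply, coaction_inl, coactInl]
    refine Eq.trans ?_ h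
    change _ = inl X (ComoduleAlgebra.regular A) (TensorProduct.lid ℂ A
        (Coalgebra.counit.rTensor A ((ComoduleAlgebra.regular A).F b)))
    induction (ComoduleAlgebra.regular A).F b using TensorProduct.induction_on with
    | zero => simp
    | add x y hx hy => simp only [map_add, hx, hy]
    | tmul w d => simp [affCounit]
  · simp only [AlgHom.comp_apply, coaction_inrT, frame_h_ι, map_add]
    have h : ∀ t : X.inv ⊗[ℂ] A, Algebra.TensorProduct.map (affCounit X) (AlgHom.id ℂ _)
        (TensorProduct.map ((inrT X (ComoduleAlgebra.regular A)).toLinearMap ∘ₗ TensorAlgebra.ι ℂ)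
            (inl X (ComoduleAlgebra.regular A)).toLinearMap t) = 0 := fun t => by
      induction t using TensorProduct.induction_on with
      | zero => simp
      | add x y hx hy => simp only [map_add, hx, hy, add_zero]
      | tmul w d => simp [affCounit]
    rw [h, map_zero, add_zero]
    simp

/-- The bialgebra structure of `Ã`. -/
abbrev affBialgebra : Bialgebra ℂ Aff :=
  Bialgebra.ofAlgHom (coaction X (ComoduleAlgebra.regular A)) (affCounit X)
    (coaction_coassoc X (ComoduleAlgebra.regular A))
    (AlgHom.ext fun x => by
      exact (LinearEquiv.eq_symm_apply (TensorProduct.lid ℂ Aff)).2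
        (AlgHom.congr_fun (affCounit_coaction X) x))
    (AlgHom.ext fun x => by
      exact (LinearEquiv.eq_symm_apply (TensorProduct.rid ℂ Aff)).2
        (AlgHom.congr_fun (coaction_counit X (ComoduleAlgebra.regular A)) x))

end CrossProduct
end

/-! ### The involution -/

noncomputable section

/-- Coassociativity of the coproduct, in the form of `coassoc_lift`. -/
theorem comul_coassoc_lift {A N : Type*} [Ring A] [HopfAlgebra ℂ A] [AddCommGroup N] [Module ℂ N]
    (F G : A ⊗[ℂ] A →ₗ[ℂ] N) (Φ : A ⊗[ℂ] (A ⊗[ℂ] A) →ₗ[ℂ] N)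
    (hF : ∀ m c, F (m ⊗ₜ c) = Φ (TensorProduct.assoc ℂ A A A (Coalgebra.comul m ⊗ₜ c)))
    (hG : ∀ m c, G (m ⊗ₜ c) = Φ (m ⊗ₜ Coalgebra.comul c)) (a : A) :
    F (Coalgebra.comul a) = G (Coalgebra.comul a) := by
  have h1 : F = Φ ∘ₗ (TensorProduct.assoc ℂ A A A).toLinearMap ∘ₗ Coalgebra.comul.rTensor A :=
    TensorProduct.ext' fun m c => by simp [hF]
  have h2 : G = Φ ∘ₗ Coalgebra.comul.lTensor A :=
    TensorProduct.ext' fun m c => by simp [hG]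
  rw [h1, h2]
  exact congrArg Φ (Coalgebra.coassoc_apply a)

section ConjOp

/-- The opposite algebra with the complex conjugate scalar action: algebra homomorphisms to
`ConjOp E` are antilinear antimultiplicative maps to `E`. -/
def ConjOp (E : Type*) : Type _ := Eᵐᵒᵖ

variable {E : Type*} [Ring E] [Algebra ℂ E]

instance : Ring (ConjOp E) := inferInstanceAs (Ring Eᵐᵒᵖ)

instance : Algebra ℂ (ConjOp E) :=
  ((algebraMap ℂ Eᵐᵒᵖ).comp (starRingEnd ℂ)).toAlgebra' fun c x =>
    Algebra.commutes (A := Eᵐᵒᵖ) (starRingEnd ℂ c) x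

/-- The identity as an antilinear map to `E`. -/
def ConjOp.unop (E : Type*) [Ring E] [Algebra ℂ E] : ConjOp E →ₛₗ[starRingEnd ℂ] E where
  toFun := MulOpposite.unop
  map_add' _ _ := rfl
  map_smul' r x := by
    change MulOpposite.unop (algebraMap ℂ Eᵐᵒᵖ (starRingEnd ℂ r) * (show Eᵐᵒᵖ from x)) = _
    rw [← Algebra.smul_def]
    rfl

/-- The identity as an antilinear map from `E`. -/
def ConjOp.op (E : Type*) [Ring E] [Algebra ℂ E] : E →ₛₗ[starRingEnd ℂ] ConjOp E where
  toFun := MulOpposite.op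
  map_add' _ _ := rfl
  map_smul' r x := by
    change _ = algebraMap ℂ Eᵐᵒᵖ (starRingEnd ℂ (starRingEnd ℂ r)) * MulOpposite.op x
    rw [← Algebra.smul_def, Complex.conj_conj]
    rfl

@[simp] theorem ConjOp.unop_op (x : E) : ConjOp.unop E (ConjOp.op E x) = x := rfl

@[simp] theorem ConjOp.unop_one : ConjOp.unop E 1 = 1 := rfl

@[simp] theorem ConjOp.unop_mul (x y : ConjOp E) :
    ConjOp.unop E (x * y) = ConjOp.unop E y * ConjOp.unop E x := rfl

@[simp] theorem ConjOp.op_one : ConjOp.op E 1 = 1 := rfl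

@[simp] theorem ConjOp.op_mul (x y : E) :
    ConjOp.op E (x * y) = ConjOp.op E y * ConjOp.op E x := rfl

end ConjOp

section StarHopf

/-- The compatibility of the coproduct with the involution in a Hopf *-algebra. -/
class IsStarHopf (A : Type*) [Ring A] [HopfAlgebra ℂ A] [StarRing A] [StarModule ℂ A] : Prop where
  comul_star : ∀ a : A, Coalgebra.comul (R := ℂ) (star a) = star (Coalgebra.comul (R := ℂ) a)

variable {A : Type*} [Ring A] [HopfAlgebra ℂ A] [StarRing A] [StarModule ℂ A] [IsStarHopf A]

theorem comul_star (a : A) :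
    Coalgebra.comul (R := ℂ) (star a) = star (Coalgebra.comul (R := ℂ) a) :=
  IsStarHopf.comul_star a

theorem counit_star (a : A) :
    Coalgebra.counit (R := ℂ) (star a) = star (Coalgebra.counit (R := ℂ) a) := by
  have h1 : ∀ t : A ⊗[ℂ] A, Coalgebra.counit (R := ℂ) (star (TensorProduct.lid ℂ A
      (Coalgebra.counit.rTensor A (star t)))) =
      TensorProduct.lid ℂ ℂ (TensorProduct.map ((starLinearEquiv ℂ (A := ℂ)).toLinearMap ∘ₛₗ
        Coalgebra.counit ∘ₛₗ (starLinearEquiv ℂ (A := A)).toLinearMap) Coalgebra.counit t) := by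
    intro t
    induction t using TensorProduct.induction_on with
    | zero => simp
    | add x y hx hy => simp only [star_add, map_add, hx, hy]
    | tmul x y => simp
  have h2 : ∀ t : A ⊗[ℂ] A,
      TensorProduct.lid ℂ ℂ (TensorProduct.map ((starLinearEquiv ℂ (A := ℂ)).toLinearMap ∘ₛₗ
        Coalgebra.counit ∘ₛₗ (starLinearEquiv ℂ (A := A)).toLinearMap) Coalgebra.counit t) =
      star (Coalgebra.counit (R := ℂ) (star (TensorProduct.rid ℂ A
      (Coalgebra.counit.lTensor A t)))) := by
    intro t
    induction t using TensorProduct.induction_on with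
    | zero => simp
    | add x y hx hy => simp only [star_add, map_add, hx, hy]
    | tmul x y => simp [mul_comm]
  have h3 := (h1 (Coalgebra.comul a)).trans (h2 (Coalgebra.comul a))
  rw [← comul_star, Coalgebra.rTensor_counit_comul, Coalgebra.lTensor_counit_comul] at h3
  simp at h3
  rw [h3]
  simp

variable (A) in
/-- The map `a ↦ κ(a*)*`, the inverse of the antipode `κ` of a Hopf *-algebra. -/
def antipodeInv : A →ₗ[ℂ] A :=
  (starLinearEquiv ℂ (A := A)).toLinearMap ∘ₛₗ HopfAlgebra.antipode ℂ ∘ₛₗ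
    (starLinearEquiv ℂ (A := A)).toLinearMap

theorem antipodeInv_apply (a : A) :
    antipodeInv A a = star (HopfAlgebra.antipode ℂ (star a)) := rfl

theorem mul_lTensor_antipodeInv (a : A) : LinearMap.mul' ℂ A ((antipodeInv A).lTensor A
    (TensorProduct.comm ℂ A A (Coalgebra.comul a))) = algebraMap ℂ A (Coalgebra.counit a) := by
  have h : ∀ t : A ⊗[ℂ] A, LinearMap.mul' ℂ A ((antipodeInv A).lTensor A
      (TensorProduct.comm ℂ A A t)) =
      star (LinearMap.mul' ℂ A ((HopfAlgebra.antipode ℂ).rTensor A (star t))) := fun t => by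
    induction t using TensorProduct.induction_on with
    | zero => simp
    | add x y hx hy => simp only [star_add, map_add, hx, hy]
    | tmul x y => simp [antipodeInv_apply]
  rw [h, ← comul_star, HopfAlgebra.mul_antipode_rTensor_comul_apply, counit_star,
    ← algebraMap_star_comm, star_star]

theorem mul_rTensor_antipodeInv (a : A) : LinearMap.mul' ℂ A ((antipodeInv A).rTensor A
    (TensorProduct.comm ℂ A A (Coalgebra.comul a))) = algebraMap ℂ A (Coalgebra.counit a) := by
  have h : ∀ t : A ⊗[ℂ] A, LinearMap.mul' ℂ A ((antipodeInv A).rTensor A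
      (TensorProduct.comm ℂ A A t)) =
      star (LinearMap.mul' ℂ A ((HopfAlgebra.antipode ℂ).lTensor A (star t))) := fun t => by
    induction t using TensorProduct.induction_on with
    | zero => simp
    | add x y hx hy => simp only [star_add, map_add, hx, hy]
    | tmul x y => simp [antipodeInv_apply]
  rw [h, ← comul_star, HopfAlgebra.mul_antipode_lTensor_comul_apply, counit_star,
    ← algebraMap_star_comm, star_star]

/-- The composition `κ κ⁻¹` is a right inverse of `κ` for the convolution product, and so it is the
identity. -/
theorem antipode_antipodeInv (a : A) : HopfAlgebra.antipode ℂ (antipodeInv A a) = a := by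
  have h1 : WithConv.toConv (HopfAlgebra.antipode ℂ (A := A)) *
      WithConv.toConv (HopfAlgebra.antipode ℂ ∘ₗ antipodeInv A) = 1 := by
    apply WithConv.ofConv_injective
    ext a
    have h : ∀ t : A ⊗[ℂ] A, LinearMap.mul' ℂ A (TensorProduct.map (HopfAlgebra.antipode ℂ)
        (HopfAlgebra.antipode ℂ ∘ₗ antipodeInv A) t) = HopfAlgebra.antipode ℂ
          (LinearMap.mul' ℂ A ((antipodeInv A).rTensor A (TensorProduct.comm ℂ A A t))) :=
        fun t => by
      induction t using TensorProduct.induction_on with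
      | zero => simp
      | add x y hx hy => simp only [map_add, hx, hy]
      | tmul x y => simp [HopfAlgebra.antipode_mul_antidistrib]
    refine (h (Coalgebra.comul a)).trans ?_
    rw [mul_rTensor_antipodeInv, Algebra.algebraMap_eq_smul_one, map_smul,
      HopfAlgebra.antipode_one, ← Algebra.algebraMap_eq_smul_one]
    rfl
  have := left_inv_eq_right_inv LinearMap.id_mul_antipode h1
  exact (LinearMap.congr_fun (congrArg WithConv.ofConv this) a).symm

theorem antipodeInv_antipode (a : A) : antipodeInv A (HopfAlgebra.antipode ℂ a) = a := by
  have := congrArg star (antipode_antipodeInv (star a))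
  rwa [antipodeInv_apply, star_star] at this

end StarHopf

variable {A Ψ B : Type*} [Ring A] [HopfAlgebra ℂ A] [StarRing A] [StarModule ℂ A] [IsStarHopf A]
  [AddCommGroup Ψ] [Module ℂ Ψ] [Module A Ψ] [Module Aᵐᵒᵖ Ψ] [SMulCommClass A Aᵐᵒᵖ Ψ]
  [IsScalarTower ℂ A Ψ] [IsScalarTower ℂ Aᵐᵒᵖ Ψ] [StarAddMonoid Ψ] [StarModule ℂ Ψ]
  [Ring B] [Algebra ℂ B]

/-- In a bimodule, `ψ a = a⁽¹⁾ (ψ ∘ a⁽²⁾)`. -/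
theorem op_smul_eq (a : A) (ψ : Ψ) : MulOpposite.op a • ψ =
    TensorProduct.lift ((lmul A Ψ).compl₂ ((circ A Ψ).flip ψ)) (Coalgebra.comul a) := by
  have h : WithConv.toConv (Algebra.lsmul ℂ ℂ Ψ : A →ₐ[ℂ] Module.End ℂ Ψ).toLinearMap *
      WithConv.toConv (circ A Ψ) = WithConv.toConv (rmul A Ψ) := by
    rw [circ_eq, ← mul_assoc]
    refine (congrArg (· * _) (conv_antipode' _)).trans (one_mul _)
  have h' := LinearMap.congr_fun (LinearMap.congr_fun (congrArg WithConv.ofConv h) a) ψ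
  refine h'.symm.trans ?_
  change LinearMap.mul' ℂ (Module.End ℂ Ψ) (TensorProduct.map _ _ (Coalgebra.comul a)) ψ = _
  induction Coalgebra.comul (R := ℂ) a using TensorProduct.induction_on with
  | zero => simp
  | add x y hx hy => simp only [map_add, LinearMap.add_apply, hx, hy]
  | tmul x y => simp

namespace BicovariantStarBimodule

variable (X : BicovariantStarBimodule A Ψ)

/-- The linear map `b ↦ (ψ ∘ b*)*`. -/
def starCircΨ (ψ : Ψ) : A →ₗ[ℂ] Ψ :=
  (starLinearEquiv ℂ (A := Ψ)).toLinearMap ∘ₛₗ (circ A Ψ).flip ψ ∘ₛₗ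
    (starLinearEquiv ℂ (A := A)).toLinearMap

include X in
/-- The adjoint of the relation `ψ a = a⁽¹⁾ (ψ ∘ a⁽²⁾)`. -/
theorem smul_star_eq (b : A) (ψ : Ψ) : b • star ψ =
    TensorProduct.lift ((rmul A Ψ).compl₂ (starCircΨ ψ)) (Coalgebra.comul b) := by
  have h := congrArg star (op_smul_eq (star b) ψ)
  rw [X.star_rmul, star_star] at h
  rw [h, comul_star]
  induction Coalgebra.comul (R := ℂ) b using TensorProduct.induction_on with
  | zero => simp
  | add x y hx hy => simp only [map_add, star_add, hx, hy]
  | tmul x y => simp [X.star_lmul, starCircΨ]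

include X in
/-- `∑ (ψ ∘ (b⁽²⁾)*)* ∘ b⁽¹⁾ = ε(b) ψ*`. -/
theorem circ_starCircΨ (b : A) (ψ : Ψ) :
    TensorProduct.lift ((circ A Ψ).compl₂ (starCircΨ ψ)) (Coalgebra.comul b) =
      Coalgebra.counit (R := ℂ) b • star ψ := by
  refine (comul_coassoc_lift
    (TensorProduct.lift ((circ A Ψ).compl₂ (starCircΨ ψ)))
    (TensorProduct.lift ((lmul A Ψ ∘ₗ HopfAlgebra.antipode ℂ).compl₂ ((lmul A Ψ).flip (star ψ))))
    (TensorProduct.lift ((lmul A Ψ ∘ₗ HopfAlgebra.antipode ℂ).compl₂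
      (TensorProduct.lift ((rmul A Ψ).compl₂ (starCircΨ ψ))))) (fun x y => ?_) (fun x y => ?_)
      b).trans ?_
  · simp only [TensorProduct.lift.tmul, LinearMap.compl₂_apply, circ, LinearMap.comp_apply]
    induction Coalgebra.comul (R := ℂ) x using TensorProduct.induction_on with
    | zero => simp
    | add x y hx hy => simp only [map_add, TensorProduct.add_tmul, LinearMap.add_apply, hx, hy]
    | tmul x z => simp
  · simp [← X.smul_star_eq]
  · have h : ∀ t : A ⊗[ℂ] A, TensorProduct.lift ((lmul A Ψ ∘ₗ HopfAlgebra.antipode ℂ).compl₂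
        ((lmul A Ψ).flip (star ψ))) t =
        LinearMap.mul' ℂ A ((HopfAlgebra.antipode ℂ).rTensor A t) • star ψ := fun t => by
      induction t using TensorProduct.induction_on with
      | zero => simp
      | add x y hx hy => simp only [map_add, add_smul, hx, hy]
      | tmul x y => simp [mul_smul]
    rw [h, HopfAlgebra.mul_antipode_rTensor_comul_apply, algebraMap_smul]

/-- The involution of `𝕍` as a semilinear map. -/
def invStarL : X.inv →ₛₗ[starRingEnd ℂ] X.inv where
  toFun := X.invStar
  map_add' v w := by ext; simp [invStar]
  map_smul' r v := by ext; simp [invStar]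

@[simp] theorem invStar_invStar (v : X.inv) : X.invStar (X.invStar v) = v := by
  ext; simp [invStar]

theorem coact_invStar (v : X.inv) : X.coact (X.invStar v) =
    TensorProduct.map X.invStarL (starLinearEquiv ℂ (A := A)).toLinearMap (X.coact v) := by
  apply Module.Flat.rTensor_preserves_injective_linearMap (M := A) _ X.inv.injective_subtype
  rw [X.rTensor_coact]
  refine (X.right_star v).trans ?_
  rw [← X.rTensor_coact]
  induction X.coact v using TensorProduct.induction_on with
  | zero => simp
  | add x y hx hy => simp only [map_add, star_add, hx, hy]
  | tmul w d => simp; rfl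

/-- The linear map `b ↦ (v ∘ b*)*`. -/
def starCirc (v : X.inv) : A →ₗ[ℂ] X.inv :=
  X.invStarL ∘ₛₗ X.invCirc.flip v ∘ₛₗ (starLinearEquiv ℂ (A := A)).toLinearMap

theorem circ_starCirc (b : A) (v : X.inv) :
    TensorProduct.lift (X.invCirc.compl₂ (X.starCirc v)) (Coalgebra.comul b) =
      Coalgebra.counit (R := ℂ) b • X.invStar v := by
  apply X.inv.injective_subtype
  refine Eq.trans ?_ (X.circ_starCircΨ b v)
  induction Coalgebra.comul (R := ℂ) b using TensorProduct.induction_on with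
  | zero => simp
  | add x y hx hy => simp only [map_add, hx, hy]
  | tmul x y => rfl

/-- The involution of `𝕍^⊗`, as a homomorphism. -/
def tensorStarHom : TensorAlgebra ℂ X.inv →ₐ[ℂ] ConjOp (TensorAlgebra ℂ X.inv) :=
  TensorAlgebra.lift ℂ (ConjOp.op _ ∘ₛₗ (TensorAlgebra.ι ℂ) ∘ₛₗ X.invStarL)

/-- The involution of `𝕍^⊗`. -/
def tensorStar : TensorAlgebra ℂ X.inv →ₛₗ[starRingEnd ℂ] TensorAlgebra ℂ X.inv :=
  ConjOp.unop _ ∘ₛₗ X.tensorStarHom.toLinearMap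

@[simp] theorem tensorStar_one : X.tensorStar 1 = 1 := by simp [tensorStar]

@[simp] theorem tensorStar_ι (v : X.inv) :
    X.tensorStar (TensorAlgebra.ι ℂ v) = TensorAlgebra.ι ℂ (X.invStar v) := by
  simp [tensorStar, tensorStarHom]; rfl

@[simp] theorem tensorStar_mul (x y : TensorAlgebra ℂ X.inv) :
    X.tensorStar (x * y) = X.tensorStar y * X.tensorStar x := by simp [tensorStar]

@[simp] theorem tensorStar_tensorStar (x : TensorAlgebra ℂ X.inv) :
    X.tensorStar (X.tensorStar x) = x := by
  induction x using cons_induction with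
  | h1 => simp
  | hc v x hx => simp [hx]
  | ha x y hx hy => simp [hx, hy]
  | hs r x hx => simp [hx]

/-- The action of `A` on `𝕍^⊗` as a linear map `x ↦ (a ↦ x ∘ a)`. -/
def tensorCircL : TensorAlgebra ℂ X.inv →ₗ[ℂ] A →ₗ[ℂ] TensorAlgebra ℂ X.inv :=
  (WithConv.linearEquiv ℂ _).toLinearMap ∘ₗ X.tensorCirc.toLinearMap

theorem tensorCircL_apply (x : TensorAlgebra ℂ X.inv) :
    X.tensorCircL x = (X.tensorCirc x).ofConv := rfl

/-- The linear map `b ↦ (x ∘ b*)*`. -/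
def starTensorCirc (x : TensorAlgebra ℂ X.inv) : A →ₗ[ℂ] TensorAlgebra ℂ X.inv :=
  X.tensorStar ∘ₛₗ (X.tensorCirc x).ofConv ∘ₛₗ (starLinearEquiv ℂ (A := A)).toLinearMap

theorem starTensorCirc_apply (x : TensorAlgebra ℂ X.inv) (b : A) :
    X.starTensorCirc x b = X.tensorStar ((X.tensorCirc x).ofConv (star b)) := rfl

theorem starTensorCirc_ι (v : X.inv) (b : A) :
    X.starTensorCirc (TensorAlgebra.ι ℂ v) b = TensorAlgebra.ι ℂ (X.starCirc v b) := by
  rw [starTensorCirc_apply, tensorCirc_ι, tensorStar_ι]; rfl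

theorem starTensorCirc_mul (x y : TensorAlgebra ℂ X.inv) (b : A) :
    X.starTensorCirc (x * y) b = LinearMap.mul' ℂ _ (TensorProduct.comm ℂ _ _
      (TensorProduct.map (X.starTensorCirc x) (X.starTensorCirc y) (Coalgebra.comul b))) := by
  rw [starTensorCirc_apply, tensorCirc_mul, comul_star]
  induction Coalgebra.comul (R := ℂ) b using TensorProduct.induction_on with
  | zero => simp
  | add x y hx hy => simp only [map_add, star_add, hx, hy]
  | tmul p q => simp [starTensorCirc_apply]

/-- `∑ (s (x ∘ (b⁽²⁾)*)*) ∘ b⁽¹⁾ = (s ∘ b) x*`. -/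
theorem circ_mul_starTensorCirc (x s : TensorAlgebra ℂ X.inv) (b : A) :
    TensorProduct.lift (X.tensorCircL ∘ₗ LinearMap.mulLeft ℂ s ∘ₗ X.starTensorCirc x).flip
      (Coalgebra.comul b) = (X.tensorCirc s).ofConv b * X.tensorStar x := by
  induction x using cons_induction generalizing s b with
  | h1 =>
    have h : ∀ t : A ⊗[ℂ] A, TensorProduct.lift (X.tensorCircL ∘ₗ LinearMap.mulLeft ℂ s ∘ₗ
        X.starTensorCirc 1).flip t = (X.tensorCirc s).ofConv
          (TensorProduct.rid ℂ A (Coalgebra.counit.lTensor A t)) := fun t => by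
      induction t using TensorProduct.induction_on with
      | zero => simp
      | add x y hx hy => simp only [map_add, hx, hy]
      | tmul p q => simp [starTensorCirc_apply, tensorCirc_one, counit_star, tensorCircL_apply,
          -map_one]
    rw [h]
    simp
  | ha x y hx hy =>
    rw [map_add, mul_add, ← hx, ← hy]
    induction Coalgebra.comul (R := ℂ) b using TensorProduct.induction_on with
    | zero => simp
    | add t t' h h' => rw [map_add, map_add, map_add, h, h']; abel
    | tmul p q => simp [starTensorCirc_apply, mul_add]
  | hs r x hx =>
    rw [map_smulₛₗ, mul_smul_comm, ← hx]
    induction Coalgebra.comul (R := ℂ) b using TensorProduct.induction_on with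
    | zero => simp
    | add t t' h h' => rw [map_add, map_add, h, h', smul_add]
    | tmul p q => simp [starTensorCirc_apply]
  | hc v x hx =>
    have hv : ∀ s b, TensorProduct.lift (X.tensorCircL ∘ₗ LinearMap.mulLeft ℂ s ∘ₗ
        X.starTensorCirc (TensorAlgebra.ι ℂ v)).flip (Coalgebra.comul b) =
        (X.tensorCirc s).ofConv b * TensorAlgebra.ι ℂ (X.invStar v) := fun s b => by
      refine (comul_coassoc_lift _ (LinearMap.mulRight ℂ (TensorAlgebra.ι ℂ (X.invStar v)) ∘ₗ
        (X.tensorCirc s).ofConv ∘ₗ (TensorProduct.rid ℂ A).toLinearMap ∘ₗ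
          Coalgebra.counit.lTensor A)
        (LinearMap.mul' ℂ _ ∘ₗ TensorProduct.map (X.tensorCirc s).ofConv (TensorAlgebra.ι ℂ ∘ₗ
          TensorProduct.lift (X.invCirc.compl₂ (X.starCirc v)))) (fun x y => ?_) (fun x y => ?_)
          b).trans ?_
      · simp only [TensorProduct.lift.tmul, LinearMap.flip_apply, LinearMap.comp_apply,
          LinearMap.mulLeft_apply, tensorCircL_apply, starTensorCirc_ι, tensorCirc_mul]
        induction Coalgebra.comul (R := ℂ) x using TensorProduct.induction_on with
        | zero => simp
        | add x y hx hy => simp only [map_add, TensorProduct.add_tmul, hx, hy]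
        | tmul p q => simp [tensorCirc_ι]
      · simp [X.circ_starCirc]
      · simp
    refine (comul_coassoc_lift (LinearMap.mulRight ℂ (TensorAlgebra.ι ℂ (X.invStar v)) ∘ₗ
      TensorProduct.lift (X.tensorCircL ∘ₗ LinearMap.mulLeft ℂ s ∘ₗ X.starTensorCirc x).flip) _
        (TensorProduct.lift (X.tensorCircL ∘ₗ LinearMap.mulLeft ℂ s ∘ₗ LinearMap.mul' ℂ _ ∘ₗ
          (TensorProduct.comm ℂ _ _).toLinearMap ∘ₗ
            TensorProduct.map (X.starTensorCirc (TensorAlgebra.ι ℂ v))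
              (X.starTensorCirc x)).flip) (fun x y => ?_) (fun x y => ?_)
          b).symm.trans ?_
    · simp only [LinearMap.comp_apply, TensorProduct.lift.tmul, LinearMap.flip_apply,
        LinearMap.mulLeft_apply, LinearMap.mulRight_apply]
      rw [tensorCircL_apply, ← hv]
      induction Coalgebra.comul (R := ℂ) x using TensorProduct.induction_on with
      | zero => simp
      | add x y hx hy => simp only [map_add, TensorProduct.add_tmul, hx, hy]
      | tmul p q => simp [mul_assoc]
    · simp [X.starTensorCirc_mul]
    · rw [LinearMap.comp_apply, hx]
      simp [mul_assoc]

/-- `(x ∘ b*)* = x* ∘ κ⁻¹(b)`. -/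
theorem starTensorCirc_eq (x : TensorAlgebra ℂ X.inv) (b : A) :
    X.starTensorCirc x b = (X.tensorCirc (X.tensorStar x)).ofConv (antipodeInv A b) := by
  have h := comul_coassoc_lift
    (TensorProduct.lift (X.tensorCircL ∘ₗ X.starTensorCirc x).flip ∘ₗ
      ((LinearMap.mul' ℂ A ∘ₗ (antipodeInv A).lTensor A ∘ₗ
        (TensorProduct.comm ℂ A A).toLinearMap ∘ₗ Coalgebra.comul).rTensor A))
    ((X.tensorCirc (X.tensorStar x)).ofConv ∘ₗ antipodeInv A ∘ₗ
      (TensorProduct.rid ℂ A).toLinearMap ∘ₗ Coalgebra.counit.lTensor A)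
    (TensorProduct.lift ((X.tensorCircL.flip ∘ₗ antipodeInv A).compl₂
      (TensorProduct.lift (X.tensorCircL ∘ₗ X.starTensorCirc x).flip)))
    (fun y z => ?_) (fun y z => ?_) b
  · have h' : ∀ t : A ⊗[ℂ] A, TensorProduct.lift (X.tensorCircL ∘ₗ X.starTensorCirc x).flip
        (((LinearMap.mul' ℂ A ∘ₗ (antipodeInv A).lTensor A ∘ₗ
          (TensorProduct.comm ℂ A A).toLinearMap ∘ₗ Coalgebra.comul).rTensor A) t) =
        X.starTensorCirc x (TensorProduct.lid ℂ A (Coalgebra.counit.rTensor A t)) := fun t => by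
      induction t using TensorProduct.induction_on with
      | zero => simp
      | add x y hx hy => simp only [map_add, hx, hy]
      | tmul p q =>
        simp [mul_lTensor_antipodeInv, Algebra.algebraMap_eq_smul_one, tensorCircL_apply,
          tensorCirc_apply_one]
    rw [LinearMap.comp_apply, h'] at h
    simpa using h
  · simp only [LinearMap.comp_apply, LinearMap.rTensor_tmul, LinearEquiv.coe_coe]
    induction Coalgebra.comul (R := ℂ) y using TensorProduct.induction_on with
    | zero => simp
    | add x y hx hy => simp only [map_add, TensorProduct.add_tmul, hx, hy]
    | tmul p q => simp [tensorCircL_apply, tensorCirc_apply_mul]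
  · have h' := X.circ_mul_starTensorCirc x 1 z
    rw [LinearMap.mulLeft_one, LinearMap.id_comp, tensorCirc_one, smul_mul_assoc, one_mul] at h'
    simp [h', tensorCircL_apply]

/-- The antilinear map `w ⊗ y ↦ ∑ w_k* ⊗ (y* ∘ c_k*)`, which turns `D(x)` into `D(x*)`. -/
def starPair : X.inv ⊗[ℂ] TensorAlgebra ℂ X.inv →ₛₗ[starRingEnd ℂ]
    X.inv ⊗[ℂ] TensorAlgebra ℂ X.inv :=
  TensorProduct.lift (LinearMap.mk₂'ₛₗ (starRingEnd ℂ) (starRingEnd ℂ)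
    (fun w y => (X.tensorCirc (X.tensorStar y)).ofConv.lTensor X.inv (X.coact (X.invStar w)))
    (fun w w' y => by
      refine (congrArg (fun u => LinearMap.lTensor X.inv _ (X.coact u))
        (X.invStarL.map_add w w')).trans ?_
      rw [map_add, map_add]; rfl)
    (fun r w y => by
      refine (congrArg (fun u => LinearMap.lTensor X.inv _ (X.coact u))
        (X.invStarL.map_smulₛₗ r w)).trans ?_
      rw [map_smul, map_smul]; rfl)
    (fun w y y' => by
      rw [map_add, map_add, WithConv.ofConv_add, LinearMap.lTensor_add]; rfl)
    (fun r w y => by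
      rw [map_smulₛₗ, map_smul, WithConv.ofConv_smul, LinearMap.lTensor_smul]; rfl))

theorem starPair_tmul (w : X.inv) (y : TensorAlgebra ℂ X.inv) : X.starPair (w ⊗ₜ y) =
    (X.tensorCirc (X.tensorStar y)).ofConv.lTensor X.inv (X.coact (X.invStar w)) := rfl

/-- The antilinear map `starPair` turns moving a letter across `v` into right multiplication by `v*`. -/
theorem starPair_twist (v w : X.inv) (y : TensorAlgebra ℂ X.inv) :
    X.starPair (twist X.braid v (w ⊗ₜ y)) =
      rightMul (TensorAlgebra.ι ℂ (X.invStar v)) (X.starPair (w ⊗ₜ y)) := by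
  obtain ⟨u, rfl⟩ : ∃ u, w = X.invStar u := ⟨X.invStar w, by simp⟩
  rw [twist_braid_tmul, starPair_tmul, X.coact_invStar, invStar_invStar]
  have h := X.coact_lift (TensorProduct.lift (LinearMap.mk₂ ℂ (fun w c =>
      (X.tensorCirc (X.tensorStar y * X.starTensorCirc (TensorAlgebra.ι ℂ v) c)).ofConv.lTensor
        X.inv (X.coact w)) (by simp) (by simp) (by simp [mul_add, LinearMap.lTensor_add])
        (by simp [LinearMap.lTensor_smul])))
    (TensorProduct.lift (X.tensorCircL ∘ₗ LinearMap.mulLeft ℂ (X.tensorStar y) ∘ₗ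
      X.starTensorCirc (TensorAlgebra.ι ℂ v)).flip) (fun w c => by
        rw [TensorProduct.lift.tmul, LinearMap.mk₂_apply]
        congr 1) u
  refine Eq.trans ?_ (h.trans ?_)
  · induction X.coact u using TensorProduct.induction_on with
    | zero => simp
    | add x y hx hy => simp only [map_add, hx, hy]
    | tmul u c =>
      simp only [TensorProduct.map_tmul, LinearMap.lTensor_tmul, LinearMap.comp_apply,
        LinearMap.mulRight_apply, LinearMap.flip_apply, starPair_tmul, tensorStar_mul,
        tensorStar_ι, TensorProduct.lift.tmul, LinearMap.mk₂_apply, starTensorCirc_apply,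
        tensorCirc_ι]
      congr 2
      exact X.invStar_invStar u
  · rw [rightMul, ← LinearMap.lTensor_comp_apply]
    congr 2
    ext b
    rw [LinearMap.comp_apply, circ_mul_starTensorCirc, tensorStar_ι]
    rfl

/-- The two Leibniz rules for `D`, for left and for right multiplication by a letter, correspond to
each other under the involution. -/
theorem deriv_tensorStar (x : TensorAlgebra ℂ X.inv) :
    deriv X.braid (X.tensorStar x) = X.starPair (deriv X.braid x) := by
  induction x using cons_induction with
  | h1 => simp
  | ha x y hx hy => simp only [map_add, hx, hy]
  | hs r x hx => simp only [map_smulₛₗ, map_smul, hx]; rfl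
  | hc v x hx =>
    rw [tensorStar_mul, tensorStar_ι, deriv_mul_ι, deriv_ι_mul, map_add, starPair_tmul, hx,
      add_comm]
    congr 1
    induction deriv X.braid x using TensorProduct.induction_on with
    | zero => simp
    | add x y hx hy => simp only [map_add, hx, hy]
    | tmul w y => rw [starPair_twist]

theorem algebraMapInv_tensorStar (x : TensorAlgebra ℂ X.inv) :
    TensorAlgebra.algebraMapInv (X.tensorStar x) = star (TensorAlgebra.algebraMapInv x) := by
  induction x using cons_induction with
  | h1 => simp
  | ha x y hx hy => simp only [map_add, star_add, hx, hy]
  | hs r x hx => simp [hx]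
  | hc v x hx => simp [TensorAlgebra.algebraMapInv]

/-- The kernel of the symmetrizer is invariant under the involution. -/
theorem symm_tensorStar_eq_zero {x : TensorAlgebra ℂ X.inv} (hx : symm X.braid x = 0) :
    symm X.braid (X.tensorStar x) = 0 := by
  -- the image of the kernel under the involution is stable under the derivative
  refine symm_eq_zero_of_stable X.braid
    ((LinearMap.ker (symm X.braid)).comap X.tensorStar) (fun y hy => ?_) (fun l y hy => ?_)
      (x := X.tensorStar x) (by simpa using hx)
  · have h := ((symm_eq_zero_iff X.braid _).1 hy).1
    rw [algebraMapInv_tensorStar] at h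
    simpa using h
  · obtain ⟨t, ht⟩ := deriv_mem_ker X.braid hy
    have h : deriv X.braid y = X.starPair (deriv X.braid (X.tensorStar y)) := by
      rw [← deriv_tensorStar, tensorStar_tensorStar]
    rw [Submodule.mem_comap, LinearMap.comp_apply, h, ← ht]
    clear ht
    induction t using TensorProduct.induction_on with
    | zero => simp
    | add a b ha hb => rw [map_add, map_add, map_add]; exact add_mem ha hb
    | tmul w z =>
      rw [LinearMap.lTensor_tmul, starPair_tmul]
      induction X.coact (X.invStar w) using TensorProduct.induction_on with
      | zero => simp
      | add a b ha hb => rw [map_add, map_add]; exact add_mem ha hb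
      | tmul u c =>
        rw [LinearMap.lTensor_tmul, contract_tmul]
        refine Submodule.smul_mem _ _ ?_
        have h2 := X.starTensorCirc_eq (X.tensorStar (z : TensorAlgebra ℂ X.inv)) (star c)
        rw [starTensorCirc_apply, star_star, tensorStar_tensorStar] at h2
        change symm X.braid (X.tensorStar _) = 0
        refine (congrArg _ h2).trans ?_
        rw [← symm_circ, LinearMap.mem_ker.1 z.2]
        simp

end BicovariantStarBimodule

/-- A comodule algebra which is a *-algebra with hermitian coaction. -/
class IsStarComodule [StarRing B] [StarModule ℂ B] (C : ComoduleAlgebra A B) : Prop where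
  F_star : ∀ b, C.F (star b) = star (C.F b)

instance : IsStarComodule (ComoduleAlgebra.regular A) := ⟨comul_star⟩

namespace CrossProduct

variable (X : BicovariantStarBimodule A Ψ) (C : ComoduleAlgebra A B)

/-- `b v* = ∑ (v ∘ c_k*)* b_k`, where `F(b) = ∑ b_k ⊗ c_k`. -/
theorem inl_mul_inrT_ι_invStar (b : B) (v : X.inv) :
    inl X C b * inrT X C (TensorAlgebra.ι ℂ (X.invStar v)) =
      LinearMap.mul' ℂ _ (TensorProduct.comm ℂ _ _ (TensorProduct.map (inl X C).toLinearMap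
        ((inrT X C).toLinearMap ∘ₗ TensorAlgebra.ι ℂ ∘ₗ X.starCirc v) (C.F b))) := by
  have h := coassoc_lift C.coassoc (LinearMap.mul' ℂ _ ∘ₗ (TensorProduct.comm ℂ _ _).toLinearMap ∘ₗ
      TensorProduct.map (inl X C).toLinearMap
        ((inrT X C).toLinearMap ∘ₗ TensorAlgebra.ι ℂ ∘ₗ X.starCirc v))
    (LinearMap.mulRight ℂ (inrT X C (TensorAlgebra.ι ℂ (X.invStar v))) ∘ₗ (inl X C).toLinearMap ∘ₗ
      (TensorProduct.rid ℂ B).toLinearMap ∘ₗ Coalgebra.counit.lTensor B)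
    (LinearMap.mul' ℂ _ ∘ₗ TensorProduct.map (inl X C).toLinearMap
      ((inrT X C).toLinearMap ∘ₗ TensorAlgebra.ι ℂ ∘ₗ
        TensorProduct.lift (X.invCirc.compl₂ (X.starCirc v)))) (fun m c => ?_) (fun m c => ?_) b
  · refine Eq.trans ?_ h.symm
    simp only [LinearMap.comp_apply, LinearEquiv.coe_coe, LinearMap.mulRight_apply,
      AlgHom.toLinearMap_apply, C.counit]
  · simp only [LinearMap.comp_apply, TensorProduct.map_tmul, LinearEquiv.coe_coe,
      TensorProduct.comm_tmul, LinearMap.mul'_apply, AlgHom.toLinearMap_apply, inrT_ι_mul_inl]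
    simp only [coconv, LinearMap.comp_apply, AlgHom.toLinearMap_apply]
    induction C.F m using TensorProduct.induction_on with
    | zero => simp
    | add x y hx hy => simp only [map_add, TensorProduct.add_tmul, hx, hy]
    | tmul p q => simp
  · simp [X.circ_starCirc]

variable [StarRing B] [StarModule ℂ B] [IsStarComodule C]

/-- The map `b ↦ b*` of `B`, with values in the conjugate opposite algebra of `B̃`. -/
def starInl : B →ₐ[ℂ] ConjOp (CrossProduct X C) :=
  AlgHom.ofLinearMap (ConjOp.op _ ∘ₛₗ (inl X C).toLinearMap ∘ₛₗ
      (starLinearEquiv ℂ (A := B)).toLinearMap)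
    ((congrArg _ ((congrArg _ (star_one B)).trans (map_one (inl X C)))).trans ConjOp.op_one)
    fun a b => (congrArg _ ((congrArg _ (star_mul a b)).trans (map_mul (inl X C) _ _))).trans
      (ConjOp.op_mul _ _)

@[simp] theorem starInl_apply (b : B) : starInl X C b = ConjOp.op _ (inl X C (star b)) := rfl

/-- The map `x ↦ x*` of `𝕍^⊗`, with values in the conjugate opposite algebra of `B̃`. -/
def starInrT : TensorAlgebra ℂ X.inv →ₐ[ℂ] ConjOp (CrossProduct X C) :=
  AlgHom.ofLinearMap (ConjOp.op _ ∘ₛₗ (inrT X C).toLinearMap ∘ₛₗ X.tensorStar)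
    ((congrArg _ ((congrArg _ X.tensorStar_one).trans (map_one (inrT X C)))).trans ConjOp.op_one)
    fun x y => (congrArg _ ((congrArg _ (X.tensorStar_mul x y)).trans
      (map_mul (inrT X C) _ _))).trans (ConjOp.op_mul _ _)

@[simp] theorem starInrT_apply (x : TensorAlgebra ℂ X.inv) :
    starInrT X C x = ConjOp.op _ (inrT X C (X.tensorStar x)) := rfl

/-- The antilinear antimultiplicative extension to `B̃` of the involutions of `B` and `𝕍`. -/
def starHom : CrossProduct X C →ₐ[ℂ] ConjOp (CrossProduct X C) :=
  lift (starInl X C) (starInrT X C)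
    (fun x hx => by simp [inrT_eq_zero X C (X.symm_tensorStar_eq_zero hx)])
    (fun v b => by
      have h := congrArg (ConjOp.op _) (inl_mul_inrT_ι_invStar X C (star b) v)
      rw [ConjOp.op_mul, IsStarComodule.F_star] at h
      refine (Eq.trans ?_ h).trans ?_
      · simp
      · simp only [coconv, LinearMap.comp_apply, AlgHom.toLinearMap_apply]
        induction C.F b using TensorProduct.induction_on with
        | zero => simp
        | add x y hx hy => simp only [map_add, star_add, hx, hy]
        | tmul w d => simp [BicovariantStarBimodule.starCirc]; rfl)

instance : StarRing (CrossProduct X C) where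
  star x := ConjOp.unop _ (starHom X C x)
  star_mul x y := by rw [map_mul, ConjOp.unop_mul]
  star_add x y := by rw [map_add, map_add]
  star_involutive x := by
    induction x using induction with
    | hl b => simp [starHom]
    | hr v => simp [starHom]
    | hm x y hx hy => simp only [map_mul, ConjOp.unop_mul, hx, hy]
    | ha x y hx hy => simp only [map_add, hx, hy]

theorem star_def (x : CrossProduct X C) : star x = ConjOp.unop _ (starHom X C x) := rfl

instance : StarModule ℂ (CrossProduct X C) where
  star_smul r x := by rw [star_def, map_smul, map_smulₛₗ]; rfl

@[simp] theorem star_inl (b : B) : star (inl X C b) = inl X C (star b) := by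
  simp [star_def, starHom]

@[simp] theorem star_inrT (x : TensorAlgebra ℂ X.inv) :
    star (inrT X C x) = inrT X C (X.tensorStar x) := by
  simp [star_def, starHom]

theorem coaction_star (x : CrossProduct X C) : coaction X C (star x) = star (coaction X C x) := by
  induction x using induction with
  | hl b =>
    rw [star_inl, coaction_inl, coaction_inl, coactInl, AlgHom.comp_apply, AlgHom.comp_apply,
      IsStarComodule.F_star]
    induction C.F b using TensorProduct.induction_on with
    | zero => simp
    | add x y hx hy => simp only [map_add, star_add, hx, hy]
    | tmul w d => simp
  | hr v =>
    rw [star_inrT, coaction_inrT, coaction_inrT, X.tensorStar_ι, frame_h_ι, frame_h_ι,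
      X.coact_invStar, star_add]
    congr 1
    · simp
    · induction X.coact v using TensorProduct.induction_on with
      | zero => simp
      | add x y hx hy => simp only [map_add, star_add, hx, hy]
      | tmul w d => simp; rfl
  | hm x y hx hy => rw [star_mul, map_mul, map_mul, star_mul, hx, hy]
  | ha x y hx hy => rw [star_add, map_add, map_add, star_add, hx, hy]

end CrossProduct
end

/-! ### The filtration by degree and the antipode -/

noncomputable section

section CanonicalMap

variable {H : Type*} [Ring H] [Bialgebra ℂ H]

variable (H) in
/-- The canonical map `q ⊗ b ↦ q b⁽¹⁾ ⊗ b⁽²⁾` of a bialgebra. -/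
def canonicalMap : H ⊗[ℂ] H →ₗ[ℂ] H ⊗[ℂ] H :=
  (LinearMap.mul' ℂ H).rTensor H ∘ₗ (TensorProduct.assoc ℂ H H H).symm.toLinearMap ∘ₗ
    Coalgebra.comul.lTensor H

theorem canonicalMap_tmul (q b : H) :
    canonicalMap H (q ⊗ₜ b) = (q ⊗ₜ 1) * Coalgebra.comul b := by
  simp only [canonicalMap, LinearMap.comp_apply, LinearMap.lTensor_tmul, LinearEquiv.coe_coe]
  induction Coalgebra.comul (R := ℂ) b using TensorProduct.induction_on with
  | zero => simp
  | add x y hx hy => simp only [map_add, TensorProduct.tmul_add, mul_add, hx, hy]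
  | tmul x y => simp

theorem canonicalMap_mul (q : H) (t : H ⊗[ℂ] H) :
    canonicalMap H ((LinearMap.mulLeft ℂ q).rTensor H t) =
      (LinearMap.mulLeft ℂ q).rTensor H (canonicalMap H t) := by
  induction t using TensorProduct.induction_on with
  | zero => simp
  | add x y hx hy => simp only [map_add, hx, hy]
  | tmul x y =>
    rw [LinearMap.rTensor_tmul, canonicalMap_tmul, canonicalMap_tmul]
    induction Coalgebra.comul (R := ℂ) y using TensorProduct.induction_on with
    | zero => simp
    | add x y hx hy => simp only [map_add, mul_add, hx, hy]
    | tmul x y => simp [mul_assoc]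

theorem mul'_eq_canonicalMap (t : H ⊗[ℂ] H) : LinearMap.mul' ℂ H t =
    TensorProduct.rid ℂ H (Coalgebra.counit.lTensor H (canonicalMap H t)) := by
  induction t using TensorProduct.induction_on with
  | zero => simp
  | add x y hx hy => simp only [map_add, hx, hy]
  | tmul q b =>
    have h : ∀ t : H ⊗[ℂ] H, TensorProduct.rid ℂ H (Coalgebra.counit.lTensor H
        ((q ⊗ₜ 1) * t)) = q * TensorProduct.rid ℂ H (Coalgebra.counit.lTensor H t) := fun t => by
      induction t using TensorProduct.induction_on with
      | zero => simp
      | add x y hx hy => simp only [map_add, mul_add, hx, hy]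
      | tmul x y => simp
    rw [canonicalMap_tmul, h]
    simp

theorem canonicalMap_colinear (t : H ⊗[ℂ] H) :
    (canonicalMap H).rTensor H ((TensorProduct.assoc ℂ H H H).symm (Coalgebra.comul.lTensor H t)) =
      (TensorProduct.assoc ℂ H H H).symm (Coalgebra.comul.lTensor H (canonicalMap H t)) := by
  induction t using TensorProduct.induction_on with
  | zero => simp
  | add x y hx hy => simp only [map_add, hx, hy]
  | tmul q b =>
    have h1 : ∀ t : H ⊗[ℂ] H, (canonicalMap H).rTensor H ((TensorProduct.assoc ℂ H H H).symm
        (q ⊗ₜ t)) = ((LinearMap.mulLeft ℂ q).rTensor H).rTensor H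
          (Coalgebra.comul.rTensor H t) := fun t => by
      induction t using TensorProduct.induction_on with
      | zero => simp
      | add x y hx hy => simp only [map_add, TensorProduct.tmul_add, hx, hy]
      | tmul x y =>
        rw [TensorProduct.assoc_symm_tmul, LinearMap.rTensor_tmul, canonicalMap_tmul,
          LinearMap.rTensor_tmul, LinearMap.rTensor_tmul]
        congr 1
        induction Coalgebra.comul (R := ℂ) x using TensorProduct.induction_on with
        | zero => simp
        | add x y hx hy => simp only [map_add, mul_add, hx, hy]
        | tmul x y => simp
    have h2 : ∀ t : H ⊗[ℂ] H, (TensorProduct.assoc ℂ H H H).symm (Coalgebra.comul.lTensor H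
        ((q ⊗ₜ 1) * t)) = ((LinearMap.mulLeft ℂ q).rTensor H).rTensor H
          ((TensorProduct.assoc ℂ H H H).symm (Coalgebra.comul.lTensor H t)) := fun t => by
      induction t using TensorProduct.induction_on with
      | zero => simp
      | add x y hx hy => simp only [map_add, mul_add, hx, hy]
      | tmul x y =>
        rw [Algebra.TensorProduct.tmul_mul_tmul, one_mul, LinearMap.lTensor_tmul,
          LinearMap.lTensor_tmul]
        induction Coalgebra.comul (R := ℂ) y using TensorProduct.induction_on with
        | zero => simp
        | add x y hx hy => simp only [map_add, TensorProduct.tmul_add, hx, hy]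
        | tmul x y => simp
    rw [LinearMap.lTensor_tmul, h1, canonicalMap_tmul, h2, Coalgebra.coassoc_symm_apply]

variable (hH : Function.Bijective (canonicalMap H))

/-- The antipode of a bialgebra with bijective canonical map `β`: it is `κ(a) = (id ⊗ ε) β⁻¹(1 ⊗ a)`. -/
def canonicalAntipode : H →ₗ[ℂ] H :=
  (TensorProduct.rid ℂ H).toLinearMap ∘ₗ Coalgebra.counit.lTensor H ∘ₗ
    (LinearEquiv.ofBijective (canonicalMap H) hH).symm.toLinearMap ∘ₗ TensorProduct.mk ℂ H H 1

theorem canonicalMap_symm (a : H) : canonicalMap H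
    ((LinearEquiv.ofBijective (canonicalMap H) hH).symm (1 ⊗ₜ a)) = 1 ⊗ₜ a :=
  (LinearEquiv.ofBijective (canonicalMap H) hH).apply_symm_apply _

theorem mul_lTensor_canonicalAntipode (a : H) : LinearMap.mul' ℂ H
    ((canonicalAntipode hH).lTensor H (Coalgebra.comul a)) =
      algebraMap ℂ H (Coalgebra.counit a) := by
  set e := LinearEquiv.ofBijective (canonicalMap H) hH with he
  have h : ∀ t : H ⊗[ℂ] H, LinearMap.mul' ℂ H ((canonicalAntipode hH).lTensor H t) =
      TensorProduct.rid ℂ H (Coalgebra.counit.lTensor H (e.symm t)) := fun t => by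
    induction t using TensorProduct.induction_on with
    | zero => simp
    | add x y hx hy => simp only [map_add, hx, hy]
    | tmul x y =>
      have h1 : e.symm (x ⊗ₜ y) = (LinearMap.mulLeft ℂ x).rTensor H (e.symm (1 ⊗ₜ y)) := by
        apply e.injective
        rw [e.apply_symm_apply]
        refine Eq.trans ?_ (canonicalMap_mul x _).symm
        rw [canonicalMap_symm]
        simp
      rw [h1, LinearMap.lTensor_tmul, LinearMap.mul'_apply]
      change x * TensorProduct.rid ℂ H (Coalgebra.counit.lTensor H (e.symm (1 ⊗ₜ y))) = _
      induction e.symm (1 ⊗ₜ y) using TensorProduct.induction_on with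
      | zero => simp
      | add x y hx hy => simp only [map_add, mul_add, hx, hy]
      | tmul x y => simp
  have h2 : e.symm (Coalgebra.comul a) = 1 ⊗ₜ a := by
    rw [LinearEquiv.symm_apply_eq]
    refine Eq.trans ?_ (canonicalMap_tmul 1 a).symm
    rw [← Algebra.TensorProduct.one_def, one_mul]
  rw [h, h2]
  simp [Algebra.algebraMap_eq_smul_one]

theorem mul_rTensor_canonicalAntipode (a : H) : LinearMap.mul' ℂ H
    ((canonicalAntipode hH).rTensor H (Coalgebra.comul a)) =
      algebraMap ℂ H (Coalgebra.counit a) := by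
  set e := LinearEquiv.ofBijective (canonicalMap H) hH with he
  have h1 : (TensorProduct.assoc ℂ H H H).symm (Coalgebra.comul.lTensor H (e.symm (1 ⊗ₜ a))) =
      (e.symm.toLinearMap ∘ₗ TensorProduct.mk ℂ H H 1).rTensor H (Coalgebra.comul a) := by
    apply Module.Flat.rTensor_preserves_injective_linearMap (M := H) (canonicalMap H) hH.1
    rw [canonicalMap_colinear, canonicalMap_symm]
    rw [LinearMap.lTensor_tmul]
    induction Coalgebra.comul (R := ℂ) a using TensorProduct.induction_on with
    | zero => simp
    | add x y hx hy => simp only [map_add, TensorProduct.tmul_add, hx, hy]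
    | tmul x y => simp [he, canonicalMap_symm]
  have h2 : ∀ t : H ⊗[ℂ] H, LinearMap.mul' ℂ H ((canonicalAntipode hH).rTensor H t) =
      LinearMap.mul' ℂ H (((TensorProduct.rid ℂ H).toLinearMap ∘ₗ
        Coalgebra.counit.lTensor H).rTensor H
          ((e.symm.toLinearMap ∘ₗ TensorProduct.mk ℂ H H 1).rTensor H t)) := fun t => by
    rw [← LinearMap.rTensor_comp_apply]; rfl
  have h3 : ∀ t : H ⊗[ℂ] H, LinearMap.mul' ℂ H (((TensorProduct.rid ℂ H).toLinearMap ∘ₗ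
        Coalgebra.counit.lTensor H).rTensor H ((TensorProduct.assoc ℂ H H H).symm
          (Coalgebra.comul.lTensor H t))) = LinearMap.mul' ℂ H t := fun t => by
    induction t using TensorProduct.induction_on with
    | zero => simp
    | add x y hx hy => simp only [map_add, hx, hy]
    | tmul x y =>
      have : ∀ t : H ⊗[ℂ] H, LinearMap.mul' ℂ H (((TensorProduct.rid ℂ H).toLinearMap ∘ₗ
        Coalgebra.counit.lTensor H).rTensor H ((TensorProduct.assoc ℂ H H H).symm
          (x ⊗ₜ t))) = x * TensorProduct.lid ℂ H (Coalgebra.counit.rTensor H t) := fun t => by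
        induction t using TensorProduct.induction_on with
        | zero => simp
        | add x y hx hy => simp only [map_add, TensorProduct.tmul_add, mul_add, hx, hy]
        | tmul x y => simp
      rw [LinearMap.lTensor_tmul, this]
      simp
  rw [h2, ← h1, h3, mul'_eq_canonicalMap, canonicalMap_symm]
  simp [Algebra.algebraMap_eq_smul_one]

end CanonicalMap

variable {A Ψ B : Type*} [Ring A] [HopfAlgebra ℂ A] [StarRing A] [StarModule ℂ A]
  [AddCommGroup Ψ] [Module ℂ Ψ] [Module A Ψ] [Module Aᵐᵒᵖ Ψ] [SMulCommClass A Aᵐᵒᵖ Ψ]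
  [IsScalarTower ℂ A Ψ] [IsScalarTower ℂ Aᵐᵒᵖ Ψ] [StarAddMonoid Ψ] [StarModule ℂ Ψ]
  [Ring B] [Algebra ℂ B]

theorem ι_mul_mem_degLT {V : Type*} [AddCommGroup V] [Module ℂ V] {n : ℕ} (v : V)
    {x : TensorAlgebra ℂ V} (hx : x ∈ degLT V n) : TensorAlgebra.ι ℂ v * x ∈ degLT V (n + 1) := by
  refine Submodule.iSup_induction _ (motive := fun x => TensorAlgebra.ι ℂ v * x ∈ degLT V (n + 1))
    hx (fun m x hx => mem_degLT (m := m + 1) (by omega) ?_) (by simp) (fun x y hx hy => ?_)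
  · rw [deg, pow_succ']
    exact Submodule.mul_mem_mul ⟨v, rfl⟩ hx
  · rw [mul_add]
    exact add_mem hx hy

/-- An operator `U` on a filtered space for which `U - 1` lowers the filtration degree is
bijective. -/
theorem bijective_of_filtration {M : Type*} [AddCommGroup M] [Module ℂ M] (U : M →ₗ[ℂ] M)
    (G : ℕ → Submodule ℂ M) (h0 : G 0 = ⊥) (hG : ∀ x, ∃ n, x ∈ G n)
    (hU : ∀ n x, x ∈ G (n + 1) → U x - x ∈ G n) : Function.Bijective U := by
  constructor
  · rw [← LinearMap.ker_eq_bot, LinearMap.ker_eq_bot']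
    intro x hx
    obtain ⟨n, hn⟩ := hG x
    induction n with
    | zero => rwa [h0, Submodule.mem_bot] at hn
    | succ n ih =>
      have := hU n x hn
      rw [hx, zero_sub, neg_mem_iff] at this
      exact ih this
  · intro y
    obtain ⟨n, hn⟩ := hG y
    induction n generalizing y with
    | zero =>
      rw [h0, Submodule.mem_bot] at hn
      exact ⟨0, by rw [hn, map_zero]⟩
    | succ n ih =>
      obtain ⟨z, hz⟩ := ih _ (hU n y hn)
      exact ⟨y - z, by rw [map_sub, hz, sub_sub_cancel]⟩

namespace CrossProduct

variable (X : BicovariantStarBimodule A Ψ) (C : ComoduleAlgebra A B)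

/-- The algebra `Ã = A ⊗ S(𝕍)`. -/
local notation "Aff" => CrossProduct X (ComoduleAlgebra.regular A)

variable {X C} in
/-- The elements of the cross product are the sums of products `b x`. -/
theorem mul_induction {p : CrossProduct X C → Prop} (h0 : p 0)
    (hm : ∀ b x, p (inl X C b * inrT X C x)) (ha : ∀ x y, p x → p y → p (x + y))
    (y : CrossProduct X C) : p y := by
  change B ⊗[ℂ] X.SymAlg at y
  induction y using TensorProduct.induction_on with
  | zero => exact h0
  | add x y hx hy => exact ha x y hx hy
  | tmul b s =>
    obtain ⟨x, rfl⟩ := X.symMk_surjective s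
    have := hm b x
    rwa [inrT_apply, inl_mul_inr] at this

theorem inl_mul_inrT (b : B) (x : TensorAlgebra ℂ X.inv) :
    inl X C b * inrT X C x = mk X C b (X.symMk x) := inl_mul_inr X C b _

/-- The map `q ⊗ a s ↦ (q ⊗ a) H(s)` of `B̃ ⊗ Ã`. -/
def spreadOp : CrossProduct X C ⊗[ℂ] Aff →ₗ[ℂ] CrossProduct X C ⊗[ℂ] Aff :=
  LinearMap.mul' ℂ (CrossProduct X C ⊗[ℂ] Aff) ∘ₗ
    TensorProduct.map ((inl X (ComoduleAlgebra.regular A)).toLinearMap.lTensor (CrossProduct X C))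
      ((coaction X C).toLinearMap ∘ₗ (inr X C).toLinearMap) ∘ₗ
    (TensorProduct.assoc ℂ (CrossProduct X C) A X.SymAlg).symm.toLinearMap

theorem spreadOp_tmul (q : CrossProduct X C) (a : A) (s : X.SymAlg) :
    spreadOp X C (q ⊗ₜ mk X _ a s) = (q ⊗ₜ inl X _ a) * coaction X C (inr X C s) := rfl

/-- The filtration of `B̃ ⊗ Ã` by the degree of the second factor: the `n`-th subspace is spanned by
the elements `q ⊗ a x` with `x` of degree less than `n`. It is defined by representatives, so that no
grading of `S(𝕍)` is needed. -/
def filtr (n : ℕ) : Submodule ℂ (CrossProduct X C ⊗[ℂ] Aff) :=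
  Submodule.span ℂ {t | ∃ q a, ∃ x ∈ degLT X.inv n, t = q ⊗ₜ (inl X _ a * inrT X _ x)}

variable {X C}

theorem tmul_mem_filtr {n : ℕ} (q : CrossProduct X C) (a : A) {x : TensorAlgebra ℂ X.inv}
    (hx : x ∈ degLT X.inv n) : q ⊗ₜ (inl X _ a * inrT X _ x) ∈ filtr X C n :=
  Submodule.subset_span ⟨q, a, x, hx, rfl⟩

theorem filtr_mono {m n : ℕ} (h : m ≤ n) : filtr X C m ≤ filtr X C n :=
  Submodule.span_mono fun _ ⟨q, a, x, hx, e⟩ => ⟨q, a, x, degLT_mono h hx, e⟩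

theorem filtr_zero : filtr X C 0 = ⊥ := by
  rw [filtr, Submodule.span_eq_bot]
  rintro _ ⟨q, a, x, hx, rfl⟩
  simp only [degLT, iSup_of_empty, Submodule.mem_bot] at hx
  simp [hx]

theorem exists_mem_filtr (t : CrossProduct X C ⊗[ℂ] Aff) : ∃ n, t ∈ filtr X C n := by
  have hadd : ∀ x y : CrossProduct X C ⊗[ℂ] Aff, (∃ n, x ∈ filtr X C n) →
      (∃ n, y ∈ filtr X C n) → ∃ n, x + y ∈ filtr X C n := by
    rintro x y ⟨m, hm⟩ ⟨n, hn⟩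
    exact ⟨max m n, add_mem (filtr_mono (le_max_left _ _) hm) (filtr_mono (le_max_right _ _) hn)⟩
  induction t using TensorProduct.induction_on with
  | zero => exact ⟨0, zero_mem _⟩
  | add x y hx hy => exact hadd x y hx hy
  | tmul q y =>
    induction y using mul_induction with
    | h0 => exact ⟨0, by rw [TensorProduct.tmul_zero]; exact zero_mem _⟩
    | ha x y hx hy =>
      rw [TensorProduct.tmul_add]
      exact hadd _ _ hx hy
    | hm a x =>
      obtain ⟨n, hn⟩ := exists_mem_degLT x
      exact ⟨n, tmul_mem_filtr q a hn⟩

theorem mul_mem_filtr {n : ℕ} (q : CrossProduct X C) (a : A) {t : CrossProduct X C ⊗[ℂ] Aff}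
    (ht : t ∈ filtr X C n) : (q ⊗ₜ inl X _ a) * t ∈ filtr X C n := by
  induction ht using Submodule.span_induction with
  | zero => simp
  | add x y _ _ hx hy => rw [mul_add]; exact add_mem hx hy
  | smul r x _ hx => rw [mul_smul_comm]; exact Submodule.smul_mem _ _ hx
  | mem t ht =>
    obtain ⟨p, b, x, hx, rfl⟩ := ht
    rw [Algebra.TensorProduct.tmul_mul_tmul, ← mul_assoc, ← map_mul]
    exact tmul_mem_filtr _ _ hx

theorem ι_mul_mem_filtr {n : ℕ} (v : X.inv) {t : CrossProduct X C ⊗[ℂ] Aff}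
    (ht : t ∈ filtr X C n) :
    (1 ⊗ₜ inrT X _ (TensorAlgebra.ι ℂ v)) * t ∈ filtr X C (n + 1) := by
  induction ht using Submodule.span_induction with
  | zero => simp
  | add x y _ _ hx hy => rw [mul_add]; exact add_mem hx hy
  | smul r x _ hx => rw [mul_smul_comm]; exact Submodule.smul_mem _ _ hx
  | mem t ht =>
    obtain ⟨p, b, x, hx, rfl⟩ := ht
    rw [Algebra.TensorProduct.tmul_mul_tmul, one_mul, ← mul_assoc, inrT_ι_mul_inl, coconv,
      LinearMap.comp_apply, LinearMap.comp_apply]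
    induction (ComoduleAlgebra.regular A).F.toLinearMap b using TensorProduct.induction_on with
    | zero => simp
    | add x y hx hy =>
      rw [map_add, map_add, add_mul, TensorProduct.tmul_add]
      exact add_mem hx hy
    | tmul c d =>
      have : TensorAlgebra.ι ℂ (X.invCirc d v) * x ∈ degLT X.inv (n + 1) :=
        ι_mul_mem_degLT _ hx
      simpa [mul_assoc] using tmul_mem_filtr p c this

/-- The leading term of `h(x)` with respect to the degree of the second factor is `1 ⊗ x`. -/
theorem frame_h_sub_mem {m : ℕ} {x : TensorAlgebra ℂ X.inv} (hx : x ∈ deg X.inv m) :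
    (frame X C).h x - 1 ⊗ₜ inrT X _ x ∈ filtr X C m := by
  induction hx using Submodule.pow_induction_on_left' with
  | algebraMap r => simp [Algebra.algebraMap_eq_smul_one, Algebra.TensorProduct.one_def]
  | add x y i hx hy ihx ihy =>
    rw [map_add, map_add, TensorProduct.tmul_add, add_sub_add_comm]
    exact add_mem ihx ihy
  | mem_mul u hu i x hx ih =>
    obtain ⟨v, rfl⟩ := hu
    rw [map_mul, frame_h_ι, map_mul]
    set r := (frame X C).h x - 1 ⊗ₜ inrT X _ x with hr
    rw [← sub_add_cancel ((frame X C).h x) (1 ⊗ₜ inrT X _ x), ← hr]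
    have h1 : ∀ t : X.inv ⊗[ℂ] A, TensorProduct.map ((inrT X C).toLinearMap ∘ₗ TensorAlgebra.ι ℂ)
        (inl X (ComoduleAlgebra.regular A)).toLinearMap t * (r + 1 ⊗ₜ inrT X _ x) ∈
          filtr X C (i + 1) := fun t => by
      induction t using TensorProduct.induction_on with
      | zero => simp
      | add x y hx hy => rw [map_add, add_mul]; exact add_mem hx hy
      | tmul w c =>
        rw [mul_add]
        refine add_mem (filtr_mono i.le_succ (mul_mem_filtr _ _ ih)) ?_
        simpa using tmul_mem_filtr (inrT X C (TensorAlgebra.ι ℂ w)) c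
          (mem_degLT i.lt_succ_self hx)
    have h2 : (1 ⊗ₜ inrT X _ (TensorAlgebra.ι ℂ v)) * r ∈ filtr X C (i + 1) :=
      ι_mul_mem_filtr v ih
    convert add_mem h2 (h1 (X.coact v)) using 1
    rw [add_mul, mul_add (1 ⊗ₜ _), Algebra.TensorProduct.tmul_mul_tmul, one_mul]
    abel

variable (X C)

/-- By `frame_h_sub_mem`, `spreadOp` is the identity up to terms of lower degree. -/
theorem spreadOp_bijective : Function.Bijective (spreadOp X C) := by
  refine bijective_of_filtration _ (filtr X C) filtr_zero exists_mem_filtr fun n t ht => ?_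
  induction ht using Submodule.span_induction with
  | zero => simp
  | add x y _ _ hx hy => rw [map_add, add_sub_add_comm]; exact add_mem hx hy
  | smul r x _ hx => rw [map_smul, ← smul_sub]; exact Submodule.smul_mem _ _ hx
  | mem t ht =>
    obtain ⟨q, a, x, hx, rfl⟩ := ht
    have h : ∀ x, spreadOp X C (q ⊗ₜ (inl X _ a * inrT X _ x)) -
        q ⊗ₜ (inl X _ a * inrT X _ x) =
          (q ⊗ₜ inl X _ a) * ((frame X C).h x - 1 ⊗ₜ inrT X _ x) := fun x => by
      rw [inl_mul_inrT, spreadOp_tmul, ← inrT_apply, coaction_inrT, mul_sub,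
        Algebra.TensorProduct.tmul_mul_tmul, mul_one, inl_mul_inrT]
    rw [h]
    refine mul_mem_filtr _ _ ?_
    refine Submodule.iSup_induction _ (motive := fun x => (frame X C).h x - 1 ⊗ₜ inrT X _ x ∈
      filtr X C n) hx (fun m x hx => ?_) (by simp) (fun x y hx hy => ?_)
    · exact filtr_mono (Nat.lt_succ_iff.1 m.2) (frame_h_sub_mem hx)
    · rw [map_add, map_add, TensorProduct.tmul_add, add_sub_add_comm]
      exact add_mem hx hy

theorem comul_eq (x : Aff) : letI := affBialgebra X
    Coalgebra.comul (R := ℂ) x = coaction X (ComoduleAlgebra.regular A) x := rfl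

attribute [local instance] affBialgebra

/-- The map `q ⊗ a s ↦ q f(a⁽¹⁾) ⊗ a⁽²⁾ s` of `Ã ⊗ Ã`. -/
def partialOp (f : A →ₗ[ℂ] A) : Aff ⊗[ℂ] Aff →ₗ[ℂ] Aff ⊗[ℂ] Aff :=
  LinearMap.mul' ℂ (Aff ⊗[ℂ] Aff) ∘ₗ TensorProduct.map
    (Algebra.TensorProduct.includeLeft : Aff →ₐ[ℂ] Aff ⊗[ℂ] Aff).toLinearMap
    (LinearMap.mul' ℂ (Aff ⊗[ℂ] Aff) ∘ₗ TensorProduct.map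
      (TensorProduct.map ((inl X (ComoduleAlgebra.regular A)).toLinearMap ∘ₗ f)
        (inl X (ComoduleAlgebra.regular A)).toLinearMap ∘ₗ Coalgebra.comul)
      ((Algebra.TensorProduct.includeRight : Aff →ₐ[ℂ] Aff ⊗[ℂ] Aff).comp
        (inr X (ComoduleAlgebra.regular A))).toLinearMap : A ⊗[ℂ] X.SymAlg →ₗ[ℂ] Aff ⊗[ℂ] Aff)

theorem partialOp_tmul (f : A →ₗ[ℂ] A) (q : Aff) (a : A) (x : TensorAlgebra ℂ X.inv) :
    partialOp X f (q ⊗ₜ (inl X _ a * inrT X _ x)) =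
      (q ⊗ₜ 1) * (TensorProduct.map ((inl X (ComoduleAlgebra.regular A)).toLinearMap ∘ₗ f)
        (inl X (ComoduleAlgebra.regular A)).toLinearMap (Coalgebra.comul a) *
          (1 ⊗ₜ inrT X _ x)) := by
  rw [inl_mul_inrT]
  rfl

/-- Coassociativity and the antipode axiom: for `f = id` and `g = κ`, or conversely, the two operators
are inverse to each other. -/
theorem partialOp_partialOp (f g : A →ₗ[ℂ] A)
    (h : ∀ a, LinearMap.mul' ℂ A (TensorProduct.map f g (Coalgebra.comul a)) =
      algebraMap ℂ A (Coalgebra.counit a)) (t : Aff ⊗[ℂ] Aff) :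
    partialOp X g (partialOp X f t) = t := by
  induction t using TensorProduct.induction_on with
  | zero => simp
  | add x y hx hy => simp only [map_add, hx, hy]
  | tmul q y =>
    induction y using mul_induction with
    | h0 => simp
    | ha x y hx hy => simp only [map_add, TensorProduct.tmul_add, hx, hy]
    | hm a x =>
      rw [partialOp_tmul]
      obtain ⟨J, hJ⟩ : ∃ J : A →ₗ[ℂ] Aff, ∀ a, J a = inl X _ a := ⟨(inl X _).toLinearMap, fun _ => rfl⟩
      obtain ⟨L, hL⟩ : ∃ L : Aff ⊗[ℂ] Aff →ₗ[ℂ] Aff ⊗[ℂ] Aff, ∀ t, L t =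
          (q ⊗ₜ 1) * (t * (1 ⊗ₜ inrT X _ x)) :=
        ⟨LinearMap.mulLeft ℂ (q ⊗ₜ 1) ∘ₗ LinearMap.mulRight ℂ (1 ⊗ₜ inrT X _ x), fun _ => rfl⟩
      obtain ⟨m, hm⟩ : ∃ m : A ⊗[ℂ] A →ₗ[ℂ] A, ∀ t, m t =
        LinearMap.mul' ℂ A (TensorProduct.map f g t) :=
        ⟨LinearMap.mul' ℂ A ∘ₗ TensorProduct.map f g, fun _ => rfl⟩
      have hJ' : (inl X (ComoduleAlgebra.regular A)).toLinearMap = J :=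
        LinearMap.ext fun a => (hJ a).symm
      rw [← hL, hJ']
      have key := comul_coassoc_lift
        (L ∘ₗ TensorProduct.map (J ∘ₗ m ∘ₗ Coalgebra.comul) J)
        (partialOp X g ∘ₗ L ∘ₗ TensorProduct.map (J ∘ₗ f) J)
        (L ∘ₗ TensorProduct.map (J ∘ₗ m) J ∘ₗ (TensorProduct.assoc ℂ A A A).symm.toLinearMap)
        (fun m c => by simp) (fun b c => by
          simp only [LinearMap.comp_apply, TensorProduct.map_tmul, hL, hJ,
            Algebra.TensorProduct.tmul_mul_tmul, one_mul, mul_one, partialOp_tmul, hJ']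
          induction Coalgebra.comul (R := ℂ) c using TensorProduct.induction_on with
          | zero => simp
          | add x y hx hy =>
            simp only [map_add, TensorProduct.tmul_add, mul_add, add_mul, hx, hy]
          | tmul p r => simp [hJ, hm, mul_assoc]) a
      refine key.symm.trans ?_
      have h' : ∀ t : A ⊗[ℂ] A, L (TensorProduct.map (J ∘ₗ m ∘ₗ Coalgebra.comul) J t) =
          q ⊗ₜ[ℂ] (inl X _ (TensorProduct.lid ℂ A (Coalgebra.counit.rTensor A t)) * inrT X _ x) :=
            fun t => by
        induction t using TensorProduct.induction_on with
        | zero => simp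
        | add x y hx hy => simp only [map_add, TensorProduct.tmul_add, add_mul, hx, hy]
        | tmul c d =>
          simp [hJ, hL, hm, h, Algebra.algebraMap_eq_smul_one, TensorProduct.smul_tmul']
      rw [LinearMap.comp_apply, h']
      simp

theorem partialOp_bijective : Function.Bijective (partialOp X LinearMap.id) := by
  refine Function.bijective_iff_has_inverse.2 ⟨partialOp X (HopfAlgebra.antipode ℂ),
    partialOp_partialOp X _ _ fun a => ?_, partialOp_partialOp X _ _ fun a => ?_⟩
  · exact HopfAlgebra.mul_antipode_lTensor_comul_apply a
  · exact HopfAlgebra.mul_antipode_rTensor_comul_apply a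

/-- The canonical map `q ⊗ a s ↦ q (a s)⁽¹⁾ ⊗ (a s)⁽²⁾` is the composition of the one for `A` with
`spreadOp`. -/
theorem canonicalMap_bijective : Function.Bijective (canonicalMap Aff) := by
  have h : canonicalMap Aff = spreadOp X (ComoduleAlgebra.regular A) ∘ₗ
      partialOp X LinearMap.id := by
    refine TensorProduct.ext' fun q y => ?_
    induction y using mul_induction with
    | h0 => simp
    | ha x y hx hy => simp only [map_add, TensorProduct.tmul_add, hx, hy]
    | hm a x =>
      rw [canonicalMap_tmul, comul_eq, map_mul, coaction_inl, coaction_inrT, LinearMap.comp_apply,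
        partialOp_tmul, coactInl, AlgHom.comp_apply]
      have hF : (ComoduleAlgebra.regular A).F a = Coalgebra.comul a := rfl
      rw [hF]
      induction Coalgebra.comul (R := ℂ) a using TensorProduct.induction_on with
      | zero => simp
      | add x y hx hy => simp only [map_add, mul_add, add_mul, hx, hy]
      | tmul c d =>
        simp [inl_mul_inrT, spreadOp_tmul, ← mul_assoc]
        rw [← inrT_apply, coaction_inrT]
  rw [h]
  exact (spreadOp_bijective X _).comp (partialOp_bijective X)

/-- The Hopf algebra structure of `Ã`. -/
abbrev affHopfAlgebra : HopfAlgebra ℂ Aff where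
  antipode := canonicalAntipode (canonicalMap_bijective X)
  mul_antipode_rTensor_comul := LinearMap.ext fun a =>
    mul_rTensor_canonicalAntipode (canonicalMap_bijective X) a
  mul_antipode_lTensor_comul := LinearMap.ext fun a =>
    mul_lTensor_canonicalAntipode (canonicalMap_bijective X) a

end CrossProduct
end

/-! ### Translation maps and the affine extension of a bundle -/

noncomputable section

section Translation

variable {A : Type*} [Ring A] [HopfAlgebra ℂ A] [StarRing A] [StarModule ℂ A]
  {V B : Type*} [Ring V] [Algebra ℂ V] [StarRing V]
  [Ring B] [Algebra ℂ B] [StarRing B] [StarModule ℂ B] {i : V →ₐ[ℂ] B}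

namespace PreBundle

variable (P : PreBundle A i)

theorem mul_eq (t : Balanced i) : Balanced.mul i t =
    TensorProduct.rid ℂ B (Coalgebra.counit.lTensor B (P.X t)) := by
  refine LinearMap.congr_fun (f := Balanced.mul i)
    (g := (TensorProduct.rid ℂ B).toLinearMap ∘ₗ Coalgebra.counit.lTensor B ∘ₗ P.X)
    (Balanced.hom_ext i fun q b => ?_) t
  have h : ∀ t : B ⊗[ℂ] A, TensorProduct.rid ℂ B (Coalgebra.counit.lTensor B
      ((q ⊗ₜ 1) * t)) = q * TensorProduct.rid ℂ B (Coalgebra.counit.lTensor B t) := fun t => by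
    induction t using TensorProduct.induction_on with
    | zero => simp
    | add x y hx hy => simp only [map_add, mul_add, hx, hy]
    | tmul x y => simp
  simp only [LinearMap.comp_apply, P.X_tmul, LinearEquiv.coe_coe, h, P.counit]
  rfl

/-- The identity `[a]_1 [a]_2 = ε(a) 1`. -/
theorem mul_translation (hX : Function.Bijective P.X) (a : A) :
    Balanced.mul i (P.translation hX a) = algebraMap ℂ B (Coalgebra.counit a) := by
  rw [P.mul_eq, X_translation]
  simp [Algebra.algebraMap_eq_smul_one]

/-- The map `id ⊗ F` corresponds under `X` to `id ⊗ φ`. -/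
theorem X_rightCoact (t : Balanced i) : P.X.rTensor A (P.rightCoact t) =
    (TensorProduct.assoc ℂ B A A).symm (Coalgebra.comul.lTensor B (P.X t)) := by
  refine LinearMap.congr_fun (f := P.X.rTensor A ∘ₗ P.rightCoact)
    (g := (TensorProduct.assoc ℂ B A A).symm.toLinearMap ∘ₗ Coalgebra.comul.lTensor B ∘ₗ P.X)
    (Balanced.hom_ext i fun q b => ?_) t
  have h1 : ∀ t : B ⊗[ℂ] A, P.X.rTensor A ((balancedRel i).mkQ.rTensor A
      ((TensorProduct.assoc ℂ B B A).symm (q ⊗ₜ t))) =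
      ((LinearMap.mulLeft ℂ q).rTensor A).rTensor A (P.F.toLinearMap.rTensor A t) := fun t => by
    induction t using TensorProduct.induction_on with
    | zero => simp
    | add x y hx hy => simp only [map_add, TensorProduct.tmul_add, hx, hy]
    | tmul b c =>
      refine (TensorProduct.map_tmul _ _ _ _).trans ?_
      change ((q ⊗ₜ 1) * P.F b) ⊗ₜ c = (LinearMap.mulLeft ℂ q).rTensor A (P.F b) ⊗ₜ c
      congr 1
      induction P.F b using TensorProduct.induction_on with
      | zero => simp
      | add x y hx hy => simp only [map_add, mul_add, hx, hy]
      | tmul x y => simp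
  have h2 : ∀ t : B ⊗[ℂ] A, (TensorProduct.assoc ℂ B A A).symm (Coalgebra.comul.lTensor B
      ((q ⊗ₜ 1) * t)) = ((LinearMap.mulLeft ℂ q).rTensor A).rTensor A
        ((TensorProduct.assoc ℂ B A A).symm (Coalgebra.comul.lTensor B t)) := fun t => by
    induction t using TensorProduct.induction_on with
    | zero => simp
    | add x y hx hy => simp only [map_add, mul_add, hx, hy]
    | tmul x y =>
      rw [Algebra.TensorProduct.tmul_mul_tmul, one_mul, LinearMap.lTensor_tmul,
        LinearMap.lTensor_tmul]
      induction Coalgebra.comul (R := ℂ) y using TensorProduct.induction_on with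
      | zero => simp
      | add x y hx hy => simp only [map_add, TensorProduct.tmul_add, hx, hy]
      | tmul x y => simp
  refine (h1 (P.F b)).trans ?_
  simp only [LinearMap.comp_apply, P.X_tmul, LinearEquiv.coe_coe, h2, ← P.coassoc,
    LinearEquiv.symm_apply_apply]

/-- The identity `[a]_1 ⊗ F[a]_2 = [a⁽¹⁾]_1 ⊗ [a⁽¹⁾]_2 ⊗ a⁽²⁾`, which is verified after applying `X`. -/
theorem rightCoact_translation (hX : Function.Bijective P.X) (a : A) :
    P.rightCoact (P.translation hX a) = (P.translation hX).rTensor A (Coalgebra.comul a) := by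
  apply Module.Flat.rTensor_preserves_injective_linearMap (M := A) P.X hX.1
  rw [X_rightCoact, X_translation, LinearMap.lTensor_tmul]
  induction Coalgebra.comul (R := ℂ) a using TensorProduct.induction_on with
  | zero => simp
  | add x y hx hy => simp only [map_add, TensorProduct.tmul_add, hx, hy]
  | tmul x y => simp [X_translation]

variable [IsStarHopf A]

theorem antipodeInv_mul (a b : A) :
    antipodeInv A (a * b) = antipodeInv A b * antipodeInv A a := by
  simp [antipodeInv_apply, HopfAlgebra.antipode_mul_antidistrib]

theorem antipodeInv_one : antipodeInv A 1 = 1 := by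
  simp [antipodeInv_apply]

variable (A) in
/-- The map `p ⊗ c ↦ c⁽¹⁾ κ⁻¹(p) ⊗ c⁽²⁾`. -/
def untwist : A ⊗[ℂ] A →ₗ[ℂ] A ⊗[ℂ] A :=
  LinearMap.mul' ℂ (A ⊗[ℂ] A) ∘ₗ TensorProduct.map Coalgebra.comul
    ((TensorProduct.mk ℂ A A).flip 1 ∘ₗ antipodeInv A) ∘ₗ (TensorProduct.comm ℂ A A).toLinearMap

theorem untwist_tmul (p c : A) :
    untwist A (p ⊗ₜ c) = Coalgebra.comul c * (antipodeInv A p ⊗ₜ 1) := rfl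

theorem untwist_comul (c : A) : untwist A (Coalgebra.comul c) = 1 ⊗ₜ c := by
  have key := comul_coassoc_lift
    ((LinearMap.mul' ℂ A ∘ₗ (antipodeInv A).lTensor A ∘ₗ
        (TensorProduct.comm ℂ A A).toLinearMap ∘ₗ Coalgebra.comul).rTensor A)
    (untwist A)
    ((LinearMap.mul' ℂ A ∘ₗ (antipodeInv A).lTensor A ∘ₗ
        (TensorProduct.comm ℂ A A).toLinearMap).rTensor A ∘ₗ
          (TensorProduct.assoc ℂ A A A).symm.toLinearMap)
    (fun m c => by simp) (fun m c => by
      rw [untwist_tmul]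
      induction Coalgebra.comul (R := ℂ) c using TensorProduct.induction_on with
      | zero => simp
      | add x y hx hy => simp only [map_add, add_mul, TensorProduct.tmul_add, hx, hy]
      | tmul x y => simp) c
  rw [← key]
  have h : LinearMap.mul' ℂ A ∘ₗ (antipodeInv A).lTensor A ∘ₗ
        (TensorProduct.comm ℂ A A).toLinearMap ∘ₗ Coalgebra.comul =
      Algebra.linearMap ℂ A ∘ₗ Coalgebra.counit :=
    LinearMap.ext fun a => mul_lTensor_antipodeInv a
  rw [h, LinearMap.rTensor_comp_apply, Coalgebra.rTensor_counit_comul]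
  simp

/-- The map `y ⊗ c ↦ ∑ c⁽¹⁾ κ⁻¹(d_k) ⊗ y_k ⊗ c⁽²⁾` for `F(y) = ∑ y_k ⊗ d_k`. -/
def opTwist : B ⊗[ℂ] A →ₗ[ℂ] A ⊗[ℂ] (B ⊗[ℂ] A) :=
  (TensorProduct.leftComm ℂ B A A).toLinearMap ∘ₗ (untwist A).lTensor B ∘ₗ
    (TensorProduct.assoc ℂ B A A).toLinearMap ∘ₗ P.F.toLinearMap.rTensor A

theorem opTwist_F (b : B) : P.opTwist (P.F b) = 1 ⊗ₜ P.F b := by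
  simp only [opTwist, LinearMap.comp_apply, LinearEquiv.coe_coe, P.coassoc]
  induction P.F b using TensorProduct.induction_on with
  | zero => simp
  | add x y hx hy => simp only [map_add, TensorProduct.tmul_add, hx, hy]
  | tmul x y => simp [untwist_comul]

theorem opTwist_tmul_one_mul (q : B) (t : B ⊗[ℂ] A) : P.opTwist ((q ⊗ₜ 1) * t) =
    TensorProduct.map₂ (LinearMap.mul ℂ A).flip
      (LinearMap.mul ℂ (B ⊗[ℂ] A) ∘ₗ (TensorProduct.mk ℂ B A).flip 1)
        (P.opF (antipodeInv A) q) (P.opTwist t) := by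
  induction t using TensorProduct.induction_on with
  | zero => simp
  | add x y hx hy => simp only [map_add, mul_add, hx, hy]
  | tmul b c =>
    simp only [Algebra.TensorProduct.tmul_mul_tmul, one_mul, opTwist, LinearMap.comp_apply,
      LinearEquiv.coe_coe, LinearMap.rTensor_tmul, AlgHom.toLinearMap_apply, map_mul, opF]
    induction P.F q using TensorProduct.induction_on with
    | zero => simp
    | add x y hx hy =>
      simp only [map_add, add_mul, TensorProduct.add_tmul, LinearMap.add_apply, hx, hy]
    | tmul u x =>
      induction P.F b using TensorProduct.induction_on with
      | zero => simp
      | add x y hx hy => simp only [map_add, mul_add, TensorProduct.add_tmul, hx, hy]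
      | tmul m p =>
        simp only [Algebra.TensorProduct.tmul_mul_tmul, TensorProduct.assoc_tmul,
          LinearMap.lTensor_tmul, untwist_tmul, antipodeInv_mul, TensorProduct.comm_tmul,
          LinearMap.rTensor_tmul]
        induction Coalgebra.comul (R := ℂ) c using TensorProduct.induction_on with
        | zero => simp
        | add x y hx hy => simp only [map_add, add_mul, TensorProduct.tmul_add, hx, hy]
        | tmul y z => simp [mul_assoc]

/-- The map `ᵒᵖF ⊗ id` corresponds under `X` to `opTwist`. -/
theorem X_leftCoact (t : Balanced i) :
    P.X.lTensor A (P.leftCoact (antipodeInv A) t) = P.opTwist (P.X t) := by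
  refine LinearMap.congr_fun (f := P.X.lTensor A ∘ₗ P.leftCoact (antipodeInv A))
    (g := P.opTwist ∘ₗ P.X) (Balanced.hom_ext i fun q b => ?_) t
  rw [LinearMap.comp_apply, LinearMap.comp_apply, X_tmul, opTwist_tmul_one_mul, opTwist_F]
  have h : ∀ t : A ⊗[ℂ] B, P.X.lTensor A ((balancedRel i).mkQ.lTensor A
      (TensorProduct.assoc ℂ A B B (t ⊗ₜ b))) =
    TensorProduct.map₂ (LinearMap.mul ℂ A).flip
      (LinearMap.mul ℂ (B ⊗[ℂ] A) ∘ₗ (TensorProduct.mk ℂ B A).flip 1) t (1 ⊗ₜ P.F b) := fun t => by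
    induction t using TensorProduct.induction_on with
    | zero => simp
    | add x y hx hy => simp only [map_add, TensorProduct.add_tmul, LinearMap.add_apply, hx, hy]
    | tmul a q =>
      refine (TensorProduct.map_tmul _ _ _ _).trans ?_
      change a ⊗ₜ ((q ⊗ₜ 1) * P.F b) = _
      simp
  exact h _

/-- The identity `ᵒᵖF[a]_1 ⊗ [a]_2 = a⁽¹⁾ ⊗ [a⁽²⁾]_1 ⊗ [a⁽²⁾]_2`, which is verified after applying `X`. -/
theorem leftCoact_translation (hX : Function.Bijective P.X) (a : A) :
    P.leftCoact (antipodeInv A) (P.translation hX a) =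
      (P.translation hX).lTensor A (Coalgebra.comul a) := by
  apply Module.Flat.lTensor_preserves_injective_linearMap (M := A) P.X hX.1
  rw [X_leftCoact, X_translation]
  simp only [opTwist, LinearMap.comp_apply, LinearEquiv.coe_coe, LinearMap.rTensor_tmul,
    AlgHom.toLinearMap_apply, map_one, Algebra.TensorProduct.one_def, TensorProduct.assoc_tmul,
    LinearMap.lTensor_tmul, untwist_tmul, antipodeInv_one]
  rw [← Algebra.TensorProduct.one_def, mul_one]
  induction Coalgebra.comul (R := ℂ) a using TensorProduct.induction_on with
  | zero => simp
  | add x y hx hy => simp only [map_add, TensorProduct.tmul_add, hx, hy]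
  | tmul x y => simp [X_translation]

theorem X_ract_mul (w : B) (t : Balanced i) :
    P.X (Balanced.ract i w t) = P.X t * P.F w := by
  have : P.X ∘ₗ Balanced.ract i w = LinearMap.mulRight ℂ (P.F w) ∘ₗ P.X :=
    Balanced.hom_ext i fun q b => by simp [mul_assoc]
  exact LinearMap.congr_fun this t

end PreBundle

end Translation

variable {A Ψ : Type*} [Ring A] [HopfAlgebra ℂ A] [StarRing A] [StarModule ℂ A] [IsStarHopf A]
  [AddCommGroup Ψ] [Module ℂ Ψ] [Module A Ψ] [Module Aᵐᵒᵖ Ψ] [SMulCommClass A Aᵐᵒᵖ Ψ]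
  [IsScalarTower ℂ A Ψ] [IsScalarTower ℂ Aᵐᵒᵖ Ψ] [StarAddMonoid Ψ] [StarModule ℂ Ψ]

attribute [local instance] CrossProduct.affHopfAlgebra

namespace BicovariantStarBimodule

variable (X : BicovariantStarBimodule A Ψ)

instance : IsStarHopf X.AffineAlg :=
  ⟨CrossProduct.coaction_star X (ComoduleAlgebra.regular A)⟩

end BicovariantStarBimodule

variable {V B : Type*} [Ring V] [Algebra ℂ V] [StarRing V]
  [Ring B] [Algebra ℂ B] [StarRing B] [StarModule ℂ B] {i : V →ₐ[ℂ] B}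

namespace PreBundle

variable (P : PreBundle A i) (X : BicovariantStarBimodule A Ψ)

instance : IsStarComodule P.toComoduleAlgebra := ⟨P.F_star⟩

open CrossProduct

/-- The map `(proj ⊗ id) H : B̃ → B ⊗ Ã` sends `b x` to `F(b) (1 ⊗ x)`. -/
theorem proj_coaction (b : B) (x : TensorAlgebra ℂ X.inv) :
    Algebra.TensorProduct.map (proj X P.toComoduleAlgebra) (AlgHom.id ℂ X.AffineAlg)
      (coaction X P.toComoduleAlgebra (inl X _ b * inrT X _ x)) =
    Algebra.TensorProduct.map (AlgHom.id ℂ B) (inl X _) (P.F b) * (1 ⊗ₜ inrT X _ x) := by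
  have h : (Algebra.TensorProduct.map (proj X P.toComoduleAlgebra) (AlgHom.id ℂ X.AffineAlg)).comp
      (frame X P.toComoduleAlgebra).h =
      Algebra.TensorProduct.includeRight.comp (inrT X (ComoduleAlgebra.regular A)) := by
    refine TensorAlgebra.hom_ext (LinearMap.ext fun v => ?_)
    simp only [LinearMap.comp_apply, AlgHom.toLinearMap_apply, AlgHom.comp_apply, frame_h_ι,
      map_add]
    have h' : ∀ t : X.inv ⊗[ℂ] A, Algebra.TensorProduct.map (proj X P.toComoduleAlgebra)
        (AlgHom.id ℂ X.AffineAlg) (TensorProduct.map ((inrT X _).toLinearMap ∘ₗ TensorAlgebra.ι ℂ)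
            (inl X (ComoduleAlgebra.regular A)).toLinearMap t) = 0 := fun t => by
      induction t using TensorProduct.induction_on with
      | zero => simp
      | add x y hx hy => simp only [map_add, hx, hy, add_zero]
      | tmul w d => simp
    rw [h']
    simp
  rw [map_mul, map_mul, coaction_inl, coaction_inrT]
  have := AlgHom.congr_fun h x
  rw [AlgHom.comp_apply, AlgHom.comp_apply] at this
  rw [this]
  congr 1
  rw [coactInl, AlgHom.comp_apply]
  induction P.F b using TensorProduct.induction_on with
  | zero => simp
  | add x y hx hy => simp only [map_add, hx, hy]
  | tmul w d => simp

/-- The map `b ⊗ a s ↦ ε(a) b s`. -/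
def collapse : B ⊗[ℂ] X.AffineAlg →ₗ[ℂ] P.AffineTotal X :=
  TensorProduct.lift (CrossProduct.mk X P.toComoduleAlgebra) ∘ₗ
    ((TensorProduct.lid ℂ X.SymAlg).toLinearMap ∘ₗ Coalgebra.counit.rTensor X.SymAlg :
      A ⊗[ℂ] X.SymAlg →ₗ[ℂ] X.SymAlg).lTensor B

theorem collapse_tmul (b : B) (a : A) (x : TensorAlgebra ℂ X.inv) :
    P.collapse X (b ⊗ₜ (inl X _ a * inrT X _ x)) =
      Coalgebra.counit (R := ℂ) a • (inl X _ b * inrT X _ x) := by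
  rw [inl_mul_inrT, inl_mul_inrT]
  refine (?_ : _ = CrossProduct.mk X P.toComoduleAlgebra b (Coalgebra.counit (R := ℂ) a • X.symMk x)).trans ?_
  · rfl
  · rw [map_smul]

theorem collapse_proj_coaction (y : P.AffineTotal X) : P.collapse X
    (Algebra.TensorProduct.map (proj X P.toComoduleAlgebra) (AlgHom.id ℂ X.AffineAlg)
      (coaction X P.toComoduleAlgebra y)) = y := by
  induction y using mul_induction with
  | h0 => simp
  | ha x y hx hy => simp only [map_add, hx, hy]
  | hm b x =>
    rw [proj_coaction]
    conv_rhs => rw [← P.counit b]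
    induction P.F b using TensorProduct.induction_on with
    | zero => simp
    | add x y hx hy => simp only [map_add, add_mul, hx, hy]
    | tmul w d => simp [collapse_tmul]

/-- The fixed points of `H` are those of `F`: if `H(y) = y ⊗ 1`, then `(proj ⊗ id) H(y) = proj(y) ⊗ 1`,
and applying `collapse` gives `y = proj(y)`, which lies in `B`. -/
theorem coaction_eq_tmul_one_iff (y : P.AffineTotal X) :
    y ∈ Set.range (P.affineBase X) ↔ coaction X P.toComoduleAlgebra y = y ⊗ₜ 1 := by
  constructor
  · rintro ⟨v, rfl⟩
    rw [AlgHom.comp_apply, coaction_inl, coactInl, AlgHom.comp_apply, P.F_i]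
    simp
  · intro hy
    have h1 := P.collapse_proj_coaction X y
    rw [hy, Algebra.TensorProduct.map_tmul, map_one] at h1
    have h2 := P.collapse_tmul X (proj X P.toComoduleAlgebra y) 1 1
    rw [map_one, map_one, mul_one, h1] at h2
    simp only [Bialgebra.counit_one, one_smul, map_one, mul_one] at h2
    rw [h2, coaction_inl] at hy
    have h3 := congrArg (Algebra.TensorProduct.map (proj X P.toComoduleAlgebra)
      (proj X (ComoduleAlgebra.regular A))) hy
    rw [coactInl, AlgHom.comp_apply] at h3
    have h4 : ∀ t : B ⊗[ℂ] A, Algebra.TensorProduct.map (proj X P.toComoduleAlgebra)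
      (proj X (ComoduleAlgebra.regular A)) (Algebra.TensorProduct.map (inl X P.toComoduleAlgebra)
        (inl X (ComoduleAlgebra.regular A)) t) = t := fun t => by
      induction t using TensorProduct.induction_on with
      | zero => simp
      | add x y hx hy => simp only [map_add, hx, hy]
      | tmul w d => simp
    rw [h4] at h3
    obtain ⟨v, hv⟩ := (P.range_i (proj X P.toComoduleAlgebra y)).2 (by simpa using h3)
    exact ⟨v, by rw [AlgHom.comp_apply, hv, h2, proj_inl]⟩

/-- The affine extension `P̃ = (B̃, i, H)`, without the freeness condition. -/
def affine : PreBundle X.AffineAlg (P.affineBase X) where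
  F := coaction X P.toComoduleAlgebra
  coassoc b := by
    refine Eq.trans ?_ (AlgHom.congr_fun (coaction_coassoc X P.toComoduleAlgebra) b)
    rfl
  counit b := AlgHom.congr_fun (coaction_counit X P.toComoduleAlgebra) b
  F_star := coaction_star X P.toComoduleAlgebra
  i_star v := by
    rw [AlgHom.comp_apply, AlgHom.comp_apply, star_inl, P.i_star]
  i_injective v w h := by
    have := congrArg (proj X P.toComoduleAlgebra) h
    rw [AlgHom.comp_apply, AlgHom.comp_apply, proj_inl, proj_inl] at this
    exact P.i_injective this
  range_i := P.coaction_eq_tmul_one_iff X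

theorem affine_F (y : P.AffineTotal X) : (P.affine X).F y = coaction X P.toComoduleAlgebra y := rfl

/-- On `B ⊗_V B` the map `X̃` is an extension of `X`. -/
theorem affine_X_map (t : Balanced i) :
    (P.affine X).X (Balanced.map i (inl X P.toComoduleAlgebra) t) =
      TensorProduct.map (inl X P.toComoduleAlgebra).toLinearMap
        (inl X (ComoduleAlgebra.regular A)).toLinearMap (P.X t) := by
  refine LinearMap.congr_fun (f := (P.affine X).X ∘ₗ Balanced.map i (inl X P.toComoduleAlgebra))
    (g := TensorProduct.map (inl X P.toComoduleAlgebra).toLinearMap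
        (inl X (ComoduleAlgebra.regular A)).toLinearMap ∘ₗ P.X)
    (Balanced.hom_ext i fun q b => ?_) t
  rw [LinearMap.comp_apply, LinearMap.comp_apply, X_tmul]
  refine (X_tmul (P.affine X) (inl X _ q) (inl X _ b)).trans ?_
  rw [affine_F, coaction_inl, coactInl, AlgHom.comp_apply]
  induction P.F b using TensorProduct.induction_on with
  | zero => simp
  | add x y hx hy => simp only [map_add, mul_add, hx, hy]
  | tmul w d => simp

variable (hX : Function.Bijective P.X)

/-- The map `q ⊗ a s ↦ q τ(a) s`. -/
def cotranslate : P.AffineTotal X ⊗[ℂ] X.AffineAlg →ₗ[ℂ] Balanced (P.affineBase X) :=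
  TensorProduct.lift (Balanced.lactHom (P.affineBase X)).flip.flip ∘ₗ
    (TensorProduct.lift ((Balanced.ractHom (P.affineBase X) ∘ₗ
      (inr X P.toComoduleAlgebra).toLinearMap).flip ∘ₗ
        Balanced.map i (inl X P.toComoduleAlgebra) ∘ₗ P.translation hX) :
      A ⊗[ℂ] X.SymAlg →ₗ[ℂ] Balanced (P.affineBase X)).lTensor (P.AffineTotal X)

theorem cotranslate_tmul (q : P.AffineTotal X) (a : A) (x : TensorAlgebra ℂ X.inv) :
    P.cotranslate X hX (q ⊗ₜ (inl X _ a * inrT X _ x)) =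
      Balanced.lact _ q (Balanced.ract _ (inrT X _ x)
        (Balanced.map i (inl X P.toComoduleAlgebra) (P.translation hX a))) := by
  rw [inl_mul_inrT]
  rfl

theorem affine_X_cotranslate (t : P.AffineTotal X ⊗[ℂ] X.AffineAlg) :
    (P.affine X).X (P.cotranslate X hX t) = spreadOp X P.toComoduleAlgebra t := by
  induction t using TensorProduct.induction_on with
  | zero => simp
  | add x y hx hy => simp only [map_add, hx, hy]
  | tmul q y =>
    induction y using mul_induction with
    | h0 => simp
    | ha x y hx hy => simp only [map_add, TensorProduct.tmul_add, hx, hy]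
    | hm a x =>
      rw [cotranslate_tmul, X_lact, X_ract_mul, affine_X_map, X_translation, affine_F,
        inl_mul_inrT, spreadOp_tmul, ← inrT_apply, ← mul_assoc]
      simp

/-- The elements `q τ(a) s` span `B̃ ⊗_V B̃`: as `X` is bijective, `1 ⊗ b` is a sum of elements `b' τ(a)`,
and `1 ⊗ b s` is obtained by multiplication with `s` from the right. -/
theorem cotranslate_surjective : Function.Surjective (P.cotranslate X hX) := by
  rw [← LinearMap.range_eq_top, eq_top_iff]
  have h1 : ∀ (q : P.AffineTotal X) (x : TensorAlgebra ℂ X.inv) (t : Balanced i),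
      Balanced.lact _ q (Balanced.ract _ (inrT X _ x)
        (Balanced.map i (inl X P.toComoduleAlgebra) t)) ∈
          LinearMap.range (P.cotranslate X hX) := fun q x t => by
    obtain ⟨s, rfl⟩ : ∃ s, (LinearEquiv.ofBijective P.X hX).symm s = t :=
      ⟨P.X t, (LinearEquiv.ofBijective P.X hX).symm_apply_apply t⟩
    induction s using TensorProduct.induction_on with
    | zero => simp
    | add x y hx hy => simp only [map_add]; exact add_mem hx hy
    | tmul b c =>
      have h2 : (LinearEquiv.ofBijective P.X hX).symm (b ⊗ₜ c) =
          Balanced.lact i b (P.translation hX c) := by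
        rw [LinearEquiv.symm_apply_eq]
        refine Eq.trans ?_ (P.X_lact b _).symm
        rw [X_translation]
        simp
      have h3 : ∀ t : Balanced i, Balanced.lact _ q (Balanced.ract _ (inrT X _ x)
        (Balanced.map i (inl X P.toComoduleAlgebra) (Balanced.lact i b t))) =
          Balanced.lact _ (q * inl X _ b) (Balanced.ract _ (inrT X _ x)
            (Balanced.map i (inl X P.toComoduleAlgebra) t)) := fun t => by
        refine LinearMap.congr_fun
          (f := Balanced.lact _ q ∘ₗ Balanced.ract _ (inrT X _ x) ∘ₗ
            Balanced.map i (inl X P.toComoduleAlgebra) ∘ₗ Balanced.lact i b)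
          (g := Balanced.lact _ (q * inl X _ b) ∘ₗ Balanced.ract _ (inrT X _ x) ∘ₗ
            Balanced.map i (inl X P.toComoduleAlgebra)) (Balanced.hom_ext i fun p r => ?_) t
        change Balanced.tmul _ (q * inl X _ (b * p)) (inl X _ r * inrT X _ x) =
          Balanced.tmul _ (q * inl X _ b * inl X _ p) (inl X _ r * inrT X _ x)
        rw [map_mul, mul_assoc]
      rw [h2, h3, ← cotranslate_tmul]
      exact ⟨_, rfl⟩
  intro t _
  obtain ⟨s, rfl⟩ := Submodule.mkQ_surjective _ t
  induction s using TensorProduct.induction_on with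
  | zero => simp
  | add x y hx hy => simp only [map_add]; exact add_mem (hx trivial) (hy trivial)
  | tmul q y =>
    induction y using mul_induction with
    | h0 => simp
    | ha x y hx hy => simp only [map_add, TensorProduct.tmul_add]; exact add_mem (hx trivial) (hy trivial)
    | hm b x =>
      have := h1 q x (Balanced.tmul i 1 b)
      have h4 : Balanced.lact (P.affineBase X) q (Balanced.ract _ (inrT X _ x)
        (Balanced.map i (inl X P.toComoduleAlgebra) (Balanced.tmul i 1 b))) =
          Balanced.tmul _ (q * inl X _ 1) (inl X _ b * inrT X _ x) := rfl
      rw [h4, map_one, mul_one] at this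
      exact this

include hX in
/-- The map `cotranslate` is surjective, and composed with `X̃` it is bijective; so both are
bijective. -/
theorem affine_X_bijective : Function.Bijective (P.affine X).X := by
  have h := spreadOp_bijective X P.toComoduleAlgebra
  constructor
  · intro t t' ht
    obtain ⟨s, rfl⟩ := P.cotranslate_surjective X hX t
    obtain ⟨s', rfl⟩ := P.cotranslate_surjective X hX t'
    rw [affine_X_cotranslate, affine_X_cotranslate] at ht
    rw [h.1 ht]
  · intro y
    obtain ⟨s, hs⟩ := h.2 y
    exact ⟨P.cotranslate X hX s, by rw [affine_X_cotranslate, hs]⟩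

end PreBundle
end

noncomputable section

variable {A Ψ : Type*} [Ring A] [HopfAlgebra ℂ A] [StarRing A] [StarModule ℂ A]
  [AddCommGroup Ψ] [Module ℂ Ψ] [Module A Ψ] [Module Aᵐᵒᵖ Ψ] [SMulCommClass A Aᵐᵒᵖ Ψ]
  [IsScalarTower ℂ A Ψ] [IsScalarTower ℂ Aᵐᵒᵖ Ψ] [StarAddMonoid Ψ] [StarModule ℂ Ψ]

/-! ### Degrees -/

section Degree

variable {V : Type*} [AddCommGroup V] [Module ℂ V] (β : V ⊗[ℂ] V →ₗ[ℂ] V ⊗[ℂ] V)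

theorem ι_mul_mem_deg (v : V) {n : ℕ} {x : TensorAlgebra ℂ V} (hx : x ∈ deg V n) :
    TensorAlgebra.ι ℂ v * x ∈ deg V (n + 1) := by
  rw [deg, pow_succ']
  exact Submodule.mul_mem_mul ⟨v, rfl⟩ hx

@[elab_as_elim]
theorem deg_succ_induction {n : ℕ} {p : TensorAlgebra ℂ V → Prop} {x : TensorAlgebra ℂ V}
    (hx : x ∈ deg V (n + 1)) (hm : ∀ v, ∀ y ∈ deg V n, p (TensorAlgebra.ι ℂ v * y))
    (ha : ∀ x y, p x → p y → p (x + y)) : p x := by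
  rw [deg, pow_succ'] at hx
  refine Submodule.mul_induction_on hx ?_ ha
  rintro _ ⟨v, rfl⟩ y hy
  exact hm v y hy

@[elab_as_elim]
theorem deg_zero_induction {p : TensorAlgebra ℂ V → Prop} {x : TensorAlgebra ℂ V}
    (hx : x ∈ deg V 0) (h : ∀ r : ℂ, p (r • 1)) : p x := by
  rw [deg, pow_zero] at hx
  obtain ⟨r, rfl⟩ := Submodule.mem_one.1 hx
  rw [Algebra.algebraMap_eq_smul_one]
  exact h r

theorem braidAt_mem_deg (i : ℕ) {n : ℕ} {x : TensorAlgebra ℂ V} (hx : x ∈ deg V n) :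
    braidAt β i x ∈ deg V n := by
  induction i generalizing n x with
  | zero =>
    match n with
    | 0 =>
      refine deg_zero_induction hx fun r => ?_
      rw [map_smul, braidAt_one]
      exact Submodule.smul_mem _ _ (Submodule.one_le.1 (by rw [deg, pow_zero]))
    | 1 =>
      rw [deg, pow_one] at hx ⊢
      obtain ⟨v, rfl⟩ := hx
      rw [braidAt_zero_ι]
      exact ⟨v, rfl⟩
    | n + 2 =>
      refine deg_succ_induction hx (fun v y hy => ?_) fun x y hx hy => by
        rw [map_add]; exact add_mem hx hy
      refine deg_succ_induction hy (fun w z hz => ?_) fun x y hx hy => by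
        rw [mul_add, map_add]; exact add_mem hx hy
      rw [braidAt_zero]
      induction β (v ⊗ₜ w) using TensorProduct.induction_on with
      | zero => simp
      | add a b ha hb => rw [map_add, add_mul]; exact add_mem ha hb
      | tmul a b =>
        simp only [pairMap, TensorProduct.lift.tmul, LinearMap.compl₁₂_apply,
          LinearMap.mul_apply', mul_assoc]
        exact ι_mul_mem_deg _ (ι_mul_mem_deg _ hz)
  | succ i ih =>
    match n with
    | 0 =>
      refine deg_zero_induction hx fun r => ?_
      rw [map_smul, braidAt_one]
      exact Submodule.smul_mem _ _ (Submodule.one_le.1 (by rw [deg, pow_zero]))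
    | n + 1 =>
      refine deg_succ_induction hx (fun v y hy => ?_) fun x y hx hy => by
        rw [map_add]; exact add_mem hx hy
      rw [braidAt_succ]
      exact ι_mul_mem_deg _ (ih hy)

theorem prod_braidAt_mem_deg (l : List ℕ) {n : ℕ} {x : TensorAlgebra ℂ V} (hx : x ∈ deg V n) :
    (l.map fun i => (braidAt β i : Module.End ℂ (TensorAlgebra ℂ V))).prod x ∈ deg V n := by
  induction l with
  | nil => exact hx
  | cons i l ih =>
    rw [List.map_cons, List.prod_cons]
    exact braidAt_mem_deg β i ih

theorem reversal_mem_deg (k : ℕ) {n : ℕ} {x : TensorAlgebra ℂ V} (hx : x ∈ deg V n) :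
    reversal β k x ∈ deg V n := prod_braidAt_mem_deg β _ hx

theorem unshuffleOp_mem_deg (m k : ℕ) {n : ℕ} {x : TensorAlgebra ℂ V} (hx : x ∈ deg V n) :
    unshuffleOp β m k x ∈ deg V n := by
  rw [unshuffleOp, LinearMap.sum_apply]
  exact sum_mem fun σ _ => prod_braidAt_mem_deg β _ hx

theorem shuffleOp_eq_unshuffleOp {n k l : ℕ} (h : k + l = n) :
    shuffleOp β k l = unshuffleOp β n k := by
  subst h
  exact shuffleOp_eq β k l

/-- The subspace `V^{⊗k} ⊗ M` of `T(V) ⊗ M`. -/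
def degFst (V : Type*) [AddCommGroup V] [Module ℂ V] (k : ℕ) (M : Type*) [AddCommGroup M]
    [Module ℂ M] : Submodule ℂ (TensorAlgebra ℂ V ⊗[ℂ] M) :=
  LinearMap.range ((deg V k).subtype.rTensor M)

section degFst

variable {k : ℕ} {M : Type*} [AddCommGroup M] [Module ℂ M]

theorem tmul_mem_degFst {t : TensorAlgebra ℂ V} (ht : t ∈ deg V k) (m : M) :
    t ⊗ₜ m ∈ degFst V k M := ⟨⟨t, ht⟩ ⊗ₜ m, rfl⟩

@[elab_as_elim]
theorem degFst_induction {p : TensorAlgebra ℂ V ⊗[ℂ] M → Prop} {z : TensorAlgebra ℂ V ⊗[ℂ] M}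
    (hz : z ∈ degFst V k M) (ht : ∀ t ∈ deg V k, ∀ m, p (t ⊗ₜ m))
    (ha : ∀ x y, p x → p y → p (x + y)) : p z := by
  obtain ⟨s, rfl⟩ := hz
  induction s using TensorProduct.induction_on with
  | zero => simpa using ht 0 (zero_mem _) 0
  | tmul t m => exact ht t t.2 m
  | add x y hx hy => rw [map_add]; exact ha _ _ hx hy

end degFst

theorem splitAt_succ_ι_mul (k : ℕ) (v : V) (x : TensorAlgebra ℂ V) :
    splitAt V (k + 1) (TensorAlgebra.ι ℂ v * x) =
      (LinearMap.mulLeft ℂ (TensorAlgebra.ι ℂ v)).rTensor _ (splitAt V k x) := by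
  rw [splitAt, consCases_ι_mul]
  simp only [LinearMap.comp_apply, LinearMap.lTensor_tmul, LinearEquiv.coe_coe]
  induction splitAt V k x using TensorProduct.induction_on with
  | zero => simp
  | add a b ha hb => simp only [map_add, TensorProduct.tmul_add, ha, hb]
  | tmul a b => simp

/-- On `V^{⊗k} ⊗ T(V)` the map `splitAt k` is left inverse to the product. -/
theorem splitAt_mul {k : ℕ} {t : TensorAlgebra ℂ V} (ht : t ∈ deg V k) (y : TensorAlgebra ℂ V) :
    splitAt V k (t * y) = t ⊗ₜ y := by
  induction k generalizing t with
  | zero =>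
    refine deg_zero_induction ht fun r => ?_
    rw [smul_mul_assoc, one_mul, map_smul, ← TensorProduct.smul_tmul']
    rfl
  | succ k ih =>
    refine deg_succ_induction ht (fun v x hx => ?_) fun a b ha hb => by
      rw [add_mul, map_add, ha, hb, TensorProduct.add_tmul]
    rw [mul_assoc, splitAt_succ_ι_mul, ih hx]
    rfl

theorem splitAt_mem_degFst (k : ℕ) (x : TensorAlgebra ℂ V) :
    splitAt V k x ∈ degFst V k (TensorAlgebra ℂ V) := by
  induction k generalizing x with
  | zero => exact tmul_mem_degFst (Submodule.one_le.1 (by rw [deg, pow_zero])) x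
  | succ k ih =>
    induction x using cons_induction with
    | h1 => simp [splitAt]
    | ha x y hx hy => rw [map_add]; exact add_mem hx hy
    | hs r x hx => rw [map_smul]; exact Submodule.smul_mem _ _ hx
    | hc v x hx =>
      rw [splitAt_succ_ι_mul]
      refine degFst_induction (ih x) (fun t ht m => ?_) fun a b ha hb => by
        rw [map_add]; exact add_mem ha hb
      exact tmul_mem_degFst (ι_mul_mem_deg v ht) m

/-- In degrees `≥ k` the map `splitAt k` is right inverse to the product. -/
theorem mul_splitAt {k n : ℕ} (h : k ≤ n) {x : TensorAlgebra ℂ V} (hx : x ∈ deg V n) :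
    LinearMap.mul' ℂ _ (splitAt V k x) = x := by
  induction k generalizing n x with
  | zero => simp [splitAt]
  | succ k ih =>
    obtain ⟨n, rfl⟩ := Nat.exists_eq_add_of_le' (Nat.one_le_of_lt h)
    refine deg_succ_induction hx (fun v y hy => ?_) fun a b ha hb => by
      rw [map_add, map_add, ha, hb]
    rw [splitAt_succ_ι_mul]
    conv_rhs => rw [← ih (Nat.le_of_succ_le_succ h) hy]
    induction splitAt V k y using TensorProduct.induction_on with
    | zero => simp
    | add a b ha hb => simp only [map_add, ha, hb, mul_add]
    | tmul a b => simp [mul_assoc]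

end Degree

/-! ### The coaction of `𝕍^⊗` and the order reversal -/

namespace BicovariantStarBimodule

variable (X : BicovariantStarBimodule A Ψ)

theorem tensorCoact_mem_degFst {k : ℕ} {x : TensorAlgebra ℂ X.inv} (hx : x ∈ deg X.inv k) :
    X.tensorCoact x ∈ degFst X.inv k A := by
  induction k generalizing x with
  | zero =>
    refine deg_zero_induction hx fun r => ?_
    rw [map_smul, map_one]
    exact Submodule.smul_mem _ _ (tmul_mem_degFst (Submodule.one_le.1 (by rw [deg, pow_zero])) 1)
  | succ k ih =>
    refine deg_succ_induction hx (fun v x hx => ?_) fun a b ha hb => by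
      rw [map_add]; exact add_mem ha hb
    rw [map_mul, X.tensorCoact_ι]
    refine degFst_induction (ih hx) (fun t ht c => ?_) fun a b ha hb => by
      rw [mul_add]; exact add_mem ha hb
    induction X.coact v using TensorProduct.induction_on with
    | zero => simp
    | add a b ha hb => rw [map_add, add_mul]; exact add_mem ha hb
    | tmul w d =>
      rw [LinearMap.rTensor_tmul, Algebra.TensorProduct.tmul_mul_tmul]
      exact tmul_mem_degFst (ι_mul_mem_deg w ht) (d * c)

theorem tensorCoact_coassoc (x : TensorAlgebra ℂ X.inv) :
    TensorProduct.assoc ℂ _ A A (X.tensorCoact.toLinearMap.rTensor A (X.tensorCoact x)) =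
      Coalgebra.comul.lTensor _ (X.tensorCoact x) := by
  have h : (Algebra.TensorProduct.assoc ℂ ℂ ℂ (TensorAlgebra ℂ X.inv) A A).toAlgHom.comp
      ((Algebra.TensorProduct.map X.tensorCoact (AlgHom.id ℂ A)).comp X.tensorCoact) =
      (Algebra.TensorProduct.map (AlgHom.id ℂ _) (Bialgebra.comulAlgHom ℂ A)).comp
        X.tensorCoact := by
    refine TensorAlgebra.hom_ext (LinearMap.ext fun v => ?_)
    have h1 := congrArg ((TensorAlgebra.ι ℂ).rTensor (A ⊗[ℂ] A)) (X.coact_coassoc v)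
    simp only [LinearMap.comp_apply, AlgHom.toLinearMap_apply, AlgHom.comp_apply, X.tensorCoact_ι]
    refine Eq.trans ?_ (h1.trans ?_)
    · induction X.coact v using TensorProduct.induction_on with
      | zero => simp
      | add a b ha hb => simp only [map_add, ha, hb]
      | tmul w c =>
        simp only [LinearMap.rTensor_tmul, Algebra.TensorProduct.map_tmul, X.tensorCoact_ι]
        induction X.coact w using TensorProduct.induction_on with
        | zero => simp
        | add a b ha hb => simp only [map_add, TensorProduct.add_tmul, ha, hb]
        | tmul u d => simp
    · induction X.coact v using TensorProduct.induction_on with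
      | zero => simp
      | add a b ha hb => simp only [map_add, ha, hb]
      | tmul w c => simp
  exact AlgHom.congr_fun h x

/-- The map `y ⊗ c ↦ y (v ∘ c)`. -/
def mulCirc (v : X.inv) : TensorAlgebra ℂ X.inv ⊗[ℂ] A →ₗ[ℂ] TensorAlgebra ℂ X.inv :=
  LinearMap.mul' ℂ _ ∘ₗ (TensorAlgebra.ι ℂ ∘ₗ X.invCirc.flip v).lTensor _

@[simp] theorem mulCirc_tmul (v : X.inv) (y : TensorAlgebra ℂ X.inv) (c : A) :
    X.mulCirc v (y ⊗ₜ c) = y * TensorAlgebra.ι ℂ (X.invCirc c v) := rfl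

/-- Moving the letter `v` across `t ∈ 𝕍^{⊗k}` gives `∑ t_j (v ∘ c_j)`, where
`ϰ(t) = ∑ t_j ⊗ c_j`. -/
theorem moveOp_ι_mul_mul (v : X.inv) {k : ℕ} {t : TensorAlgebra ℂ X.inv} (ht : t ∈ deg X.inv k)
    (x : TensorAlgebra ℂ X.inv) : moveOp X.braid k (TensorAlgebra.ι ℂ v * (t * x)) =
      X.mulCirc v (X.tensorCoact t) * x := by
  induction k generalizing t v with
  | zero =>
    refine deg_zero_induction ht fun r => ?_
    rw [moveOp_zero, map_smul, map_one, map_smul, Algebra.TensorProduct.one_def, mulCirc_tmul,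
      invCirc_one]
    simp
  | succ k ih =>
    refine deg_succ_induction ht (fun w y hy => ?_) fun a b ha hb => by
      rw [add_mul, mul_add, map_add, ha, hb, map_add, map_add, add_mul]
    rw [mul_assoc, moveOp_succ_ι_mul_ι_mul, X.braid_tmul, map_mul, X.tensorCoact_ι]
    induction X.coact w using TensorProduct.induction_on with
    | zero => simp
    | add a b ha hb => simp only [map_add, add_mul, ha, hb]
    | tmul u d =>
      simp only [LinearMap.lTensor_tmul, TensorProduct.lift.tmul, LinearMap.compl₁₂_apply,
        LinearMap.mul_apply', LinearMap.comp_apply, LinearMap.mulRight_apply, LinearMap.flip_apply,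
        LinearMap.rTensor_tmul]
      rw [ih _ hy]
      clear ih
      induction X.tensorCoact y using TensorProduct.induction_on with
      | zero => simp
      | add a b ha hb => simp only [map_add, add_mul, mul_add, ha, hb]
      | tmul s c => simp [invCirc_mul, mul_assoc]

theorem moveOp_ι_mul (v : X.inv) {k : ℕ} {t : TensorAlgebra ℂ X.inv} (ht : t ∈ deg X.inv k) :
    moveOp X.braid k (TensorAlgebra.ι ℂ v * t) = X.mulCirc v (X.tensorCoact t) := by
  simpa using X.moveOp_ι_mul_mul v ht 1

/-- The map `y ⊗ c ↦ ∑ y (v_j ∘ c⁽¹⁾) ⊗ e_j c⁽²⁾`, where `ϰ(v) = ∑ v_j ⊗ e_j`. -/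
def appendCoact (v : X.inv) :
    TensorAlgebra ℂ X.inv ⊗[ℂ] A →ₗ[ℂ] TensorAlgebra ℂ X.inv ⊗[ℂ] A :=
  LinearMap.mul' ℂ _ ∘ₗ TensorProduct.map
    (Algebra.TensorProduct.includeLeft : _ →ₐ[ℂ] TensorAlgebra ℂ X.inv ⊗[ℂ] A).toLinearMap
    (conv (X.circCoact v) (Algebra.TensorProduct.includeRight : A →ₐ[ℂ] _).toLinearMap)

theorem appendCoact_tmul (v : X.inv) (y : TensorAlgebra ℂ X.inv) (c : A) :
    X.appendCoact v (y ⊗ₜ c) = (y ⊗ₜ 1) *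
      conv (X.circCoact v) (Algebra.TensorProduct.includeRight : A →ₐ[ℂ] _).toLinearMap c := rfl

theorem tensorCoact_mulCirc (v : X.inv) (y : TensorAlgebra ℂ X.inv) :
    X.tensorCoact (X.mulCirc v (X.tensorCoact y)) = X.appendCoact v (X.tensorCoact y) := by
  let g := TensorAlgebra.ι ℂ ∘ₗ X.invCirc.flip v
  refine coassoc_lift X.tensorCoact_coassoc (X.tensorCoact.toLinearMap ∘ₗ X.mulCirc v)
    (X.appendCoact v) (LinearMap.mul' ℂ _ ∘ₗ TensorProduct.map
    (Algebra.TensorProduct.includeLeft : _ →ₐ[ℂ] TensorAlgebra ℂ X.inv ⊗[ℂ] A).toLinearMap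
    (LinearMap.mul' ℂ _ ∘ₗ TensorProduct.map
      (Algebra.TensorProduct.includeRight : A →ₐ[ℂ] TensorAlgebra ℂ X.inv ⊗[ℂ] A).toLinearMap
      (X.tensorCoact.toLinearMap ∘ₗ g))) (fun m c => ?_) (fun m c => ?_) y
  · simp only [LinearMap.comp_apply, mulCirc_tmul, AlgHom.toLinearMap_apply, map_mul]
    induction X.tensorCoact m using TensorProduct.induction_on with
    | zero => simp
    | add a b ha hb => simp only [map_add, add_mul, TensorProduct.add_tmul, ha, hb]
    | tmul s d =>
      simp only [TensorProduct.assoc_tmul, LinearMap.comp_apply, TensorProduct.map_tmul,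
        LinearMap.mul'_apply, AlgHom.toLinearMap_apply, g, LinearMap.flip_apply]
      rw [← mul_assoc]
      simp
  · rw [appendCoact_tmul, ← X.conv_coact_circ]
    rfl

/-- The map `t ↦ ∑ I{t_j} ⊗ c_j` on `𝕍^{⊗k}`, where `ϰ(t) = ∑ t_j ⊗ c_j`. -/
def reversedCoact (k : ℕ) : TensorAlgebra ℂ X.inv →ₗ[ℂ] TensorAlgebra ℂ X.inv ⊗[ℂ] A :=
  (reversal X.braid k).rTensor A ∘ₗ X.tensorCoact.toLinearMap

/-- Coassociativity, applied to the order reversal: a further coaction of `t_j` in `∑ I{t_j} ⊗ c_j` can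
be replaced by the coproduct of `c_j`. -/
theorem reversedCoact_lift {N : Type*} [AddCommGroup N] [Module ℂ N] (k : ℕ)
    (Φ : TensorAlgebra ℂ X.inv ⊗[ℂ] (A ⊗[ℂ] A) →ₗ[ℂ] N) (t : TensorAlgebra ℂ X.inv) :
    Φ (TensorProduct.assoc ℂ _ A A ((X.reversedCoact k).rTensor A (X.tensorCoact t))) =
      Φ (Coalgebra.comul.lTensor _ (X.reversedCoact k t)) := by
  have h := congrArg (fun z => Φ ((reversal X.braid k).rTensor _ z)) (X.tensorCoact_coassoc t)
  refine Eq.trans ?_ (h.trans ?_)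
  · congr 1
    induction X.tensorCoact t using TensorProduct.induction_on with
    | zero => simp
    | add a b ha hb => simp only [map_add, ha, hb]
    | tmul s c =>
      simp only [LinearMap.rTensor_tmul, reversedCoact, LinearMap.comp_apply,
        AlgHom.toLinearMap_apply]
      induction X.tensorCoact s using TensorProduct.induction_on with
      | zero => simp
      | add a b ha hb => simp only [map_add, TensorProduct.add_tmul, ha, hb]
      | tmul u d => simp
  · congr 1
    simp only [reversedCoact, LinearMap.comp_apply, AlgHom.toLinearMap_apply]
    induction X.tensorCoact t using TensorProduct.induction_on with
    | zero => simp
    | add a b ha hb => simp only [map_add, ha, hb]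
    | tmul s c => simp

/-- The map `y ⊗ p ⊗ q ↦ (y ⊗ 1) g(p) (1 ⊗ q)`. -/
def mulMulTensor {R : Type*} [Ring R] [Algebra ℂ R] (g : A →ₗ[ℂ] R ⊗[ℂ] A) :
    R ⊗[ℂ] (A ⊗[ℂ] A) →ₗ[ℂ] R ⊗[ℂ] A :=
  LinearMap.mul' ℂ _ ∘ₗ TensorProduct.map
    (Algebra.TensorProduct.includeLeft : R →ₐ[ℂ] R ⊗[ℂ] A).toLinearMap
    (LinearMap.mul' ℂ _ ∘ₗ TensorProduct.map g
      (Algebra.TensorProduct.includeRight : A →ₐ[ℂ] R ⊗[ℂ] A).toLinearMap)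

theorem mulMulTensor_tmul {R : Type*} [Ring R] [Algebra ℂ R] (g : A →ₗ[ℂ] R ⊗[ℂ] A) (y : R)
    (p q : A) : mulMulTensor g (y ⊗ₜ (p ⊗ₜ q)) = (y ⊗ₜ 1) * (g p * (1 ⊗ₜ q)) := rfl

theorem mulMulTensor_add {R : Type*} [Ring R] [Algebra ℂ R] (g h : A →ₗ[ℂ] R ⊗[ℂ] A)
    (z : R ⊗[ℂ] (A ⊗[ℂ] A)) :
    mulMulTensor (g + h) z = mulMulTensor g z + mulMulTensor h z := by
  simp only [mulMulTensor, TensorProduct.map_add_left, LinearMap.comp_add,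
    TensorProduct.map_add_right, LinearMap.add_apply]

/-- The order reversal commutes with the coaction `ϰ`, and `∑ I{(v t)_j} ⊗ c_j` is determined
recursively. The two assertions are proved together, since each of them in degree `k` is used for the
other one in the next degree. -/
theorem tensorCoact_reversal_and_reversedCoact_succ (k : ℕ) :
    (∀ t ∈ deg X.inv k, X.tensorCoact (reversal X.braid k t) = X.reversedCoact k t) ∧
    ∀ v, ∀ t ∈ deg X.inv k, X.reversedCoact (k + 1) (TensorAlgebra.ι ℂ v * t) =
      X.appendCoact v (X.reversedCoact k t) := by
  have step : ∀ k, (∀ t ∈ deg X.inv k, X.tensorCoact (reversal X.braid k t) =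
      X.reversedCoact k t) → ∀ v, ∀ t ∈ deg X.inv k,
      X.reversedCoact (k + 1) (TensorAlgebra.ι ℂ v * t) =
        X.appendCoact v (X.reversedCoact k t) := by
    intro k ih v t ht
    have h2 : ∀ s ∈ deg X.inv k, ∀ (c : A) (q : X.inv ⊗[ℂ] A),
        (reversal X.braid (k + 1)).rTensor A ((TensorAlgebra.ι ℂ).rTensor A q * (s ⊗ₜ c)) =
        mulMulTensor (circTensor X q) (TensorProduct.assoc ℂ _ A A (X.reversedCoact k s ⊗ₜ c)) := by
      intro s hs c q
      induction q using TensorProduct.induction_on with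
      | zero => simp [mulMulTensor]
      | add a b ha hb => simp only [map_add, add_mul, ha, hb, mulMulTensor_add]
      | tmul w e =>
        rw [LinearMap.rTensor_tmul, Algebra.TensorProduct.tmul_mul_tmul, LinearMap.rTensor_tmul,
          reversal_succ, X.moveOp_ι_mul w (reversal_mem_deg _ k hs), ih s hs]
        generalize X.reversedCoact k s = z
        induction z using TensorProduct.induction_on with
        | zero => simp
        | add a b ha hb => simp only [map_add, TensorProduct.add_tmul, ha, hb]
        | tmul y p =>
          rw [TensorProduct.assoc_tmul, mulMulTensor_tmul, circTensor_tmul, mulCirc_tmul]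
          simp
    have h1 : ∀ z ∈ degFst X.inv k A, (reversal X.braid (k + 1)).rTensor A
        (X.tensorCoact (TensorAlgebra.ι ℂ v) * z) = mulMulTensor (X.circCoact v)
          (TensorProduct.assoc ℂ _ A A ((X.reversedCoact k).rTensor A z)) := by
      intro z hz
      refine degFst_induction hz (fun s hs c => ?_) fun a b ha hb => by
        simp only [mul_add, map_add, ha, hb]
      rw [X.tensorCoact_ι, h2 s hs, ← circCoact_eq, LinearMap.rTensor_tmul]
    change (reversal X.braid (k + 1)).rTensor A (X.tensorCoact (TensorAlgebra.ι ℂ v * t)) = _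
    rw [map_mul, h1 _ (X.tensorCoact_mem_degFst ht),
      X.reversedCoact_lift k (mulMulTensor (X.circCoact v))]
    induction X.reversedCoact k t using TensorProduct.induction_on with
    | zero => simp
    | add a b ha hb => simp only [map_add, ha, hb]
    | tmul y c => rfl
  induction k with
  | zero =>
    have h : ∀ t ∈ deg X.inv 0, X.tensorCoact (reversal X.braid 0 t) = X.reversedCoact 0 t := by
      intro t _
      have h0 : reversal X.braid 0 = LinearMap.id := by simp [reversal, braidPerm, reducedWord]; rfl
      rw [reversedCoact, h0, LinearMap.rTensor_id]
      rfl
    exact ⟨h, step 0 h⟩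
  | succ k ih =>
    have h : ∀ t ∈ deg X.inv (k + 1), X.tensorCoact (reversal X.braid (k + 1) t) =
        X.reversedCoact (k + 1) t := by
      intro t ht
      refine deg_succ_induction ht (fun v y hy => ?_) fun a b ha hb => by
        simp only [map_add, ha, hb]
      rw [reversal_succ, X.moveOp_ι_mul v (reversal_mem_deg _ k hy), tensorCoact_mulCirc,
        ih.1 y hy, ih.2 v y hy]
    exact ⟨h, step (k + 1) h⟩

end BicovariantStarBimodule
end

noncomputable section

variable {A Ψ : Type*} [Ring A] [HopfAlgebra ℂ A] [StarRing A] [StarModule ℂ A]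
  [AddCommGroup Ψ] [Module ℂ Ψ] [Module A Ψ] [Module Aᵐᵒᵖ Ψ] [SMulCommClass A Aᵐᵒᵖ Ψ]
  [IsScalarTower ℂ A Ψ] [IsScalarTower ℂ Aᵐᵒᵖ Ψ] [StarAddMonoid Ψ] [StarModule ℂ Ψ]

/-! ### The formula for the translation map -/

namespace CoproductFrame

variable {X : BicovariantStarBimodule A Ψ} {E : Type*} [Ring E] [Algebra ℂ E]
  (Φ : CoproductFrame X E)

/-- The map `t ⊗ ϑ ↦ ∑ (I{t_j} ⊗ c_j) h(ϑ)` on `𝕍^{⊗k} ⊗ 𝕍^⊗`, where `ϰ(t) = ∑ t_j ⊗ c_j`. -/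
def reversedMul (k : ℕ) : TensorAlgebra ℂ X.inv ⊗[ℂ] TensorAlgebra ℂ X.inv →ₗ[ℂ] E :=
  LinearMap.mul' ℂ E ∘ₗ TensorProduct.map (Φ.J.toLinearMap ∘ₗ X.reversedCoact k) Φ.h.toLinearMap

theorem reversedMul_tmul (k : ℕ) (t y : TensorAlgebra ℂ X.inv) :
    Φ.reversedMul k (t ⊗ₜ y) = Φ.J (X.reversedCoact k t) * Φ.h y := rfl

/-- Moving a letter `v` across `t` to the second factor:
`∑ (I{t_j} ⊗ c_j⁽¹⁾) h(v ∘ c_j⁽²⁾) h(y) = v ∑ (I{t_j} ⊗ c_j) h(y) + ∑ (I{(v t)_j} ⊗ c_j) h(y)`. On the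
left the two terms of `h(v ∘ c⁽²⁾) = 1 ⊗ (v ∘ c⁽²⁾) + ϰ(v ∘ c⁽²⁾)` give the two terms on the right. -/
theorem reversedMul_move (k : ℕ) (v : X.inv) {t : TensorAlgebra ℂ X.inv} (ht : t ∈ deg X.inv k)
    (y : TensorAlgebra ℂ X.inv) :
    Φ.reversedMul k ((LinearMap.mulRight ℂ y ∘ₗ TensorAlgebra.ι ℂ ∘ₗ X.invCirc.flip v).lTensor _
        (X.tensorCoact t)) =
      Φ.r (TensorAlgebra.ι ℂ v) * Φ.reversedMul k (t ⊗ₜ y) +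
        Φ.reversedMul (k + 1) ((TensorAlgebra.ι ℂ v * t) ⊗ₜ y) := by
  let hv : A →ₗ[ℂ] E := Φ.h.toLinearMap ∘ₗ TensorAlgebra.ι ℂ ∘ₗ X.invCirc.flip v
  let K : TensorAlgebra ℂ X.inv ⊗[ℂ] (A ⊗[ℂ] A) →ₗ[ℂ] E :=
    LinearMap.mul' ℂ E ∘ₗ TensorProduct.map
      (Φ.J.comp Algebra.TensorProduct.includeLeft).toLinearMap
      (LinearMap.mul' ℂ E ∘ₗ TensorProduct.map Φ.α.toLinearMap hv)
  have h1 : ∀ z : TensorAlgebra ℂ X.inv ⊗[ℂ] A, Φ.reversedMul k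
      ((LinearMap.mulRight ℂ y ∘ₗ TensorAlgebra.ι ℂ ∘ₗ X.invCirc.flip v).lTensor _ z) =
      K (TensorProduct.assoc ℂ _ A A ((X.reversedCoact k).rTensor A z)) * Φ.h y := fun z => by
    induction z using TensorProduct.induction_on with
    | zero => simp
    | add a b ha hb => simp only [map_add, add_mul, ha, hb]
    | tmul s c =>
      simp only [LinearMap.lTensor_tmul, LinearMap.rTensor_tmul, reversedMul_tmul,
        LinearMap.comp_apply, LinearMap.mulRight_apply, map_mul, LinearMap.flip_apply]
      rw [← mul_assoc]
      congr 1
      induction X.reversedCoact k s using TensorProduct.induction_on with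
      | zero => simp
      | add a b ha hb => simp only [map_add, add_mul, TensorProduct.add_tmul, ha, hb]
      | tmul u d =>
        have h2 : u ⊗ₜ[ℂ] d = (u ⊗ₜ 1) * (1 ⊗ₜ d) := by simp
        rw [h2, map_mul, ← h2, mul_assoc]
        rfl
  have h3 : ∀ z : TensorAlgebra ℂ X.inv ⊗[ℂ] A, K (Coalgebra.comul.lTensor _ z) =
      Φ.r (TensorAlgebra.ι ℂ v) * Φ.J z + Φ.J (X.appendCoact v z) := fun z => by
    induction z using TensorProduct.induction_on with
    | zero => simp
    | add a b ha hb => simp only [map_add, mul_add, ha, hb]; abel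
    | tmul u d =>
      have h2 : u ⊗ₜ[ℂ] d = (u ⊗ₜ 1) * (1 ⊗ₜ d) := by simp
      have h4 : K (Coalgebra.comul.lTensor _ (u ⊗ₜ d)) =
          Φ.J (u ⊗ₜ 1) * conv Φ.α.toLinearMap hv d := rfl
      rw [h4, Φ.conv_h, X.appendCoact_tmul, mul_add, ← mul_assoc, ← Φ.comm, mul_assoc, map_mul,
        algHom_conv, h2, map_mul]
      rfl
  rw [h1, X.reversedCoact_lift k K, h3, add_mul, reversedMul_tmul, reversedMul_tmul,
    (X.tensorCoact_reversal_and_reversedCoact_succ k).2 v t ht, mul_assoc]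

/-- The relation `reversedMul_move` for words `z` of length `n`, the first `k` letters of which form
the block `t`. -/
theorem reversedMul_splitAt_moveOp (k n : ℕ) (hk : k ≤ n) (v : X.inv)
    {z : TensorAlgebra ℂ X.inv} (hz : z ∈ deg X.inv n) :
    Φ.reversedMul k (splitAt X.inv k (moveOp X.braid k (TensorAlgebra.ι ℂ v * z))) =
      Φ.r (TensorAlgebra.ι ℂ v) * Φ.reversedMul k (splitAt X.inv k z) +
      Φ.reversedMul (k + 1) (splitAt X.inv (k + 1) (TensorAlgebra.ι ℂ v * z)) := by
  have h : ∀ w ∈ degFst X.inv k (TensorAlgebra ℂ X.inv), Φ.reversedMul k (splitAt X.inv k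
        (moveOp X.braid k (TensorAlgebra.ι ℂ v * LinearMap.mul' ℂ _ w))) =
      Φ.r (TensorAlgebra.ι ℂ v) * Φ.reversedMul k (splitAt X.inv k (LinearMap.mul' ℂ _ w)) +
      Φ.reversedMul (k + 1)
        (splitAt X.inv (k + 1) (TensorAlgebra.ι ℂ v * LinearMap.mul' ℂ _ w)) := by
    intro w hw
    refine degFst_induction hw (fun t ht y => ?_) fun a b ha hb => by
      simp only [map_add, mul_add, ha, hb]; abel
    have h1 : ∀ q ∈ degFst X.inv k A, splitAt X.inv k (X.mulCirc v q * y) =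
        (LinearMap.mulRight ℂ y ∘ₗ TensorAlgebra.ι ℂ ∘ₗ X.invCirc.flip v).lTensor _ q := by
      intro q hq
      refine degFst_induction hq (fun s hs c => ?_) fun a b ha hb => by
        simp only [map_add, add_mul, ha, hb]
      rw [X.mulCirc_tmul, mul_assoc, splitAt_mul hs]
      rfl
    rw [LinearMap.mul'_apply, X.moveOp_ι_mul_mul v ht, h1 _ (X.tensorCoact_mem_degFst ht),
      Φ.reversedMul_move k v ht, splitAt_mul ht, ← mul_assoc (TensorAlgebra.ι ℂ v),
      splitAt_mul (ι_mul_mem_deg v ht)]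
  have h2 := h _ (splitAt_mem_degFst k z)
  rwa [mul_splitAt hk hz] at h2

/-- The alternating sum over all unshuffles of `x` reduces to the second copy of `x`: in the step from
`y` to `v y`, the terms with `v` in front cancel against the second terms in `reversedMul_move`. -/
theorem sum_reversedMul_unshuffleOp {n : ℕ} {x : TensorAlgebra ℂ X.inv} (hx : x ∈ deg X.inv n) :
    ∑ k ∈ Finset.range (n + 1), (-1 : ℂ) ^ k •
      Φ.reversedMul k (splitAt X.inv k (unshuffleOp X.braid n k x)) = Φ.r x := by
  induction n generalizing x with
  | zero =>
    refine deg_zero_induction hx fun r => ?_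
    simp only [zero_add, Finset.range_one, Finset.sum_singleton, pow_zero, one_smul,
      unshuffleOp_zero]
    rw [map_smul, map_smul, map_smul]
    change r • Φ.reversedMul 0 (1 ⊗ₜ 1) = _
    have h0 : X.reversedCoact 0 1 = 1 := by
      rw [BicovariantStarBimodule.reversedCoact, LinearMap.comp_apply, AlgHom.toLinearMap_apply,
        map_one]
      simp [Algebra.TensorProduct.one_def, reversal, braidPerm, reducedWord]
    rw [reversedMul_tmul, h0, map_one, map_one, mul_one, map_one]
  | succ n ih =>
    refine deg_succ_induction hx (fun v y hy => ?_) fun a b ha hb => by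
      simp only [map_add, smul_add, Finset.sum_add_distrib, ha, hb]
    -- `m k` collects the unshuffles which leave `v` in front, `q k` those which move it to position `k`
    set m : ℕ → E := fun k => Φ.reversedMul k (splitAt X.inv k
      (TensorAlgebra.ι ℂ v * unshuffleOp X.braid n (k - 1) y)) with hm
    set q : ℕ → E := fun k => Φ.reversedMul k (splitAt X.inv k
      (moveOp X.braid k (TensorAlgebra.ι ℂ v * unshuffleOp X.braid n k y))) with hq
    have h1 : ∀ k ∈ Finset.range (n + 2), (-1 : ℂ) ^ k • Φ.reversedMul k (splitAt X.inv k
        (unshuffleOp X.braid (n + 1) k (TensorAlgebra.ι ℂ v * y))) =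
        (if 0 < k then (-1 : ℂ) ^ k • m k else 0) + if k ≤ n then (-1 : ℂ) ^ k • q k else 0 := by
      intro k _
      rw [unshuffleOp_succ_eq_sum, map_add, map_add, smul_add]
      congr 1 <;> split_ifs <;> simp [hm, hq]
    -- `m (k + 1)` is to cancel against a part of `q k`, so the first sum is shifted by one
    rw [Finset.sum_congr rfl h1, Finset.sum_add_distrib, Finset.sum_range_succ',
      Finset.sum_range_succ (fun k => if k ≤ n then (-1 : ℂ) ^ k • q k else 0) (n + 1),
      if_neg (lt_irrefl 0), if_neg (Nat.not_succ_le_self n), add_zero, add_zero,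
      ← Finset.sum_add_distrib, map_mul, ← ih hy, Finset.mul_sum]
    refine Finset.sum_congr rfl fun k hk => ?_
    have hk' : k ≤ n := Nat.lt_succ_iff.1 (Finset.mem_range.1 hk)
    rw [if_pos (Nat.succ_pos k), if_pos hk', hq, hm]
    dsimp only
    rw [Φ.reversedMul_splitAt_moveOp k n hk' v (unshuffleOp_mem_deg _ n k hy), Nat.add_sub_cancel,
      pow_succ, smul_add, mul_neg_one, neg_smul, mul_smul_comm]
    abel

end CoproductFrame

section

variable [IsStarHopf A] {V B : Type*} [Ring V] [Algebra ℂ V] [StarRing V] [Ring B] [Algebra ℂ B]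
  [StarRing B] [StarModule ℂ B] {i : V →ₐ[ℂ] B}

namespace PreBundle

open CrossProduct

attribute [local instance] CrossProduct.affHopfAlgebra

variable (P : PreBundle A i) (X : BicovariantStarBimodule A Ψ)

/-- Inserting `τ(a)` between the two factors corresponds under `X` to left multiplication by `1 ⊗ a`. -/
theorem X_insert (hX : Function.Bijective P.X) (a : A) (t : Balanced i) :
    P.X (P.insert hX a t) = (1 ⊗ₜ a) * P.X t := by
  have : P.X ∘ₗ P.insert hX a = LinearMap.mulLeft ℂ (1 ⊗ₜ a) ∘ₗ P.X :=
    Balanced.hom_ext i fun q b => by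
      rw [LinearMap.comp_apply, insert_tmul, X_lact, X_ract_mul, X_translation,
        LinearMap.comp_apply, X_tmul, LinearMap.mulLeft_apply, ← mul_assoc, ← mul_assoc]
      simp
  exact LinearMap.congr_fun this t

/-- The left part `∑ I{t_β} [c_β]_1 τ(a) [c_β]_2` of a summand corresponds under `X̃` to
`(1 ⊗ a) ∑ I{t_β} ⊗ c_β`. -/
theorem affine_X_summandLeft (hX : Function.Bijective P.X) (a : A) (k : ℕ)
    (t : TensorAlgebra ℂ X.inv) : (P.affine X).X (P.affineSummandLeft X hX a k t) =
      (1 ⊗ₜ inl X _ a) * (frame X P.toComoduleAlgebra).J (X.reversedCoact k t) := by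
  rw [affineSummandLeft, BicovariantStarBimodule.reversedCoact, LinearMap.comp_apply,
    LinearMap.comp_apply, AlgHom.toLinearMap_apply]
  induction X.tensorCoact t using TensorProduct.induction_on with
  | zero => simp
  | add x y hx hy => simp only [map_add, mul_add, hx, hy]
  | tmul s c =>
    rw [TensorProduct.lift.tmul, LinearMap.rTensor_tmul]
    change (P.affine X).X (Balanced.lact _ (inrT X _ (reversal X.braid k s))
      (Balanced.map i (inl X P.toComoduleAlgebra) (P.insert hX a (P.translation hX c)))) = _
    rw [X_lact, affine_X_map, X_insert, X_translation]
    simp [frame]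

theorem affine_X_summand (hX : Function.Bijective P.X) (a : A) (k : ℕ)
    (z : TensorAlgebra ℂ X.inv ⊗[ℂ] TensorAlgebra ℂ X.inv) :
    (P.affine X).X (P.affineSummand X hX a k z) =
      (1 ⊗ₜ inl X _ a) * (frame X P.toComoduleAlgebra).reversedMul k z := by
  induction z using TensorProduct.induction_on with
  | zero => simp
  | add x y hx hy => simp only [map_add, mul_add, hx, hy]
  | tmul t y =>
    change (P.affine X).X (Balanced.ract _ (inrT X _ y) (P.affineSummandLeft X hX a k t)) = _
    rw [X_ract_mul, affine_X_summandLeft, affine_F, coaction_inrT,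
      CoproductFrame.reversedMul_tmul, mul_assoc]

/-- The map `X̃` sends the right-hand side of the formula for `τ(a ⊗ [x])` to `1 ⊗ a [x]`. -/
theorem affine_X_translation (hX : Function.Bijective P.X) (a : A) (n : ℕ)
    {x : TensorAlgebra ℂ X.inv} (hx : x ∈ deg X.inv n) :
    (P.affine X).X (P.affineTranslation X hX a n x) = 1 ⊗ₜ CrossProduct.mk X _ a (X.symMk x) := by
  have h := (frame X P.toComoduleAlgebra).sum_reversedMul_unshuffleOp hx
  have h1 : ((1 : P.AffineTotal X) ⊗ₜ[ℂ] inl X (ComoduleAlgebra.regular A) a) *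
      (frame X P.toComoduleAlgebra).r x = 1 ⊗ₜ CrossProduct.mk X _ a (X.symMk x) := by
    rw [← inl_mul_inrT]
    simp [frame]
  rw [← h1, ← h, affineTranslation, map_sum, Finset.mul_sum,
    Finset.Nat.sum_antidiagonal_eq_sum_range_succ_mk]
  refine Finset.sum_congr rfl fun k hk => ?_
  have hk' : k ≤ n := Nat.lt_succ_iff.1 (Finset.mem_range.1 hk)
  rw [map_smul, affine_X_summand, mul_smul_comm,
    shuffleOp_eq_unshuffleOp X.braid (Nat.add_sub_cancel' hk')]

end PreBundle

end
end

noncomputable section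

variable {A Ψ : Type*} [Ring A] [HopfAlgebra ℂ A] [StarRing A] [StarModule ℂ A]
  [AddCommGroup Ψ] [Module ℂ Ψ] [Module A Ψ] [Module Aᵐᵒᵖ Ψ] [SMulCommClass A Aᵐᵒᵖ Ψ]
  [IsScalarTower ℂ A Ψ] [IsScalarTower ℂ Aᵐᵒᵖ Ψ] [StarAddMonoid Ψ] [StarModule ℂ Ψ]

/-! ### Left-invariant elements generate a bicovariant bimodule -/

namespace BicovariantStarBimodule

variable (X : BicovariantStarBimodule A Ψ)

open WithConv

/-- The map `ψ ↦ ∑ κ(a_k) φ_k`, for `ℓ(ψ) = ∑ a_k ⊗ φ_k`, of `Ψ` to the left-invariant elements. -/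
def leftAverage : Ψ →ₗ[ℂ] Ψ :=
  TensorProduct.lift (lmul A Ψ ∘ₗ HopfAlgebra.antipode ℂ) ∘ₗ X.left

theorem left_leftAverage (ψ : Ψ) : X.left (X.leftAverage ψ) = 1 ⊗ₜ X.leftAverage ψ := by
  let M := ((Module.End.rTensorAlgHom ℂ A Ψ).comp (Algebra.lmul ℂ A))
  let N := ((Module.End.lTensorAlgHom ℂ Ψ A).comp (Algebra.lsmul ℂ ℂ Ψ : A →ₐ[ℂ] _))
  have e : toConv ((lamL A Ψ).toLinearMap ∘ₗ HopfAlgebra.antipode ℂ) * toConv M.toLinearMap =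
      toConv (N.toLinearMap ∘ₗ HopfAlgebra.antipode ℂ) := by
    have e1 : toConv M.toLinearMap = toConv (lamL A Ψ).toLinearMap *
        toConv (N.toLinearMap ∘ₗ HopfAlgebra.antipode ℂ) := by
      rw [lamL_conv, mul_assoc, conv_antipode', mul_one]
    rw [e1, ← mul_assoc, conv_antipode, one_mul]
  have hF : ∀ t : A ⊗[ℂ] Ψ,
      X.left (TensorProduct.lift (lmul A Ψ ∘ₗ HopfAlgebra.antipode ℂ) t) =
      TensorProduct.lift ((lamL A Ψ).toLinearMap ∘ₗ HopfAlgebra.antipode ℂ)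
        (X.left.lTensor A t) := fun t => by
    induction t using TensorProduct.induction_on with
    | zero => simp
    | add x y hx hy => simp only [map_add, hx, hy]
    | tmul a φ =>
      simp only [TensorProduct.lift.tmul, LinearMap.comp_apply, lmul_apply, X.left_lmul,
        LinearMap.lTensor_tmul, AlgHom.toLinearMap_apply, lamL_apply]
  have hG : ∀ t : A ⊗[ℂ] Ψ,
      TensorProduct.lift ((lamL A Ψ).toLinearMap ∘ₗ HopfAlgebra.antipode ℂ)
        (TensorProduct.assoc ℂ A A Ψ (Coalgebra.comul.rTensor Ψ t)) =
      1 ⊗ₜ TensorProduct.lift (lmul A Ψ ∘ₗ HopfAlgebra.antipode ℂ) t := fun t => by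
    induction t using TensorProduct.induction_on with
    | zero => simp
    | add x y hx hy => simp only [map_add, TensorProduct.tmul_add, hx, hy]
    | tmul a φ =>
      have h := LinearMap.congr_fun (LinearMap.congr_fun (congrArg WithConv.ofConv e) a) (1 ⊗ₜ φ)
      refine Eq.trans ?_ (h.trans ?_)
      · simp only [LinearMap.convMul_def, LinearMap.comp_apply, LinearMap.rTensor_tmul,
          ofConv_toConv]
        induction Coalgebra.comul (R := ℂ) a using TensorProduct.induction_on with
        | zero => simp
        | add x y hx hy => simp only [map_add, TensorProduct.add_tmul, LinearMap.add_apply, hx, hy]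
        | tmul x y =>
          have hM : M y (1 ⊗ₜ φ) = y ⊗ₜ φ := by
            change (y * 1) ⊗ₜ[ℂ] φ = _
            rw [mul_one]
          rw [TensorProduct.map_tmul, LinearMap.mul'_apply, Module.End.mul_apply,
            AlgHom.toLinearMap_apply M, hM]
          rfl
      · simp [N]; rfl
  rw [leftAverage, LinearMap.comp_apply, hF, ← X.left_coassoc, hG]

/-- The projection `leftAverage` of `Ψ` onto `𝕍`. -/
def toInv : Ψ →ₗ[ℂ] X.inv :=
  X.leftAverage.codRestrict X.inv fun ψ => X.mem_inv.2 (X.left_leftAverage ψ)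

theorem coe_toInv (ψ : Ψ) : (X.toInv ψ : Ψ) = X.leftAverage ψ := rfl

theorem left_smul_inv (a : A) (v : X.inv) :
    X.left (a • (v : Ψ)) = ((lmul A Ψ).flip (v : Ψ)).lTensor A (Coalgebra.comul a) := by
  rw [X.left_lmul, X.mem_inv.1 v.2]
  induction Coalgebra.comul (R := ℂ) a using TensorProduct.induction_on with
  | zero => simp
  | add x y hx hy => simp only [map_add, LinearMap.add_apply, hx, hy]
  | tmul x y => simp

theorem toInv_smul (a : A) (v : X.inv) : X.toInv (a • (v : Ψ)) = Coalgebra.counit (R := ℂ) a • v := by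
  refine Subtype.ext ?_
  rw [coe_toInv, leftAverage, LinearMap.comp_apply, left_smul_inv]
  have h : ∀ t : A ⊗[ℂ] A, TensorProduct.lift (lmul A Ψ ∘ₗ HopfAlgebra.antipode ℂ)
      (((lmul A Ψ).flip (v : Ψ)).lTensor A t) =
      (LinearMap.mul' ℂ A ((HopfAlgebra.antipode ℂ).rTensor A t)) • (v : Ψ) := fun t => by
    induction t using TensorProduct.induction_on with
    | zero => simp
    | add x y hx hy => simp only [map_add, add_smul, hx, hy]
    | tmul x y => simp [mul_smul]
  rw [h, HopfAlgebra.mul_antipode_rTensor_comul_apply, algebraMap_smul]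
  rfl

/-- Every element is a sum of products `a v` with `v` left-invariant, namely `ψ = ∑ a_k toInv(φ_k)` for
`ℓ(ψ) = ∑ a_k ⊗ φ_k`. -/
@[elab_as_elim]
theorem smul_inv_induction {p : Ψ → Prop} (hm : ∀ (a : A) (v : X.inv), p (a • (v : Ψ)))
    (ha : ∀ x y, p x → p y → p (x + y)) (ψ : Ψ) : p ψ := by
  let F : A ⊗[ℂ] (A ⊗[ℂ] Ψ) →ₗ[ℂ] Ψ := TensorProduct.lift (lmul A Ψ) ∘ₗ
    (TensorProduct.lift (lmul A Ψ ∘ₗ HopfAlgebra.antipode ℂ)).lTensor A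
  have h1 : ∀ t : A ⊗[ℂ] Ψ, F (TensorProduct.assoc ℂ A A Ψ (Coalgebra.comul.rTensor Ψ t)) =
      TensorProduct.lid ℂ Ψ (Coalgebra.counit.rTensor Ψ t) := fun t => by
    induction t using TensorProduct.induction_on with
    | zero => simp
    | add x y hx hy => simp only [map_add, hx, hy]
    | tmul a φ =>
      have h2 : ∀ t : A ⊗[ℂ] A, F (TensorProduct.assoc ℂ A A Ψ (t ⊗ₜ φ)) =
          (LinearMap.mul' ℂ A ((HopfAlgebra.antipode ℂ).lTensor A t)) • φ := fun t => by
        induction t using TensorProduct.induction_on with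
        | zero => simp
        | add x y hx hy => simp only [map_add, TensorProduct.add_tmul, add_smul, hx, hy]
        | tmul x y => simp [F, mul_smul]
      rw [LinearMap.rTensor_tmul, h2, HopfAlgebra.mul_antipode_lTensor_comul_apply,
        algebraMap_smul]
      simp
  have h2 : TensorProduct.lift (lmul A Ψ) (X.leftAverage.lTensor A (X.left ψ)) = ψ := by
    conv_rhs => rw [← X.left_counit ψ, ← h1, X.left_coassoc]
    simp only [F, LinearMap.comp_apply, leftAverage, LinearMap.lTensor_comp]
  rw [← h2]
  induction X.left ψ using TensorProduct.induction_on with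
  | zero => simpa using hm 0 0
  | add x y hx hy => rw [map_add, map_add]; exact ha _ _ hx hy
  | tmul a φ => exact hm a (X.toInv φ)

variable [IsStarHopf A]

theorem op_smul_inv_eq (a : A) (v : X.inv) : MulOpposite.op a • (v : Ψ) =
    TensorProduct.lift ((lmul A Ψ).compl₂ (X.inv.subtype ∘ₗ X.invCirc.flip v))
      (Coalgebra.comul a) := op_smul_eq a (v : Ψ)

/-! ### The projection of the tensor bundle algebra -/

open CrossProduct

/-- The inclusion of `Ψ` in `Ã`, which sends `a v` to `a ⊗ [v]` for `v ∈ 𝕍`. -/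
def bimoduleHom : Ψ →ₗ[ℂ] X.AffineAlg :=
  TensorProduct.lift ((LinearMap.mul ℂ X.AffineAlg).compl₁₂ (inl X (ComoduleAlgebra.regular A)).toLinearMap
    ((inrT X (ComoduleAlgebra.regular A)).toLinearMap ∘ₗ TensorAlgebra.ι ℂ ∘ₗ X.toInv)) ∘ₗ X.left

theorem bimoduleHom_smul_inv (a : A) (v : X.inv) : X.bimoduleHom (a • (v : Ψ)) =
    inl X _ a * inrT X _ (TensorAlgebra.ι ℂ v) := by
  rw [bimoduleHom, LinearMap.comp_apply, left_smul_inv]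
  have h : inl X (ComoduleAlgebra.regular A) (TensorProduct.rid ℂ A
      (Coalgebra.counit.lTensor A (Coalgebra.comul (R := ℂ) a))) = inl X _ a := by simp
  rw [← h]
  induction Coalgebra.comul (R := ℂ) a using TensorProduct.induction_on with
  | zero => simp
  | add x y hx hy => simp only [map_add, add_mul, hx, hy]
  | tmul x y => simp [toInv_smul]

theorem bimoduleHom_inv (v : X.inv) : X.bimoduleHom (v : Ψ) = inrT X _ (TensorAlgebra.ι ℂ v) := by
  simpa using X.bimoduleHom_smul_inv 1 v

theorem bimoduleHom_smul (a : A) (ψ : Ψ) :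
    X.bimoduleHom (a • ψ) = inl X _ a * X.bimoduleHom ψ := by
  refine X.smul_inv_induction (fun b v => ?_) (fun x y hx hy => ?_) ψ
  · rw [← mul_smul, bimoduleHom_smul_inv, bimoduleHom_smul_inv, map_mul, mul_assoc]
  · rw [smul_add, map_add, map_add, mul_add, hx, hy]

theorem bimoduleHom_op_smul (a : A) (ψ : Ψ) :
    X.bimoduleHom (MulOpposite.op a • ψ) = X.bimoduleHom ψ * inl X _ a := by
  refine X.smul_inv_induction (fun b v => ?_) (fun x y hx hy => ?_) ψ
  · rw [bimoduleHom_smul_inv, mul_assoc, inrT_ι_mul_inl, ← smul_comm b, bimoduleHom_smul,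
      op_smul_inv_eq]
    congr 1
    change _ = LinearMap.mul' ℂ _ (TensorProduct.map _ _ (Coalgebra.comul a))
    induction Coalgebra.comul (R := ℂ) a using TensorProduct.induction_on with
    | zero => simp
    | add x y hx hy => simp only [map_add, hx, hy]
    | tmul x y => simp [bimoduleHom_smul_inv, ← coe_invCirc]
  · rw [smul_add, map_add, map_add, add_mul, hx, hy]

/-- The projection of `T(Ψ)` onto `Ã`. -/
def bundleProj : TensorBundle A Ψ →ₐ[ℂ] X.AffineAlg :=
  RingQuot.liftAlgHom ℂ ⟨TensorAlgebra.lift ℂ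
    (LinearMap.coprod (inl X (ComoduleAlgebra.regular A)).toLinearMap X.bimoduleHom), by
    intro x y h
    cases h with
    | one => simp
    | mul a b => simp
    | left a ψ => simp [bimoduleHom_smul]
    | right a ψ => simp [bimoduleHom_op_smul]⟩

theorem bundleProj_inA (a : A) : X.bundleProj (TensorBundle.inA A Ψ a) = inl X _ a := by
  refine (RingQuot.liftAlgHom_mkAlgHom_apply ..).trans ?_
  simp

theorem bundleProj_inΨ (ψ : Ψ) : X.bundleProj (TensorBundle.inΨ A Ψ ψ) = X.bimoduleHom ψ := by
  refine (RingQuot.liftAlgHom_mkAlgHom_apply ..).trans ?_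
  simp

theorem bundleProj_inT (x : TensorAlgebra ℂ X.inv) : X.bundleProj (X.inT x) = inrT X _ x := by
  have h : X.bundleProj.comp X.inT = inrT X _ := TensorAlgebra.hom_ext (LinearMap.ext fun v => by
    simp [inT, bundleProj_inΨ, bimoduleHom_inv])
  exact AlgHom.congr_fun h x

theorem bundleProj_surjective : Function.Surjective X.bundleProj := by
  intro y
  induction y using CrossProduct.induction with
  | hl a => exact ⟨_, X.bundleProj_inA a⟩
  | hr v => exact ⟨_, X.bundleProj_inT _⟩
  | hm x y hx hy =>
    obtain ⟨x, rfl⟩ := hx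
    obtain ⟨y, rfl⟩ := hy
    exact ⟨x * y, map_mul _ _ _⟩
  | ha x y hx hy =>
    obtain ⟨x, rfl⟩ := hx
    obtain ⟨y, rfl⟩ := hy
    exact ⟨x + y, map_add _ _ _⟩

theorem inΨ_smul (a : A) (ψ : Ψ) : TensorBundle.inΨ A Ψ (a • ψ) =
    TensorBundle.inA A Ψ a * TensorBundle.inΨ A Ψ ψ :=
  (RingQuot.mkAlgHom_rel ℂ (TensorBundleRel.left a ψ)).trans (map_mul (TensorBundle.proj A Ψ) _ _)

theorem inΨ_op_smul (a : A) (ψ : Ψ) : TensorBundle.inΨ A Ψ (MulOpposite.op a • ψ) =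
    TensorBundle.inΨ A Ψ ψ * TensorBundle.inA A Ψ a :=
  (RingQuot.mkAlgHom_rel ℂ (TensorBundleRel.right a ψ)).trans (map_mul (TensorBundle.proj A Ψ) _ _)

/-- The map `a ⊗ x ↦ a x` of `A ⊗ 𝕍^⊗` to `T(Ψ)`. -/
def toBundle : A ⊗[ℂ] TensorAlgebra ℂ X.inv →ₗ[ℂ] TensorBundle A Ψ :=
  LinearMap.mul' ℂ _ ∘ₗ TensorProduct.map (TensorBundle.inA A Ψ).toLinearMap X.inT.toLinearMap

theorem toBundle_tmul (a : A) (x : TensorAlgebra ℂ X.inv) :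
    X.toBundle (a ⊗ₜ x) = TensorBundle.inA A Ψ a * X.inT x := rfl

theorem inA_mul_mem_range (a : A) {y : TensorBundle A Ψ} (hy : y ∈ LinearMap.range X.toBundle) :
    TensorBundle.inA A Ψ a * y ∈ LinearMap.range X.toBundle := by
  obtain ⟨z, rfl⟩ := hy
  induction z using TensorProduct.induction_on with
  | zero => simp
  | add x y hx hy => rw [map_add, mul_add]; exact add_mem hx hy
  | tmul b x => exact ⟨(a * b) ⊗ₜ x, by rw [toBundle_tmul, toBundle_tmul, map_mul, mul_assoc]⟩

theorem inΨ_mul_mem_range (ψ : Ψ) {y : TensorBundle A Ψ} (hy : y ∈ LinearMap.range X.toBundle) :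
    TensorBundle.inΨ A Ψ ψ * y ∈ LinearMap.range X.toBundle := by
  refine X.smul_inv_induction (fun a v => ?_) (fun x y hx hy => ?_) ψ
  · rw [inΨ_smul, mul_assoc]
    refine X.inA_mul_mem_range a ?_
    obtain ⟨z, rfl⟩ := hy
    induction z using TensorProduct.induction_on with
    | zero => simp
    | add x y hx hy => rw [map_add, mul_add]; exact add_mem hx hy
    | tmul b x =>
      rw [toBundle_tmul, ← mul_assoc, ← inΨ_op_smul, op_smul_inv_eq]
      induction Coalgebra.comul (R := ℂ) b using TensorProduct.induction_on with
      | zero => simp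
      | add x y hx hy => rw [map_add, map_add, add_mul]; exact add_mem hx hy
      | tmul c d =>
        refine ⟨c ⊗ₜ (TensorAlgebra.ι ℂ (X.invCirc d v) * x), ?_⟩
        rw [toBundle_tmul, TensorProduct.lift.tmul, LinearMap.compl₂_apply, lmul_apply, inΨ_smul,
          map_mul, mul_assoc]
        simp [inT]
  · rw [map_add, add_mul]; exact add_mem hx hy

theorem toBundle_surjective : Function.Surjective X.toBundle := by
  intro y
  obtain ⟨z, rfl⟩ := RingQuot.mkAlgHom_surjective ℂ (TensorBundleRel A Ψ) y
  change TensorBundle.proj A Ψ z ∈ LinearMap.range X.toBundle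
  induction z using cons_induction with
  | h1 => exact ⟨1 ⊗ₜ 1, by rw [toBundle_tmul, map_one, map_one, map_one, one_mul]⟩
  | ha x y hx hy => rw [map_add]; exact add_mem hx hy
  | hs r x hx => rw [map_smul]; exact Submodule.smul_mem _ _ hx
  | hc w x hx =>
    obtain ⟨a, ψ⟩ := w
    have h : TensorBundle.proj A Ψ (TensorAlgebra.ι ℂ (a, ψ)) =
        TensorBundle.inA A Ψ a + TensorBundle.inΨ A Ψ ψ := by
      have h1 : ((a, ψ) : A × Ψ) = (a, 0) + (0, ψ) := by simp
      rw [h1, map_add, map_add]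
      rfl
    rw [map_mul, h, add_mul]
    exact add_mem (X.inA_mul_mem_range a hx) (X.inΨ_mul_mem_range ψ hx)

theorem bundleProj_toBundle (z : A ⊗[ℂ] TensorAlgebra ℂ X.inv) :
    X.bundleProj (X.toBundle z) = X.symMk.toLinearMap.lTensor A z := by
  induction z using TensorProduct.induction_on with
  | zero => simp; rfl
  | add x y hx hy => rw [map_add, map_add, hx, hy, map_add]; rfl
  | tmul a x =>
    rw [toBundle_tmul, map_mul, bundleProj_inA, bundleProj_inT, inl_mul_inrT]
    rfl

/-- On `A ⊗ 𝕍^⊗`, which maps onto `T(Ψ)`, the projection is `id ⊗ symMk`, with the kernel `A ⊗ ker Y`. -/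
theorem ker_bundleProj : LinearMap.ker X.bundleProj.toLinearMap = Submodule.span ℂ
    {t | ∃ (a : A) (x : TensorAlgebra ℂ X.inv), symm X.braid x = 0 ∧
      t = TensorBundle.inA A Ψ a * X.inT x} := by
  apply le_antisymm
  · intro y hy
    obtain ⟨z, rfl⟩ := X.toBundle_surjective y
    have hz : X.symMk.toLinearMap.lTensor A z = 0 := (X.bundleProj_toBundle z).symm.trans hy
    have hex := lTensor_exact A (LinearMap.exact_subtype_ker_map X.symMk.toLinearMap)
      X.symMk_surjective
    obtain ⟨w, rfl⟩ := (hex z).1 hz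
    clear hy hz
    induction w using TensorProduct.induction_on with
    | zero => simp
    | add x y hx hy => rw [map_add, map_add]; exact add_mem hx hy
    | tmul a x => exact Submodule.subset_span ⟨a, x, (X.symMk_eq_zero_iff _).1 x.2, rfl⟩
  · rw [Submodule.span_le]
    rintro _ ⟨a, x, hx, rfl⟩
    change X.bundleProj (TensorBundle.inA A Ψ a * X.inT x) = 0
    rw [map_mul, bundleProj_inT, inrT_eq_zero X _ hx, mul_zero]

/-- The coproduct of `Ã` is `ℓ + ℘` on `Ψ`. -/
theorem coaction_bimoduleHom (ψ : Ψ) :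
    coaction X (ComoduleAlgebra.regular A) (X.bimoduleHom ψ) =
      TensorProduct.map (inl X (ComoduleAlgebra.regular A)).toLinearMap X.bimoduleHom (X.left ψ) +
      TensorProduct.map X.bimoduleHom (inl X (ComoduleAlgebra.regular A)).toLinearMap
        (X.right ψ) := by
  refine X.smul_inv_induction (fun a v => ?_) (fun x y hx hy => ?_) ψ
  · rw [bimoduleHom_smul_inv, map_mul, coaction_inl, coaction_inrT, frame_h_ι, mul_add]
    congr 1
    · rw [left_smul_inv, coactInl, AlgHom.comp_apply]
      change Algebra.TensorProduct.map _ _ (Coalgebra.comul (R := ℂ) a) * _ = _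
      induction Coalgebra.comul (R := ℂ) a using TensorProduct.induction_on with
      | zero => simp
      | add x y hx hy => simp only [map_add, add_mul, hx, hy]
      | tmul x y => simp [bimoduleHom_smul_inv]
    · rw [X.right_lmul, ← X.rTensor_coact, coactInl, AlgHom.comp_apply]
      change Algebra.TensorProduct.map _ _ (Coalgebra.comul (R := ℂ) a) * _ = _
      induction Coalgebra.comul (R := ℂ) a using TensorProduct.induction_on with
      | zero => simp
      | add x y hx hy => simp only [map_add, LinearMap.add_apply, add_mul, hx, hy]
      | tmul x y =>
        induction X.coact v using TensorProduct.induction_on with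
        | zero => simp
        | add x y hx hy => simp only [map_add, mul_add, hx, hy]
        | tmul w c => simp [bimoduleHom_smul_inv]
  · simp only [map_add, hx, hy]; abel

theorem affCounit_bimoduleHom (ψ : Ψ) : affCounit X (X.bimoduleHom ψ) = 0 := by
  refine X.smul_inv_induction (fun a v => ?_) (fun x y hx hy => ?_) ψ
  · rw [bimoduleHom_smul_inv, map_mul]
    simp [affCounit]
  · rw [map_add, map_add, hx, hy, add_zero]

theorem star_bimoduleHom (ψ : Ψ) : star (X.bimoduleHom ψ) = X.bimoduleHom (star ψ) := by
  refine X.smul_inv_induction (fun a v => ?_) (fun x y hx hy => ?_) ψ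
  · rw [bimoduleHom_smul_inv, star_mul, star_inl, star_inrT, X.tensorStar_ι, X.star_lmul,
      bimoduleHom_op_smul]
    congr 1
    exact (X.bimoduleHom_inv (X.invStar v)).symm
  · rw [map_add, star_add, star_add, map_add, hx, hy]

end BicovariantStarBimodule
end

/-! ### The Hopf *-algebra axioms -/

noncomputable section

theorem isHopfStarAlgebra (A : Type*) [Ring A] [HopfAlgebra ℂ A] [StarRing A] [StarModule ℂ A]
    [IsStarHopf A] : IsHopfStarAlgebra A (HopfAlgebra.antipode ℂ) where
  comul_one := Bialgebra.comul_one
  comul_mul := Bialgebra.comul_mul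
  counit_one := Bialgebra.counit_one
  counit_mul := Bialgebra.counit_mul
  antipode_left := HopfAlgebra.mul_antipode_rTensor_comul_apply
  antipode_right := HopfAlgebra.mul_antipode_lTensor_comul_apply
  comul_star := comul_star

theorem antipode_comp_antipodeInv (A : Type*) [Ring A] [HopfAlgebra ℂ A] [StarRing A]
    [StarModule ℂ A] [IsStarHopf A] :
    HopfAlgebra.antipode ℂ (A := A) ∘ₗ antipodeInv A = LinearMap.id :=
  LinearMap.ext antipode_antipodeInv

theorem antipodeInv_comp_antipode (A : Type*) [Ring A] [HopfAlgebra ℂ A] [StarRing A]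
    [StarModule ℂ A] [IsStarHopf A] :
    antipodeInv A ∘ₗ HopfAlgebra.antipode ℂ (A := A) = LinearMap.id :=
  LinearMap.ext antipodeInv_antipode

end

end AffineBundle

theorem mainTheorem1
    -- the Hopf *-algebra `A` of the quantum group `G`
    {A : Type*} [Ring A] [HopfAlgebra ℂ A] [StarRing A] [StarModule ℂ A]
    (hA : ∀ a : A, Coalgebra.comul (R := ℂ) (star a) = star (Coalgebra.comul (R := ℂ) a))
    -- the bicovariant *-bimodule `Ψ`
    {Ψ : Type*} [AddCommGroup Ψ] [Module ℂ Ψ] [Module A Ψ] [Module Aᵐᵒᵖ Ψ]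
    [SMulCommClass A Aᵐᵒᵖ Ψ] [IsScalarTower ℂ A Ψ] [IsScalarTower ℂ Aᵐᵒᵖ Ψ]
    [StarAddMonoid Ψ] [StarModule ℂ Ψ]
    (X : AffineBundle.BicovariantStarBimodule A Ψ)
    -- the quantum principal bundle `P = (B, i, F)` over `V`, which is Hopf-Galois
    {V B : Type*} [Ring V] [Algebra ℂ V] [StarRing V] [StarModule ℂ V]
    [Ring B] [Algebra ℂ B] [StarRing B] [StarModule ℂ B]
    (i : V →ₐ[ℂ] B) (P : AffineBundle.QuantumPrincipalBundle A i)
    (hX : Function.Bijective P.X) :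
    -- the kernel of `Y` on `𝕍^⊗` is an ideal, so that `S(𝕍)` is its quotient by this kernel
    (∀ x, X.symMk x = 0 ↔ AffineBundle.symm X.braid x = 0) ∧
    -- `Ã = A ⊗ S(𝕍)` is the quotient of `T(Ψ)` by the kernel `A ⊗ ker(Y|𝕍^⊗)` of `Y`
    ∃ p : AffineBundle.TensorBundle A Ψ →ₐ[ℂ] X.AffineAlg,
    Function.Surjective p ∧
    LinearMap.ker p.toLinearMap = Submodule.span ℂ
      {t | ∃ (a : A) (x : TensorAlgebra ℂ X.inv), AffineBundle.symm X.braid x = 0 ∧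
        t = AffineBundle.TensorBundle.inA A Ψ a * X.inT x} ∧
    (∀ a, p (AffineBundle.TensorBundle.inA A Ψ a) = AffineBundle.CrossProduct.inl X _ a) ∧
    (∀ x, p (X.inT x) = AffineBundle.CrossProduct.inr X _ (X.symMk x)) ∧
    -- `Ã` is a Hopf *-algebra, with the structure induced from `T(Ψ)`
    ∃ (_ : Coalgebra ℂ X.AffineAlg) (_ : StarRing X.AffineAlg) (_ : StarModule ℂ X.AffineAlg)
      (κ κinv : X.AffineAlg →ₗ[ℂ] X.AffineAlg),
    AffineBundle.IsHopfStarAlgebra X.AffineAlg κ ∧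
    κ ∘ₗ κinv = LinearMap.id ∧ κinv ∘ₗ κ = LinearMap.id ∧
    (∀ a : A, Coalgebra.comul (R := ℂ) (p (AffineBundle.TensorBundle.inA A Ψ a)) =
      TensorProduct.map (p.toLinearMap ∘ₗ (AffineBundle.TensorBundle.inA A Ψ).toLinearMap)
        (p.toLinearMap ∘ₗ (AffineBundle.TensorBundle.inA A Ψ).toLinearMap) (Coalgebra.comul (R := ℂ) a)) ∧
    (∀ ψ : Ψ, Coalgebra.comul (R := ℂ) (p (AffineBundle.TensorBundle.inΨ A Ψ ψ)) =
      TensorProduct.map (p.toLinearMap ∘ₗ (AffineBundle.TensorBundle.inA A Ψ).toLinearMap)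
        (p.toLinearMap ∘ₗ AffineBundle.TensorBundle.inΨ A Ψ) (X.left ψ) +
      TensorProduct.map (p.toLinearMap ∘ₗ AffineBundle.TensorBundle.inΨ A Ψ)
        (p.toLinearMap ∘ₗ (AffineBundle.TensorBundle.inA A Ψ).toLinearMap) (X.right ψ)) ∧
    (∀ a : A, Coalgebra.counit (R := ℂ) (p (AffineBundle.TensorBundle.inA A Ψ a)) =
      Coalgebra.counit (R := ℂ) a) ∧
    (∀ ψ : Ψ, Coalgebra.counit (R := ℂ) (p (AffineBundle.TensorBundle.inΨ A Ψ ψ)) = 0) ∧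
    (∀ a : A, star (p (AffineBundle.TensorBundle.inA A Ψ a)) = p (AffineBundle.TensorBundle.inA A Ψ (star a))) ∧
    (∀ ψ : Ψ, star (p (AffineBundle.TensorBundle.inΨ A Ψ ψ)) = p (AffineBundle.TensorBundle.inΨ A Ψ (star ψ))) ∧
    -- `B̃ = B ⊗ S(𝕍)` is a *-algebra, containing `B` and `S(𝕍)` as *-subalgebras
    ∃ (_ : StarRing (P.AffineTotal X)) (_ : StarModule ℂ (P.AffineTotal X)),
    (∀ b : B, star (AffineBundle.CrossProduct.inl X P.toComoduleAlgebra b) =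
      AffineBundle.CrossProduct.inl X P.toComoduleAlgebra (star b)) ∧
    (∀ θ : X.inv, star (P.inTotal X (TensorAlgebra.ι ℂ θ)) =
      P.inTotal X (TensorAlgebra.ι ℂ (X.invStar θ))) ∧
    -- `P̃ = (B̃, i, H)` is a quantum principal bundle, `H` being the common extension of `F` and
    -- of the restriction of the coproduct of `Ã`
    ∃ Q : AffineBundle.QuantumPrincipalBundle X.AffineAlg (P.affineBase X),
    (∀ b : B, Q.F (AffineBundle.CrossProduct.inl X P.toComoduleAlgebra b) =
      TensorProduct.map (AffineBundle.CrossProduct.inl X P.toComoduleAlgebra).toLinearMap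
        (AffineBundle.CrossProduct.inl X (AffineBundle.ComoduleAlgebra.regular A)).toLinearMap
        (P.F b)) ∧
    (∀ θ : X.inv, Q.F (P.inTotal X (TensorAlgebra.ι ℂ θ)) =
      1 ⊗ₜ[ℂ] AffineBundle.CrossProduct.inr X _ (X.symMk (TensorAlgebra.ι ℂ θ)) +
      TensorProduct.map (P.inTotal X ∘ₗ TensorAlgebra.ι ℂ)
        (AffineBundle.CrossProduct.inl X (AffineBundle.ComoduleAlgebra.regular A)).toLinearMap
        (X.coact θ)) ∧
    -- the extended translation map
    ∃ τ : X.AffineAlg →ₗ[ℂ] AffineBundle.Balanced (P.affineBase X),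
    (∀ (a : A) (n : ℕ) (x : TensorAlgebra ℂ X.inv), x ∈ AffineBundle.deg X.inv n →
      τ (AffineBundle.CrossProduct.mk X _ a (X.symMk x)) = P.affineTranslation X hX a n x) ∧
    (∀ a : A, τ (AffineBundle.CrossProduct.inl X _ a) =
      AffineBundle.Balanced.map i (AffineBundle.CrossProduct.inl X P.toComoduleAlgebra)
        (P.translation hX a)) ∧
    -- the three identities
    (∀ ψ : X.AffineAlg, Q.rightCoact (τ ψ) = τ.rTensor X.AffineAlg (Coalgebra.comul ψ)) ∧
    (∀ ψ : X.AffineAlg, AffineBundle.Balanced.mul _ (τ ψ) =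
      algebraMap ℂ (P.AffineTotal X) (Coalgebra.counit ψ)) ∧
    (∀ ψ : X.AffineAlg, Q.leftCoact κinv (τ ψ) =
      τ.lTensor X.AffineAlg (Coalgebra.comul ψ)) ∧
    -- `X̃` is bijective, with `X̃⁻¹(1 ⊗ ψ) = τ(ψ)`
    ∃ hQ : Function.Bijective Q.X, ∀ ψ : X.AffineAlg, Q.translation hQ ψ = τ ψ := by
  have : AffineBundle.IsStarHopf A := ⟨hA⟩
  let := AffineBundle.CrossProduct.affHopfAlgebra X
  let Q : AffineBundle.QuantumPrincipalBundle X.AffineAlg (P.affineBase X) :=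
    { toPreBundle := P.affine X, free := (P.affine_X_bijective X hX).2 }
  -- `Q` is the affine extension `P̃`, and its translation map is `ψ ↦ X̃⁻¹(1 ⊗ ψ)`
  have hQ : Function.Bijective Q.X := P.affine_X_bijective X hX
  have hτ : ∀ (a : A) (n : ℕ) (x : TensorAlgebra ℂ X.inv), x ∈ AffineBundle.deg X.inv n →
      Q.translation hQ (AffineBundle.CrossProduct.mk X _ a (X.symMk x)) =
        P.affineTranslation X hX a n x := fun a n x hx =>
    hQ.1 ((Q.X_translation hQ _).trans (P.affine_X_translation X hX a n hx).symm)
  have hp : (X.bundleProj.toLinearMap ∘ₗ (AffineBundle.TensorBundle.inA A Ψ).toLinearMap) =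
      (AffineBundle.CrossProduct.inl X (AffineBundle.ComoduleAlgebra.regular A)).toLinearMap :=
    LinearMap.ext fun a => X.bundleProj_inA a
  have hpΨ : (X.bundleProj.toLinearMap ∘ₗ AffineBundle.TensorBundle.inΨ A Ψ) = X.bimoduleHom :=
    LinearMap.ext fun ψ => X.bundleProj_inΨ ψ
  refine ⟨fun x => X.symMk_eq_zero_iff x, X.bundleProj, X.bundleProj_surjective,
    X.ker_bundleProj, X.bundleProj_inA, X.bundleProj_inT, inferInstance, inferInstance,
    inferInstance, HopfAlgebra.antipode ℂ, AffineBundle.antipodeInv X.AffineAlg, ?_, ?_, ?_, ?_,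
    ?_, ?_, ?_, ?_, ?_, inferInstance, inferInstance,
    fun b => AffineBundle.CrossProduct.star_inl X _ b, fun θ => ?_, Q, ?_, ?_,
    Q.translation hQ, hτ, fun a => hQ.1 ?_, Q.rightCoact_translation hQ, Q.mul_translation hQ,
    Q.leftCoact_translation hQ, hQ, fun _ => rfl⟩
  · exact AffineBundle.isHopfStarAlgebra X.AffineAlg
  · exact AffineBundle.antipode_comp_antipodeInv X.AffineAlg
  · exact AffineBundle.antipodeInv_comp_antipode X.AffineAlg
  · intro a
    rw [hp, X.bundleProj_inA]
    exact AffineBundle.CrossProduct.coaction_inl X _ a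
  · intro ψ
    rw [hp, hpΨ, X.bundleProj_inΨ]
    exact X.coaction_bimoduleHom ψ
  · intro a
    rw [X.bundleProj_inA]
    exact congrArg (Coalgebra.counit (R := ℂ)) (AffineBundle.CrossProduct.proj_inl X _ a)
  · intro ψ
    rw [X.bundleProj_inΨ]
    exact X.affCounit_bimoduleHom ψ
  · intro a
    rw [X.bundleProj_inA, X.bundleProj_inA, AffineBundle.CrossProduct.star_inl]
  · intro ψ
    rw [X.bundleProj_inΨ, X.bundleProj_inΨ, X.star_bimoduleHom]
  · refine (AffineBundle.CrossProduct.star_inrT X _ _).trans ?_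
    rw [X.tensorStar_ι]
    rfl
  · exact AffineBundle.CrossProduct.coaction_inl X _
  · intro θ
    exact (AffineBundle.CrossProduct.coaction_inrT X _ _).trans
      (AffineBundle.CrossProduct.frame_h_ι X _ θ)
  · refine (Q.X_translation hQ _).trans ((P.affine_X_map X _).trans ?_).symm
    rw [P.X_translation hX]
    simp
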